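/- Let $d,m\ge 1$ be integers, $0<\theta<1$, $1\le q<\infty$, and let $\Omega\subset\mathbb R^d$ be a Lipschitz domain: a nonempty connected open set that is either a Lipschitz graph domain, i.e. $\Omega=\{(x',t):x'\in\mathbb R^{d-1},\ t>\psi(x')\}$ in some orthonormal coordinate system with $\psi:\mathbb R^{d-1}\to\mathbb R$ Lipschitz, or has nonempty boundary covered by finitely many balls $B(x_j,r_j)$ with $x_j\in\partial\Omega$, such that for some $M>0$ and each $j$ there is a Lipschitz graph domain $V_j$ with Lipschitz constant at most $M$ and $x_j\in\partial V_j$ for which $\Omega$ and $V_j$ coincide in the cylinder centered at $x_j$ of height $(8+8M)r_j$ and radius $2r_j$ with axis parallel to the $t$-axis of $V_j$. For $0<p\le\infty$, $1\le q\le\infty$, $\theta\in\mathbb R$ let $L^{p,\theta,q}_{av}(\Omega)$ be the space of locally integrable (arrays of) complex-valued functions $H$ on $\Omega$ for which $$\|H\|_{L^{p,\theta,q}_{av}(\Omega)}=\Bigl(\int_\Omega\Bigl(\frac1{|B_x|}\int_{B_x}|H|^q\Bigr)^{p/q}\operatorname{dist}(x,\partial\Omega)^{p-1-p\theta}\,dx\Bigr)^{1/p},\qquad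 B_x=B\bigl(x,\tfrac12\operatorname{dist}(x,\partial\Omega)\bigr),$$ is finite; if $q=\infty$ the inner average is replaced by $\|H\|_{L^\infty(B_x)}$, and if $p=\infty$ the norm is the essential supremum over $x\in\Omega$ of $\bigl(\frac1{|B_x|}\int_{B_x}|H|^q\bigr)^{1/q}\operatorname{dist}(x,\partial\Omega)^{1-\theta}$. Let $\dot W^{p,\theta,q}_{m,av}(\Omega)$ be the space of locally integrable $u$ on $\Omega$ with weak derivatives of order up to $m$ and $\nabla^m u=(\partial^\alpha u)_{|\alpha|=m}\in L^{p,\theta,q}_{av}(\Omega)$, modulo polynomials of degree at most $m-1$, with (quasi-)norm $\|\nabla^m u\|_{L^{p,\theta,q}_{av}(\Omega)}$. Write $\langle G,F\rangle_\Omega=\sum_{|\alpha|=m}\int_\Omega\overline{G_\alpha}F_\alpha$ and $1/q+1/q'=1$; say that $\varphi_n\to u$ weakly in $\dot W^{\infty,\theta,q}_{m,av}(\Omega)$ if $\langle G,\nabla^m\varphi_n\rangle_\Omega\to\langle G,\nabla^m u\rangle_\Omega$ (all these integrals being absolutely convergent) for all $G\in L^{1,1-\theta,q'}_{av}(\Omega)$.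 Let $\operatorname{Tr}_k^\Omega u$ be the array of boundary traces of the functions $\partial^\gamma u$, $|\gamma|=k$, the trace on $W^{1,1}_{loc}(\overline\Omega)$ being the extension by continuity of the restriction $\varphi\mapsto\varphi|_{\partial\Omega}$, $\varphi\in C_0^\infty(\mathbb R^d)$, with values in $L^1_{loc}(\partial\Omega)$ with respect to surface measure. 1. If $0<p<\infty$, then $\{\Phi|_\Omega:\Phi\in C_0^\infty(\mathbb R^d)\}$ is contained and dense in $\dot W^{p,\theta,q}_{m,av}(\Omega)$. 2. If $u\in\dot W^{\infty,\theta,q}_{m,av}(\Omega)$, then there is a sequence $\varphi_n\in C_0^\infty(\mathbb R^d)$ with $\varphi_n\to u$ weakly in $\dot W^{\infty,\theta,q}_{m,av}(\Omega)$. 3. Let $\frac{d-1}{d-1+\theta}<p\le\infty$ and let $u\in\dot W^{p,\theta,q}_{m,av}(\Omega)$ with $\operatorname{Tr}_k^\Omega u=0$ for all $0\le k\le m-1$. (a) If $\Omega$ is bounded or a Lipschitz graph domain, then there is a sequence of functions $\varphi_n$, smooth and compactly supported in $\Omega$, with $\varphi_n\to u$ in $\dot W^{p,\theta,q}_{m,av}(\Omega)$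 (if $p<\infty$) or weakly (if $p=\infty$). (b) If $\mathbb R^d\setminus\Omega$ is bounded, then there is a sequence $\varphi_n\in C_0^\infty(\mathbb R^d)$ such that $\nabla^m\varphi_n=0$ in a neighborhood of $\mathbb R^d\setminus\Omega$ and $\varphi_n\to u$ in the same sense. -/

import Mathlib

open MeasureTheory Filter Topology Metric
open scoped ENNReal NNReal ProbabilityTheory ComplexConjugate

noncomputable section

namespace AvSobolev

/-! ### Multiindices and classical partial derivatives -/

/-- The multiindices `γ ∈ ℕ^d` with `|γ| = k`. -/
def multiIndices (d k : ℕ) : Finset (Fin d → ℕ) :=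
  Finset.piAntidiag Finset.univ k

/-- The partial derivative `∂_i f`. -/
def partialDeriv {d : ℕ} (i : Fin d) (f : EuclideanSpace ℝ (Fin d) → ℂ) :
    EuclideanSpace ℝ (Fin d) → ℂ :=
  fun x => fderiv ℝ f x (EuclideanSpace.single i 1)

/-- `∂^γ f = ∂_1^{γ_1} ∂_2^{γ_2} ⋯ ∂_d^{γ_d} f`. -/
def mixedDeriv {d : ℕ} (γ : Fin d → ℕ) (f : EuclideanSpace ℝ (Fin d) → ℂ) :
    EuclideanSpace ℝ (Fin d) → ℂ :=
  (List.finRange d).foldr (fun i g => (partialDeriv i)^[γ i] g) f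

/-- `f ∈ C_0^∞(ℝ^d)`. -/
def IsSmoothCompact {d : ℕ} (f : EuclideanSpace ℝ (Fin d) → ℂ) : Prop :=
  ContDiff ℝ ((⊤ : ℕ∞) : WithTop ℕ∞) f ∧ HasCompactSupport f

/-- `f ∈ C_0^∞(Ω)`: smooth on `ℝ^d`, with compact support contained in `Ω`. -/
def IsSmoothCompactIn {d : ℕ} (Ω : Set (EuclideanSpace ℝ (Fin d)))
    (f : EuclideanSpace ℝ (Fin d) → ℂ) : Prop :=
  IsSmoothCompact f ∧ tsupport f ⊆ Ω

/-! ### Lipschitz domains -/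

/-- `V = {(x', t) : t > ψ(x')}` in the orthonormal coordinate system given by the isometry `e`. -/
def graphRegion {n : ℕ}
    (e : EuclideanSpace ℝ (Fin (n + 1)) ≃ᵃⁱ[ℝ] WithLp 2 (EuclideanSpace ℝ (Fin n) × ℝ))
    (ψ : EuclideanSpace ℝ (Fin n) → ℝ) : Set (EuclideanSpace ℝ (Fin (n + 1))) :=
  {x | ψ (e x).fst < (e x).snd}

/-- The cylinder of height `h` and radius `ρ` centered at `x₀`, with axis parallel to the `t`-axis
of the coordinate system `e`. -/
def cylinder {n : ℕ}
    (e : EuclideanSpace ℝ (Fin (n + 1)) ≃ᵃⁱ[ℝ] WithLp 2 (EuclideanSpace ℝ (Fin n) × ℝ))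
    (x₀ : EuclideanSpace ℝ (Fin (n + 1))) (h ρ : ℝ) : Set (EuclideanSpace ℝ (Fin (n + 1))) :=
  {x | dist (e x).fst (e x₀).fst < ρ ∧ |(e x).snd - (e x₀).snd| < h / 2}

def IsLipschitzGraphDomain {n : ℕ} (V : Set (EuclideanSpace ℝ (Fin (n + 1)))) : Prop :=
  ∃ (e : EuclideanSpace ℝ (Fin (n + 1)) ≃ᵃⁱ[ℝ] WithLp 2 (EuclideanSpace ℝ (Fin n) × ℝ))
    (ψ : EuclideanSpace ℝ (Fin n) → ℝ) (M : ℝ≥0), LipschitzWith M ψ ∧ V = graphRegion e ψ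

/-- The second alternative in the definition of a Lipschitz domain: the boundary is covered by
finitely many (and at least one) balls, around each of which `Ω` agrees, in a cylinder, with a
Lipschitz graph domain. -/
def HasLipschitzCharts {n : ℕ} (Ω : Set (EuclideanSpace ℝ (Fin (n + 1)))) : Prop :=
  ∃ (r : ℝ) (M : ℝ≥0) (c₀ : ℝ) (N : ℕ) (x : Fin N → EuclideanSpace ℝ (Fin (n + 1)))
    (ρ : Fin N → ℝ),
    0 < r ∧ 0 < M ∧ 1 ≤ c₀ ∧ 0 < N ∧ (∀ j, x j ∈ frontier Ω) ∧
    (∀ j, r / c₀ < ρ j ∧ ρ j < c₀ * r) ∧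
    frontier Ω ⊆ ⋃ j, ball (x j) (ρ j) ∧
    ∀ j, ∃ (e : EuclideanSpace ℝ (Fin (n + 1)) ≃ᵃⁱ[ℝ] WithLp 2 (EuclideanSpace ℝ (Fin n) × ℝ))
      (ψ : EuclideanSpace ℝ (Fin n) → ℝ), LipschitzWith M ψ ∧
      x j ∈ frontier (graphRegion e ψ) ∧
      cylinder e (x j) ((8 + 8 * M) * ρ j) (2 * ρ j) ∩ Ω =
        cylinder e (x j) ((8 + 8 * M) * ρ j) (2 * ρ j) ∩ graphRegion e ψ

/-- Lipschitz domains in `ℝ^(n+1)`; a domain is a nonempty connected open set. -/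
def IsLipschitzDomain {n : ℕ} (Ω : Set (EuclideanSpace ℝ (Fin (n + 1)))) : Prop :=
  IsOpen Ω ∧ IsConnected Ω ∧ (IsLipschitzGraphDomain Ω ∨ HasLipschitzCharts Ω)

/-! ### Weak derivatives -/

/-- `g` is the weak derivative `∂^γ u` in `Ω`. -/
def HasWeakDeriv {d : ℕ} (Ω : Set (EuclideanSpace ℝ (Fin d))) (γ : Fin d → ℕ)
    (u g : EuclideanSpace ℝ (Fin d) → ℂ) : Prop :=
  LocallyIntegrableOn g Ω ∧
    ∀ φ : EuclideanSpace ℝ (Fin d) → ℂ, IsSmoothCompactIn Ω φ →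
      ∫ x in Ω, u x * mixedDeriv γ φ x = (-1) ^ (∑ i, γ i) * ∫ x in Ω, g x * φ x

open Classical in
/-- A representative of the weak derivative `∂^γ u` in `Ω` (and `0` if there is none). -/
def weakDeriv {d : ℕ} (Ω : Set (EuclideanSpace ℝ (Fin d))) (γ : Fin d → ℕ)
    (u : EuclideanSpace ℝ (Fin d) → ℂ) : EuclideanSpace ℝ (Fin d) → ℂ :=
  if h : ∃ g, HasWeakDeriv Ω γ u g then h.choose else 0

/-! ### Weighted averaged Lebesgue and Sobolev spaces

An array of functions indexed by the multiindices of length `m` is given as a family indexed by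
all multiindices, of which only the entries of length `m` are used. -/

/-- The length `|H(y)|` of an array indexed by the multiindices of length `m`. -/
def arrayNorm {d : ℕ} (m : ℕ) (H : (Fin d → ℕ) → EuclideanSpace ℝ (Fin d) → ℂ)
    (y : EuclideanSpace ℝ (Fin d)) : ℝ :=
  Real.sqrt (∑ γ ∈ multiIndices d m, ‖H γ y‖ ^ 2)

/-- `(⨍_{B(x, dist(x,∂Ω)/2)} |H|^q)^{1/q}`, the essential supremum over the ball if `q = ∞`. -/
def whitneyAverage {d : ℕ} (m : ℕ) (q : ℝ≥0∞) (Ω : Set (EuclideanSpace ℝ (Fin d)))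
    (H : (Fin d → ℕ) → EuclideanSpace ℝ (Fin d) → ℂ) (x : EuclideanSpace ℝ (Fin d)) : ℝ≥0∞ :=
  eLpNorm (arrayNorm m H) q
    (ProbabilityTheory.cond volume (ball x (infDist x (frontier Ω) / 2)))

open Classical in
/-- The (quasi-)norm of `L_av^{p,θ,q}(Ω)`. -/
def avNorm {d : ℕ} (m : ℕ) (p : ℝ≥0∞) (θ : ℝ) (q : ℝ≥0∞) (Ω : Set (EuclideanSpace ℝ (Fin d)))
    (H : (Fin d → ℕ) → EuclideanSpace ℝ (Fin d) → ℂ) : ℝ≥0∞ :=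
  if p = ∞ then
    essSup (fun x => whitneyAverage m q Ω H x *
      ENNReal.ofReal (infDist x (frontier Ω) ^ (1 - θ))) (volume.restrict Ω)
  else
    (∫⁻ x in Ω, whitneyAverage m q Ω H x ^ p.toReal *
      ENNReal.ofReal (infDist x (frontier Ω) ^ (p.toReal - 1 - p.toReal * θ))) ^ (1 / p.toReal)

/-- Membership of an array in `L_av^{p,θ,q}(Ω)`. -/
def MemAv {d : ℕ} (m : ℕ) (p : ℝ≥0∞) (θ : ℝ) (q : ℝ≥0∞) (Ω : Set (EuclideanSpace ℝ (Fin d)))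
    (H : (Fin d → ℕ) → EuclideanSpace ℝ (Fin d) → ℂ) : Prop :=
  (∀ γ ∈ multiIndices d m, LocallyIntegrableOn (H γ) Ω) ∧ avNorm m p θ q Ω H < ∞

/-- The (weak) gradient array of `u` in `Ω`; its entries of length `m` form `∇^m u`. -/
def gradArray {d : ℕ} (Ω : Set (EuclideanSpace ℝ (Fin d)))
    (u : EuclideanSpace ℝ (Fin d) → ℂ) : (Fin d → ℕ) → EuclideanSpace ℝ (Fin d) → ℂ :=
  fun γ => weakDeriv Ω γ u

/-- `u` represents an element of `Ẇ_{m,av}^{p,θ,q}(Ω)`: it is locally integrable, has weak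
derivatives of order up to `m`, and `∇^m u ∈ L_av^{p,θ,q}(Ω)`. -/
def MemSobolev {d : ℕ} (m : ℕ) (p : ℝ≥0∞) (θ : ℝ) (q : ℝ≥0∞)
    (Ω : Set (EuclideanSpace ℝ (Fin d))) (u : EuclideanSpace ℝ (Fin d) → ℂ) : Prop :=
  LocallyIntegrableOn u Ω ∧
    (∀ γ : Fin d → ℕ, ∑ i, γ i ≤ m → ∃ g, HasWeakDeriv Ω γ u g) ∧
    MemAv m p θ q Ω (gradArray Ω u)

/-- The (quasi-)norm of `Ẇ_{m,av}^{p,θ,q}(Ω)`; on functions, rather than on classes modulo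
polynomials of degree `m - 1`, it is a (quasi-)seminorm. -/
def sobolevNorm {d : ℕ} (m : ℕ) (p : ℝ≥0∞) (θ : ℝ) (q : ℝ≥0∞)
    (Ω : Set (EuclideanSpace ℝ (Fin d))) (u : EuclideanSpace ℝ (Fin d) → ℂ) : ℝ≥0∞ :=
  avNorm m p θ q Ω (gradArray Ω u)

/-- `⟨G, F⟩_Ω = ∑_{|γ|=m} ∫_Ω conj(G_γ) F_γ`. -/
def pairing {d : ℕ} (m : ℕ) (Ω : Set (EuclideanSpace ℝ (Fin d)))
    (G F : (Fin d → ℕ) → EuclideanSpace ℝ (Fin d) → ℂ) : ℂ :=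
  ∑ γ ∈ multiIndices d m, ∫ x in Ω, conj (G γ x) * F γ x

/-- The integrals defining `⟨G, F⟩_Ω` converge absolutely. -/
def PairingIntegrable {d : ℕ} (m : ℕ) (Ω : Set (EuclideanSpace ℝ (Fin d)))
    (G F : (Fin d → ℕ) → EuclideanSpace ℝ (Fin d) → ℂ) : Prop :=
  ∀ γ ∈ multiIndices d m, IntegrableOn (fun x => conj (G γ x) * F γ x) Ω

/-- Weak convergence `φ_j → u` in `Ẇ_{m,av}^{∞,θ,q}(Ω)`: for every `G ∈ L_av^{1,1-θ,q'}(Ω)` the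
pairings `⟨G, ∇^m φ_j⟩_Ω` and `⟨G, ∇^m u⟩_Ω` converge absolutely and
`⟨G, ∇^m φ_j⟩_Ω → ⟨G, ∇^m u⟩_Ω`. -/
def WeaklyTendsto {d : ℕ} (m : ℕ) (θ : ℝ) (q : ℝ≥0∞) (Ω : Set (EuclideanSpace ℝ (Fin d)))
    (φ : ℕ → EuclideanSpace ℝ (Fin d) → ℂ) (u : EuclideanSpace ℝ (Fin d) → ℂ) : Prop :=
  ∀ G : (Fin d → ℕ) → EuclideanSpace ℝ (Fin d) → ℂ,
    MemAv m 1 (1 - θ) (ENNReal.conjExponent q) Ω G →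
      PairingIntegrable m Ω G (gradArray Ω u) ∧
      (∀ j, PairingIntegrable m Ω G (gradArray Ω (φ j))) ∧
      Tendsto (fun j => pairing m Ω G (gradArray Ω (φ j))) atTop
        (𝓝 (pairing m Ω G (gradArray Ω u)))

/-- Convergence in (quasi-)norm if `p < ∞`, weak convergence if `p = ∞`. -/
def SobolevTendsto {d : ℕ} (m : ℕ) (p : ℝ≥0∞) (θ : ℝ) (q : ℝ≥0∞)
    (Ω : Set (EuclideanSpace ℝ (Fin d)))
    (φ : ℕ → EuclideanSpace ℝ (Fin d) → ℂ) (u : EuclideanSpace ℝ (Fin d) → ℂ) : Prop :=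
  (p < ∞ → Tendsto (fun j => sobolevNorm m p θ q Ω (u - φ j)) atTop (𝓝 0)) ∧
  (p = ∞ → WeaklyTendsto m θ q Ω φ u)

/-! ### Traces -/

/-- `g` is the boundary trace of `f ∈ W^{1,1}_loc(closure Ω)`, where the trace operator is the
extension by continuity of `φ ↦ φ|_∂Ω`: there are `φ_j ∈ C_0^∞(ℝ^(n+1))` that converge to `f`,
together with their gradients, in `L^1(Ω ∩ B(0,R))`, and to `g` in `L^1(∂Ω ∩ B(0,R))` with respect
to surface measure, for every `R > 0`. -/
def HasTrace {n : ℕ} (Ω : Set (EuclideanSpace ℝ (Fin (n + 1))))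
    (f g : EuclideanSpace ℝ (Fin (n + 1)) → ℂ) : Prop :=
  LocallyIntegrableOn f Ω ∧ AEStronglyMeasurable g (μHE[n].restrict (frontier Ω)) ∧
  ∃ Df : Fin (n + 1) → EuclideanSpace ℝ (Fin (n + 1)) → ℂ,
    (∀ i, HasWeakDeriv Ω (Pi.single i 1) f (Df i)) ∧
    ∃ φ : ℕ → EuclideanSpace ℝ (Fin (n + 1)) → ℂ, (∀ j, IsSmoothCompact (φ j)) ∧
      ∀ R : ℝ, 0 < R →
        Tendsto (fun j => ∫⁻ x in Ω ∩ ball 0 R, ‖φ j x - f x‖ₑ) atTop (𝓝 0) ∧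
        (∀ i, Tendsto (fun j => ∫⁻ x in Ω ∩ ball 0 R, ‖partialDeriv i (φ j) x - Df i x‖ₑ)
          atTop (𝓝 0)) ∧
        Tendsto (fun j => ∫⁻ x in frontier Ω ∩ ball 0 R, ‖φ j x - g x‖ₑ ∂μHE[n]) atTop (𝓝 0)

/-- `Tr_k^Ω u = g`, that is, `Trace ∂^γ u = g_γ` for every multiindex `γ` of length `k`. -/
def HasTraceArray {n : ℕ} (k : ℕ) (Ω : Set (EuclideanSpace ℝ (Fin (n + 1))))
    (u : EuclideanSpace ℝ (Fin (n + 1)) → ℂ)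
    (g : (Fin (n + 1) → ℕ) → EuclideanSpace ℝ (Fin (n + 1)) → ℂ) : Prop :=
  ∀ γ ∈ multiIndices (n + 1) k, HasTrace Ω (weakDeriv Ω γ u) (g γ)

end AvSobolev

end

open AvSobolev

noncomputable section

namespace AvSobolev

open ENNReal (coe_lt_top coe_mul coe_ne_top coe_rpow_of_nonneg coe_toNNReal conjExponent mul_lt_top
  mul_ne_top mul_rpow_of_nonneg ofReal ofReal_eq_zero ofReal_le_ofReal ofReal_mul ofReal_natCast
  ofReal_ne_top ofReal_one rpow_le_rpow rpow_mul rpow_natCast rpow_ne_top_of_nonneg rpow_one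
  toReal_one toReal_pos zero_rpow_of_pos)
open EuclideanSpace (single)
open Finset (single_le_sum sum_le_sum sum_congr mem_range)
open Real (norm_of_nonneg norm_eq_abs)
open Set (indicator_of_mem indicator_of_notMem Ioc Ioo)

/-! ### Calculus of partial derivatives of smooth functions -/

/-- The Euclidean space `ℝ^d`. -/
abbrev Eucl (d : ℕ) := EuclideanSpace ℝ (Fin d)

/-- Functions of class `C^∞`. -/
abbrev Smooth {d : ℕ} {G : Type*} [NormedAddCommGroup G] [NormedSpace ℝ G] (f : Eucl d → G) : Prop :=
  ContDiff ℝ ((⊤ : ℕ∞) : WithTop ℕ∞) f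

/-- Families of functions indexed by multiindices, such as the derivatives of a function. -/
abbrev Jet (d : ℕ) := (Fin d → ℕ) → Eucl d → ℂ

variable {d m k : ℕ} {p : ℝ≥0∞} {q θ r ε : ℝ} {γ : Fin d → ℕ} {x y w : Eucl d} {u f : Eucl d → ℂ}
  {D H : Jet d} {F : Eucl d → ℝ≥0∞}

lemma Smooth.partialDeriv (hf : Smooth f) (i : Fin d) : Smooth (partialDeriv i f) := by
  unfold AvSobolev.partialDeriv
  exact (hf.fderiv_right (m := ((⊤ : ℕ∞) : WithTop ℕ∞)) (by simp)).clm_apply contDiff_const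

lemma Smooth.iterate_partialDeriv (hf : Smooth f) (i : Fin d) (k : ℕ) :
    Smooth ((AvSobolev.partialDeriv i)^[k] f) := by
  induction k with
  | zero => exact hf
  | succ k ih => rw [Function.iterate_succ_apply']; exact ih.partialDeriv i

lemma Smooth.foldr_partialDeriv (hf : Smooth f) (γ : Fin d → ℕ) (l : List (Fin d)) :
    Smooth (l.foldr (fun i g => (AvSobolev.partialDeriv i)^[γ i] g) f) := by
  induction l with
  | nil => exact hf
  | cons j l ih => exact Smooth.iterate_partialDeriv ih j _

lemma Smooth.mixedDeriv (hf : Smooth f) (γ : Fin d → ℕ) : Smooth (mixedDeriv γ f) := hf.foldr_partialDeriv γ _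

lemma partialDeriv_comm (hf : Smooth f) (i j : Fin d) :
    partialDeriv i (partialDeriv j f) = partialDeriv j (partialDeriv i f) := by
  have h2 : ContDiff ℝ ((⊤ : ℕ∞) : WithTop ℕ∞) (fderiv ℝ f) :=
    hf.fderiv_right (m := ((⊤ : ℕ∞) : WithTop ℕ∞)) (by simp)
  have hd : Differentiable ℝ (fderiv ℝ f) := h2.differentiable (by simp)
  funext x
  have key : ∀ a b : Fin d, partialDeriv a (partialDeriv b f) x =
      fderiv ℝ (fderiv ℝ f) x (single a 1) (single b 1) := by
    intro a b
    unfold AvSobolev.partialDeriv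
    rw [fderiv_clm_apply (hd x) (differentiableAt_const _)]
    simp
  rw [key, key]
  have h2 : (2 : WithTop ℕ∞) ≤ ((⊤ : ℕ∞) : WithTop ℕ∞) :=
    WithTop.coe_le_coe.2 (le_top : (2 : ℕ∞) ≤ ⊤)
  exact (hf.contDiffAt.isSymmSndFDerivAt (by simpa using h2)) _ _

lemma partialDeriv_iterate_comm (hf : Smooth f) (i j : Fin d) (k : ℕ) :
    partialDeriv i ((partialDeriv j)^[k] f) = (partialDeriv j)^[k] (partialDeriv i f) := by
  induction k with
  | zero => rfl
  | succ k ih =>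
    rw [Function.iterate_succ_apply', Function.iterate_succ_apply', ← ih,
      partialDeriv_comm (hf.iterate_partialDeriv j k)]

lemma mixedDeriv_add_single (hf : Smooth f) (γ : Fin d → ℕ) (i : Fin d) :
    mixedDeriv (γ + Pi.single i 1) f = partialDeriv i (mixedDeriv γ f) := by
  have key : ∀ l : List (Fin d), l.Nodup →
      l.foldr (fun j g => (partialDeriv j)^[(γ + Pi.single i 1 : Fin d → ℕ) j] g) f =
        if i ∈ l then partialDeriv i (l.foldr (fun j g => (partialDeriv j)^[γ j] g) f)
        else l.foldr (fun j g => (partialDeriv j)^[γ j] g) f := by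
    intro l
    induction l with
    | nil => simp
    | cons j l ih =>
      intro hl
      obtain ⟨hj, hl'⟩ := List.nodup_cons.1 hl
      simp only [List.foldr_cons, ih hl', List.mem_cons]
      by_cases hij : i = j
      · subst hij
        simp [hj, Function.iterate_succ_apply']
      · by_cases hil : i ∈ l
        · simp only [hij, hil, or_true, if_true]
          rw [partialDeriv_iterate_comm (hf.foldr_partialDeriv γ l)]
          simp [Ne.symm hij]
        · simp [hij, hil, Ne.symm hij]
  have := key (List.finRange d) (List.nodup_finRange d)
  simpa [mixedDeriv] using this

lemma mixedDeriv_zero (f : Eucl d → ℂ) : mixedDeriv 0 f = f := by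
  unfold mixedDeriv
  induction List.finRange d with
  | nil => rfl
  | cons j l ih => simp only [List.foldr_cons, ih]; simp

/-- Every nonzero multiindex is the successor of another one. -/
lemma exists_eq_add_single (h : ∑ i, γ i = k + 1) :
    ∃ (β : Fin d → ℕ) (i : Fin d), γ = β + Pi.single i 1 ∧ ∑ i, β i = k := by
  obtain ⟨i, -, hi⟩ : ∃ i ∈ Finset.univ, γ i ≠ 0 := by
    by_contra! hcon
    rw [Finset.sum_eq_zero hcon] at h
    omega
  have hγ : γ = (γ - Pi.single i 1) + Pi.single i 1 := by
    ext j
    by_cases hj : j = i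
    · subst hj; simp; omega
    · simp [hj]
  refine ⟨γ - Pi.single i 1, i, hγ, ?_⟩
  rw [hγ] at h
  simp only [Pi.add_apply, Finset.sum_add_distrib] at h
  simp at h
  simpa using h

lemma mem_multiIndices : γ ∈ multiIndices d k ↔ ∑ i, γ i = k := by
  simp [multiIndices, Finset.mem_piAntidiag]

lemma sum_add_single (γ : Fin d → ℕ) (i : Fin d) :
    ∑ j, (γ + Pi.single i 1 : Fin d → ℕ) j = ∑ j, γ j + 1 := by
  simp [Finset.sum_add_distrib]

/-- An induction principle for multiindices. -/
lemma multiIndex_induction {Q : (Fin d → ℕ) → Prop} (h0 : Q 0)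
    (h1 : ∀ γ i, Q γ → Q (γ + Pi.single i 1)) (γ : Fin d → ℕ) : Q γ := by
  obtain ⟨k, hk⟩ : ∃ k, ∑ i, γ i = k := ⟨_, rfl⟩
  induction k generalizing γ with
  | zero =>
    have : γ = 0 := by
      ext i
      have := Finset.sum_eq_zero_iff.1 hk i (Finset.mem_univ i)
      simpa using this
    rwa [this]
  | succ k ih =>
    obtain ⟨β, i, rfl, hβ⟩ := exists_eq_add_single hk
    exact h1 β i (ih β hβ)

/-- The multiindex counting the entries of a tuple of indices. -/
def tupleCount (t : Fin k → Fin d) : Fin d → ℕ := ∑ j, Pi.single (t j) 1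

lemma sum_tupleCount (t : Fin k → Fin d) : ∑ i, tupleCount t i = k := by
  simp only [tupleCount, Finset.sum_apply]
  rw [Finset.sum_comm]
  simp

lemma iteratedFDeriv_apply_single (hf : Smooth f) (t : Fin k → Fin d) (x : Eucl d) :
    iteratedFDeriv ℝ k f x (fun j => single (t j) 1) = mixedDeriv (tupleCount t) f x := by
  induction k generalizing x with
  | zero => simp [tupleCount, mixedDeriv_zero]
  | succ k ih =>
    have h1 : tupleCount t = tupleCount (fun j => t (Fin.succ j)) + Pi.single (t 0) 1 := by
      simp only [tupleCount, Fin.sum_univ_succ]; rw [add_comm]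
    rw [h1, mixedDeriv_add_single hf, iteratedFDeriv_succ_apply_left]
    have h2 : mixedDeriv (tupleCount (fun j => t (Fin.succ j))) f = fun y =>
        iteratedFDeriv ℝ k f y (fun j => single (t (Fin.succ j)) 1) := by
      funext y; exact (ih _ y).symm
    rw [h2]
    unfold AvSobolev.partialDeriv
    have hd : DifferentiableAt ℝ (iteratedFDeriv ℝ k f) x :=
      (hf.differentiable_iteratedFDeriv (by exact_mod_cast ENat.natCast_lt_top k)) x
    rw [fderiv_continuousMultilinear_apply_const_apply hd]
    rfl

lemma exists_tupleCount_eq (h : ∑ i, γ i = k) : ∃ t : Fin k → Fin d, tupleCount t = γ := by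
  induction k generalizing γ with
  | zero =>
    refine ⟨Fin.elim0, ?_⟩
    ext i
    have := Finset.sum_eq_zero_iff.1 h i (Finset.mem_univ i)
    simp [tupleCount, this]
  | succ k ih =>
    obtain ⟨β, i, rfl, hβ⟩ := exists_eq_add_single h
    obtain ⟨t, rfl⟩ := ih hβ
    refine ⟨Fin.cons i t, ?_⟩
    simp only [tupleCount, Fin.sum_univ_succ, Fin.cons_zero, Fin.cons_succ]
    rw [add_comm]

lemma norm_mixedDeriv_le (hf : Smooth f) (h : ∑ i, γ i = k) (x : Eucl d) :
    ‖mixedDeriv γ f x‖ ≤ ‖iteratedFDeriv ℝ k f x‖ := by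
  obtain ⟨t, rfl⟩ := exists_tupleCount_eq h
  rw [← iteratedFDeriv_apply_single hf]
  refine (ContinuousMultilinearMap.le_opNorm _ _).trans ?_
  simp

lemma norm_multilinear_le {G : Type*} [NormedAddCommGroup G] [NormedSpace ℝ G]
    (A : ContinuousMultilinearMap ℝ (fun _ : Fin k => Eucl d) G) :
    ‖A‖ ≤ ∑ t : Fin k → Fin d, ‖A (fun j => single (t j) 1)‖ := by
  refine A.opNorm_le_bound (Finset.sum_nonneg fun _ _ => norm_nonneg _) fun v => ?_
  have hv : v = fun j => ∑ i, v j i • single i (1 : ℝ) := by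
    funext j
    conv_lhs => rw [← (EuclideanSpace.basisFun (Fin d) ℝ).sum_repr (v j)]
    simp
  have h1 : A v = ∑ t : Fin k → Fin d, (∏ j, v j (t j)) •
      A (fun j => single (t j) 1) := by
    conv_lhs => rw [hv]
    rw [ContinuousMultilinearMap.map_sum]
    refine sum_congr rfl fun t _ => ?_
    exact A.map_smul_univ (fun j => v j (t j)) _
  rw [h1, Finset.sum_mul]
  refine (norm_sum_le _ _).trans (sum_le_sum fun t _ => ?_)
  rw [norm_smul, mul_comm]
  gcongr
  rw [norm_prod]
  exact Finset.prod_le_prod (fun _ _ => norm_nonneg _) fun j _ => PiLp.norm_apply_le (v j) (t j)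

lemma norm_iteratedFDeriv_le_sum (hf : Smooth f) (k : ℕ) (x : Eucl d) :
    ‖iteratedFDeriv ℝ k f x‖ ≤ d ^ k * ∑ γ ∈ multiIndices d k, ‖mixedDeriv γ f x‖ := by
  refine (norm_multilinear_le _).trans ?_
  have : ∀ t ∈ (Finset.univ : Finset (Fin k → Fin d)),
      ‖iteratedFDeriv ℝ k f x (fun j => single (t j) 1)‖ ≤
        ∑ γ ∈ multiIndices d k, ‖mixedDeriv γ f x‖ := by
    intro t _
    rw [iteratedFDeriv_apply_single hf]
    exact single_le_sum (f := fun γ => ‖mixedDeriv γ f x‖) (fun _ _ => norm_nonneg _)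
      (mem_multiIndices.2 (sum_tupleCount t))
  refine (Finset.sum_le_card_nsmul _ _ _ this).trans ?_
  simp

/-- The mean of iterated derivatives is symmetric. -/
lemma eq_of_apply_single_eq {G : Type*} [NormedAddCommGroup G] [NormedSpace ℝ G]
    {A B : ContinuousMultilinearMap ℝ (fun _ : Fin k => Eucl d) G}
    (h : ∀ t : Fin k → Fin d, A (fun j => single (t j) 1) = B (fun j => single (t j) 1)) :
    A = B := by
  rw [← sub_eq_zero, ← norm_le_zero_iff]
  refine (norm_multilinear_le _).trans ?_
  simp [h]

/-! ### Integration by parts and weak derivatives -/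

lemma partialDeriv_compactSupport (hf : HasCompactSupport f) (i : Fin d) :
    HasCompactSupport (partialDeriv i f) := hf.fderiv_apply (𝕜 := ℝ) _

lemma tsupport_partialDeriv_subset (f : Eucl d → ℂ) (i : Fin d) :
    tsupport (partialDeriv i f) ⊆ tsupport f := tsupport_fderiv_apply_subset ℝ _

lemma IsSmoothCompactIn.partialDeriv {Ω : Set (Eucl d)} (hf : IsSmoothCompactIn Ω f) (i : Fin d) :
    IsSmoothCompactIn Ω (partialDeriv i f) :=
  ⟨⟨Smooth.partialDeriv hf.1.1 i, partialDeriv_compactSupport hf.1.2 i⟩,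
    (tsupport_partialDeriv_subset f i).trans hf.2⟩

lemma IsSmoothCompactIn.mixedDeriv {Ω : Set (Eucl d)} (hf : IsSmoothCompactIn Ω f) (γ : Fin d → ℕ) :
    IsSmoothCompactIn Ω (mixedDeriv γ f) := by
  induction γ using multiIndex_induction with
  | h0 => rwa [mixedDeriv_zero]
  | h1 γ i ih => rw [mixedDeriv_add_single hf.1.1]; exact ih.partialDeriv i

lemma setIntegral_eq_integral_of_tsupport_subset {Ω : Set (Eucl d)} {g : Eucl d → ℂ}
    (hf : tsupport f ⊆ Ω) : ∫ x in Ω, g x * f x = ∫ x, g x * f x := by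
  refine setIntegral_eq_integral_of_forall_compl_eq_zero fun x hx => ?_
  rw [image_eq_zero_of_notMem_tsupport fun h => hx (hf h), mul_zero]

lemma integral_mul_partialDeriv {g : Eucl d → ℂ} (hf : Smooth f) (hg : IsSmoothCompact g)
    (i : Fin d) : ∫ x, f x * partialDeriv i g x = -∫ x, partialDeriv i f x * g x := by
  have hcg : Continuous g := hg.1.continuous
  refine integral_mul_fderiv_eq_neg_fderiv_mul_of_integrable ?_ ?_ ?_ ?_ ?_
  · exact ((hf.partialDeriv i).continuous.mul hcg).integrable_of_hasCompactSupport hg.2.mul_left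
  · exact (hf.continuous.mul (Smooth.partialDeriv hg.1 i).continuous).integrable_of_hasCompactSupport
      (partialDeriv_compactSupport hg.2 i).mul_left
  · exact (hf.continuous.mul hcg).integrable_of_hasCompactSupport hg.2.mul_left
  · exact fun x _ => hf.differentiable (by simp) x
  · exact fun x _ => hg.1.differentiable (by simp) x

lemma hasWeakDeriv_of_smooth {Ω : Set (Eucl d)} (hf : Smooth f) (γ : Fin d → ℕ) :
    HasWeakDeriv Ω γ f (mixedDeriv γ f) := by
  refine ⟨(hf.mixedDeriv γ).continuous.locallyIntegrable.locallyIntegrableOn _, fun φ hφ => ?_⟩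
  rw [setIntegral_eq_integral_of_tsupport_subset (hφ.mixedDeriv γ).2,
    setIntegral_eq_integral_of_tsupport_subset hφ.2]
  induction γ using multiIndex_induction generalizing φ with
  | h0 => simp [mixedDeriv_zero]
  | h1 γ i ih =>
    have hc : mixedDeriv (γ + Pi.single i 1) φ = mixedDeriv γ (partialDeriv i φ) := by
      clear ih
      induction γ using multiIndex_induction with
      | h0 => rw [mixedDeriv_add_single hφ.1.1, mixedDeriv_zero, mixedDeriv_zero]
      | h1 β j ih =>
        rw [mixedDeriv_add_single hφ.1.1, mixedDeriv_add_single hφ.1.1 β j,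
          mixedDeriv_add_single (Smooth.partialDeriv hφ.1.1 i), ← ih,
          mixedDeriv_add_single hφ.1.1,
          partialDeriv_comm (Smooth.mixedDeriv hφ.1.1 β)]
    rw [hc, ih _ (hφ.partialDeriv i), integral_mul_partialDeriv (hf.mixedDeriv γ) hφ.1,
      mixedDeriv_add_single hf, sum_add_single, pow_succ]
    ring

lemma mixedDeriv_partialDeriv (hf : Smooth f) (γ : Fin d → ℕ) (i : Fin d) :
    mixedDeriv γ (partialDeriv i f) = mixedDeriv (γ + Pi.single i 1) f := by
  induction γ using multiIndex_induction with
  | h0 => rw [mixedDeriv_add_single hf, mixedDeriv_zero, mixedDeriv_zero]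
  | h1 β j ih =>
    rw [mixedDeriv_add_single (hf.partialDeriv i), ih, mixedDeriv_add_single hf,
      mixedDeriv_add_single hf _ i, mixedDeriv_add_single hf, partialDeriv_comm (hf.mixedDeriv β)]

/-- Functions that are locally integrable in an open set and have the same integral against all
test functions agree almost everywhere. -/
lemma ae_eq_of_integral_test_eq {Ω : Set (Eucl d)} (hΩ : IsOpen Ω) {g h : Eucl d → ℂ}
    (hg : LocallyIntegrableOn g Ω) (hh : LocallyIntegrableOn h Ω)
    (H : ∀ φ : Eucl d → ℂ, IsSmoothCompactIn Ω φ → ∫ x in Ω, g x * φ x = ∫ x in Ω, h x * φ x) :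
    g =ᵐ[volume.restrict Ω] h := by
  have h1 : ∀ᵐ x ∂(volume : Measure (Eucl d)), x ∈ Ω → (g - h) x = 0 := by
    refine hΩ.ae_eq_zero_of_integral_contDiff_smul_eq_zero (hg.sub hh) fun φ hφ hc hs => ?_
    have hts : tsupport (fun x => (φ x : ℂ)) ⊆ Ω :=
      (closure_mono fun x hx => by simpa using hx).trans hs
    have hφ' : IsSmoothCompactIn Ω (fun x => (φ x : ℂ)) :=
      ⟨⟨Complex.ofRealCLM.contDiff.comp hφ, hc.comp_left (g := fun r : ℝ => (r : ℂ)) (by simp)⟩, hts⟩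
    have := H _ hφ'
    rw [setIntegral_eq_integral_of_tsupport_subset hts,
      setIntegral_eq_integral_of_tsupport_subset hts] at this
    have hInt : ∀ k : Eucl d → ℂ, LocallyIntegrableOn k Ω → Integrable (fun x => k x * (φ x : ℂ)) := by
      intro k hk
      have h3 : IntegrableOn k (tsupport φ) := hk.integrableOn_compact_subset hs hc
      have h4 : IntegrableOn (fun x => (φ x : ℂ) * k x) (tsupport φ) :=
        h3.continuousOn_mul (Complex.continuous_ofReal.comp hφ.continuous).continuousOn hc
      rw [← integrableOn_iff_integrable_of_support_subset (s := tsupport φ)]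
      · simpa [mul_comm] using h4
      · intro x hx
        exact subset_tsupport _ (by intro h0; simp [h0] at hx)
    calc ∫ x, φ x • (g - h) x = ∫ x, (g x * (φ x : ℂ) - h x * (φ x : ℂ)) := by
          congr 1; funext x; simp; ring
      _ = 0 := by rw [integral_sub (hInt g hg) (hInt h hh), this, sub_self]
  rw [Filter.EventuallyEq, ae_restrict_iff' hΩ.measurableSet]
  filter_upwards [h1] with x hx hxΩ
  have := hx hxΩ
  simpa [sub_eq_zero] using this

lemma HasWeakDeriv.ae_eq {Ω : Set (Eucl d)} (hΩ : IsOpen Ω) {g h : Eucl d → ℂ}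
    (hg : HasWeakDeriv Ω γ u g) (hh : HasWeakDeriv Ω γ u h) : g =ᵐ[volume.restrict Ω] h := by
  refine ae_eq_of_integral_test_eq hΩ hg.1 hh.1 fun φ hφ => ?_
  have h1 := (hg.2 φ hφ).symm.trans (hh.2 φ hφ)
  exact mul_left_cancel₀ (pow_ne_zero _ (by norm_num)) h1

lemma hasWeakDeriv_weakDeriv {Ω : Set (Eucl d)} (h : ∃ g, HasWeakDeriv Ω γ u g) :
    HasWeakDeriv Ω γ u (weakDeriv Ω γ u) := by
  rw [weakDeriv, dif_pos h]; exact h.choose_spec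

lemma HasWeakDeriv.weakDeriv_ae_eq {Ω : Set (Eucl d)} (hΩ : IsOpen Ω) {g : Eucl d → ℂ}
    (h : HasWeakDeriv Ω γ u g) : weakDeriv Ω γ u =ᵐ[volume.restrict Ω] g :=
  (hasWeakDeriv_weakDeriv ⟨g, h⟩).ae_eq hΩ h

lemma integrableOn_mul_test {Ω : Set (Eucl d)} {φ : Eucl d → ℂ} (hu : LocallyIntegrableOn u Ω)
    (hφ : IsSmoothCompactIn Ω φ) : Integrable (fun x => u x * φ x) := by
  have h3 : IntegrableOn u (tsupport φ) := hu.integrableOn_compact_subset hφ.2 hφ.1.2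
  have h4 : IntegrableOn (fun x => φ x * u x) (tsupport φ) :=
    h3.continuousOn_mul hφ.1.1.continuous.continuousOn hφ.1.2
  rw [← integrableOn_iff_integrable_of_support_subset (s := tsupport φ)]
  · simpa [mul_comm] using h4
  · intro x hx
    exact subset_tsupport _ (by intro h0; simp [h0] at hx)

lemma HasWeakDeriv.sub {Ω : Set (Eucl d)} {v g h : Eucl d → ℂ} (hu : LocallyIntegrableOn u Ω)
    (hv : LocallyIntegrableOn v Ω) (hg : HasWeakDeriv Ω γ u g) (hh : HasWeakDeriv Ω γ v h) :
    HasWeakDeriv Ω γ (u - v) (g - h) := by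
  refine ⟨hg.1.sub hh.1, fun φ hφ => ?_⟩
  have e1 : ∀ a b : Eucl d → ℂ, LocallyIntegrableOn a Ω → LocallyIntegrableOn b Ω →
      ∀ ψ, IsSmoothCompactIn Ω ψ →
      ∫ x in Ω, (a - b) x * ψ x = (∫ x in Ω, a x * ψ x) - ∫ x in Ω, b x * ψ x := by
    intro a b ha hb ψ hψ
    rw [← integral_sub (integrableOn_mul_test ha hψ).integrableOn
      (integrableOn_mul_test hb hψ).integrableOn]
    congr 1; funext x; simp; ring
  rw [e1 _ _ hu hv _ (hφ.mixedDeriv γ), e1 _ _ hg.1 hh.1 _ hφ, hg.2 φ hφ, hh.2 φ hφ]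
  ring

/-! ### Averages over balls -/

/-- The integral over the unit ball of `F` transported to `B(w, r)`; this is `r^{-d} ∫_{B(w,r)} F`
if `r > 0`. -/
def bavg (F : Eucl d → ℝ≥0∞) (w : Eucl d) (r : ℝ) : ℝ≥0∞ :=
  ∫⁻ z in ball (0 : Eucl d) 1, F (w + r • z)

lemma lintegral_comp_add_smul (G : Eucl d → ℝ≥0∞) (w : Eucl d) (hr : 0 < r) :
    ∫⁻ y, G y = ofReal (r ^ d) * ∫⁻ z, G (w + r • z) := by
  have h1 : ∫⁻ z, G (w + r • z) = ∫⁻ z, (fun y => G (w + y)) z ∂(Measure.map (r • ·) volume) := by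
    exact ((Homeomorph.smulOfNeZero r hr.ne').measurableEmbedding.lintegral_map
      (μ := volume) (fun y => G (w + y))).symm
  rw [h1, Measure.map_addHaar_smul _ hr.ne', lintegral_smul_measure, lintegral_add_left_eq_self,
    smul_eq_mul, ← mul_assoc, ← ofReal_mul (by positivity)]
  have : r ^ d * |(r ^ Module.finrank ℝ (Eucl d))⁻¹| = 1 := by
    rw [finrank_euclideanSpace_fin, abs_of_pos (by positivity)]
    exact mul_inv_cancel₀ (by positivity)
  rw [this]; simp

lemma lintegral_ball_eq (F : Eucl d → ℝ≥0∞) (w : Eucl d) (hr : 0 < r) :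
    ∫⁻ y in ball w r, F y = ofReal (r ^ d) * bavg F w r := by
  rw [bavg, ← lintegral_indicator measurableSet_ball, ← lintegral_indicator measurableSet_ball,
    lintegral_comp_add_smul _ w hr]
  congr 2
  funext z
  have : w + r • z ∈ ball w r ↔ z ∈ ball (0 : Eucl d) 1 := by
    simp only [mem_ball, dist_self_add_left, dist_zero_right, norm_smul, norm_eq_abs,
      abs_of_pos hr]
    constructor
    · intro h; exact lt_of_mul_lt_mul_left (by simpa using h) hr.le
    · intro h; nlinarith
  by_cases hz : z ∈ ball (0 : Eucl d) 1
  · rw [indicator_of_mem (this.2 hz), indicator_of_mem hz]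
  · rw [indicator_of_notMem (fun h => hz (this.1 h)), indicator_of_notMem hz]

lemma bavg_eq (F : Eucl d → ℝ≥0∞) (w : Eucl d) (hr : 0 < r) :
    bavg F w r = ofReal ((r ^ d)⁻¹) * ∫⁻ y in ball w r, F y := by
  rw [lintegral_ball_eq F w hr, ← mul_assoc, ← ofReal_mul (by positivity),
    inv_mul_cancel₀ (by positivity)]
  simp

lemma mem_ball_add_smul {z : Eucl d} (hr : 0 < r) (hz : z ∈ ball (0 : Eucl d) 1) :
    w + r • z ∈ ball w r := by
  simp only [mem_ball, dist_self_add_left, norm_smul, norm_eq_abs, abs_of_pos hr]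
  rw [mem_ball_zero_iff] at hz
  nlinarith

lemma bavg_mono {G : Eucl d → ℝ≥0∞} (hr : 0 < r) (h : ∀ y ∈ ball w r, F y ≤ G y) :
    bavg F w r ≤ bavg G w r :=
  setLIntegral_mono' measurableSet_ball fun _ hz => h _ (mem_ball_add_smul hr hz)

lemma bavg_congr {G : Eucl d → ℝ≥0∞} (hr : 0 < r) (h : ∀ y ∈ ball w r, F y = G y) :
    bavg F w r = bavg G w r :=
  le_antisymm (bavg_mono hr fun y hy => (h y hy).le) (bavg_mono hr fun y hy => (h y hy).ge)

lemma bavg_const_mul {c : ℝ≥0∞} (hc : c ≠ ∞) : bavg (fun y => c * F y) w r = c * bavg F w r :=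
  lintegral_const_mul' _ _ hc

lemma bavg_const {c : ℝ≥0∞} : bavg (fun _ => c) w r = c * volume (ball (0 : Eucl d) 1) := by
  simp [bavg]

lemma bavg_add {G : Eucl d → ℝ≥0∞} (hF : Measurable F) :
    bavg (fun y => F y + G y) w r = bavg F w r + bavg G w r :=
  lintegral_add_left (hF.comp (by fun_prop)) _

lemma bavg_sum {ι : Type*} {F : ι → Eucl d → ℝ≥0∞} {s : Finset ι} (hF : ∀ i ∈ s, Measurable (F i)) :
    bavg (fun y => ∑ i ∈ s, F i y) w r = ∑ i ∈ s, bavg (F i) w r :=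
  lintegral_finsetSum' _ fun i hi => ((hF i hi).comp (by fun_prop)).aemeasurable

lemma bavg_le_of_subset {w' : Eucl d} {r' : ℝ} (hr : 0 < r) (hr' : 0 < r')
    (h : ball w r ⊆ ball w' r') : bavg F w r ≤ ofReal ((r' / r) ^ d) * bavg F w' r' := by
  rw [bavg_eq F w hr, bavg_eq F w' hr', ← mul_assoc, ← ofReal_mul (by positivity)]
  have : (r' / r) ^ d * (r' ^ d)⁻¹ = (r ^ d)⁻¹ := by rw [div_pow]; field_simp
  rw [this]
  gcongr

lemma bavg_le_mul_of_dist {w' : Eucl d} {r' Λ : ℝ} (hr : 0 < r) (hr' : r' ≤ Λ * r)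
    (h : dist w w' + r ≤ r') : bavg F w r ≤ ofReal (Λ ^ d) * bavg F w' r' := by
  have hr'0 : 0 < r' := lt_of_lt_of_le hr ((le_add_of_nonneg_left dist_nonneg).trans h)
  refine (bavg_le_of_subset hr hr'0 (ball_subset_ball' (by linarith))).trans ?_
  gcongr
  rwa [div_le_iff₀ hr]

lemma rpow_lintegral_le {α : Type*} [MeasurableSpace α] (μ : Measure α) {f : α → ℝ≥0∞}
    (hf : AEMeasurable f μ) (hq : 1 ≤ q) :
    (∫⁻ a, f a ∂μ) ^ q ≤ μ Set.univ ^ (q - 1) * ∫⁻ a, f a ^ q ∂μ := by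
  rcases hq.eq_or_lt with rfl | hq
  · simp
  have hpq := Real.HolderConjugate.conjExponent hq
  have h := ENNReal.lintegral_mul_le_Lp_mul_Lq μ hpq hf (aemeasurable_const (b := (1 : ℝ≥0∞)))
  simp only [Pi.mul_apply, mul_one, ENNReal.one_rpow, lintegral_const, one_mul] at h
  calc (∫⁻ a, f a ∂μ) ^ q ≤ ((∫⁻ a, f a ^ q ∂μ) ^ (1 / q) *
        μ Set.univ ^ (1 / q.conjExponent)) ^ q := by gcongr
    _ = μ Set.univ ^ (q - 1) * ∫⁻ a, f a ^ q ∂μ := by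
      rw [mul_rpow_of_nonneg _ _ (by linarith), ← rpow_mul, ← rpow_mul,
        one_div_mul_cancel (by linarith), rpow_one, mul_comm]
      congr 2
      rw [Real.conjExponent]
      have : q ≠ 0 := by linarith
      have : q - 1 ≠ 0 := by linarith
      field_simp

lemma measurable_enorm_rpow_comp {α : Type*} [TopologicalSpace α] [MeasurableSpace α]
    [OpensMeasurableSpace α] {G : Type*} [NormedAddCommGroup G] {f : α → G} (hf : Continuous f) (q : ℝ) :
    Measurable fun a => ‖f a‖ₑ ^ q :=
  hf.enorm.measurable.pow_const q

variable {G : Type*} [NormedAddCommGroup G] [NormedSpace ℝ G]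

lemma enorm_sub_le_lintegral_fderiv [CompleteSpace G] {V : Eucl d → G} (hV : ContDiff ℝ 1 V)
    (a b : Eucl d) :
    ‖V b - V a‖ₑ ≤ ∫⁻ s in Ioc (0 : ℝ) 1, ‖fderiv ℝ V (a + s • (b - a))‖ₑ * ‖b - a‖ₑ := by
  have hc : Continuous fun s : ℝ => fderiv ℝ V (a + s • (b - a)) (b - a) :=
    ((hV.continuous_fderiv (by simp)).comp (by fun_prop)).clm_apply continuous_const
  have h1 : ∫ s in (0 : ℝ)..1, fderiv ℝ V (a + s • (b - a)) (b - a) = V b - V a := by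
    rw [intervalIntegral.integral_eq_sub_of_hasDerivAt (f := fun s : ℝ => V (a + s • (b - a)))]
    · simp
    · intro s _
      have h2 : HasDerivAt (fun s : ℝ => a + s • (b - a)) (b - a) s := by
        simpa using ((hasDerivAt_id s).smul_const (b - a)).const_add a
      exact ((hV.differentiable (by simp) _).hasFDerivAt.comp_hasDerivAt s h2)
    · exact hc.intervalIntegrable _ _
  rw [← h1, intervalIntegral.integral_of_le zero_le_one]
  refine (enorm_integral_le_lintegral_enorm _).trans (lintegral_mono fun s => ?_)
  exact ContinuousLinearMap.le_opENorm _ _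

/-- Averages over two balls are compared through the balls that interpolate between them. -/
lemma bavg_hop [CompleteSpace G] {V : Eucl d → G} (hV : ContDiff ℝ 1 V) (hq : 1 ≤ q)
    (x w : Eucl d) (r r' : ℝ) {L : ℝ} (hL : ‖w - x‖ + |r' - r| ≤ L) {A : ℝ≥0∞}
    (hA : ∀ s ∈ Set.Icc (0 : ℝ) 1,
      bavg (fun y => ‖fderiv ℝ V y‖ₑ ^ q) (x + s • (w - x)) (r + s * (r' - r)) ≤ A) :
    bavg (fun y => ‖V y‖ₑ ^ q) x r ≤
      2 ^ (q - 1) * (bavg (fun y => ‖V y‖ₑ ^ q) w r' + ofReal L ^ q * A) := by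
  have hq0 : 0 ≤ q := by linarith
  set c : ℝ × Eucl d → Eucl d := fun p => (x + p.1 • (w - x)) + (r + p.1 * (r' - r)) • p.2 with hc
  have hcc : Continuous c := by fun_prop
  have hdc : Continuous fun p => fderiv ℝ V (c p) := (hV.continuous_fderiv (by simp)).comp hcc
  have key : ∀ z ∈ ball (0 : Eucl d) 1, ‖V (x + r • z)‖ₑ ^ q ≤ 2 ^ (q - 1) *
      (‖V (w + r' • z)‖ₑ ^ q + ofReal L ^ q *
        ∫⁻ s in Ioc (0 : ℝ) 1, ‖fderiv ℝ V (c (s, z))‖ₑ ^ q) := by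
    intro z hz
    rw [mem_ball_zero_iff] at hz
    have h1 : ‖V (x + r • z)‖ₑ ≤ ‖V (w + r' • z)‖ₑ + ofReal L *
        ∫⁻ s in Ioc (0 : ℝ) 1, ‖fderiv ℝ V (c (s, z))‖ₑ := by
      have h2 := enorm_sub_le_lintegral_fderiv hV (x + r • z) (w + r' • z)
      have h3 : ‖V (x + r • z)‖ₑ ≤ ‖V (w + r' • z)‖ₑ + ‖V (w + r' • z) - V (x + r • z)‖ₑ := by
        have := enorm_sub_le (a := V (w + r' • z)) (b := V (w + r' • z) - V (x + r • z))
        simpa using this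
      refine h3.trans (add_le_add le_rfl (h2.trans ?_))
      rw [← lintegral_const_mul' _ _ ofReal_ne_top]
      refine lintegral_mono fun s => ?_
      have h4 : x + r • z + s • (w + r' • z - (x + r • z)) = c (s, z) := by
        simp only [hc]; module
      rw [h4, mul_comm]
      gcongr
      rw [← ofReal_norm]
      apply ofReal_le_ofReal
      have h5 : w + r' • z - (x + r • z) = (w - x) + (r' - r) • z := by module
      rw [h5]
      refine (norm_add_le _ _).trans (le_trans ?_ hL)
      rw [norm_smul, norm_eq_abs]
      nlinarith [abs_nonneg (r' - r)]
    calc ‖V (x + r • z)‖ₑ ^ q ≤ (‖V (w + r' • z)‖ₑ + ofReal L *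
          ∫⁻ s in Ioc (0 : ℝ) 1, ‖fderiv ℝ V (c (s, z))‖ₑ) ^ q := by gcongr
      _ ≤ _ := ENNReal.rpow_add_le_mul_rpow_add_rpow _ _ hq
      _ ≤ _ := by
        rw [mul_rpow_of_nonneg _ _ hq0]
        gcongr
        refine (rpow_lintegral_le _ ?_ hq).trans (by simp)
        exact (hdc.comp (Continuous.prodMk_left z)).enorm.measurable.aemeasurable
  have hm1 : Measurable fun z : Eucl d => ‖V (w + r' • z)‖ₑ ^ q :=
    measurable_enorm_rpow_comp (hV.continuous.comp (by fun_prop)) q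
  have hmu : Measurable (fun p : ℝ × Eucl d => ‖fderiv ℝ V (c p)‖ₑ ^ q) :=
    measurable_enorm_rpow_comp hdc q
  refine (setLIntegral_mono' measurableSet_ball key).trans ?_
  rw [lintegral_const_mul' _ _ (by simp), lintegral_add_left hm1,
    lintegral_const_mul' _ _ (by simp [hq0])]
  gcongr
  · rfl
  · rw [lintegral_lintegral_swap (f := fun z s => ‖fderiv ℝ V (c (s, z))‖ₑ ^ q)
      (hmu.comp measurable_swap).aemeasurable]
    calc ∫⁻ s in Ioc (0 : ℝ) 1, ∫⁻ z in ball (0 : Eucl d) 1, ‖fderiv ℝ V (c (s, z))‖ₑ ^ q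
        ≤ ∫⁻ s in Ioc (0 : ℝ) 1, A :=
          setLIntegral_mono' measurableSet_Ioc fun s hs => hA s ⟨hs.1.le, hs.2⟩
      _ = A := by simp

lemma lintegral_ball_convex_comb_le (Φ : Eucl d → ℝ≥0∞) {z : Eucl d}
    (hz : z ∈ ball (0 : Eucl d) 1) {s : ℝ} (hs : 1 / 2 ≤ s) (hs1 : s ≤ 1) :
    ∫⁻ y in ball (0 : Eucl d) 1, Φ ((1 - s) • z + s • y) ≤
      2 ^ d * ∫⁻ y in ball (0 : Eucl d) 1, Φ y := by
  rw [mem_ball_zero_iff] at hz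
  have h := bavg_le_mul_of_dist (F := Φ) (w := (1 - s) • z) (w' := 0) (r := s) (r' := 1) (Λ := 2)
    (by linarith) (by linarith) (by
      rw [dist_zero_right, norm_smul, norm_eq_abs, abs_of_nonneg (by linarith)]
      nlinarith)
  simpa [bavg] using h

/-- A Poincaré inequality on a ball. -/
lemma bavg_poincare [CompleteSpace G] {V : Eucl d → G} (hV : ContDiff ℝ 1 V) (hq : 1 ≤ q)
    (w : Eucl d) (hr : 0 ≤ r) :
    volume (ball (0 : Eucl d) 1) ^ q * bavg (fun y => ‖V y‖ₑ ^ q) w r ≤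
      2 ^ (q - 1) * (volume (ball (0 : Eucl d) 1) * ‖∫ z in ball (0 : Eucl d) 1, V (w + r • z)‖ₑ ^ q
        + volume (ball (0 : Eucl d) 1) ^ q * (ofReal (2 * r) ^ q *
          (2 ^ d * bavg (fun y => ‖fderiv ℝ V y‖ₑ ^ q) w r))) := by
  have hq0 : 0 ≤ q := by linarith
  set v := volume (ball (0 : Eucl d) 1) with hv
  have hvt : v ≠ ∞ := measure_ball_lt_top.ne
  set ν := (volume : Measure (Eucl d)).restrict (ball 0 1) with hν
  have : IsFiniteMeasure ν := ⟨by simp [hν, measure_ball_lt_top]⟩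
  set W : Eucl d → G := fun z => V (w + r • z)
  have hWc : ContDiff ℝ 1 W := hV.comp (by fun_prop)
  have hWi : Integrable W ν := (hWc.continuous.continuousOn.integrableOn_compact
    (isCompact_closedBall 0 1)).mono_set ball_subset_closedBall
  set Φ : Eucl d → ℝ≥0∞ := fun z => ‖fderiv ℝ V (w + r • z)‖ₑ ^ q
  have hdV : Continuous (fderiv ℝ V) := hV.continuous_fderiv (by simp)
  have hΦm : Measurable Φ := measurable_enorm_rpow_comp (hdV.comp (by fun_prop)) q
  set c : Eucl d × Eucl d × ℝ → Eucl d := fun p => p.2.1 + p.2.2 • (p.1 - p.2.1) with hc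
  have hcc : Continuous c := by fun_prop
  have hmp : ∀ z, Continuous fun p : Eucl d × ℝ => fderiv ℝ V (w + r • c (z, p)) := fun z =>
    hdV.comp (by fun_prop)
  set μ := ν.prod ((volume : Measure ℝ).restrict (Ioc 0 1)) with hμ
  have hμv : μ Set.univ = v := by
    rw [hμ, ← Set.univ_prod_univ, Measure.prod_prod]; simp [hν, hv]
  have key : ∀ z ∈ ball (0 : Eucl d) 1, v ^ q * ‖W z‖ₑ ^ q ≤ 2 ^ (q - 1) *
      (‖∫ z, W z ∂ν‖ₑ ^ q + ofReal (2 * r) ^ q * (v ^ (q - 1) * ∫⁻ p, Φ (c (z, p)) ∂μ)) := by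
    intro z hz
    have h1 : v * ‖W z‖ₑ ≤ ‖∫ z, W z ∂ν‖ₑ + ofReal (2 * r) *
        ∫⁻ p, ‖fderiv ℝ V (w + r • c (z, p))‖ₑ ∂μ := by
      have e1 : ∫ z', (W z - W z') ∂ν = v.toReal • W z - ∫ z, W z ∂ν := by
        rw [integral_sub (integrable_const _) hWi]; simp [hν, hv, Measure.real]
      have e2 : v * ‖W z‖ₑ = ‖v.toReal • W z‖ₑ := by
        rw [enorm_smul, Real.enorm_eq_ofReal ENNReal.toReal_nonneg, ENNReal.ofReal_toReal hvt]
      have e3 : v.toReal • W z = ∫ z, W z ∂ν + ∫ z', (W z - W z') ∂ν := by rw [e1]; abel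
      rw [e2, e3]
      refine (enorm_add_le _ _).trans (add_le_add le_rfl ?_)
      refine (enorm_integral_le_lintegral_enorm _).trans ?_
      rw [hμ, lintegral_prod _ (hmp z).enorm.measurable.aemeasurable,
        ← lintegral_const_mul' _ _ ofReal_ne_top]
      refine setLIntegral_mono' measurableSet_ball fun z' hz' => ?_
      rw [← lintegral_const_mul' _ _ ofReal_ne_top]
      refine (enorm_sub_le_lintegral_fderiv hV (w + r • z') (w + r • z)).trans
        (lintegral_mono fun s => ?_)
      have h4 : w + r • z' + s • (w + r • z - (w + r • z')) = w + r • c (z, z', s) := by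
        simp only [hc]; module
      rw [h4, mul_comm]
      gcongr
      rw [← ofReal_norm]
      apply ofReal_le_ofReal
      have h5 : w + r • z - (w + r • z') = r • (z - z') := by module
      rw [h5, norm_smul, norm_eq_abs, abs_of_nonneg hr]
      rw [mem_ball_zero_iff] at hz hz'
      nlinarith [norm_sub_le z z']
    calc v ^ q * ‖W z‖ₑ ^ q = (v * ‖W z‖ₑ) ^ q := (mul_rpow_of_nonneg _ _ hq0).symm
      _ ≤ _ := rpow_le_rpow h1 hq0
      _ ≤ _ := ENNReal.rpow_add_le_mul_rpow_add_rpow _ _ hq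
      _ ≤ _ := by
        rw [mul_rpow_of_nonneg _ _ hq0]
        gcongr
        refine (rpow_lintegral_le _ (hmp z).enorm.measurable.aemeasurable hq).trans ?_
        rw [hμv]
  have hfub : ∫⁻ z, ∫⁻ p, Φ (c (z, p)) ∂μ ∂ν ≤ v * (2 ^ d * ∫⁻ z, Φ z ∂ν) := by
    have m1 : Measurable fun p : Eucl d × (Eucl d × ℝ) => Φ (c p) := hΦm.comp hcc.measurable
    have e1 : ∫⁻ z, ∫⁻ p, Φ (c (z, p)) ∂μ ∂ν =
        ∫⁻ s in Ioc (0 : ℝ) 1, ∫⁻ z, ∫⁻ z', Φ (z' + s • (z - z')) ∂ν ∂ν := by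
      have e2 : ∀ z, ∫⁻ p, Φ (c (z, p)) ∂μ =
          ∫⁻ s in Ioc (0 : ℝ) 1, ∫⁻ z', Φ (z' + s • (z - z')) ∂ν := by
        intro z
        rw [hμ]
        exact lintegral_prod_symm (fun p => Φ (c (z, p)))
          (m1.comp measurable_prodMk_left).aemeasurable
      simp_rw [e2]
      rw [lintegral_lintegral_swap]
      have m2 : Measurable fun p : (Eucl d × ℝ) × Eucl d => Φ (p.2 + p.1.2 • (p.1.1 - p.2)) :=
        hΦm.comp (by fun_prop)
      exact (Measurable.lintegral_prod_right' (ν := ν) m2).aemeasurable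
    rw [e1]
    have bound : ∀ s ∈ Ioc (0 : ℝ) 1, ∫⁻ z, ∫⁻ z', Φ (z' + s • (z - z')) ∂ν ∂ν ≤
        v * (2 ^ d * ∫⁻ z, Φ z ∂ν) := by
      intro s hs
      have hvc : ∫⁻ _, (2 ^ d * ∫⁻ z, Φ z ∂ν) ∂ν = v * (2 ^ d * ∫⁻ z, Φ z ∂ν) := by
        rw [lintegral_const, mul_comm]; simp [hν, hv]
      rw [← hvc]
      rcases le_total s (1 / 2) with h | h
      · refine setLIntegral_mono' measurableSet_ball fun z hz => ?_
        have := lintegral_ball_convex_comb_le Φ hz (s := 1 - s) (by linarith) (by linarith [hs.1])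
        refine le_trans (le_of_eq ?_) this
        refine lintegral_congr fun z' => ?_
        congr 1; module
      · rw [lintegral_lintegral_swap]
        · refine setLIntegral_mono' measurableSet_ball fun z' hz' => ?_
          have := lintegral_ball_convex_comb_le Φ hz' (s := s) (by linarith) hs.2
          refine le_trans (le_of_eq ?_) this
          refine lintegral_congr fun z => ?_
          congr 1; module
        · exact (hΦm.comp (by fun_prop : Measurable fun p : Eucl d × Eucl d =>
            p.2 + s • (p.1 - p.2))).aemeasurable
    calc _ ≤ ∫⁻ s in Ioc (0 : ℝ) 1, v * (2 ^ d * ∫⁻ z, Φ z ∂ν) :=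
          setLIntegral_mono' measurableSet_Ioc bound
      _ = _ := by simp
  calc v ^ q * bavg (fun y => ‖V y‖ₑ ^ q) w r = ∫⁻ z, v ^ q * ‖W z‖ₑ ^ q ∂ν := by
        rw [lintegral_const_mul' _ _ (by simp [hq0, hvt])]; rfl
    _ ≤ ∫⁻ z, 2 ^ (q - 1) * (‖∫ z, W z ∂ν‖ₑ ^ q + ofReal (2 * r) ^ q *
        (v ^ (q - 1) * ∫⁻ p, Φ (c (z, p)) ∂μ)) ∂ν := setLIntegral_mono' measurableSet_ball key
    _ = 2 ^ (q - 1) * (v * ‖∫ z, W z ∂ν‖ₑ ^ q + ofReal (2 * r) ^ q *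
        (v ^ (q - 1) * ∫⁻ z, ∫⁻ p, Φ (c (z, p)) ∂μ ∂ν)) := by
        rw [lintegral_const_mul' _ _ (by simp), lintegral_add_left measurable_const,
          lintegral_const_mul' _ _ (rpow_ne_top_of_nonneg hq0 ofReal_ne_top),
          lintegral_const_mul' _ _ (by simp [hq, hvt]),
          lintegral_const, mul_comm v]
        simp [hν, hv]
    _ ≤ 2 ^ (q - 1) * (v * ‖∫ z, W z ∂ν‖ₑ ^ q + ofReal (2 * r) ^ q *
        (v ^ (q - 1) * (v * (2 ^ d * ∫⁻ z, Φ z ∂ν)))) := by gcongr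
    _ = _ := by
      have : v ^ (q - 1) * v = v ^ q := by
        conv_lhs => rw [← rpow_one v, ← rpow_mul, one_mul]
        rw [← ENNReal.rpow_add_of_nonneg _ _ (by linarith) zero_le_one]
        congr 1; ring
      rw [← mul_assoc (v ^ (q - 1)), this]
      congr 2
      change _ = v ^ q * (ofReal (2 * r) ^ q * (2 ^ d * ∫⁻ z, Φ z ∂ν))
      ring

lemma Smooth.iteratedFDeriv (hf : Smooth f) (k : ℕ) : ContDiff ℝ 1 (iteratedFDeriv ℝ k f) :=
  ContDiff.iteratedFDeriv_right (n := ((⊤ : ℕ∞) : WithTop ℕ∞)) hf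
    (by exact_mod_cast (le_top : ((1 + k : ℕ) : ℕ∞) ≤ ⊤))

lemma enorm_fderiv_iteratedFDeriv (f : Eucl d → ℂ) (k : ℕ) (x : Eucl d) :
    ‖fderiv ℝ (iteratedFDeriv ℝ k f) x‖ₑ = ‖iteratedFDeriv ℝ (k + 1) f x‖ₑ := by
  rw [← ofReal_norm, ← ofReal_norm, norm_fderiv_iteratedFDeriv]

/-- The density `‖D^k U‖^q`. -/
def jetPow (q : ℝ) (k : ℕ) (U : Eucl d → ℂ) (y : Eucl d) : ℝ≥0∞ := ‖iteratedFDeriv ℝ k U y‖ₑ ^ q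

lemma measurable_jetPow (q : ℝ) (k : ℕ) {U : Eucl d → ℂ} (hU : Smooth U) :
    Measurable (jetPow q k U) :=
  measurable_enorm_rpow_comp (hU.iteratedFDeriv k).continuous q

lemma fderiv_jetPow_eq (q : ℝ) (k : ℕ) (U : Eucl d → ℂ) :
    (fun y => ‖fderiv ℝ (iteratedFDeriv ℝ k U) y‖ₑ ^ q) = jetPow q (k + 1) U := by
  funext y
  rw [enorm_fderiv_iteratedFDeriv, jetPow]

lemma bavg_jetPow_hop {U : Eucl d → ℂ} (hU : Smooth U) (hq : 1 ≤ q) (k : ℕ)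
    {Good : Set (Eucl d × ℝ)} {B B' : Eucl d × ℝ} (hB : segment ℝ B B' ⊆ Good) {L : ℝ}
    (hL : ‖B'.1 - B.1‖ + |B'.2 - B.2| ≤ L) {A : ℝ≥0∞}
    (hA : ∀ B ∈ Good, bavg (jetPow q (k + 1) U) B.1 B.2 ≤ A) :
    bavg (jetPow q k U) B.1 B.2 ≤
      2 ^ (q - 1) * (bavg (jetPow q k U) B'.1 B'.2 + ofReal L ^ q * A) := by
  have key : ∀ s ∈ Set.Icc (0 : ℝ) 1, bavg (fun y => ‖fderiv ℝ (iteratedFDeriv ℝ k U) y‖ₑ ^ q)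
      (B.1 + s • (B'.1 - B.1)) (B.2 + s * (B'.2 - B.2)) ≤ A := by
   intro s hs
   have h1 : (B.1 + s • (B'.1 - B.1), B.2 + s * (B'.2 - B.2)) ∈ Good := by
    refine hB ?_
    rw [segment_eq_image']
    refine ⟨s, hs, Prod.ext ?_ ?_⟩
    · simp only [Prod.fst_add, Prod.smul_fst, Prod.fst_sub]
    · simp only [Prod.snd_add, Prod.smul_snd, Prod.snd_sub, smul_eq_mul]
   have h2 := hA _ h1
   rw [fderiv_jetPow_eq]
   exact h2
  have h3 := bavg_hop (V := iteratedFDeriv ℝ k U) (hU.iteratedFDeriv k) hq B.1 B'.1 B.2 B'.2 hL key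
  exact h3

lemma le_two_rpow_mul (hq : 1 ≤ q) (a : ℝ≥0∞) : a ≤ 2 ^ (q - 1) * a := le_mul_of_one_le_left' (by
    simpa using ENNReal.rpow_le_rpow_of_exponent_le (x := 2) (by norm_num)
      (show (0 : ℝ) ≤ q - 1 by linarith))

/-- Control of lower order derivatives by derivatives of top order along families of balls that are
connected to a reference ball. -/
lemma exists_chain_const (d m : ℕ) (hq : 1 ≤ q) :
    ∃ C : ℝ≥0, ∀ (U : Eucl d → ℂ) (_ : Smooth U) (Good : Set (Eucl d × ℝ)) (ref : Eucl d × ℝ)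
      (L : ℝ) (A : ℝ≥0∞), ref ∈ Good → 0 ≤ ref.2 → ref.2 ≤ L →
      (∀ B ∈ Good, ∃ B₁ B₂, segment ℝ B B₁ ⊆ Good ∧ segment ℝ B₁ B₂ ⊆ Good ∧
        segment ℝ B₂ ref ⊆ Good) →
      (∀ B ∈ Good, ∀ B' ∈ Good, ‖B'.1 - B.1‖ + |B'.2 - B.2| ≤ L) →
      (∀ B ∈ Good, bavg (jetPow q m U) B.1 B.2 ≤ A) →
      (∀ j < m, ‖∫ z in ball (0 : Eucl d) 1, iteratedFDeriv ℝ j U (ref.1 + ref.2 • z)‖ₑ ^ q ≤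
        (ofReal L ^ q) ^ (m - j) * A) →
      ∀ k ≤ m, ∀ B ∈ Good, bavg (jetPow q k U) B.1 B.2 ≤ C * ((ofReal L ^ q) ^ (m - k) * A) := by
  have hq0 : 0 ≤ q := by linarith
  set v := volume (ball (0 : Eucl d) 1)
  have hvt : v ≠ ∞ := measure_ball_lt_top.ne
  have hv0 : v ≠ 0 := (measure_ball_pos _ _ one_pos).ne'
  have hvq0 : v ^ q ≠ 0 := by simp [hv0, hvt]
  have hvqt : v ^ q ≠ ∞ := rpow_ne_top_of_nonneg hq0 hvt
  set H : ℝ≥0∞ := 2 ^ (q - 1)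
  have hHt : H ≠ ∞ := rpow_ne_top_of_nonneg (by linarith) (by norm_num)
  set CP : ℝ≥0∞ := (v ^ q)⁻¹ * (H * (v + v ^ q * (2 ^ q * 2 ^ d))) with hCP
  set C₀ : ℝ≥0∞ := H * (H * (H * (CP + 1) + 1) + 1) with hC₀
  have h2q : (2 : ℝ≥0∞) ^ q ≠ ∞ := rpow_ne_top_of_nonneg hq0 (by norm_num)
  have hCPt : CP ≠ ∞ := by
    refine mul_ne_top (by simp [hvq0]) (mul_ne_top hHt ?_)
    exact ENNReal.add_ne_top.2 ⟨hvt, mul_ne_top hvqt (mul_ne_top h2q (by finiteness))⟩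
  have hC₀t : C₀ ≠ ∞ := by finiteness
  have hC₀1 : 1 ≤ C₀ := by
    refine le_trans ?_ (le_two_rpow_mul hq _)
    exact le_add_self
  refine ⟨(C₀ ^ m).toNNReal, fun U hU Good ref L A href href0 hrefL hG hL htop hmean => ?_⟩
  rw [coe_toNNReal (ENNReal.pow_ne_top hC₀t)]
  set Λ := ofReal L ^ q with hΛ
  have main : ∀ i ≤ m, ∀ B ∈ Good, bavg (jetPow q (m - i) U) B.1 B.2 ≤ C₀ ^ i * (Λ ^ i * A) := by
    intro i
    induction i with
    | zero => intro _ B hB; simpa using htop B hB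
    | succ i ih =>
      intro hi B hB
      have ih' := ih (by omega)
      have hk : m - i = (m - (i + 1)) + 1 := by omega
      rw [hk] at ih'
      set k := m - (i + 1)
      set X := C₀ ^ i * (Λ ^ i * A) with hX
      have hΛX : C₀ ^ i * (Λ ^ (i + 1) * A) = Λ * X := by rw [hX, pow_succ]; ring
      have hrefb : bavg (jetPow q k U) ref.1 ref.2 ≤ CP * (Λ * X) := by
        have h1 := bavg_poincare (hU.iteratedFDeriv k) hq ref.1 href0
        have h2 : ‖∫ z in ball (0 : Eucl d) 1, iteratedFDeriv ℝ k U (ref.1 + ref.2 • z)‖ₑ ^ q ≤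
            Λ * X := by
          refine (hmean k (by omega)).trans ?_
          have : m - k = i + 1 := by omega
          rw [this, ← hΛX]
          exact le_mul_of_one_le_left' (one_le_pow₀ hC₀1)
        have h3 : bavg (fun y => ‖fderiv ℝ (iteratedFDeriv ℝ k U) y‖ₑ ^ q) ref.1 ref.2 ≤ X := by
          rw [fderiv_jetPow_eq]
          exact ih' ref href
        have h4 : ofReal (2 * ref.2) ^ q ≤ 2 ^ q * Λ := by
          rw [hΛ, ← mul_rpow_of_nonneg _ _ hq0, ofReal_mul (by norm_num)]
          gcongr
          simp
        have h5 : v ^ q * bavg (jetPow q k U) ref.1 ref.2 ≤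
            H * (v * (Λ * X) + v ^ q * ((2 ^ q * Λ) * (2 ^ d * X))) := by
          refine h1.trans ?_
          gcongr
        calc bavg (jetPow q k U) ref.1 ref.2
            = (v ^ q)⁻¹ * (v ^ q * bavg (jetPow q k U) ref.1 ref.2) := by
              rw [← mul_assoc, ENNReal.inv_mul_cancel hvq0 hvqt, one_mul]
          _ ≤ (v ^ q)⁻¹ * _ := mul_le_mul_right h5 _
          _ = CP * (Λ * X) := by rw [hCP]; ring
      obtain ⟨B₁, B₂, s1, s2, s3⟩ := hG B hB
      have hB₁ : B₁ ∈ Good := s1 (right_mem_segment _ _ _)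
      have hB₂ : B₂ ∈ Good := s2 (right_mem_segment _ _ _)
      have t3 := bavg_jetPow_hop hU hq k s3 (hL _ hB₂ _ href) ih'
      have t2 := bavg_jetPow_hop hU hq k s2 (hL _ hB₁ _ hB₂) ih'
      have t1 := bavg_jetPow_hop hU hq k s1 (hL _ hB _ hB₁) ih'
      calc bavg (jetPow q k U) B.1 B.2
          ≤ H * (H * (H * (CP * (Λ * X) + Λ * X) + Λ * X) + Λ * X) := by
            refine t1.trans ?_
            gcongr
            refine t2.trans ?_
            gcongr
            refine t3.trans ?_
            gcongr
        _ = C₀ * (Λ * X) := by rw [hC₀]; ring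
        _ = C₀ ^ (i + 1) * (Λ ^ (i + 1) * A) := by rw [← hΛX, pow_succ C₀]; ring
  intro k hk B hB
  have := main (m - k) (by omega) B hB
  rw [show m - (m - k) = k by omega] at this
  refine this.trans ?_
  gcongr ?_ * _
  exact pow_le_pow_right₀ hC₀1 (by omega)

/-- Multiplication by a cutoff function whose derivatives of order `i` are of size `L^{-i}`. -/
lemma exists_leibniz_const (d m : ℕ) (hq : 1 ≤ q) :
    ∃ C : ℝ≥0, ∀ (ζ V : Eucl d → ℂ) (_ : Smooth ζ) (_ : Smooth V) (w : Eucl d) (r L Cζ : ℝ)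
      (A : ℝ≥0∞), 0 < r → 0 < L →
      (∀ i ≤ m, ∀ y ∈ ball w r, ‖iteratedFDeriv ℝ i ζ y‖ * L ^ i ≤ Cζ) →
      (∀ k ≤ m, bavg (jetPow q k V) w r ≤ (ofReal L ^ q) ^ (m - k) * A) →
      bavg (jetPow q m (fun y => ζ y * V y)) w r ≤ C * (ofReal Cζ ^ q * A) := by
  have hq0 : 0 ≤ q := by linarith
  set K : ℝ≥0∞ := ((m + 1 : ℕ) : ℝ≥0∞) ^ (q - 1) * ((m + 1 : ℕ) * ((2 ^ m : ℝ≥0∞) ^ q)) with hK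
  have hKt : K ≠ ∞ := by
    refine mul_ne_top (rpow_ne_top_of_nonneg (by linarith) (by simp)) ?_
    exact mul_ne_top (by simp) (rpow_ne_top_of_nonneg hq0 (by finiteness))
  refine ⟨K.toNNReal, fun ζ V hζ hV w r L Cζ A hr hL hζb hVb => ?_⟩
  rw [coe_toNNReal hKt]
  set Λ := ofReal L ^ q with hΛ
  have hΛ0 : Λ ≠ 0 := by simp [hΛ, hL]
  have hΛt : Λ ≠ ∞ := rpow_ne_top_of_nonneg hq0 ofReal_ne_top
  set T := ofReal Cζ ^ q
  have hTt : T ≠ ∞ := rpow_ne_top_of_nonneg hq0 ofReal_ne_top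
  have hζe : ∀ i ≤ m, ∀ y ∈ ball w r, ‖iteratedFDeriv ℝ i ζ y‖ₑ ^ q ≤ T * (Λ⁻¹) ^ i := by
    intro i hi y hy
    have h1 : ‖iteratedFDeriv ℝ i ζ y‖ₑ * ofReal L ^ i ≤ ofReal Cζ := by
      rw [← ofReal_norm, ← ENNReal.ofReal_pow hL.le, ← ofReal_mul (norm_nonneg _)]
      exact ofReal_le_ofReal (hζb i hi y hy)
    have h2 : ‖iteratedFDeriv ℝ i ζ y‖ₑ ^ q * Λ ^ i ≤ T := by
      calc _ = (‖iteratedFDeriv ℝ i ζ y‖ₑ * ofReal L ^ i) ^ q := by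
            rw [mul_rpow_of_nonneg _ _ hq0, hΛ, ← rpow_natCast,
              ← rpow_natCast, ← rpow_mul, ← rpow_mul, mul_comm q]
        _ ≤ T := rpow_le_rpow h1 hq0
    rw [← ENNReal.inv_pow, ← div_eq_mul_inv, ENNReal.le_div_iff_mul_le (by simp [hΛ0])
      (by simp [hΛt])]
    exact h2
  have key : ∀ y ∈ ball w r, jetPow q m (fun y => ζ y * V y) y ≤
      ∑ i ∈ Finset.range (m + 1), (((m + 1 : ℕ) : ℝ≥0∞) ^ (q - 1) * ((2 ^ m : ℝ≥0∞) ^ q *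
        (T * (Λ⁻¹) ^ i))) * jetPow q (m - i) V y := by
    intro y hy
    have h1 := norm_iteratedFDeriv_mul_le hζ hV y (n := m)
      (by exact_mod_cast (le_top : (m : ℕ∞) ≤ ⊤))
    have h2 : ‖iteratedFDeriv ℝ m (fun y => ζ y * V y) y‖ₑ ≤ ∑ i ∈ Finset.range (m + 1),
        2 ^ m * ‖iteratedFDeriv ℝ i ζ y‖ₑ * ‖iteratedFDeriv ℝ (m - i) V y‖ₑ := by
      rw [← ofReal_norm]
      refine (ofReal_le_ofReal h1).trans ?_
      rw [ENNReal.ofReal_sum_of_nonneg (fun _ _ => by positivity)]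
      refine sum_le_sum fun i _ => ?_
      rw [ofReal_mul (by positivity), ofReal_mul (by positivity),
        ofReal_norm, ofReal_norm, ofReal_natCast]
      gcongr
      exact_mod_cast Nat.choose_le_two_pow m i
    rw [jetPow]
    refine (rpow_le_rpow h2 hq0).trans ?_
    refine (ENNReal.rpow_sum_le_const_mul_sum_rpow _ _ hq).trans ?_
    rw [Finset.card_range, Finset.mul_sum]
    refine sum_le_sum fun i hi => ?_
    rw [mul_rpow_of_nonneg _ _ hq0, mul_rpow_of_nonneg _ _ hq0, mul_assoc, mul_assoc, mul_assoc]
    gcongr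
    · exact hζe i (by simpa [Nat.lt_succ_iff] using hi) y hy
    · rfl
  refine (bavg_mono hr key).trans ?_
  rw [bavg_sum (fun i _ => (measurable_jetPow q _ hV).const_mul _)]
  calc _ ≤ ∑ i ∈ Finset.range (m + 1), ((m + 1 : ℕ) : ℝ≥0∞) ^ (q - 1) * ((2 ^ m : ℝ≥0∞) ^ q *
        (T * A)) := by
        refine sum_le_sum fun i hi => ?_
        have him : i ≤ m := by simpa [Nat.lt_succ_iff] using hi
        rw [bavg_const_mul]
        · have h3 := hVb (m - i) (by omega)
          rw [show m - (m - i) = i by omega] at h3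
          have h4 : (Λ⁻¹) ^ i * Λ ^ i = 1 := by
            rw [← mul_pow, ENNReal.inv_mul_cancel hΛ0 hΛt, one_pow]
          calc _ ≤ _ := mul_le_mul_right h3 _
            _ = ((m + 1 : ℕ) : ℝ≥0∞) ^ (q - 1) * ((2 ^ m : ℝ≥0∞) ^ q *
              (T * (((Λ⁻¹) ^ i * Λ ^ i) * A))) := by ring
            _ = _ := by rw [h4, one_mul]
        · refine mul_ne_top (rpow_ne_top_of_nonneg (by linarith) (by simp)) ?_
          refine mul_ne_top (rpow_ne_top_of_nonneg hq0 (by finiteness)) ?_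
          exact mul_ne_top hTt (ENNReal.pow_ne_top (by simp [hΛ0]))
    _ = K * (T * A) := by
        rw [Finset.sum_const, Finset.card_range, nsmul_eq_mul, hK]
        ring

/-! ### Polynomials with prescribed means of derivatives -/

lemma iteratedFDeriv_eq_zero_of_le {j : ℕ} (hkj : k ≤ j) (h : iteratedFDeriv ℝ k f = 0) :
    iteratedFDeriv ℝ j f = 0 := by
  induction j, hkj using Nat.le_induction with
  | base => exact h
  | succ j _ ih =>
    funext x
    ext y
    have : fderiv ℝ (0 : Eucl d → ContinuousMultilinearMap ℝ (fun _ : Fin j => Eucl d) ℂ) x = 0 :=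
      fderiv_const_apply 0
    rw [iteratedFDeriv_succ_apply_left, ih, this]
    rfl

lemma integrableOn_ball_of_continuous {G : Type*} [NormedAddCommGroup G] {f : Eucl d → G}
    (hf : Continuous f) (w : Eucl d) (r : ℝ) : IntegrableOn f (ball w r) :=
  (hf.continuousOn.integrableOn_compact (isCompact_closedBall w r)).mono_set ball_subset_closedBall

lemma exists_polynomial_mean_zero {U : Eucl d → ℂ} (hU : Smooth U) (w : Eucl d) (r : ℝ) (m : ℕ) :
    ∃ P : Eucl d → ℂ, Smooth P ∧ iteratedFDeriv ℝ m P = 0 ∧ ∀ j < m, ∫ z in ball (0 : Eucl d) 1,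
        iteratedFDeriv ℝ j (fun y => U y - P y) (w + r • z) = 0 := by
  have main : ∀ i ≤ m, ∃ P : Eucl d → ℂ, Smooth P ∧ iteratedFDeriv ℝ m P = 0 ∧
      ∀ j < m, m ≤ j + i → ∫ z in ball (0 : Eucl d) 1,
        iteratedFDeriv ℝ j (fun y => U y - P y) (w + r • z) = 0 := by
    intro i
    induction i with
    | zero =>
      intro _
      refine ⟨fun _ => 0, contDiff_const, ?_, fun j hj hj' => by omega⟩
      funext x; exact congrFun iteratedFDeriv_fun_zero x
    | succ i ih =>
      intro hi
      obtain ⟨P, hP, hPm, hPj⟩ := ih (by omega)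
      set k := m - (i + 1)
      have hV : Smooth (fun y => U y - P y) := hU.sub hP
      have hInt : ∀ (W : Eucl d → ℂ) (_ : Smooth W) (j : ℕ), Integrable
          (fun z => iteratedFDeriv ℝ j W (w + r • z)) (volume.restrict (ball (0 : Eucl d) 1)) :=
        fun W hW j => integrableOn_ball_of_continuous
          ((hW.iteratedFDeriv j).continuous.comp (by fun_prop)) _ _
      set v := volume.real (ball (0 : Eucl d) 1) with hv
      have hv0 : v ≠ 0 := (toReal_pos (measure_ball_pos _ _ one_pos).ne' measure_ball_lt_top.ne).ne'
      set A := v⁻¹ • ∫ z in ball (0 : Eucl d) 1,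
        iteratedFDeriv ℝ k (fun y => U y - P y) (w + r • z) with hA
      have hsymm : ∀ (σ : Equiv.Perm (Fin k)) (x : Fin k → Eucl d), A (fun j => x (σ j)) = A x := by
        intro σ x
        have h1 : A.domDomCongr σ = A := by
          apply eq_of_apply_single_eq
          intro t
          have h2 : ∀ t : Fin k → Fin d, A (fun j => single (t j) 1) =
              v⁻¹ • ∫ z in ball (0 : Eucl d) 1,
                mixedDeriv (tupleCount t) (fun y => U y - P y) (w + r • z) := by
            intro t
            rw [hA, smul_apply]
            congr 1
            have := ContinuousLinearMap.integral_comp_comm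
              (ContinuousMultilinearMap.apply ℝ (fun _ : Fin k => Eucl d) ℂ
                (fun j => single (t j) 1)) (hInt _ hV k)
            simp only [ContinuousMultilinearMap.apply_apply] at this
            rw [← this]
            exact integral_congr_ae (.of_forall fun z => iteratedFDeriv_apply_single hV t _)
          rw [ContinuousMultilinearMap.domDomCongr_apply]
          have h3 : tupleCount (fun j => t (σ j)) = tupleCount t :=
            Equiv.sum_comp σ (fun j => (Pi.single (t j) 1 : Fin d → ℕ))
          rw [h2 (fun j => t (σ j)), h2, h3]
        conv_rhs => rw [← h1]
        rfl
      set Q : Eucl d → ℂ := fun x => ((k.factorial : ℝ)⁻¹) • A (fun _ => x) with hQ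
      have hdiag : ContDiff ℝ ((⊤ : ℕ∞) : WithTop ℕ∞) (fun x : Eucl d => A (fun _ => x)) :=
        A.contDiff.comp (contDiff_pi.2 fun _ => contDiff_id)
      have hQs : Smooth Q := hdiag.const_smul _
      have hQk : iteratedFDeriv ℝ k Q = fun _ => A := by
        funext x
        ext y
        rw [hQ, iteratedFDeriv_const_smul_apply' (hdiag.contDiffAt.of_le
          (by exact_mod_cast (le_top : (k : ℕ∞) ≤ ⊤))), smul_apply,
          ContinuousMultilinearMap.iteratedFDeriv_comp_diagonal]
        simp only [hsymm]
        rw [Finset.sum_const, Finset.card_univ, Fintype.card_perm, Fintype.card_fin,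
          ← Nat.cast_smul_eq_nsmul ℝ, smul_smul, inv_mul_cancel₀ (by positivity), one_smul]
      have hQj : ∀ j, k < j → iteratedFDeriv ℝ j Q = 0 := by
        intro j hj
        refine iteratedFDeriv_eq_zero_of_le (k := k + 1) hj ?_
        funext x
        ext y
        rw [iteratedFDeriv_succ_apply_left, hQk, fderiv_const_apply]
        rfl
      have hof : ∀ (W : Eucl d → ℂ) (_ : Smooth W) (j : ℕ), ContDiff ℝ j W := fun W hW j =>
        hW.of_le (by exact_mod_cast (le_top : (j : ℕ∞) ≤ ⊤))
      refine ⟨fun y => P y + Q y, hP.add hQs, ?_, fun j hj hj' => ?_⟩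
      · have := iteratedFDeriv_add (hof P hP m) (hof Q hQs m)
        rw [hPm, hQj m (by omega), add_zero] at this
        exact this
      · have e1 : ∀ x, iteratedFDeriv ℝ j (fun y => U y - (P y + Q y)) x =
            iteratedFDeriv ℝ j (fun y => U y - P y) x - iteratedFDeriv ℝ j Q x := by
          intro x
          have := congrFun (iteratedFDeriv_sub (hof _ hV j) (hof Q hQs j)) x
          rw [← Pi.sub_apply, ← this]
          congr 1
          funext y
          simp only [Pi.sub_apply]; ring
        simp_rw [e1]
        rw [integral_sub (hInt _ hV j) (hInt Q hQs j)]
        rcases (show k ≤ j by omega).eq_or_lt with h | h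
        · rw [← h, hQk]
          simp only [integral_const, MeasurableSet.univ, measureReal_restrict_apply, Set.univ_inter]
          rw [← hv, hA, smul_smul, mul_inv_cancel₀ hv0, one_smul, sub_self]
        · rw [hPj j hj (by omega), hQj j h]
          simp
  obtain ⟨P, h1, h2, h3⟩ := main m le_rfl
  exact ⟨P, h1, h2, fun j hj => h3 j hj (by omega)⟩

variable {Ω : Set (Eucl d)}

/-! ### The distance to the boundary -/

/-- The distance to the boundary of `Ω`. -/
abbrev bdist (Ω : Set (Eucl d)) (x : Eucl d) : ℝ := infDist x (frontier Ω)

lemma bdist_le_add (Ω : Set (Eucl d)) (x y : Eucl d) : bdist Ω x ≤ bdist Ω y + dist x y :=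
  infDist_le_infDist_add_dist

lemma bdist_le_add' (Ω : Set (Eucl d)) (x y : Eucl d) : bdist Ω x ≤ bdist Ω y + dist y x :=
  dist_comm x y ▸ bdist_le_add Ω x y

lemma norm_sub_le_dist (x y : Eucl d) : ‖x‖ - ‖y‖ ≤ dist x y :=
  (norm_sub_norm_le x y).trans_eq (dist_eq_norm x y).symm

lemma norm_sub_le_dist' (x y : Eucl d) : ‖x‖ - ‖y‖ ≤ dist y x :=
  dist_comm x y ▸ norm_sub_le_dist x y

lemma bdist_le_norm_add (hne : (frontier Ω).Nonempty) {R : ℝ} (hR : frontier Ω ⊆ ball 0 R)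
    (x : Eucl d) : bdist Ω x ≤ ‖x‖ + R := by
  obtain ⟨w, hw⟩ := hne
  refine (infDist_le_dist_of_mem hw).trans ?_
  linarith [dist_eq_norm x w, norm_sub_le x w, mem_ball_zero_iff.1 (hR hw)]

lemma norm_sub_le_bdist (hne : (frontier Ω).Nonempty) {R : ℝ} (hR : frontier Ω ⊆ ball 0 R)
    (x : Eucl d) : ‖x‖ - R ≤ bdist Ω x := (le_infDist hne).2 fun z hz => by
  linarith [norm_sub_le_dist x z, mem_ball_zero_iff.1 (hR hz)]

lemma bdist_nonneg (Ω : Set (Eucl d)) (x : Eucl d) : 0 ≤ bdist Ω x := infDist_nonneg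

lemma continuous_bdist (Ω : Set (Eucl d)) : Continuous (bdist Ω) := continuous_infDist_pt _

lemma notMem_frontier (hΩ : IsOpen Ω) (hx : x ∈ Ω) : x ∉ frontier Ω := by
  rw [hΩ.frontier_eq]; exact fun h => h.2 hx

lemma bdist_pos (hΩ : IsOpen Ω) (hne : (frontier Ω).Nonempty) (hx : x ∈ Ω) : 0 < bdist Ω x :=
  (isClosed_frontier.notMem_iff_infDist_pos hne).1 (notMem_frontier hΩ hx)

lemma ball_subset_of_mem (hΩ : IsOpen Ω) (hx : x ∈ Ω) : ball x (bdist Ω x) ⊆ Ω := by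
  intro y hy
  by_contra hyΩ
  have hpre : IsPreconnected (ball x (bdist Ω x)) := (convex_ball x _).isPreconnected
  have hx0 : x ∈ ball x (bdist Ω x) := mem_ball_self (pos_of_mem_ball hy)
  have h2 := hpre Ω (closure Ω)ᶜ hΩ isClosed_closure.isOpen_compl ?_ ⟨x, hx0, hx⟩ ⟨y, hy, ?_⟩
  · obtain ⟨z, -, hz, hz'⟩ := h2
    exact hz' (subset_closure hz)
  · intro z hz
    by_cases hzΩ : z ∈ Ω
    · exact Or.inl hzΩ
    · refine Or.inr fun hcl => ?_
      have : z ∈ frontier Ω := by rw [hΩ.frontier_eq]; exact ⟨hcl, hzΩ⟩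
      have h3 : bdist Ω x ≤ dist x z := infDist_le_dist_of_mem this
      rw [mem_ball, dist_comm] at hz
      linarith
  · intro hcl
    have : y ∈ frontier Ω := by rw [hΩ.frontier_eq]; exact ⟨hcl, hyΩ⟩
    have h3 : bdist Ω x ≤ dist x y := infDist_le_dist_of_mem this
    rw [mem_ball, dist_comm] at hy
    linarith

lemma le_bdist_of_ball_subset (hΩ : IsOpen Ω) (hne : (frontier Ω).Nonempty) (h : ball x r ⊆ Ω) :
    r ≤ bdist Ω x := by
  refine (le_infDist hne).2 fun y hy => ?_
  by_contra! hlt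
  exact notMem_frontier hΩ (h (by rwa [mem_ball, dist_comm])) hy

lemma mem_of_dist_lt (hΩ : IsOpen Ω) (hx : x ∈ Ω) (h : dist y x < bdist Ω x) : y ∈ Ω := ball_subset_of_mem hΩ hx h

/-! ### Powers of the distance as weights -/

/-- The weight `dist(x, ∂Ω)^e`. -/
def dw (Ω : Set (Eucl d)) (e : ℝ) (x : Eucl d) : ℝ≥0∞ := ofReal (bdist Ω x ^ e)

lemma measurable_dw (Ω : Set (Eucl d)) (e : ℝ) : Measurable (dw Ω e) :=
  ENNReal.measurable_ofReal.comp ((continuous_bdist Ω).measurable.pow_const e)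

lemma dw_ne_top (Ω : Set (Eucl d)) (e : ℝ) (x : Eucl d) : dw Ω e x ≠ ∞ := ofReal_ne_top

lemma dw_mul (hx : 0 < bdist Ω x) (e f : ℝ) : dw Ω e x * dw Ω f x = dw Ω (e + f) x := by
  rw [dw, dw, dw, ← ofReal_mul (by positivity), Real.rpow_add hx]

lemma dw_ne_zero (hx : 0 < bdist Ω x) (e : ℝ) : dw Ω e x ≠ 0 := by
  simp only [dw, ne_eq, ofReal_eq_zero, not_le]; positivity

lemma dw_zero (Ω : Set (Eucl d)) (x : Eucl d) : dw Ω 0 x = 1 := by simp [dw]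

lemma dw_rpow (hx : 0 < bdist Ω x) (e s : ℝ) : dw Ω e x ^ s = dw Ω (e * s) x := by
  rw [dw, dw, ENNReal.ofReal_rpow_of_pos (by positivity), ← Real.rpow_mul hx.le]

lemma dw_le_of_le (hx : 0 < bdist Ω x) (hy : 0 < bdist Ω y) {Λ : ℝ}
    (hxy : bdist Ω x ≤ Λ * bdist Ω y) (hyx : bdist Ω y ≤ Λ * bdist Ω x) (e : ℝ) :
    dw Ω e x ≤ ofReal (Λ ^ |e|) * dw Ω e y := by
  have hΛ : 0 < Λ := by
    by_contra! h
    nlinarith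
  rw [dw, dw, ← ofReal_mul (by positivity)]
  apply ofReal_le_ofReal
  rcases le_total 0 e with he | he
  · rw [abs_of_nonneg he, ← Real.mul_rpow hΛ.le hy.le]
    exact Real.rpow_le_rpow hx.le hxy he
  · rw [abs_of_nonpos he, Real.rpow_neg hΛ.le, ← Real.inv_rpow hΛ.le,
      ← Real.mul_rpow (by positivity) hy.le]
    refine Real.rpow_le_rpow_of_nonpos (by positivity) ?_ he
    rw [inv_mul_le_iff₀ hΛ]; exact hyx

/-! ### Balls in cones and Whitney balls -/

/-- `B = (w, r)` is a Whitney ball of `Ω`, of a size comparable to its distance to `x`. -/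
def Adm (Ω : Set (Eucl d)) (K : ℝ) (x : Eucl d) (B : Eucl d × ℝ) : Prop :=
  B.1 ∈ Ω ∧ 0 < B.2 ∧ 4 * B.2 ≤ bdist Ω B.1 ∧ bdist Ω B.1 ≤ K * B.2 ∧ dist B.1 x ≤ K * B.2

/-- The supremum of the averages over the Whitney balls in a cone with vertex `x`. -/
def coneSup (Ω : Set (Eucl d)) (F : Eucl d → ℝ≥0∞) (K : ℝ) (x : Eucl d) : ℝ≥0∞ :=
  ⨆ (B : Eucl d × ℝ) (_ : Adm Ω K x B), bavg F B.1 B.2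

lemma Adm.le_coneSup {K : ℝ} {B : Eucl d × ℝ} (h : Adm Ω K x B) (F : Eucl d → ℝ≥0∞) :
    bavg F B.1 B.2 ≤ coneSup Ω F K x :=
  le_iSup₂ (f := fun (B : Eucl d × ℝ) (_ : Adm Ω K x B) => bavg F B.1 B.2) B h

lemma Adm.mono {K K' : ℝ} (hK : K ≤ K') {B : Eucl d × ℝ} (h : Adm Ω K x B) : Adm Ω K' x B :=
  ⟨h.1, h.2.1, h.2.2.1, h.2.2.2.1.trans (mul_le_mul_of_nonneg_right hK h.2.1.le),
    h.2.2.2.2.trans (mul_le_mul_of_nonneg_right hK h.2.1.le)⟩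

lemma coneSup_mono {K K' : ℝ} (hK : K ≤ K') (F : Eucl d → ℝ≥0∞) (x : Eucl d) :
    coneSup Ω F K x ≤ coneSup Ω F K' x :=
  iSup₂_le fun _ h => (h.mono hK).le_coneSup F

/-- The average of `F` over the Whitney ball `B(x, dist(x, ∂Ω) / 2)`. -/
def wavg (Ω : Set (Eucl d)) (F : Eucl d → ℝ≥0∞) (x : Eucl d) : ℝ≥0∞ := bavg F x (bdist Ω x / 2)

lemma measurable_bavg (hF : Measurable F) {ρ : Eucl d → ℝ} (hρ : Continuous ρ) :
    Measurable fun y => bavg F y (ρ y) := by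
  have m : Measurable fun p : Eucl d × Eucl d => F (p.1 + ρ p.1 • p.2) :=
    hF.comp (by fun_prop : Continuous fun p : Eucl d × Eucl d => p.1 + ρ p.1 • p.2).measurable
  exact Measurable.lintegral_prod_right' (ν := volume.restrict (ball 0 1)) m

lemma measurable_wavg (Ω : Set (Eucl d)) (hF : Measurable F) : Measurable (wavg Ω F) :=
  measurable_bavg hF ((continuous_bdist Ω).div_const 2)

lemma Adm.bavg_le_wavg {K : ℝ} {B : Eucl d × ℝ} (h : Adm Ω K x B) (F : Eucl d → ℝ≥0∞)
    (hy : y ∈ ball B.1 (B.2 / 2)) : bavg F B.1 B.2 ≤ ofReal ((K + 1) ^ d) * wavg Ω F y := by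
  obtain ⟨-, h0, h1, h2, -⟩ := h
  rw [mem_ball] at hy
  have e1 := bdist_le_add' Ω B.1 y
  have e2 := bdist_le_add Ω y B.1
  refine bavg_le_mul_of_dist h0 ?_ ?_
  · nlinarith
  · rw [dist_comm]; linarith

/-- Weights of exponent `a` are integrable up to the boundary, uniformly at all scales. -/
def HasLayerBound (Ω : Set (Eucl d)) (a : ℝ) : Prop := ∀ K : ℝ, ∃ C : ℝ≥0, ∀ y ∈ Ω,
    ∫⁻ x in Ω ∩ ball y (K * bdist Ω y), dw Ω a x ≤ C * dw Ω (d + a) y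

/-- All powers of the distance above `-1` are integrable. -/
abbrev HasLayerBounds (Ω : Set (Eucl d)) : Prop := ∀ a : ℝ, -1 < a → HasLayerBound Ω a

lemma volume_ball_eq (w : Eucl d) (hr : 0 < r) :
    volume (ball w r) = ofReal (r ^ d) * volume (ball (0 : Eucl d) 1) := by
  have := lintegral_ball_eq (fun _ => 1) w hr
  simpa [bavg_const] using this

lemma lintegral_swap_of_measurable {α β : Type*} [MeasurableSpace α] [MeasurableSpace β]
    {μ : Measure α} {ν : Measure β} [SFinite μ] [SFinite ν] {f : α × β → ℝ≥0∞}
    (hf : Measurable f) : ∫⁻ x, ∫⁻ y, f (x, y) ∂ν ∂μ = ∫⁻ y, ∫⁻ x, f (x, y) ∂μ ∂ν :=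
  lintegral_lintegral_swap (f := fun x y => f (x, y)) hf.aemeasurable

/-- An average over a ball is controlled by the averages over smaller balls. -/
lemma bavg_le_of_forall_le (hF : Measurable F) {R ρ : ℝ} (hR : 0 < R) (hρ : 0 < ρ) {A : ℝ≥0∞}
    (h : ∀ y ∈ ball x (R + ρ), bavg F y ρ ≤ A) : bavg F x R ≤ ofReal (((R + ρ) / R) ^ d) * A := by
  set v := volume (ball (0 : Eucl d) 1)
  have hvt : v ≠ ∞ := measure_ball_lt_top.ne
  have hv0 : v ≠ 0 := (measure_ball_pos _ _ one_pos).ne'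
  have hmeas : MeasurableSet {p : Eucl d × Eucl d | dist p.2 p.1 < ρ} :=
    (isOpen_lt (by fun_prop) continuous_const).measurableSet
  have key : (∫⁻ t in ball x R, F t) * (ofReal (ρ ^ d) * v) ≤
      ∫⁻ y in ball x (R + ρ), ∫⁻ t in ball y ρ, F t := by
    have e1 : ∀ y, ∫⁻ t in ball y ρ, F t =
        ∫⁻ t, Set.indicator {p : Eucl d × Eucl d | dist p.2 p.1 < ρ} (fun p => F p.2) (y, t) := by
      intro y
      rw [← lintegral_indicator measurableSet_ball]
      rfl
    simp_rw [e1]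
    rw [lintegral_swap_of_measurable
      (f := Set.indicator {p : Eucl d × Eucl d | dist p.2 p.1 < ρ} (fun p => F p.2))
      ((hF.comp measurable_snd).indicator hmeas)]
    rw [← lintegral_mul_const' _ _ (mul_ne_top ofReal_ne_top hvt),
      ← lintegral_indicator measurableSet_ball]
    refine lintegral_mono fun t => ?_
    by_cases ht : t ∈ ball x R
    · rw [indicator_of_mem ht]
      have e2 : ball t ρ ⊆ ball x (R + ρ) := by
        refine ball_subset_ball' ?_
        rw [mem_ball] at ht; linarith
      have e3 : ∀ y, Set.indicator {p : Eucl d × Eucl d | dist p.2 p.1 < ρ} (fun p => F p.2) (y, t)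
          = Set.indicator (ball t ρ) (fun _ => F t) y := by
        intro y
        simp only [Set.indicator, mem_ball, Set.mem_ofPred_eq, dist_comm t y]
      simp_rw [e3]
      rw [lintegral_indicator measurableSet_ball, Measure.restrict_restrict measurableSet_ball,
        Set.inter_eq_left.2 e2, lintegral_const, Measure.restrict_apply_univ,
        volume_ball_eq t hρ]
    · rw [indicator_of_notMem ht]; exact bot_le
  have key2 : ∫⁻ y in ball x (R + ρ), ∫⁻ t in ball y ρ, F t ≤
      (ofReal ((R + ρ) ^ d) * v) * (ofReal (ρ ^ d) * A) := by
    calc _ ≤ ∫⁻ y in ball x (R + ρ), ofReal (ρ ^ d) * A := by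
          refine setLIntegral_mono' measurableSet_ball fun y hy => ?_
          rw [lintegral_ball_eq F y hρ]
          gcongr
          exact h y hy
      _ = _ := by
          rw [lintegral_const, Measure.restrict_apply_univ, volume_ball_eq x (by positivity),
            mul_comm]
  have hc : ofReal (ρ ^ d) * v ≠ 0 := mul_ne_zero (by simp; positivity) hv0
  have hct : ofReal (ρ ^ d) * v ≠ ∞ := mul_ne_top ofReal_ne_top hvt
  have key3 : ∫⁻ t in ball x R, F t ≤ ofReal ((R + ρ) ^ d) * A := by
    have h1 := key.trans key2
    have h2 : (ofReal ((R + ρ) ^ d) * v) * (ofReal (ρ ^ d) * A) =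
        (ofReal ((R + ρ) ^ d) * A) * (ofReal (ρ ^ d) * v) := by ring
    rw [h2] at h1
    exact (ENNReal.mul_le_mul_iff_left hc hct).1 h1
  rw [bavg_eq F x hR]
  calc _ ≤ ofReal ((R ^ d)⁻¹) * (ofReal ((R + ρ) ^ d) * A) := by gcongr
    _ = _ := by
      rw [← mul_assoc, ← ofReal_mul (by positivity), div_pow, div_eq_inv_mul]

/-- Integrals over subsets of `Ω` are controlled by integrals of averages over small Whitney
balls. -/
lemma exists_lintegral_le_lintegral_bavg (d : ℕ) : ∃ C : ℝ≥0, ∀ (Ω : Set (Eucl d)), IsOpen Ω →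
    (frontier Ω).Nonempty → ∀ (F : Eucl d → ℝ≥0∞), Measurable F → ∀ X X' : Set (Eucl d),
    MeasurableSet X → MeasurableSet X' → X ⊆ Ω →
    (∀ t ∈ X, ball t (bdist Ω t / 16) ⊆ X') →
    ∫⁻ t in X, F t ≤ C * ∫⁻ y in X', bavg F y (bdist Ω y / 8) := by
  set v := volume (ball (0 : Eucl d) 1)
  have hvt : v ≠ ∞ := measure_ball_lt_top.ne
  have hv0 : v ≠ 0 := (measure_ball_pos _ _ one_pos).ne'
  set c : ℝ≥0∞ := ofReal ((1 / 4) ^ d) * v with hc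
  have hc0 : c ≠ 0 := mul_ne_zero (by simp) hv0
  have hct : c ≠ ∞ := mul_ne_top ofReal_ne_top hvt
  refine ⟨c⁻¹.toNNReal, fun Ω hΩ hne F hF X X' hX hX' hXΩ hXX' => ?_⟩
  rw [coe_toNNReal (by simp [hc0])]
  have hmeas : MeasurableSet {p : Eucl d × Eucl d | dist p.2 p.1 < bdist Ω p.1 / 8} :=
    (isOpen_lt (by fun_prop) (((continuous_bdist Ω).comp continuous_fst).div_const 8)).measurableSet
  set k : Eucl d → ℝ≥0∞ := fun y => ofReal (((bdist Ω y / 8) ^ d)⁻¹) with hk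
  have hkm : Measurable k := ENNReal.measurable_ofReal.comp
    ((((continuous_bdist Ω).div_const 8).pow d).measurable.inv)
  have key : c * ∫⁻ t in X, F t ≤ ∫⁻ y in X' ∩ Ω, bavg F y (bdist Ω y / 8) := by
    have e1 : ∀ y ∈ X' ∩ Ω, bavg F y (bdist Ω y / 8) = ∫⁻ t,
        Set.indicator {p : Eucl d × Eucl d | dist p.2 p.1 < bdist Ω p.1 / 8}
          (fun p => k p.1 * F p.2) (y, t) := by
      intro y hy
      have hy0 := bdist_pos hΩ hne hy.2
      rw [bavg_eq F y (by positivity), ← lintegral_const_mul' _ _ ofReal_ne_top,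
        ← lintegral_indicator measurableSet_ball]
      rfl
    rw [setLIntegral_congr_fun (hX'.inter hΩ.measurableSet) e1, lintegral_swap_of_measurable
      (f := Set.indicator {p : Eucl d × Eucl d | dist p.2 p.1 < bdist Ω p.1 / 8}
          (fun p => k p.1 * F p.2))
      (((hkm.comp measurable_fst).mul (hF.comp measurable_snd)).indicator hmeas),
      ← lintegral_const_mul' _ _ hct, ← lintegral_indicator hX]
    refine lintegral_mono fun t => ?_
    by_cases ht : t ∈ X
    · rw [indicator_of_mem ht]
      have ht0 := bdist_pos hΩ hne (hXΩ ht)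
      have e2 : ball t (bdist Ω t / 16) ⊆ X' ∩ Ω := fun y hy => ⟨hXX' t ht hy,
        ball_subset_of_mem hΩ (hXΩ ht) (ball_subset_ball (by linarith) hy)⟩
      have e3 : ∀ y ∈ ball t (bdist Ω t / 16), ofReal (((bdist Ω t / 4) ^ d)⁻¹) * F t ≤
          Set.indicator {p : Eucl d × Eucl d | dist p.2 p.1 < bdist Ω p.1 / 8}
          (fun p => k p.1 * F p.2) (y, t) := by
        intro y hy
        rw [mem_ball] at hy
        have h1 := bdist_le_add' Ω t y
        have h2 := bdist_le_add Ω y t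
        have h3 : 0 < bdist Ω y := by linarith
        rw [indicator_of_mem]
        · simp only [hk]
          gcongr ?_ * _
          apply ofReal_le_ofReal
          apply inv_anti₀ (by positivity)
          apply pow_le_pow_left₀ (by positivity)
          linarith
        · simp only [Set.mem_ofPred_eq]
          rw [dist_comm]; linarith
      calc c * F t = ∫⁻ y in ball t (bdist Ω t / 16), ofReal (((bdist Ω t / 4) ^ d)⁻¹) * F t := by
            rw [lintegral_const, Measure.restrict_apply_univ, volume_ball_eq t (by positivity), hc]
            have h4 : ((bdist Ω t / 4) ^ d)⁻¹ * (bdist Ω t / 16) ^ d = (1 / 4) ^ d := by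
              rw [div_pow, div_pow, div_pow, show (16 : ℝ) = 4 * 4 by norm_num, mul_pow]
              field_simp
              simp
            rw [← h4, ofReal_mul (by positivity)]
            ring
        _ ≤ _ := setLIntegral_mono' measurableSet_ball e3
        _ ≤ _ := lintegral_mono_set e2
    · rw [indicator_of_notMem ht]; exact bot_le
  calc ∫⁻ t in X, F t = c⁻¹ * (c * ∫⁻ t in X, F t) := by
        rw [← mul_assoc, ENNReal.inv_mul_cancel hc0 hct, one_mul]
    _ ≤ c⁻¹ * ∫⁻ y in X' ∩ Ω, bavg F y (bdist Ω y / 8) := by gcongr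
    _ ≤ _ := by gcongr; exact Set.inter_subset_left

/-! ### Dominating functions -/

/-- Finiteness of the weighted norm of the averages of `F` (the `q`-th power of a function). -/
def AvFinite (Ω : Set (Eucl d)) (p : ℝ≥0∞) (θ q : ℝ) (F : Eucl d → ℝ≥0∞) : Prop :=
  (p < ∞ → ∫⁻ x in Ω, wavg Ω F x ^ (p.toReal / q) *
    dw Ω (p.toReal - 1 - p.toReal * θ) x < ∞) ∧
  (p = ∞ → ∃ C : ℝ≥0, ∀ᵐ x ∂volume.restrict Ω, wavg Ω F x ≤ C * dw Ω (q * (θ - 1)) x)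

/-- `G` (the `q`-th power of a function) is bounded by a function of finite weighted norm. -/
def Dominating (Ω : Set (Eucl d)) (p : ℝ≥0∞) (θ q : ℝ) (G : Eucl d → ℝ≥0∞) : Prop :=
  ∃ G' : Eucl d → ℝ≥0∞, Measurable G' ∧ (∀ x ∈ Ω, G x ≤ G' x) ∧
    (p < ∞ → ∫⁻ x in Ω, G' x ^ (p.toReal / q) * dw Ω (p.toReal - 1 - p.toReal * θ) x < ∞) ∧
    (p = ∞ → ∃ C : ℝ≥0, ∀ x ∈ Ω, G' x ≤ C * dw Ω (q * (θ - 1)) x)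

lemma Dominating.const_mul (hq : 0 < q) {G : Eucl d → ℝ≥0∞} (hG : Dominating Ω p θ q G) (C : ℝ≥0) :
    Dominating Ω p θ q (fun x => C * G x) := by
  obtain ⟨G', h1, h2, h3, h4⟩ := hG
  refine ⟨fun x => C * G' x, h1.const_mul _, fun x hx => mul_le_mul_right (h2 x hx) _,
    fun hp => ?_, fun hp => ?_⟩
  · have hs : 0 ≤ p.toReal / q := by positivity
    have : ∀ x, (C * G' x) ^ (p.toReal / q) * dw Ω (p.toReal - 1 - p.toReal * θ) x =
        (C : ℝ≥0∞) ^ (p.toReal / q) * (G' x ^ (p.toReal / q) *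
          dw Ω (p.toReal - 1 - p.toReal * θ) x) := by
      intro x; rw [mul_rpow_of_nonneg _ _ hs, mul_assoc]
    simp_rw [this]
    have hC : (C : ℝ≥0∞) ^ (p.toReal / q) ≠ ∞ := rpow_ne_top_of_nonneg hs coe_ne_top
    rw [lintegral_const_mul' _ _ hC]
    exact mul_lt_top hC.lt_top (h3 hp)
  · obtain ⟨C', hC'⟩ := h4 hp
    refine ⟨C * C', fun x hx => ?_⟩
    rw [coe_mul, mul_assoc]
    exact mul_le_mul_right (hC' x hx) _

lemma add_rpow_le_two_rpow_mul (a b : ℝ≥0∞) {s : ℝ} (hs : 0 ≤ s) :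
    (a + b) ^ s ≤ 2 ^ s * (a ^ s + b ^ s) := by
  calc (a + b) ^ s ≤ (2 * max a b) ^ s := by
        gcongr
        rw [two_mul]
        exact add_le_add (le_max_left _ _) (le_max_right _ _)
    _ = 2 ^ s * (max a b) ^ s := mul_rpow_of_nonneg _ _ hs
    _ ≤ _ := by
        gcongr
        rcases max_choice a b with h | h <;> rw [h]
        · exact le_self_add
        · exact le_add_self

lemma Dominating.add (hq : 0 < q) {G H : Eucl d → ℝ≥0∞} (hG : Dominating Ω p θ q G)
    (hH : Dominating Ω p θ q H) : Dominating Ω p θ q (fun x => G x + H x) := by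
  obtain ⟨G', h1, h2, h3, h4⟩ := hG
  obtain ⟨H', k1, k2, k3, k4⟩ := hH
  refine ⟨fun x => G' x + H' x, h1.add k1, fun x hx => add_le_add (h2 x hx) (k2 x hx),
    fun hp => ?_, fun hp => ?_⟩
  · have hs : 0 ≤ p.toReal / q := by positivity
    set s := p.toReal / q
    set w := dw Ω (p.toReal - 1 - p.toReal * θ)
    have hwm : Measurable w := measurable_dw _ _
    calc ∫⁻ x in Ω, (G' x + H' x) ^ s * w x ≤
        ∫⁻ x in Ω, 2 ^ s * (G' x ^ s * w x + H' x ^ s * w x) := by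
          refine lintegral_mono fun x => ?_
          refine (mul_le_mul_left (add_rpow_le_two_rpow_mul _ _ hs) _).trans (le_of_eq ?_)
          ring
      _ = 2 ^ s * ((∫⁻ x in Ω, G' x ^ s * w x) + ∫⁻ x in Ω, H' x ^ s * w x) := by
          rw [lintegral_const_mul' _ _ (rpow_ne_top_of_nonneg hs (by norm_num)),
            lintegral_add_left (show Measurable fun x => G' x ^ s * w x from (h1.pow_const s).mul hwm)]
      _ < ∞ := mul_lt_top (rpow_ne_top_of_nonneg hs (by norm_num)).lt_top
          (ENNReal.add_lt_top.2 ⟨h3 hp, k3 hp⟩)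
  · obtain ⟨C, hC⟩ := h4 hp
    obtain ⟨C', hC'⟩ := k4 hp
    refine ⟨C + C', fun x hx => ?_⟩
    rw [ENNReal.coe_add, add_mul]
    exact add_le_add (hC x hx) (hC' x hx)

lemma exists_mem_ball_of_ae (hr : 0 < r) (hw : ball w r ⊆ Ω) {Q : Eucl d → Prop}
    (h : ∀ᵐ x ∂volume.restrict Ω, Q x) : ∃ y ∈ ball w r, Q y := by
  have h1 : ∀ᵐ x ∂volume.restrict (ball w r), Q x := ae_mono (Measure.restrict_mono hw le_rfl) h
  have : (volume.restrict (ball w r)) ≠ 0 := by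
    rw [Ne, Measure.restrict_eq_zero]; exact (measure_ball_pos _ _ hr).ne'
  have : NeBot (ae (volume.restrict (ball w r))) := ae_neBot.2 this
  obtain ⟨y, hy1, hy2⟩ := (h1.and (ae_restrict_mem measurableSet_ball)).exists
  exact ⟨y, hy2, hy1⟩

lemma dominating_indicator_ball (hΩ : IsOpen Ω) (hne : (frontier Ω).Nonempty) (hΩne : Ω.Nonempty)
    (hp0 : 0 < p) (hθ : θ < 1) (hq : 0 < q) (hC : HasLayerBounds Ω) (D : ℝ) :
    Dominating Ω p θ q ((ball (0 : Eucl d) D).indicator fun _ => 1) := by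
  refine ⟨_, measurable_const.indicator measurableSet_ball, fun x _ => le_rfl, fun hp => ?_,
    fun hp => ?_⟩
  · have hpr : 0 < p.toReal := toReal_pos hp0.ne' hp.ne
    obtain ⟨y, hy⟩ := hΩne
    have hy0 := bdist_pos hΩ hne hy
    obtain ⟨C, hC⟩ := hC (p.toReal - 1 - p.toReal * θ) (by nlinarith) ((|D| + ‖y‖) / bdist Ω y)
    refine lt_of_le_of_lt ?_ (lt_of_le_of_lt (hC y hy) (mul_lt_top coe_lt_top
      (dw_ne_top _ _ _).lt_top))
    rw [div_mul_cancel₀ _ hy0.ne', ← lintegral_indicator hΩ.measurableSet,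
      ← lintegral_indicator (hΩ.measurableSet.inter measurableSet_ball)]
    refine lintegral_mono fun x => ?_
    by_cases hx : x ∈ Ω
    · by_cases hx' : x ∈ ball (0 : Eucl d) D
      · have : x ∈ Ω ∩ ball y (|D| + ‖y‖) := by
          refine ⟨hx, ?_⟩
          rw [mem_ball_zero_iff] at hx'
          rw [mem_ball, dist_eq_norm]
          exact (norm_sub_le _ _).trans_lt (by linarith [le_abs_self D])
        simp [hx, hx', this]
      · have hs : 0 < p.toReal / q := by positivity
        simp [hx, hx', hs]
    · simp [hx]
  · obtain ⟨z, hz⟩ := hne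
    set M := |D| + ‖z‖ + 1
    have hM0 : 0 < M := by positivity
    refine ⟨(ofReal (M ^ (q * (θ - 1))))⁻¹.toNNReal, fun x hx => ?_⟩
    have hx0 := bdist_pos hΩ ⟨z, hz⟩ hx
    have hpos : ofReal (M ^ (q * (θ - 1))) ≠ 0 := by
      simp only [ne_eq, ofReal_eq_zero, not_le]; positivity
    rw [coe_toNNReal (by simpa using hpos)]
    by_cases hx' : x ∈ ball (0 : Eucl d) D
    · rw [indicator_of_mem hx']
      have h1 : bdist Ω x ≤ M := by
        refine (infDist_le_dist_of_mem hz).trans ?_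
        rw [mem_ball_zero_iff] at hx'
        rw [dist_eq_norm]
        exact (norm_sub_le _ _).trans (by linarith [le_abs_self D])
      rw [← ENNReal.inv_mul_cancel hpos ofReal_ne_top]
      gcongr
      rw [dw]
      apply ofReal_le_ofReal
      exact Real.rpow_le_rpow_of_nonpos hx0 h1 (by nlinarith)
    · rw [indicator_of_notMem hx']; exact bot_le

theorem dominating_coneSup (hΩ : IsOpen Ω) (hne : (frontier Ω).Nonempty) (hp0 : 0 < p)
    (hθ : θ < 1) (hq : 1 ≤ q) (hC : HasLayerBounds Ω) (hF : Measurable F)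
    (hfin : AvFinite Ω p θ q F) (K : ℝ) : Dominating Ω p θ q (coneSup Ω F K) := by
  have hq0 : 0 < q := by linarith
  rcases eq_or_ne p ∞ with hp | hp
  · obtain ⟨C, hC⟩ := hfin.2 hp
    set Λ := 2 * |K| + 1
    set C' : ℝ≥0∞ := ofReal ((K + 1) ^ d) * (C * ofReal (Λ ^ (-(q * (θ - 1)))))
      with hC'
    have hC't : C' ≠ ∞ := by rw [hC']; finiteness
    refine ⟨fun x => C' * dw Ω (q * (θ - 1)) x, (measurable_dw _ _).const_mul _, fun x hx => ?_,
      fun h => absurd hp h.ne, fun _ => ⟨C'.toNNReal, fun x _ => ?_⟩⟩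
    · refine iSup₂_le fun B hB => ?_
      have hBb := hB
      obtain ⟨hw, hr, h4, hK, hdist⟩ := hB
      have hsub : ball B.1 (B.2 / 2) ⊆ Ω :=
        (ball_subset_ball (by linarith)).trans (ball_subset_of_mem hΩ hw)
      obtain ⟨y, hy, hyC⟩ := exists_mem_ball_of_ae (by positivity) hsub hC
      refine (hBb.bavg_le_wavg F hy).trans ?_
      simp only [hC', mul_assoc]
      gcongr
      refine hyC.trans ?_
      gcongr
      have hy0 := bdist_pos hΩ hne (hsub hy)
      have hx0 := bdist_pos hΩ hne hx
      rw [mem_ball] at hy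
      have e1 := bdist_le_add' Ω x B.1
      have e2 := bdist_le_add' Ω B.1 y
      rw [dw, dw, ← ofReal_mul (by positivity)]
      apply ofReal_le_ofReal
      rw [Real.rpow_neg (by positivity), ← Real.inv_rpow (by positivity),
        ← Real.mul_rpow (by positivity) hx0.le]
      refine Real.rpow_le_rpow_of_nonpos (by positivity) ?_ (by nlinarith)
      rw [inv_mul_le_iff₀ (by positivity)]
      nlinarith [le_abs_self K, abs_nonneg K, mul_nonneg (abs_nonneg K) hr.le]
    · rw [coe_toNNReal hC't]
  · have hpr : 0 < p.toReal := toReal_pos hp0.ne' hp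
    set s := p.toReal / q
    have hs0 : 0 < s := by positivity
    set a := p.toReal - 1 - p.toReal * θ
    have ha1 : -1 < a := by nlinarith
    have hfin' := hfin.1 (lt_top_iff_ne_top.2 hp)
    obtain ⟨CL, hCL⟩ := hC a ha1 (K + 1)
    set v := volume (ball (0 : Eucl d) 1)
    have hvt : v ≠ ∞ := measure_ball_lt_top.ne
    have hv0 : v ≠ 0 := (measure_ball_pos _ _ one_pos).ne'
    set h : Eucl d → ℝ≥0∞ := fun y => wavg Ω F y ^ s with hh
    have hhm : Measurable h := (measurable_wavg Ω hF).pow_const s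
    set Γ : Set (Eucl d × Eucl d) := {z | dist z.1 z.2 < (K + 1) * bdist Ω z.2} with hΓ
    have hΓm : MeasurableSet Γ := (isOpen_lt (by fun_prop) (continuous_const.mul
      ((continuous_bdist Ω).comp continuous_snd))).measurableSet
    set f : Eucl d × Eucl d → ℝ≥0∞ := Γ.indicator fun z => h z.2 * dw Ω (-(d : ℝ)) z.2 with hf
    have hfm : Measurable f :=
      ((hhm.comp measurable_snd).mul ((measurable_dw Ω _).comp measurable_snd)).indicator hΓm
    set T : Eucl d → ℝ≥0∞ := fun x => ∫⁻ y in Ω, f (x, y) with hT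
    have hTm : Measurable T := Measurable.lintegral_prod_right' (ν := volume.restrict Ω) hfm
    set cK := ofReal ((K + 1) ^ d) with hcK
    set c : ℝ≥0∞ := ofReal ((1 / 2) ^ d) * v with hc
    have hc0 : c ≠ 0 := mul_ne_zero (by simp) hv0
    have hct : c ≠ ∞ := mul_ne_top ofReal_ne_top hvt
    set C₁ := c⁻¹ * (cK ^ s * cK) with hC₁
    have hC₁t : C₁ ≠ ∞ := by
      refine mul_ne_top (by simp [hc0]) (mul_ne_top ?_ ofReal_ne_top)
      exact rpow_ne_top_of_nonneg hs0.le ofReal_ne_top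
    have point : ∀ x ∈ Ω, ∀ B, Adm Ω K x B → bavg F B.1 B.2 ^ s ≤ C₁ * T x := by
      intro x hx B hB
      have hBb := hB
      obtain ⟨hw, hr, h4, hK, hdist⟩ := hB
      have hK1 : 0 < K + 1 := by nlinarith
      have hsub : ball B.1 (B.2 / 2) ⊆ Ω :=
        (ball_subset_ball (by linarith)).trans (ball_subset_of_mem hΩ hw)
      have key : c * bavg F B.1 B.2 ^ s ≤ (cK ^ s * cK) * T x := by
        calc c * bavg F B.1 B.2 ^ s = ∫⁻ y in ball B.1 (B.2 / 2),
              bavg F B.1 B.2 ^ s * ofReal (B.2 ^ (-(d : ℝ))) := by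
              rw [lintegral_const, Measure.restrict_apply_univ, volume_ball_eq _ (by positivity),
                hc]
              have h5 : B.2 ^ (-(d : ℝ)) * (B.2 / 2) ^ d = (1 / 2) ^ d := by
                rw [Real.rpow_neg hr.le, Real.rpow_natCast, div_pow, div_pow, one_pow]
                field_simp
              rw [← h5, ofReal_mul (by positivity)]
              ring
          _ ≤ ∫⁻ y in ball B.1 (B.2 / 2), (cK ^ s * cK) * f (x, y) := by
              refine setLIntegral_mono' measurableSet_ball fun y hy => ?_
              have hy' := hy
              rw [mem_ball] at hy
              have e1 := bdist_le_add' Ω B.1 y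
              have e2 := bdist_le_add Ω y B.1
              have hy0 : 0 < bdist Ω y := by linarith
              have hmem : (x, y) ∈ Γ := by
                simp only [hΓ, Set.mem_ofPred_eq]
                have e3 := dist_triangle x B.1 y
                rw [dist_comm x B.1, dist_comm B.1 y] at e3
                nlinarith
              rw [hf, indicator_of_mem hmem]
              have e4 : bavg F B.1 B.2 ^ s ≤ cK ^ s * h y := by
                rw [hh, ← mul_rpow_of_nonneg _ _ hs0.le]
                exact rpow_le_rpow (hBb.bavg_le_wavg F hy') hs0.le
              have e5 : ofReal (B.2 ^ (-(d : ℝ))) ≤ cK * dw Ω (-(d : ℝ)) y := by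
                rw [hcK, dw, ← ofReal_mul (by positivity)]
                apply ofReal_le_ofReal
                rw [Real.rpow_neg hr.le, Real.rpow_neg hy0.le, Real.rpow_natCast,
                  Real.rpow_natCast, inv_eq_one_div, ← div_eq_mul_inv,
                  div_le_div_iff₀ (by positivity) (by positivity), one_mul, ← mul_pow]
                gcongr
                nlinarith
              calc _ ≤ (cK ^ s * h y) * (cK * dw Ω (-(d : ℝ)) y) := mul_le_mul' e4 e5
                _ = _ := by ring
          _ ≤ ∫⁻ y in Ω, (cK ^ s * cK) * f (x, y) := lintegral_mono_set hsub
          _ = _ := by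
              rw [lintegral_const_mul' _ _ (mul_ne_top (rpow_ne_top_of_nonneg hs0.le ofReal_ne_top)
                ofReal_ne_top)]
      calc bavg F B.1 B.2 ^ s = c⁻¹ * (c * bavg F B.1 B.2 ^ s) := by
            rw [← mul_assoc, ENNReal.inv_mul_cancel hc0 hct, one_mul]
        _ ≤ c⁻¹ * ((cK ^ s * cK) * T x) := by gcongr
        _ = C₁ * T x := by rw [hC₁]; ring
    refine ⟨fun x => (C₁ * T x) ^ (1 / s), (hTm.const_mul _).pow_const _, fun x hx => ?_,
      fun _ => ?_, fun h => absurd h hp⟩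
    · refine iSup₂_le fun B hB => ?_
      have := rpow_le_rpow (point x hx B hB) (z := 1 / s) (by positivity)
      rwa [← rpow_mul, mul_one_div_cancel hs0.ne', rpow_one] at this
    · have e1 : ∀ x, ((C₁ * T x) ^ (1 / s)) ^ s = C₁ * T x := by
        intro x
        rw [← rpow_mul, one_div_mul_cancel hs0.ne', rpow_one]
      rw [lintegral_congr (g := fun x => C₁ * (T x * dw Ω a x)) fun x => by rw [e1, mul_assoc]]
      rw [lintegral_const_mul' _ _ hC₁t]
      refine mul_lt_top hC₁t.lt_top (lt_of_le_of_lt ?_ (mul_lt_top (coe_lt_top (r := CL)) hfin'))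
      have e2 : ∀ x, T x * dw Ω a x = ∫⁻ y in Ω, f (x, y) * dw Ω a x := by
        intro x
        rw [hT, lintegral_mul_const' _ _ (dw_ne_top _ _ _)]
      rw [lintegral_congr e2]
      rw [lintegral_swap_of_measurable (f := fun z => f z * dw Ω a z.1)
        (hfm.mul ((measurable_dw Ω a).comp measurable_fst)),
        ← lintegral_const_mul' _ _ coe_ne_top]
      refine setLIntegral_mono' hΩ.measurableSet fun y hy => ?_
      have hy0 := bdist_pos hΩ hne hy
      have e3 : ∀ x, f (x, y) * dw Ω a x = (h y * dw Ω (-(d : ℝ)) y) *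
          (ball y ((K + 1) * bdist Ω y)).indicator (dw Ω a) x := by
        intro x
        by_cases hx : dist x y < (K + 1) * bdist Ω y
        · rw [indicator_of_mem (by exact hx), hf, indicator_of_mem (by exact hx)]
        · rw [indicator_of_notMem (by exact hx), hf, indicator_of_notMem (by exact hx), zero_mul, mul_zero]
      rw [lintegral_congr e3, lintegral_const_mul _ ((measurable_dw Ω a).indicator measurableSet_ball),
        lintegral_indicator measurableSet_ball, Measure.restrict_restrict measurableSet_ball,
        Set.inter_comm]
      calc _ ≤ (h y * dw Ω (-(d : ℝ)) y) * (CL * dw Ω (d + a) y) := by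
            gcongr; exact hCL y hy
        _ = CL * (h y * (dw Ω (-(d : ℝ)) y * dw Ω (d + a) y)) := by ring
        _ = _ := by
            rw [dw_mul hy0]
            congr 3
            ring

/-! ### Averages over large boundary balls -/

/-- The average of `f` over `Ω ∩ B(x, K dist(x, ∂Ω))`, up to a constant. -/
def shadowAvg (Ω : Set (Eucl d)) (f : Eucl d → ℝ≥0∞) (K : ℝ) (x : Eucl d) : ℝ≥0∞ :=
  dw Ω (-(d : ℝ)) x * ∫⁻ y in Ω ∩ ball x (K * bdist Ω x), f y

lemma bavg_rpow_inv_le (hF : Measurable F) (hq : 1 ≤ q) (w : Eucl d) (r : ℝ) :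
    bavg (fun y => F y ^ (1 / q)) w r ≤
      volume (ball (0 : Eucl d) 1) ^ ((q - 1) / q) * bavg F w r ^ (1 / q) := by
  have hq0 : 0 < q := by linarith
  have h1 : Measurable fun z => F (w + r • z) ^ (1 / q) :=
    (hF.comp (by fun_prop : Continuous fun z : Eucl d => w + r • z).measurable).pow_const _
  have := rpow_lintegral_le (volume.restrict (ball (0 : Eucl d) 1)) h1.aemeasurable hq
  have h2 := rpow_le_rpow this (z := 1 / q) (by positivity)
  rw [← rpow_mul, mul_one_div_cancel hq0.ne', rpow_one,
    mul_rpow_of_nonneg _ _ (by positivity), ← rpow_mul,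
    Measure.restrict_apply_univ] at h2
  refine h2.trans (le_of_eq ?_)
  rw [mul_one_div, bavg]
  congr 3
  funext z
  rw [← rpow_mul, one_div_mul_cancel hq0.ne', rpow_one]

lemma bavg_eighth_le_wavg (F : Eucl d → ℝ≥0∞) {t : Eucl d} (hy : 0 < bdist Ω y)
    (ht : t ∈ ball y (bdist Ω y / 16)) :
    bavg F y (bdist Ω y / 8) ≤ ofReal (8 ^ d) * wavg Ω F t := by
  rw [mem_ball] at ht
  have e1 := bdist_le_add' Ω y t
  have e2 := bdist_le_add Ω t y
  refine bavg_le_mul_of_dist (by positivity) (by linarith) ?_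
  rw [dist_comm]; linarith

lemma lintegral_dw_far_le (hΩ : IsOpen Ω) (hne : (frontier Ω).Nonempty) {b : ℝ} (hb : b < 0)
    {K : ℝ} (hK : 0 ≤ K) : ∃ C : ℝ≥0, ∀ y ∈ Ω,
    ∫⁻ x in Ω ∩ {x | dist x y < K * bdist Ω x}, dw Ω (b - d) x ≤ C * dw Ω b y := by
  set I := ∫⁻ z : Eucl d, ofReal ((1 + ‖z‖) ^ (-(d - b)))
  have hIt : I < ∞ := finite_integral_one_add_norm (by simp; linarith)
  refine ⟨(ofReal ((1 + 2 * K) ^ (d - b)) * I).toNNReal, fun y hy => ?_⟩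
  rw [coe_toNNReal (by finiteness)]
  have hy0 := bdist_pos hΩ hne hy
  set S : Set (Eucl d) := Ω ∩ {x | dist x y < K * bdist Ω x}
  have hSm : MeasurableSet S := hΩ.measurableSet.inter
    (isOpen_lt (by fun_prop) (continuous_const.mul (continuous_bdist Ω))).measurableSet
  rw [← lintegral_indicator hSm, lintegral_comp_add_smul _ y hy0]
  have key : ∀ z, S.indicator (dw Ω (b - d)) (y + bdist Ω y • z) ≤
      (ofReal ((1 + 2 * K) ^ (d - b)) * ofReal (bdist Ω y ^ (b - d))) *
        ofReal ((1 + ‖z‖) ^ (-(d - b))) := by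
    intro z
    by_cases hz : y + bdist Ω y • z ∈ S
    · rw [indicator_of_mem hz, dw]
      set x := y + bdist Ω y • z with hx
      have hx0 := bdist_pos hΩ hne hz.1
      have h1 : dist x y < K * bdist Ω x := hz.2
      have h2 := bdist_le_add' Ω y x
      have h3 : dist x y = bdist Ω y * ‖z‖ := by
        rw [hx, dist_self_add_left, norm_smul, norm_of_nonneg hy0.le]
      have h4 : bdist Ω y * (1 + ‖z‖) ≤ (1 + 2 * K) * bdist Ω x := by nlinarith
      rw [← ofReal_mul (by positivity), ← ofReal_mul (by positivity)]
      apply ofReal_le_ofReal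
      have h5 : (1 + 2 * K) ^ (d - b) = (1 + 2 * K)⁻¹ ^ (b - d) := by
        rw [Real.inv_rpow (by positivity), ← Real.rpow_neg (by positivity), neg_sub]
      rw [h5, neg_sub, ← Real.mul_rpow (by positivity) hy0.le, ← Real.mul_rpow (by positivity)
        (by positivity)]
      have hd : (0 : ℝ) ≤ d := Nat.cast_nonneg d
      refine Real.rpow_le_rpow_of_nonpos (by positivity) ?_ (by linarith)
      rw [mul_assoc, inv_mul_le_iff₀ (by positivity)]
      exact h4
    · rw [indicator_of_notMem hz]; exact bot_le
  calc _ ≤ ofReal (bdist Ω y ^ d) * ∫⁻ z,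
        (ofReal ((1 + 2 * K) ^ (d - b)) * ofReal (bdist Ω y ^ (b - d))) *
        ofReal ((1 + ‖z‖) ^ (-(d - b))) := by
        gcongr; exact key _
    _ = ofReal ((1 + 2 * K) ^ (d - b)) * I *
        (ofReal (bdist Ω y ^ d) * ofReal (bdist Ω y ^ (b - d))) := by
        rw [lintegral_const_mul' _ _ (by finiteness)]; ring
    _ = _ := by
        rw [← ofReal_mul (by positivity), dw, ← Real.rpow_natCast, ← Real.rpow_add hy0]
        congr 3; ring

/-- The integral of `h dist(·, ∂Ω)^e` over a large boundary ball. -/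
def shadowInt (Ω : Set (Eucl d)) (h : Eucl d → ℝ≥0∞) (e K : ℝ) (x : Eucl d) : ℝ≥0∞ :=
  ∫⁻ y in Ω ∩ ball x (K * bdist Ω x), h y * dw Ω e y

lemma shadowInt_eq (h : Eucl d → ℝ≥0∞) (e K : ℝ) (x : Eucl d) :
    shadowInt Ω h e K x = ∫⁻ y in Ω, Set.indicator {z : Eucl d × Eucl d |
      dist z.1 z.2 < K * bdist Ω z.1} (fun z => h z.2 * dw Ω e z.2) (x, y) := by
  rw [shadowInt, Set.inter_comm, ← Measure.restrict_restrict measurableSet_ball,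
    ← lintegral_indicator measurableSet_ball]
  refine lintegral_congr fun y => ?_
  by_cases hy : dist x y < K * bdist Ω x
  · rw [indicator_of_mem (by rw [mem_ball, dist_comm]; exact hy),
      indicator_of_mem (by exact hy)]
  · rw [indicator_of_notMem (by rw [mem_ball, dist_comm]; exact hy),
      indicator_of_notMem (by exact hy)]

lemma measurable_shadow_indicator {h : Eucl d → ℝ≥0∞} (hh : Measurable h) (e K : ℝ) :
    Measurable (Set.indicator {z : Eucl d × Eucl d |
      dist z.1 z.2 < K * bdist Ω z.1} (fun z => h z.2 * dw Ω e z.2)) :=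
  ((hh.comp measurable_snd).mul ((measurable_dw Ω e).comp measurable_snd)).indicator
    (isOpen_lt (by fun_prop) (continuous_const.mul
      ((continuous_bdist Ω).comp continuous_fst))).measurableSet

lemma measurable_shadowInt {h : Eucl d → ℝ≥0∞} (hh : Measurable h) (e K : ℝ) :
    Measurable (shadowInt Ω h e K) := by
  rw [show shadowInt Ω h e K = _ from funext (shadowInt_eq h e K)]
  exact Measurable.lintegral_prod_right' (ν := volume.restrict Ω) (measurable_shadow_indicator hh e K)

lemma lintegral_shadowInt_le (hΩ : IsOpen Ω) (hne : (frontier Ω).Nonempty) {h : Eucl d → ℝ≥0∞}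
    (hh : Measurable h) {a e : ℝ} (hae : a < e) {K : ℝ} (hK : 0 ≤ K) : ∃ C : ℝ≥0,
    ∫⁻ x in Ω, (dw Ω (-d - e) x * shadowInt Ω h e K x) * dw Ω a x ≤
      C * ∫⁻ y in Ω, h y * dw Ω a y := by
  obtain ⟨C, hC⟩ := lintegral_dw_far_le hΩ hne (b := a - e) (by linarith) hK
  refine ⟨C, ?_⟩
  set f := Set.indicator {z : Eucl d × Eucl d |
      dist z.1 z.2 < K * bdist Ω z.1} (fun z => h z.2 * dw Ω e z.2) with hf
  have hfm : Measurable f := measurable_shadow_indicator hh e K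
  have e1 : ∀ x ∈ Ω, (dw Ω (-d - e) x * shadowInt Ω h e K x) * dw Ω a x =
      ∫⁻ y in Ω, f (x, y) * dw Ω (a - e - d) x := by
    intro x hx
    rw [shadowInt_eq, lintegral_mul_const' _ _ (dw_ne_top _ _ _),
      show a - e - d = -d - e + a by ring, ← dw_mul (bdist_pos hΩ hne hx)]
    ring
  rw [setLIntegral_congr_fun hΩ.measurableSet e1, lintegral_swap_of_measurable
    (f := fun z => f z * dw Ω (a - e - d) z.1) (hfm.mul ((measurable_dw Ω _).comp measurable_fst)),
    ← lintegral_const_mul' _ _ coe_ne_top]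
  refine setLIntegral_mono' hΩ.measurableSet fun y hy => ?_
  have hSm : MeasurableSet {x : Eucl d | dist x y < K * bdist Ω x} :=
    (isOpen_lt (by fun_prop) (continuous_const.mul (continuous_bdist Ω))).measurableSet
  have e3 : ∀ x, f (x, y) * dw Ω (a - e - d) x = (h y * dw Ω e y) *
      {x : Eucl d | dist x y < K * bdist Ω x}.indicator (dw Ω (a - e - d)) x := by
    intro x
    by_cases hx : dist x y < K * bdist Ω x
    · rw [indicator_of_mem (by exact hx), hf, indicator_of_mem (by exact hx)]
    · rw [indicator_of_notMem (by exact hx), hf, indicator_of_notMem (by exact hx),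
        zero_mul, mul_zero]
  rw [lintegral_congr e3, lintegral_const_mul _ ((measurable_dw Ω _).indicator hSm),
    lintegral_indicator hSm, Measure.restrict_restrict hSm, Set.inter_comm]
  calc _ ≤ (h y * dw Ω e y) * (C * dw Ω (a - e) y) := by gcongr; exact hC y hy
    _ = C * (h y * (dw Ω e y * dw Ω (a - e) y)) := by ring
    _ = _ := by
      rw [dw_mul (bdist_pos hΩ hne hy)]
      congr 3
      ring

lemma exists_shadowAvg_le (d : ℕ) (hq : 1 ≤ q) : ∃ C : ℝ≥0, ∀ (Ω : Set (Eucl d)),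
    IsOpen Ω → (frontier Ω).Nonempty → ∀ F : Eucl d → ℝ≥0∞, Measurable F → ∀ K : ℝ, 0 ≤ K →
    ∀ x ∈ Ω, shadowAvg Ω (fun y => F y ^ (1 / q)) K x ≤ C * (dw Ω (-(d : ℝ)) x *
      ∫⁻ y in Ω ∩ ball x ((2 * K + 1) * bdist Ω x), bavg F y (bdist Ω y / 8) ^ (1 / q)) := by
  obtain ⟨C, hC⟩ := exists_lintegral_le_lintegral_bavg d
  set v := volume (ball (0 : Eucl d) 1) ^ ((q - 1) / q)
  have hvt : v ≠ ∞ := rpow_ne_top_of_nonneg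
    (div_nonneg (by linarith) (by linarith)) measure_ball_lt_top.ne
  refine ⟨C * v.toNNReal, fun Ω hΩ hne F hF K hK x hx => ?_⟩
  have hx0 := bdist_pos hΩ hne hx
  rw [shadowAvg, coe_mul, coe_toNNReal hvt]
  calc _ ≤ dw Ω (-(d : ℝ)) x * (C * ∫⁻ y in Ω ∩ ball x ((2 * K + 1) * bdist Ω x),
        bavg (fun y => F y ^ (1 / q)) y (bdist Ω y / 8)) := by
        gcongr
        refine hC Ω hΩ hne _ (hF.pow_const _) _ _ (hΩ.measurableSet.inter measurableSet_ball)
          (hΩ.measurableSet.inter measurableSet_ball) Set.inter_subset_left ?_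
        rintro t ⟨ht, ht'⟩ y hy
        have ht0 := bdist_pos hΩ hne ht
        rw [mem_ball] at ht' hy
        refine ⟨mem_of_dist_lt hΩ ht (by linarith), ?_⟩
        rw [mem_ball]
        have h1 := bdist_le_add Ω t x
        have h2 := dist_triangle y t x
        nlinarith
    _ ≤ dw Ω (-(d : ℝ)) x * (C * ∫⁻ y in Ω ∩ ball x ((2 * K + 1) * bdist Ω x),
        v * bavg F y (bdist Ω y / 8) ^ (1 / q)) := by
        gcongr
        exact bavg_rpow_inv_le hF hq _ _
    _ = _ := by rw [lintegral_const_mul' _ _ hvt]; ring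

lemma bavg_eighth_rpow_le (F : Eucl d → ℝ≥0∞) (hΩ : IsOpen Ω) (hne : (frontier Ω).Nonempty)
    {s : ℝ} (hs : 0 ≤ s) (hy : y ∈ Ω) :
    bavg F y (bdist Ω y / 8) ^ s ≤ ofReal (8 ^ d) ^ s * wavg Ω F y ^ s := by
  have hy0 := bdist_pos hΩ hne hy
  rw [← mul_rpow_of_nonneg _ _ hs]
  exact rpow_le_rpow (bavg_eighth_le_wavg F hy0 (mem_ball_self (by positivity))) hs

/-- The average over a Whitney ball is controlled by the integral over a boundary ball. -/
lemma exists_bavg_rpow_le_shadowInt (hΩ : IsOpen Ω) (hne : (frontier Ω).Nonempty)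
    (F : Eucl d → ℝ≥0∞) {s : ℝ} (hs : 0 ≤ s) (e : ℝ) {K : ℝ} (hK : 0 ≤ K) : ∃ C : ℝ≥0,
    ∀ x ∈ Ω, ∀ y ∈ Ω ∩ ball x (K * bdist Ω x), bavg F y (bdist Ω y / 8) ^ s ≤
      C * (dw Ω (-d - e) y * shadowInt Ω (fun t => wavg Ω F t ^ s) e (2 * K + 1) x) := by
  set v := volume (ball (0 : Eucl d) 1)
  have hvt : v ≠ ∞ := measure_ball_lt_top.ne
  have hv0 : v ≠ 0 := (measure_ball_pos _ _ one_pos).ne'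
  set c : ℝ≥0∞ := ofReal ((1 / 16) ^ d) * v with hc
  have hc0 : c ≠ 0 := mul_ne_zero (by simp) hv0
  have hct : c ≠ ∞ := mul_ne_top ofReal_ne_top hvt
  set C₁ := ofReal (8 ^ d) ^ s * ofReal (2 ^ |e|) with hC₁
  have hC₁t : C₁ ≠ ∞ := mul_ne_top (rpow_ne_top_of_nonneg hs ofReal_ne_top) ofReal_ne_top
  refine ⟨(c⁻¹ * C₁).toNNReal, fun x hx y hy => ?_⟩
  rw [coe_toNNReal (mul_ne_top (by simp [hc0]) hC₁t)]
  obtain ⟨hy, hyx⟩ := hy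
  have hy0 := bdist_pos hΩ hne hy
  have hx0 := bdist_pos hΩ hne hx
  set b := bavg F y (bdist Ω y / 8)
  set X := shadowInt Ω (fun t => wavg Ω F t ^ s) e (2 * K + 1) x with hX
  have key : b ^ s * dw Ω e y * (dw Ω d y * c) ≤ C₁ * X := by
    calc b ^ s * dw Ω e y * (dw Ω d y * c) = ∫⁻ t in ball y (bdist Ω y / 16), b ^ s * dw Ω e y := by
          rw [lintegral_const, Measure.restrict_apply_univ, volume_ball_eq _ (by positivity), hc,
            show dw Ω d y = ofReal (bdist Ω y ^ d) by rw [dw, Real.rpow_natCast],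
            div_pow, div_pow, one_pow, div_eq_mul_one_div (_ ^ d),
            ofReal_mul (p := bdist Ω y ^ d) (by positivity)]
          ring
      _ ≤ ∫⁻ t in ball y (bdist Ω y / 16), C₁ * (wavg Ω F t ^ s * dw Ω e t) := by
          refine setLIntegral_mono' measurableSet_ball fun t ht => ?_
          have ht' := ht
          rw [mem_ball] at ht
          have e1 := bdist_le_add' Ω y t
          have e2 := bdist_le_add Ω t y
          have e3 : b ^ s ≤ ofReal (8 ^ d) ^ s * wavg Ω F t ^ s := by
            rw [← mul_rpow_of_nonneg _ _ hs]
            exact rpow_le_rpow (bavg_eighth_le_wavg F hy0 ht') hs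
          have e4 := dw_le_of_le (Λ := 2) hy0 (show 0 < bdist Ω t by linarith) (by linarith)
            (by linarith) e
          calc _ ≤ (ofReal (8 ^ d) ^ s * wavg Ω F t ^ s) *
                (ofReal (2 ^ |e|) * dw Ω e t) := mul_le_mul' e3 e4
            _ = _ := by rw [hC₁]; ring
      _ = C₁ * ∫⁻ t in ball y (bdist Ω y / 16), wavg Ω F t ^ s * dw Ω e t :=
          lintegral_const_mul' _ _ hC₁t
      _ ≤ _ := by
          rw [hX, shadowInt]
          gcongr
          intro t ht
          rw [mem_ball] at ht hyx
          refine ⟨mem_of_dist_lt hΩ hy (by linarith), ?_⟩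
          rw [mem_ball]
          have h1 := bdist_le_add Ω y x
          have h2 := dist_triangle t y x
          nlinarith
  calc b ^ s = dw Ω (-d - e) y * c⁻¹ * (b ^ s * dw Ω e y * (dw Ω d y * c)) := by
        have : dw Ω (-d - e) y * (dw Ω e y * dw Ω d y) = 1 := by
          rw [dw_mul hy0, dw_mul hy0, show -(d : ℝ) - e + (e + d) = 0 by ring, dw_zero]
        calc b ^ s = b ^ s * (dw Ω (-d - e) y * (dw Ω e y * dw Ω d y)) * (c⁻¹ * c) := by
              rw [this, ENNReal.inv_mul_cancel hc0 hct, mul_one, mul_one]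
          _ = _ := by ring
    _ ≤ dw Ω (-d - e) y * c⁻¹ * (C₁ * X) := by gcongr
    _ = _ := by ring

lemma exists_shadow_le_of_le_one (hΩ : IsOpen Ω) (hne : (frontier Ω).Nonempty) (hF : Measurable F)
    {p : ℝ} (hp : 0 < p) (hp1 : p ≤ 1) (hq : 1 ≤ q) {K : ℝ} (hK : 0 ≤ K) :
    ∃ C : ℝ≥0, ∀ x ∈ Ω,
    (∫⁻ y in Ω ∩ ball x (K * bdist Ω x), bavg F y (bdist Ω y / 8) ^ (1 / q)) ^ p ≤
      C * shadowInt Ω (fun t => wavg Ω F t ^ (p / q)) (d * (p - 1)) (2 * K + 1) x := by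
  have hq0 : 0 < q := by linarith
  set e : ℝ := d * (p - 1) with he
  set s := (1 - p) / p with hs
  have hs0 : 0 ≤ s := div_nonneg (by linarith) hp.le
  obtain ⟨C₁, hC₁⟩ := exists_bavg_rpow_le_shadowInt hΩ hne F (s := p / q) (by positivity) e hK
  set C₂ : ℝ≥0∞ := ofReal (8 ^ d) ^ (p / q) * (C₁ : ℝ≥0∞) ^ s with hC₂
  have hC₂t : C₂ ≠ ∞ := mul_ne_top (rpow_ne_top_of_nonneg (by positivity) ofReal_ne_top)
    (rpow_ne_top_of_nonneg hs0 coe_ne_top)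
  have hC₂p : C₂ ^ p ≠ ∞ := rpow_ne_top_of_nonneg hp.le hC₂t
  refine ⟨(C₂ ^ p).toNNReal, fun x hx => ?_⟩
  rw [coe_toNNReal hC₂p]
  set X := shadowInt Ω (fun t => wavg Ω F t ^ (p / q)) e (2 * K + 1) x with hX
  have hx0 := bdist_pos hΩ hne hx
  have hwm : Measurable (wavg Ω F) := measurable_wavg Ω hF
  have key : ∫⁻ y in Ω ∩ ball x (K * bdist Ω x), bavg F y (bdist Ω y / 8) ^ (1 / q) ≤
      C₂ * X ^ (1 / p) := by
    calc _ ≤ ∫⁻ y in Ω ∩ ball x (K * bdist Ω x), C₂ * X ^ s *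
          (wavg Ω F y ^ (p / q) * dw Ω e y) := by
          refine setLIntegral_mono' (hΩ.measurableSet.inter measurableSet_ball) fun y hy => ?_
          have hy0 := bdist_pos hΩ hne hy.1
          set b := bavg F y (bdist Ω y / 8)
          have e1 : b ^ (1 / q) = b ^ (p / q) * (b ^ (p / q)) ^ s := by
            rw [← rpow_mul, ← ENNReal.rpow_add_of_nonneg _ _ (by positivity) (by positivity), hs]
            congr 1
            field_simp
            ring
          have e2 : (b ^ (p / q)) ^ s ≤ (C₁ : ℝ≥0∞) ^ s * (dw Ω e y * X ^ s) := by
            refine (rpow_le_rpow (hC₁ x hx y hy) hs0).trans (le_of_eq ?_)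
            rw [mul_rpow_of_nonneg _ _ hs0, mul_rpow_of_nonneg _ _ hs0, dw_rpow hy0]
            congr 3
            rw [he, hs]
            field_simp
            ring
          rw [e1]
          calc _ ≤ (ofReal (8 ^ d) ^ (p / q) * wavg Ω F y ^ (p / q)) *
                ((C₁ : ℝ≥0∞) ^ s * (dw Ω e y * X ^ s)) :=
                mul_le_mul' (bavg_eighth_rpow_le F hΩ hne (by positivity) hy.1) e2
            _ = _ := by rw [hC₂]; ring
      _ = C₂ * X ^ s * ∫⁻ y in Ω ∩ ball x (K * bdist Ω x), (wavg Ω F y ^ (p / q) * dw Ω e y) :=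
          lintegral_const_mul _ ((hwm.pow_const _).mul (measurable_dw Ω e))
      _ ≤ C₂ * X ^ s * X := by
          rw [hX, shadowInt]
          gcongr
          linarith
      _ = _ := by
          rw [mul_assoc]
          congr 1
          nth_rewrite 2 [← rpow_one X]
          rw [← ENNReal.rpow_add_of_nonneg _ _ hs0 zero_le_one, hs]
          congr 1
          field_simp
          ring
  refine (rpow_le_rpow key hp.le).trans (le_of_eq ?_)
  rw [mul_rpow_of_nonneg _ _ hp.le, ← rpow_mul, one_div_mul_cancel hp.ne', rpow_one]

lemma exists_shadow_le_of_one_lt (hΩ : IsOpen Ω) (hne : (frontier Ω).Nonempty) (hF : Measurable F)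
    {p : ℝ} (hp1 : 1 < p) (hq : 1 ≤ q) (hC : HasLayerBounds Ω) {κ : ℝ}
    (hκ : κ < 1 - 1 / p) (K : ℝ) :
    ∃ C : ℝ≥0, ∀ x ∈ Ω,
    (∫⁻ y in Ω ∩ ball x (K * bdist Ω x), bavg F y (bdist Ω y / 8) ^ (1 / q)) ^ p ≤
      C * (dw Ω (d * (p - 1) - κ * p) x *
        shadowInt Ω (fun t => wavg Ω F t ^ (p / q)) (κ * p) K x) := by
  have hp : 0 < p := by linarith
  have hq0 : 0 < q := by linarith
  have hpq := Real.HolderConjugate.conjExponent hp1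
  set p' := Real.conjExponent p
  have hp'0 : 0 < p' := hpq.symm.pos
  have hpp : p / p' = p - 1 := hpq.div_conj_eq_sub_one
  have hp'i : 1 - 1 / p = 1 / p' := by have := hpq.inv_add_inv_eq_one; simp only [one_div]; linarith
  have hκ' : κ * p' < 1 := by rwa [hp'i, lt_div_iff₀ hp'0] at hκ
  obtain ⟨C₁, hC₁⟩ := hC (-(κ * p')) (by linarith) K
  set C₂ : ℝ≥0∞ := ofReal (8 ^ d) ^ (p / q) * (C₁ : ℝ≥0∞) ^ (p - 1) with hC₂
  have hC₂t : C₂ ≠ ∞ := mul_ne_top (rpow_ne_top_of_nonneg (by positivity) ofReal_ne_top)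
    (rpow_ne_top_of_nonneg (by linarith) coe_ne_top)
  refine ⟨C₂.toNNReal, fun x hx => ?_⟩
  rw [coe_toNNReal hC₂t]
  have hx0 := bdist_pos hΩ hne hx
  have hwm : Measurable (wavg Ω F) := measurable_wavg Ω hF
  set S := Ω ∩ ball x (K * bdist Ω x)
  have hSm : MeasurableSet S := hΩ.measurableSet.inter measurableSet_ball
  have hbm : Measurable fun y => bavg F y (bdist Ω y / 8) :=
    measurable_bavg hF ((continuous_bdist Ω).div_const 8)
  set f : Eucl d → ℝ≥0∞ := fun y => bavg F y (bdist Ω y / 8) ^ (1 / q) * dw Ω κ y with hf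
  have hfm : Measurable f := (hbm.pow_const _).mul (measurable_dw _ _)
  have h1 := ENNReal.lintegral_mul_le_Lp_mul_Lq (volume.restrict S) hpq hfm.aemeasurable
    (measurable_dw Ω (-κ)).aemeasurable
  have h2 : ∫⁻ y in S, bavg F y (bdist Ω y / 8) ^ (1 / q) = ∫⁻ y in S, (f * dw Ω (-κ)) y := by
    refine setLIntegral_congr_fun hSm fun y hy => ?_
    simp only [Pi.mul_apply, hf]
    rw [mul_assoc, dw_mul (bdist_pos hΩ hne hy.1), add_neg_cancel, dw_zero, mul_one]
  rw [h2]
  refine (rpow_le_rpow h1 hp.le).trans ?_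
  rw [mul_rpow_of_nonneg _ _ hp.le, ← rpow_mul, ← rpow_mul,
    one_div_mul_cancel hp.ne', rpow_one, one_div_mul_eq_div, hpp]
  have h3 : ∫⁻ y in S, f y ^ p ≤ ofReal (8 ^ d) ^ (p / q) *
      shadowInt Ω (fun t => wavg Ω F t ^ (p / q)) (κ * p) K x := by
    rw [shadowInt, ← lintegral_const_mul' _ _ (rpow_ne_top_of_nonneg (by positivity) ofReal_ne_top)]
    refine setLIntegral_mono' hSm fun y hy => ?_
    simp only [hf]
    rw [mul_rpow_of_nonneg _ _ hp.le, dw_rpow (bdist_pos hΩ hne hy.1),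
      ← rpow_mul, one_div_mul_eq_div, ← mul_assoc]
    gcongr
    exact bavg_eighth_rpow_le F hΩ hne (by positivity) hy.1
  have h4 : (∫⁻ y in S, dw Ω (-κ) y ^ p') ^ (p - 1) ≤
      (C₁ : ℝ≥0∞) ^ (p - 1) * dw Ω (d * (p - 1) - κ * p) x := by
    have h5 : ∫⁻ y in S, dw Ω (-κ) y ^ p' = ∫⁻ y in S, dw Ω (-(κ * p')) y := by
      refine setLIntegral_congr_fun hSm fun y hy => ?_
      rw [dw_rpow (bdist_pos hΩ hne hy.1), neg_mul]
    rw [h5]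
    refine (rpow_le_rpow (hC₁ x hx) (by linarith)).trans (le_of_eq ?_)
    rw [mul_rpow_of_nonneg _ _ (by linarith), dw_rpow hx0]
    congr 2
    have : p' * (p - 1) = p := by rw [← hpp]; field_simp
    linear_combination (-κ) * this
  refine (mul_le_mul' h3 h4).trans (le_of_eq ?_)
  rw [hC₂]; ring

theorem dominating_shadowAvg (hΩ : IsOpen Ω) (hne : (frontier Ω).Nonempty) (hp0 : 0 < p)
    (hθ0 : 0 < θ) (hθ : θ < 1) (hq : 1 ≤ q) (hpd : p < ∞ → (d : ℝ) - 1 < p.toReal * (d - 1 + θ))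
    (hC : HasLayerBounds Ω) (hF : Measurable F) (hfin : AvFinite Ω p θ q F)
    {K : ℝ} (hK : 0 ≤ K) :
    Dominating Ω p θ q (fun x => shadowAvg Ω (fun y => F y ^ (1 / q)) K x ^ q) := by
  have hq0 : 0 < q := by linarith
  obtain ⟨C₀, hC₀⟩ := exists_shadowAvg_le d hq
  set K' := 2 * K + 1
  have hK'0 : 0 ≤ K' := by positivity
  rcases eq_or_ne p ∞ with hp | hp
  · obtain ⟨C₁, hC₁⟩ := hfin.2 hp
    obtain ⟨C₂, hC₂⟩ := hC (θ - 1) (by linarith) K'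
    set Λ : ℝ := 2 ^ |θ - 1|
    set A : ℝ≥0∞ := ofReal (8 ^ d) ^ (1 / q) * (C₁ ^ (1 / q) * ofReal Λ) with hA
    have hAt : A ≠ ∞ := by
      have : 0 ≤ 1 / q := by positivity
      rw [hA]; finiteness
    have hpt : ∀ y ∈ Ω, bavg F y (bdist Ω y / 8) ^ (1 / q) ≤ A * dw Ω (θ - 1) y := by
      intro y hy
      have hy0 := bdist_pos hΩ hne hy
      obtain ⟨t, ht, htC⟩ := exists_mem_ball_of_ae (w := y) (r := bdist Ω y / 16) (by positivity)
        ((ball_subset_ball (by linarith)).trans (ball_subset_of_mem hΩ hy)) hC₁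
      have ht' := ht
      rw [mem_ball] at ht'
      have e1 := bdist_le_add' Ω y t
      have e2 := bdist_le_add Ω t y
      have ht0 : 0 < bdist Ω t := by linarith
      calc _ ≤ (ofReal (8 ^ d) * (C₁ * dw Ω (q * (θ - 1)) t)) ^ (1 / q) := by
            gcongr
            exact (bavg_eighth_le_wavg F hy0 ht).trans (by gcongr)
        _ = ofReal (8 ^ d) ^ (1 / q) * (C₁ ^ (1 / q) * dw Ω (θ - 1) t) := by
            rw [mul_rpow_of_nonneg _ _ (by positivity),
              mul_rpow_of_nonneg _ _ (by positivity), dw_rpow ht0]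
            congr 3
            field_simp
        _ ≤ ofReal (8 ^ d) ^ (1 / q) * (C₁ ^ (1 / q) * (ofReal Λ * dw Ω (θ - 1) y)) := by
            gcongr
            exact dw_le_of_le ht0 hy0 (by linarith) (by linarith) _
        _ = _ := by rw [hA]; ring
    set B : ℝ≥0∞ := (C₀ * (A * C₂)) ^ q with hB
    have hBt : B ≠ ∞ := rpow_ne_top_of_nonneg hq0.le (by finiteness)
    refine ⟨fun x => B * dw Ω (q * (θ - 1)) x, (measurable_dw _ _).const_mul _, fun x hx => ?_,
      fun h => absurd hp h.ne, fun _ => ⟨B.toNNReal, fun x _ => by rw [coe_toNNReal hBt]⟩⟩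
    have hx0 := bdist_pos hΩ hne hx
    have : shadowAvg Ω (fun y => F y ^ (1 / q)) K x ≤ C₀ * (A * C₂) * dw Ω (θ - 1) x := by
      refine (hC₀ Ω hΩ hne F hF K hK x hx).trans ?_
      calc _ ≤ C₀ * (dw Ω (-(d : ℝ)) x * (A * (C₂ * dw Ω (d + (θ - 1)) x))) := by
            gcongr
            calc _ ≤ ∫⁻ y in Ω ∩ ball x (K' * bdist Ω x), A * dw Ω (θ - 1) y :=
                  setLIntegral_mono' (hΩ.measurableSet.inter measurableSet_ball)
                    fun y hy => hpt y hy.1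
              _ = A * ∫⁻ y in Ω ∩ ball x (K' * bdist Ω x), dw Ω (θ - 1) y :=
                  lintegral_const_mul' _ _ hAt
              _ ≤ _ := by gcongr; exact hC₂ x hx
        _ = C₀ * (A * C₂) * (dw Ω (-(d : ℝ)) x * dw Ω (d + (θ - 1)) x) := by ring
        _ = _ := by rw [dw_mul hx0]; congr 2; ring
    refine (rpow_le_rpow this hq0.le).trans (le_of_eq ?_)
    rw [mul_rpow_of_nonneg _ _ hq0.le, dw_rpow hx0, mul_comm q]
  · have hpr : 0 < p.toReal := toReal_pos hp0.ne' hp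
    set P := p.toReal
    set a := P - 1 - P * θ with ha
    have hfin' := hfin.1 (lt_top_iff_ne_top.2 hp)
    have hpd' := hpd (lt_top_iff_ne_top.2 hp)
    obtain ⟨e, C, K'', hK'', hae, hCe⟩ : ∃ (e : ℝ) (C : ℝ≥0) (K'' : ℝ), 0 ≤ K'' ∧ a < e ∧ ∀ x ∈ Ω,
        (dw Ω (-(d : ℝ)) x * ∫⁻ y in Ω ∩ ball x (K' * bdist Ω x),
          bavg F y (bdist Ω y / 8) ^ (1 / q)) ^ P ≤
        C * (dw Ω (-d - e) x * shadowInt Ω (fun t => wavg Ω F t ^ (P / q)) e K'' x) := by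
      rcases le_or_gt P 1 with hP1 | hP1
      · obtain ⟨C, hC⟩ := exists_shadow_le_of_le_one hΩ hne hF hpr hP1 hq hK'0
        refine ⟨d * (P - 1), C, 2 * K' + 1, by positivity, by rw [ha]; linarith, fun x hx => ?_⟩
        rw [mul_rpow_of_nonneg _ _ hpr.le, dw_rpow (bdist_pos hΩ hne hx),
          show -(d : ℝ) - d * (P - 1) = -d * P by ring, mul_left_comm]
        gcongr
        exact hC x hx
      · obtain ⟨C, hC⟩ := exists_shadow_le_of_one_lt hΩ hne hF hP1 hq hC
          (κ := 1 - 1 / P - θ / 2) (by linarith) K'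
        refine ⟨(1 - 1 / P - θ / 2) * P, C, K', hK'0, ?_, fun x hx => ?_⟩
        · have : (1 - 1 / P - θ / 2) * P = P - 1 - θ / 2 * P := by field_simp
          rw [this, ha]; nlinarith
        · have hx0 := bdist_pos hΩ hne hx
          rw [mul_rpow_of_nonneg _ _ hpr.le, dw_rpow hx0]
          refine (mul_le_mul_right (hC x hx) _).trans (le_of_eq ?_)
          rw [mul_left_comm, ← mul_assoc (dw Ω _ x), dw_mul hx0]
          congr 3
          ring
    obtain ⟨C₃, hC₃⟩ := lintegral_shadowInt_le hΩ hne (h := fun t => wavg Ω F t ^ (P / q))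
      ((measurable_wavg Ω hF).pow_const _) hae hK''
    set B : ℝ≥0∞ := (C₀ : ℝ≥0∞) ^ P * C with hB
    have hBt : B ≠ ∞ := mul_ne_top (rpow_ne_top_of_nonneg hpr.le coe_ne_top) coe_ne_top
    set T : Eucl d → ℝ≥0∞ := fun x =>
      dw Ω (-d - e) x * shadowInt Ω (fun t => wavg Ω F t ^ (P / q)) e K'' x
    have hTm : Measurable T := (measurable_dw _ _).mul
      (measurable_shadowInt ((measurable_wavg Ω hF).pow_const _) e K'')
    refine ⟨fun x => (B * T x) ^ (q / P), (hTm.const_mul _).pow_const _, fun x hx => ?_,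
      fun _ => ?_, fun h => absurd h hp⟩
    · have h1 : shadowAvg Ω (fun y => F y ^ (1 / q)) K x ^ P ≤ B * T x := by
        refine (rpow_le_rpow (hC₀ Ω hΩ hne F hF K hK x hx) hpr.le).trans ?_
        rw [mul_rpow_of_nonneg _ _ hpr.le, hB, mul_assoc]
        gcongr
        exact hCe x hx
      have h2 := rpow_le_rpow h1 (z := q / P) (by positivity)
      rwa [← rpow_mul, mul_div_cancel₀ _ hpr.ne'] at h2
    · have e1 : ∀ x, ((B * T x) ^ (q / P)) ^ (P / q) * dw Ω a x = B * (T x * dw Ω a x) := by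
        intro x
        rw [← rpow_mul, div_mul_div_cancel₀ hpr.ne', div_self hq0.ne', rpow_one, mul_assoc]
      rw [lintegral_congr e1, lintegral_const_mul' _ _ hBt]
      exact mul_lt_top hBt.lt_top (hC₃.trans_lt (mul_lt_top coe_lt_top hfin'))

/-! ### Arrays and their averages -/

/-- The sum of the `q`-th powers of the entries of length `m` of an array. -/
def powSum (q : ℝ) (m : ℕ) (H : Jet d) (y : Eucl d) : ℝ≥0∞ :=
  ∑ γ ∈ multiIndices d m, ‖H γ y‖ₑ ^ q

lemma measurable_powSum (q : ℝ) (m : ℕ) (hH : ∀ γ ∈ multiIndices d m, Measurable (H γ)) :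
    Measurable (powSum q m H) :=
  Finset.measurable_sum _ fun γ hγ => ((hH γ hγ).enorm).pow_const q

lemma ennreal_rpow_sum_le {ι : Type*} (s : Finset ι) (f : ι → ℝ≥0∞) (hq : 1 ≤ q) :
    (∑ i ∈ s, f i) ^ q ≤ (s.card : ℝ≥0∞) ^ (q - 1) * ∑ i ∈ s, f i ^ q :=
  ENNReal.rpow_sum_le_const_mul_sum_rpow s f hq

lemma norm_le_arrayNorm (H : Jet d) (hγ : γ ∈ multiIndices d m) (y : Eucl d) :
    ‖H γ y‖ ≤ arrayNorm m H y := by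
  apply Real.le_sqrt_of_sq_le
  exact single_le_sum (f := fun γ => ‖H γ y‖ ^ 2) (fun _ _ => by positivity) hγ

lemma enorm_arrayNorm_le (m : ℕ) (H : Jet d) (y : Eucl d) :
    ‖arrayNorm m H y‖ₑ ≤ ∑ γ ∈ multiIndices d m, ‖H γ y‖ₑ := by
  have h1 : arrayNorm m H y ≤ ∑ γ ∈ multiIndices d m, ‖H γ y‖ := by
    refine Real.sqrt_le_iff.2 ⟨Finset.sum_nonneg fun _ _ => norm_nonneg _, ?_⟩
    exact Finset.sum_sq_le_sq_sum_of_nonneg fun _ _ => norm_nonneg _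
  rw [← ofReal_norm, norm_of_nonneg (show 0 ≤ arrayNorm m H y from Real.sqrt_nonneg _)]
  refine (ofReal_le_ofReal h1).trans (le_of_eq ?_)
  rw [ENNReal.ofReal_sum_of_nonneg fun _ _ => norm_nonneg _]
  simp_rw [ofReal_norm]

lemma enorm_le_enorm_arrayNorm (H : Jet d) (hγ : γ ∈ multiIndices d m) (y : Eucl d) :
    ‖H γ y‖ₑ ≤ ‖arrayNorm m H y‖ₑ := by
  rw [← ofReal_norm, ← ofReal_norm, norm_of_nonneg (show 0 ≤ arrayNorm m H y from Real.sqrt_nonneg _)]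
  exact ofReal_le_ofReal (norm_le_arrayNorm H hγ y)

lemma exists_enorm_arrayNorm_rpow_le (d m : ℕ) (hq : 1 ≤ q) :
    ∃ C : ℝ≥0, ∀ (H : Jet d) y, ‖arrayNorm m H y‖ₑ ^ q ≤ C * powSum q m H y := by
  refine ⟨((multiIndices d m).card : ℝ≥0) ^ (q - 1), fun H y => ?_⟩
  rw [coe_rpow_of_nonneg _ (by linarith), ENNReal.coe_natCast]
  exact (rpow_le_rpow (enorm_arrayNorm_le m H y) (by linarith)).trans (ennreal_rpow_sum_le _ _ hq)

lemma exists_powSum_le (d m : ℕ) (hq : 0 ≤ q) :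
    ∃ C : ℝ≥0, ∀ (H : Jet d) y, powSum q m H y ≤ C * ‖arrayNorm m H y‖ₑ ^ q := by
  refine ⟨(multiIndices d m).card, fun H y => ?_⟩
  rw [ENNReal.coe_natCast, ← nsmul_eq_mul]
  exact Finset.sum_le_card_nsmul _ _ _ fun γ hγ =>
    rpow_le_rpow (enorm_le_enorm_arrayNorm H hγ y) hq

lemma bavg_congr_ae {G : Eucl d → ℝ≥0∞} (hr : 0 < r) (h : F =ᵐ[volume.restrict (ball w r)] G) :
    bavg F w r = bavg G w r := by
  rw [bavg_eq F w hr, bavg_eq G w hr, lintegral_congr_ae h]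

lemma restrict_ball_le (hΩ : IsOpen Ω) (hx : x ∈ Ω) :
    (volume : Measure (Eucl d)).restrict (ball x (bdist Ω x / 2)) ≤ volume.restrict Ω :=
  Measure.restrict_mono ((ball_subset_ball (by linarith [bdist_nonneg Ω x])).trans
    (ball_subset_of_mem hΩ hx)) le_rfl

lemma wavg_congr_ae (hΩ : IsOpen Ω) (hne : (frontier Ω).Nonempty) {G : Eucl d → ℝ≥0∞} (hx : x ∈ Ω)
    (h : F =ᵐ[volume.restrict Ω] G) : wavg Ω F x = wavg Ω G x :=
  bavg_congr_ae (by linarith [bdist_pos hΩ hne hx]) (ae_mono (restrict_ball_le hΩ hx) h)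

lemma ae_eq_forall_multiIndices {H' : Jet d} {μ : Measure (Eucl d)}
    (h : ∀ γ ∈ multiIndices d m, H γ =ᵐ[μ] H' γ) :
    ∀ᵐ y ∂μ, ∀ γ ∈ multiIndices d m, H γ y = H' γ y := by
  rw [eventually_all_finset]; exact h

lemma powSum_congr_ae (q : ℝ) {H' : Jet d} {μ : Measure (Eucl d)}
    (h : ∀ γ ∈ multiIndices d m, H γ =ᵐ[μ] H' γ) : powSum q m H =ᵐ[μ] powSum q m H' := by
  filter_upwards [ae_eq_forall_multiIndices h] with y hy
  exact sum_congr rfl fun γ hγ => by rw [hy γ hγ]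

lemma whitneyAverage_congr_ae (hΩ : IsOpen Ω) (q : ℝ≥0∞) {H' : Jet d}
    (h : ∀ γ ∈ multiIndices d m, H γ =ᵐ[volume.restrict Ω] H' γ) (hx : x ∈ Ω) :
    whitneyAverage m q Ω H x = whitneyAverage m q Ω H' x := by
  refine eLpNorm_congr_ae ?_
  rw [Filter.EventuallyEq]
  refine Measure.ae_smul_measure (ae_mono (restrict_ball_le hΩ hx) ?_) _
  filter_upwards [ae_eq_forall_multiIndices h] with y hy
  unfold arrayNorm
  congr 1
  exact sum_congr rfl fun γ hγ => by rw [hy γ hγ]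

lemma lintegral_cond_ball (f : Eucl d → ℝ≥0∞) (x : Eucl d) (hr : 0 < r) :
    ∫⁻ y, f y ∂(ProbabilityTheory.cond volume (ball x r)) =
      (volume (ball (0 : Eucl d) 1))⁻¹ * bavg f x r := by
  have hv0 : volume (ball (0 : Eucl d) 1) ≠ 0 := (measure_ball_pos _ _ one_pos).ne'
  have hr0 : ofReal (r ^ d) ≠ 0 := by simp only [ne_eq, ofReal_eq_zero, not_le]; positivity
  rw [ProbabilityTheory.cond, lintegral_smul_measure, lintegral_ball_eq f x hr,
    volume_ball_eq x hr, smul_eq_mul, ENNReal.mul_inv (Or.inl hr0) (Or.inl ofReal_ne_top)]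
  calc _ = (volume (ball (0 : Eucl d) 1))⁻¹ * bavg f x r *
      ((ofReal (r ^ d))⁻¹ * ofReal (r ^ d)) := by ring
    _ = _ := by rw [ENNReal.inv_mul_cancel hr0 ofReal_ne_top, mul_one]

lemma whitneyAverage_eq (m : ℕ) {q : ℝ≥0∞} (hq0 : q ≠ 0) (hqt : q ≠ ∞) (H : Jet d)
    (hx : 0 < bdist Ω x) :
    whitneyAverage m q Ω H x = ((volume (ball (0 : Eucl d) 1))⁻¹ *
      wavg Ω (fun y => ‖arrayNorm m H y‖ₑ ^ q.toReal) x) ^ (1 / q.toReal) := by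
  rw [whitneyAverage, eLpNorm_eq_lintegral_rpow_enorm_toReal hq0 hqt,
    lintegral_cond_ball _ _ (by positivity), wavg]

lemma one_le_toReal {q : ℝ≥0∞} (hq1 : 1 ≤ q) (hqt : q ≠ ∞) : 1 ≤ q.toReal :=
  toReal_one ▸ ENNReal.toReal_mono hqt hq1

lemma exists_whitneyAverage_le (d m : ℕ) {q : ℝ≥0∞} (hq1 : 1 ≤ q) (hqt : q ≠ ∞) : ∃ C : ℝ≥0,
    ∀ (Ω : Set (Eucl d)) (H : Jet d) (x : Eucl d), 0 < bdist Ω x →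
      whitneyAverage m q Ω H x ≤ C * wavg Ω (powSum q.toReal m H) x ^ (1 / q.toReal) := by
  have hq0 : q ≠ 0 := (zero_lt_one.trans_le hq1).ne'
  have hqr := one_le_toReal hq1 hqt
  obtain ⟨C, hC⟩ := exists_enorm_arrayNorm_rpow_le d m hqr
  have hv0 : volume (ball (0 : Eucl d) 1) ≠ 0 := (measure_ball_pos _ _ one_pos).ne'
  set A : ℝ≥0∞ := ((volume (ball (0 : Eucl d) 1))⁻¹ * C) ^ (1 / q.toReal) with hA
  have hAt : A ≠ ∞ := rpow_ne_top_of_nonneg (by positivity) (mul_ne_top (by simp [hv0]) coe_ne_top)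
  refine ⟨A.toNNReal, fun Ω H x hx => ?_⟩
  rw [whitneyAverage_eq m hq0 hqt H hx, coe_toNNReal hAt, hA,
    ← mul_rpow_of_nonneg _ _ (by positivity), mul_assoc]
  gcongr
  rw [wavg, wavg, ← bavg_const_mul coe_ne_top]
  exact bavg_mono (by positivity) fun y _ => hC H y

lemma exists_wavg_powSum_le (d m : ℕ) {q : ℝ≥0∞} (hq1 : 1 ≤ q) (hqt : q ≠ ∞) : ∃ C : ℝ≥0,
    ∀ (Ω : Set (Eucl d)) (H : Jet d) (x : Eucl d), 0 < bdist Ω x →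
      wavg Ω (powSum q.toReal m H) x ≤ C * whitneyAverage m q Ω H x ^ q.toReal := by
  have hq0 : q ≠ 0 := (zero_lt_one.trans_le hq1).ne'
  have hqr : 0 < q.toReal := toReal_pos hq0 hqt
  obtain ⟨C, hC⟩ := exists_powSum_le d m hqr.le
  have hv0 : volume (ball (0 : Eucl d) 1) ≠ 0 := (measure_ball_pos _ _ one_pos).ne'
  have hvt : volume (ball (0 : Eucl d) 1) ≠ ∞ := measure_ball_lt_top.ne
  refine ⟨C * (volume (ball (0 : Eucl d) 1)).toNNReal, fun Ω H x hx => ?_⟩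
  rw [whitneyAverage_eq m hq0 hqt H hx, coe_mul, coe_toNNReal hvt,
    ← rpow_mul, one_div_mul_cancel hqr.ne', rpow_one, mul_assoc,
    ← mul_assoc (volume _), ENNReal.mul_inv_cancel hv0 hvt, one_mul]
  rw [wavg, wavg, ← bavg_const_mul coe_ne_top]
  exact bavg_mono (by positivity) fun y _ => hC H y

lemma MemAv.avFinite (hΩ : IsOpen Ω) (hne : (frontier Ω).Nonempty) (hp : 0 < p) {q : ℝ≥0∞}
    (hq1 : 1 ≤ q) (hqt : q ≠ ∞) {H' : Jet d} (hH : MemAv m p θ q Ω H)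
    (h : ∀ γ ∈ multiIndices d m, H γ =ᵐ[volume.restrict Ω] H' γ) :
    AvFinite Ω p θ q.toReal (powSum q.toReal m H') := by
  have hq0 : q ≠ 0 := (zero_lt_one.trans_le hq1).ne'
  have hqr : 0 < q.toReal := toReal_pos hq0 hqt
  obtain ⟨C, hC⟩ := exists_wavg_powSum_le d m hq1 hqt
  have hC' : ∀ x ∈ Ω, wavg Ω (powSum q.toReal m H') x ≤ C * whitneyAverage m q Ω H x ^ q.toReal := by
    intro x hx
    rw [← wavg_congr_ae hΩ hne hx (powSum_congr_ae _ h)]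
    exact hC Ω H x (bdist_pos hΩ hne hx)
  refine ⟨fun hpt => ?_, fun hpt => ?_⟩
  · have hpr : 0 < p.toReal := toReal_pos hp.ne' hpt.ne
    have h1 := hH.2
    rw [avNorm, if_neg hpt.ne, ENNReal.rpow_lt_top_iff_of_pos (by positivity)] at h1
    have hCt : (C : ℝ≥0∞) ^ (p.toReal / q.toReal) ≠ ∞ :=
      rpow_ne_top_of_nonneg (by positivity) coe_ne_top
    refine lt_of_le_of_lt ?_ (mul_lt_top hCt.lt_top h1)
    rw [← lintegral_const_mul' _ _ hCt]
    refine setLIntegral_mono' hΩ.measurableSet fun x hx => ?_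
    rw [dw, ← mul_assoc]
    gcongr
    refine (rpow_le_rpow (hC' x hx) (by positivity)).trans (le_of_eq ?_)
    rw [mul_rpow_of_nonneg _ _ (by positivity), ← rpow_mul, mul_div_cancel₀ _ hqr.ne']
  · have h1 := hH.2
    rw [avNorm, if_pos hpt] at h1
    set E := essSup (fun x => whitneyAverage m q Ω H x *
      ofReal (infDist x (frontier Ω) ^ (1 - θ))) (volume.restrict Ω)
    have hEt : C * E ^ q.toReal ≠ ∞ := mul_ne_top coe_ne_top (rpow_ne_top_of_nonneg hqr.le h1.ne)
    refine ⟨(C * E ^ q.toReal).toNNReal, ?_⟩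
    filter_upwards [ae_le_essSup (f := fun x => whitneyAverage m q Ω H x *
      ofReal (infDist x (frontier Ω) ^ (1 - θ))), ae_restrict_mem hΩ.measurableSet]
      with x hx hxΩ
    have hx0 := bdist_pos hΩ hne hxΩ
    rw [coe_toNNReal hEt]
    refine (hC' x hxΩ).trans ?_
    rw [mul_assoc]
    gcongr
    have h2 : whitneyAverage m q Ω H x ≤ E * dw Ω (θ - 1) x := by
      calc whitneyAverage m q Ω H x = whitneyAverage m q Ω H x *
            (dw Ω (1 - θ) x * dw Ω (θ - 1) x) := by
            rw [dw_mul hx0, show 1 - θ + (θ - 1) = 0 by ring, dw_zero, mul_one]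
        _ ≤ _ := by rw [← mul_assoc]; gcongr; exact hx
    refine (rpow_le_rpow h2 hqr.le).trans (le_of_eq ?_)
    rw [mul_rpow_of_nonneg _ _ hqr.le, dw_rpow hx0, mul_comm q.toReal]

lemma exists_wavg_le_coneSup (d : ℕ) : ∃ C : ℝ≥0, ∀ (Ω : Set (Eucl d)), IsOpen Ω →
    (frontier Ω).Nonempty → ∀ F : Eucl d → ℝ≥0∞, Measurable F → ∀ x ∈ Ω,
    wavg Ω F x ≤ C * coneSup Ω F 32 x := by
  refine ⟨(ofReal ((3 / 2) ^ d)).toNNReal, fun Ω hΩ hne F hF x hx => ?_⟩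
  rw [coe_toNNReal ofReal_ne_top]
  have hx0 := bdist_pos hΩ hne hx
  have := bavg_le_of_forall_le hF (x := x) (R := bdist Ω x / 2) (ρ := bdist Ω x / 16)
    (A := coneSup Ω F 32 x) (by positivity) (by positivity) fun y hy => ?_
  · refine this.trans ?_
    gcongr ?_ * _
    refine ofReal_le_ofReal (pow_le_pow_left₀ (by positivity) ?_ _)
    rw [div_le_iff₀ (by positivity)]; linarith
  · rw [mem_ball] at hy
    have e1 := bdist_le_add' Ω x y
    have e2 := bdist_le_add Ω y x
    refine Adm.le_coneSup (B := (y, bdist Ω x / 16)) ?_ F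
    refine ⟨mem_of_dist_lt hΩ hx (by linarith), by positivity, ?_, ?_, ?_⟩ <;>
    · simp only; linarith

/-! ### Measurable representatives of the weak derivatives -/

/-- `D` consists of measurable representatives of the weak derivatives of `u` of order up
to `m`. -/
def IsJet (Ω : Set (Eucl d)) (m : ℕ) (u : Eucl d → ℂ) (D : Jet d) : Prop :=
  (∀ γ, Measurable (D γ)) ∧ ∀ γ : Fin d → ℕ, ∑ i, γ i ≤ m → HasWeakDeriv Ω γ u (D γ)

lemma locallyIntegrableOn_congr_ae {g : Eucl d → ℂ} (hf : LocallyIntegrableOn f Ω)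
    (h : f =ᵐ[volume.restrict Ω] g) : LocallyIntegrableOn g Ω := by
  intro x hx
  obtain ⟨U, hU, hfU⟩ := hf x hx
  refine ⟨U ∩ Ω, inter_mem hU self_mem_nhdsWithin, ?_⟩
  exact (hfU.mono_set Set.inter_subset_left).congr
    (ae_mono (Measure.restrict_mono Set.inter_subset_right le_rfl) h)

lemma HasWeakDeriv.congr_ae {g h : Eucl d → ℂ} (hg : HasWeakDeriv Ω γ u g)
    (hgh : g =ᵐ[volume.restrict Ω] h) : HasWeakDeriv Ω γ u h := by
  refine ⟨locallyIntegrableOn_congr_ae hg.1 hgh, fun φ hφ => ?_⟩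
  rw [hg.2 φ hφ]
  congr 1
  refine integral_congr_ae ?_
  filter_upwards [hgh] with x hx
  rw [hx]

lemma exists_measurable_ae_eq (hf : LocallyIntegrableOn f Ω) :
    ∃ g : Eucl d → ℂ, Measurable g ∧ f =ᵐ[volume.restrict Ω] g :=
  ⟨_, hf.aestronglyMeasurable.stronglyMeasurable_mk.measurable, hf.aestronglyMeasurable.ae_eq_mk⟩

lemma exists_isJet (h : ∀ γ : Fin d → ℕ, ∑ i, γ i ≤ m → ∃ g, HasWeakDeriv Ω γ u g) :
    ∃ D, IsJet Ω m u D := by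
  classical
  have : ∀ γ : Fin d → ℕ, ∃ g : Eucl d → ℂ, Measurable g ∧
      (∑ i, γ i ≤ m → HasWeakDeriv Ω γ u g) := by
    intro γ
    by_cases hγ : ∑ i, γ i ≤ m
    · obtain ⟨g, hg⟩ := h γ hγ
      obtain ⟨g', h1, h2⟩ := exists_measurable_ae_eq hg.1
      exact ⟨g', h1, fun _ => hg.congr_ae h2⟩
    · exact ⟨0, measurable_const, fun h => absurd h hγ⟩
  choose D hD1 hD2 using this
  exact ⟨D, hD1, hD2⟩

lemma IsJet.weakDeriv_ae_eq (hΩ : IsOpen Ω) (hD : IsJet Ω m u D) (hγ : ∑ i, γ i ≤ m) :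
    weakDeriv Ω γ u =ᵐ[volume.restrict Ω] D γ :=
  (hD.2 γ hγ).weakDeriv_ae_eq hΩ

lemma MemSobolev.avFinite (hΩ : IsOpen Ω) (hne : (frontier Ω).Nonempty) (hp0 : 0 < p) {q : ℝ≥0∞}
    (hq1 : 1 ≤ q) (hqt : q ≠ ∞) (hu : MemSobolev m p θ q Ω u) (hD : IsJet Ω m u D) :
    AvFinite Ω p θ q.toReal (powSum q.toReal m D) :=
  hu.2.2.avFinite hΩ hne hp0 hq1 hqt fun _ hγ =>
    hD.weakDeriv_ae_eq hΩ (mem_multiIndices.1 hγ).le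

lemma IsJet.measurable_jet (hD : IsJet Ω m u D) (q : ℝ) : Measurable (powSum q m D) :=
  measurable_powSum _ _ fun γ _ => hD.1 γ

lemma gradArray_smooth_ae_eq (hΩ : IsOpen Ω) {φ : Eucl d → ℂ} (hφ : Smooth φ) (γ : Fin d → ℕ) :
    gradArray Ω φ γ =ᵐ[volume.restrict Ω] mixedDeriv γ φ :=
  (hasWeakDeriv_of_smooth hφ γ).weakDeriv_ae_eq hΩ

lemma gradArray_sub_ae_eq (hΩ : IsOpen Ω) {φ : Eucl d → ℂ} (hu : LocallyIntegrableOn u Ω)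
    (hD : IsJet Ω m u D) (hφ : Smooth φ) (hγ : ∑ i, γ i ≤ m) :
    gradArray Ω (u - φ) γ =ᵐ[volume.restrict Ω] fun y => D γ y - mixedDeriv γ φ y :=
  (HasWeakDeriv.sub hu (hφ.continuous.locallyIntegrable.locallyIntegrableOn _) (hD.2 γ hγ)
    (hasWeakDeriv_of_smooth hφ γ)).weakDeriv_ae_eq hΩ

/-! ### Duality -/

lemma measurable_arrayNorm (hH : ∀ γ ∈ multiIndices d m, Measurable (H γ)) :
    Measurable (arrayNorm m H) :=
  (Finset.measurable_sum _ fun γ hγ => ((hH γ hγ).norm).pow_const 2).sqrt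

lemma measurable_eLpNorm_top_wavg (hΩ : IsOpen Ω) (hne : (frontier Ω).Nonempty) {f : Eucl d → ℝ}
    (hf : Measurable f) :
    AEMeasurable (fun x => eLpNorm f ∞ (ProbabilityTheory.cond volume (ball x (bdist Ω x / 2))))
      (volume.restrict Ω) := by
  refine (aemeasurable_restrict_iff_comap_subtype hΩ.measurableSet).2 ?_
  refine Measurable.aemeasurable (measurable_of_Ioi fun c => ?_)
  have hm : MeasurableSet {y | c < ‖f y‖ₑ} := measurableSet_lt measurable_const hf.enorm
  have h1 : Measurable (wavg Ω ({y | c < ‖f y‖ₑ}.indicator fun _ => 1)) :=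
    measurable_wavg Ω (measurable_const.indicator hm)
  have h2 : MeasurableSet {x | 0 < wavg Ω ({y | c < ‖f y‖ₑ}.indicator fun _ => 1) x} :=
    measurableSet_lt measurable_const h1
  convert! measurable_subtype_coe h2 using 1
  ext ⟨x, hx⟩
  have hx0 := bdist_pos hΩ hne hx
  set μ := ProbabilityTheory.cond volume (ball x (bdist Ω x / 2)) with hμ
  have h3 : wavg Ω ({y | c < ‖f y‖ₑ}.indicator fun _ => 1) x =
      volume (ball (0 : Eucl d) 1) * μ {y | c < ‖f y‖ₑ} := by
    have := lintegral_cond_ball ({y | c < ‖f y‖ₑ}.indicator fun _ => 1) x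
      (r := bdist Ω x / 2) (by positivity)
    rw [lintegral_indicator hm, lintegral_const, one_mul, Measure.restrict_apply_univ] at this
    rw [hμ, this, wavg, ← mul_assoc, ENNReal.mul_inv_cancel (measure_ball_pos _ _ one_pos).ne'
      measure_ball_lt_top.ne, one_mul]
  simp only [Function.comp, Set.mem_preimage, Set.mem_Ioi, Set.mem_ofPred_eq, h3,
    eLpNorm_exponent_top]
  have h4 : eLpNormEssSup f μ ≤ c ↔ ∀ᵐ y ∂μ, ‖f y‖ₑ ≤ c :=
    ⟨fun h => (ae_le_essSup (f := fun y => ‖f y‖ₑ)).mono fun y hy => hy.trans h,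
      fun h => essSup_le_of_ae_le c h⟩
  rw [← not_le, h4, pos_iff_ne_zero, mul_ne_zero_iff, ae_iff]
  simp [(measure_ball_pos volume (0 : Eucl d) one_pos).ne']

lemma aemeasurable_whitneyAverage (hΩ : IsOpen Ω) (hne : (frontier Ω).Nonempty) {q : ℝ≥0∞}
    (hq0 : q ≠ 0) (hH : ∀ γ ∈ multiIndices d m, LocallyIntegrableOn (H γ) Ω) :
    AEMeasurable (whitneyAverage m q Ω H) (volume.restrict Ω) := by
  classical
  have : ∀ γ, ∃ g : Eucl d → ℂ, Measurable g ∧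
      (γ ∈ multiIndices d m → H γ =ᵐ[volume.restrict Ω] g) := by
    intro γ
    by_cases hγ : γ ∈ multiIndices d m
    · obtain ⟨g, h1, h2⟩ := exists_measurable_ae_eq (hH γ hγ)
      exact ⟨g, h1, fun _ => h2⟩
    · exact ⟨0, measurable_const, fun h => absurd h hγ⟩
  choose H' hm h using this
  have e1 : whitneyAverage m q Ω H' =ᵐ[volume.restrict Ω] whitneyAverage m q Ω H := by
    filter_upwards [ae_restrict_mem hΩ.measurableSet] with x hx
    exact (whitneyAverage_congr_ae hΩ q h hx).symm
  refine AEMeasurable.congr ?_ e1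
  have ham : Measurable (arrayNorm m H') := measurable_arrayNorm fun γ _ => hm γ
  by_cases hqt : q = ∞
  · rw [hqt]; exact measurable_eLpNorm_top_wavg hΩ hne ham
  · have e2 : (fun x => ((volume (ball (0 : Eucl d) 1))⁻¹ *
        wavg Ω (fun y => ‖arrayNorm m H' y‖ₑ ^ q.toReal) x) ^ (1 / q.toReal))
        =ᵐ[volume.restrict Ω] whitneyAverage m q Ω H' := by
      filter_upwards [ae_restrict_mem hΩ.measurableSet] with x hx
      exact (whitneyAverage_eq m hq0 hqt H' (bdist_pos hΩ hne hx)).symm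
    refine AEMeasurable.congr (Measurable.aemeasurable ?_) e2
    exact ((measurable_wavg Ω (ham.enorm.pow_const _)).const_mul _).pow_const _

/-- The pairing is controlled by the product of the averages with conjugate exponents. -/
lemma exists_lintegral_mul_le (hΩ : IsOpen Ω) (hne : (frontier Ω).Nonempty) (m : ℕ)
    {q : ℝ≥0∞} (hq1 : 1 ≤ q) : ∃ C : ℝ≥0, ∀ G H : Jet d,
    (∀ γ ∈ multiIndices d m, LocallyIntegrableOn (G γ) Ω) →
    (∀ γ ∈ multiIndices d m, LocallyIntegrableOn (H γ) Ω) → ∀ γ ∈ multiIndices d m,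
    ∫⁻ y in Ω, ‖G γ y‖ₑ * ‖H γ y‖ₑ ≤ C * ∫⁻ x in Ω,
      whitneyAverage m (conjExponent q) Ω G x * whitneyAverage m q Ω H x := by
  obtain ⟨C, hC⟩ := exists_lintegral_le_lintegral_bavg d
  set v := volume (ball (0 : Eucl d) 1)
  have hvt : v ≠ ∞ := measure_ball_lt_top.ne
  have hv0 : v ≠ 0 := (measure_ball_pos _ _ one_pos).ne'
  have hAt : ofReal (4 ^ d) * v ≠ ∞ := by finiteness
  refine ⟨C * (ofReal (4 ^ d) * v).toNNReal, fun G H hG hH γ hγ => ?_⟩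
  obtain ⟨g, hgm, hg⟩ := exists_measurable_ae_eq (hG γ hγ)
  obtain ⟨h, hhm, hh⟩ := exists_measurable_ae_eq (hH γ hγ)
  have e1 : ∫⁻ y in Ω, ‖G γ y‖ₑ * ‖H γ y‖ₑ = ∫⁻ y in Ω, ‖g y‖ₑ * ‖h y‖ₑ := by
    refine lintegral_congr_ae ?_
    filter_upwards [hg, hh] with y h1 h2
    rw [h1, h2]
  rw [e1, coe_mul, coe_toNNReal hAt, mul_assoc, ← lintegral_const_mul' _ _ hAt]
  refine (hC Ω hΩ hne (fun y => ‖g y‖ₑ * ‖h y‖ₑ) (hgm.enorm.mul hhm.enorm) Ω Ω hΩ.measurableSet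
    hΩ.measurableSet le_rfl fun t ht => (ball_subset_ball
      (by linarith [bdist_nonneg Ω t])).trans (ball_subset_of_mem hΩ ht)).trans ?_
  refine mul_le_mul_right ?_ _
  refine setLIntegral_mono' hΩ.measurableSet fun x hx => ?_
  have hx0 := bdist_pos hΩ hne hx
  set μ := ProbabilityTheory.cond volume (ball x (bdist Ω x / 2))
  have hac : ∀ {Q : Eucl d → Prop}, (∀ᵐ y ∂volume.restrict Ω, Q y) → ∀ᵐ y ∂μ, Q y :=
    fun h => Measure.ae_smul_measure (ae_mono (restrict_ball_le hΩ hx) h) _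
  have hconj : ENNReal.HolderTriple (conjExponent q) q 1 :=
    (ENNReal.HolderConjugate.conjExponent hq1).symm
  have hold := eLpNorm_smul_le_mul_eLpNorm (μ := μ) (p := conjExponent q) (q := q) (r := 1)
    (f := h) (φ := g) hhm.aestronglyMeasurable hgm.aestronglyMeasurable
  have e2 : eLpNorm (g • h) 1 μ = v⁻¹ * bavg (fun y => ‖g y‖ₑ * ‖h y‖ₑ) x (bdist Ω x / 2) := by
    rw [eLpNorm_one_eq_lintegral_enorm, ← lintegral_cond_ball _ _ (by positivity)]
    refine lintegral_congr fun y => ?_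
    rw [Pi.smul_apply', smul_eq_mul, enorm_mul]
  have e3 : bavg (fun y => ‖g y‖ₑ * ‖h y‖ₑ) x (bdist Ω x / 8) ≤ ofReal (4 ^ d) *
      bavg (fun y => ‖g y‖ₑ * ‖h y‖ₑ) x (bdist Ω x / 2) :=
    bavg_le_mul_of_dist (by positivity) (by linarith) (by rw [dist_self]; linarith)
  have e4 : bavg (fun y => ‖g y‖ₑ * ‖h y‖ₑ) x (bdist Ω x / 2) = v * eLpNorm (g • h) 1 μ := by
    rw [e2, ← mul_assoc, ENNReal.mul_inv_cancel hv0 hvt, one_mul]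
  have e5 : eLpNorm g (conjExponent q) μ ≤ whitneyAverage m (conjExponent q) Ω G x := by
    refine eLpNorm_mono_ae ?_
    filter_upwards [hac hg] with y hy
    rw [← hy]
    exact (norm_le_arrayNorm G hγ y).trans (le_abs_self _)
  have e6 : eLpNorm h q μ ≤ whitneyAverage m q Ω H x := by
    refine eLpNorm_mono_ae ?_
    filter_upwards [hac hh] with y hy
    rw [← hy]
    exact (norm_le_arrayNorm H hγ y).trans (le_abs_self _)
  calc _ ≤ ofReal (4 ^ d) * (v * eLpNorm (g • h) 1 μ) := by rw [← e4]; exact e3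
    _ ≤ ofReal (4 ^ d) * (v * (whitneyAverage m (conjExponent q) Ω G x *
        whitneyAverage m q Ω H x)) := by gcongr; exact hold.trans (mul_le_mul' e5 e6)
    _ = _ := by ring

/-! ### A criterion for convergence -/

lemma powSum_sub_le (hq : 0 ≤ q) (m : ℕ) (H H' : Jet d) (y : Eucl d) :
    powSum q m (fun γ y => H γ y - H' γ y) y ≤ 2 ^ q * (powSum q m H y + powSum q m H' y) := by
  rw [powSum, powSum, powSum, ← Finset.sum_add_distrib, Finset.mul_sum]
  refine sum_le_sum fun γ _ => ?_
  exact (rpow_le_rpow (enorm_sub_le (a := H γ y) (b := H' γ y)) hq).trans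
    (add_rpow_le_two_rpow_mul _ _ hq)

lemma tendsto_zero_of_le {ι : Type*} {l : Filter ι} {f g : ι → ℝ≥0∞} (hg : Tendsto g l (𝓝 0))
    (h : ∀ i, f i ≤ g i) : Tendsto f l (𝓝 0) :=
  tendsto_of_tendsto_of_tendsto_of_le_of_le tendsto_const_nhds hg (fun _ => bot_le) h

lemma tendsto_const_mul_zero {ι : Type*} {l : Filter ι} {f : ι → ℝ≥0∞} (hf : Tendsto f l (𝓝 0))
    {c : ℝ≥0∞} (hc : c ≠ ∞) : Tendsto (fun i => c * f i) l (𝓝 0) := by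
  simpa using ENNReal.Tendsto.const_mul hf (Or.inr hc)

lemma tendsto_rpow_zero_of_pos {ι : Type*} {l : Filter ι} {f : ι → ℝ≥0∞}
    (hf : Tendsto f l (𝓝 0)) {s : ℝ} (hs : 0 < s) : Tendsto (fun i => f i ^ s) l (𝓝 0) := by
  have := (ENNReal.continuous_rpow_const (y := s)).tendsto 0
  rw [zero_rpow_of_pos hs] at this
  exact this.comp hf

lemma wavg_powSum_sub_le (hΩ : IsOpen Ω) (hne : (frontier Ω).Nonempty) (hq : 0 ≤ q) {H' : Jet d}
    (hH : ∀ γ, Measurable (H γ)) {A : ℝ≥0∞} (hx : x ∈ Ω) (h1 : wavg Ω (powSum q m H) x ≤ A)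
    (h2 : wavg Ω (powSum q m H') x ≤ A) :
    wavg Ω (powSum q m fun γ y => H γ y - H' γ y) x ≤ 2 ^ q * (A + A) := by
  have hx0 := bdist_pos hΩ hne hx
  calc _ ≤ bavg (fun y => 2 ^ q * (powSum q m H y + powSum q m H' y)) x (bdist Ω x / 2) :=
        bavg_mono (by positivity) fun y _ => powSum_sub_le hq m H H' y
    _ = 2 ^ q * (bavg (powSum q m H) x (bdist Ω x / 2) +
        bavg (powSum q m H') x (bdist Ω x / 2)) := by
        rw [bavg_const_mul (rpow_ne_top_of_nonneg hq (by norm_num)),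
          bavg_add (measurable_powSum q m fun γ _ => hH γ)]
    _ ≤ _ := by gcongr; exacts [h1, h2]

theorem tendsto_sobolevNorm_of_dominated (hΩ : IsOpen Ω) (hne : (frontier Ω).Nonempty)
    (hp0 : 0 < p) (hpt : p < ∞) {q : ℝ≥0∞} (hq1 : 1 ≤ q) (hqt : q ≠ ∞)
    (hu : LocallyIntegrableOn u Ω) (hD : IsJet Ω m u D) {φ : ℕ → Eucl d → ℂ}
    (hφ : ∀ n, Smooth (φ n)) {Gd : Eucl d → ℝ≥0∞} (hG : Dominating Ω p θ q.toReal Gd)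
    (hdom : ∀ n, ∀ x ∈ Ω, wavg Ω (powSum q.toReal m fun γ y => D γ y - mixedDeriv γ (φ n) y) x ≤
      Gd x) (hconv : ∀ x ∈ Ω, Tendsto (fun n => wavg Ω (powSum q.toReal m
      fun γ y => D γ y - mixedDeriv γ (φ n) y) x) atTop (𝓝 0)) :
    Tendsto (fun j => sobolevNorm m p θ q Ω (u - φ j)) atTop (𝓝 0) := by
  have hq0 : q ≠ 0 := (zero_lt_one.trans_le hq1).ne'
  have hqr : 0 < q.toReal := toReal_pos hq0 hqt
  have hpr : 0 < p.toReal := toReal_pos hp0.ne' hpt.ne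
  obtain ⟨C, hC⟩ := exists_whitneyAverage_le d m hq1 hqt
  set W : ℕ → Eucl d → ℝ≥0∞ := fun n => wavg Ω (powSum q.toReal m
    fun γ y => D γ y - mixedDeriv γ (φ n) y)
  have hWm : ∀ n, Measurable (W n) := fun n => measurable_wavg Ω (measurable_powSum _ _ fun γ _ =>
    (hD.1 γ).sub ((hφ n).mixedDeriv γ).continuous.measurable)
  obtain ⟨G', hG'm, hGG', hG'f, -⟩ := hG
  have hs : 0 < p.toReal / q.toReal := by positivity
  set w := dw Ω (p.toReal - 1 - p.toReal * θ) with hw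
  have hwm : Measurable w := measurable_dw _ _
  have hI : Tendsto (fun n => ∫⁻ x in Ω, W n x ^ (p.toReal / q.toReal) * w x) atTop (𝓝 0) := by
    have := tendsto_lintegral_of_dominated_convergence (μ := volume.restrict Ω)
      (F := fun n x => W n x ^ (p.toReal / q.toReal) * w x) (f := fun _ => 0)
      (fun x => G' x ^ (p.toReal / q.toReal) * w x)
      (fun n => ((hWm n).pow_const _).mul hwm) (fun n => ?_) (hG'f hpt).ne ?_
    · simpa using this
    · filter_upwards [ae_restrict_mem hΩ.measurableSet] with x hx
      gcongr
      exact (hdom n x hx).trans (hGG' x hx)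
    · filter_upwards [ae_restrict_mem hΩ.measurableSet] with x hx
      have h1 := tendsto_rpow_zero_of_pos (hconv x hx) hs
      have h2 := ENNReal.Tendsto.mul_const h1 (b := w x) (Or.inr (dw_ne_top _ _ _))
      simpa using h2
  have hCt : (C : ℝ≥0∞) ^ p.toReal ≠ ∞ := rpow_ne_top_of_nonneg hpr.le coe_ne_top
  have hI2 := tendsto_const_mul_zero hI (c := (C : ℝ≥0∞) ^ p.toReal) hCt
  have hI3 := tendsto_rpow_zero_of_pos hI2 (s := 1 / p.toReal) (by positivity)
  refine tendsto_zero_of_le hI3 fun n => ?_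
  simp only [sobolevNorm, avNorm, if_neg hpt.ne]
  gcongr
  rw [← lintegral_const_mul' _ _ hCt]
  refine setLIntegral_mono' hΩ.measurableSet fun x hx => ?_
  rw [← mul_assoc, hw, dw]
  gcongr
  rw [whitneyAverage_congr_ae hΩ q (fun γ hγ => gradArray_sub_ae_eq hΩ hu hD (hφ n)
    (mem_multiIndices.1 hγ).le) hx]
  refine (rpow_le_rpow (hC Ω _ x (bdist_pos hΩ hne hx)) hpr.le).trans (le_of_eq ?_)
  rw [mul_rpow_of_nonneg _ _ hpr.le, ← rpow_mul, one_div_mul_eq_div]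

theorem weaklyTendsto_of_dominated (hΩ : IsOpen Ω) (hne : (frontier Ω).Nonempty) {q : ℝ≥0∞}
    (hq1 : 1 ≤ q) (hqt : q ≠ ∞) (hD : IsJet Ω m u D) {φ : ℕ → Eucl d → ℂ} (hφ : ∀ n, Smooth (φ n))
    {Gd : Eucl d → ℝ≥0∞} (hG : Dominating Ω ∞ θ q.toReal Gd)
    (hdomu : ∀ x ∈ Ω, wavg Ω (powSum q.toReal m D) x ≤ Gd x)
    (hdom' : ∀ n, ∀ x ∈ Ω, wavg Ω (powSum q.toReal m fun γ => mixedDeriv γ (φ n)) x ≤ Gd x)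
    (hdom : ∀ n, ∀ x ∈ Ω, wavg Ω (powSum q.toReal m fun γ y => D γ y - mixedDeriv γ (φ n) y) x ≤
      Gd x) (hconv : ∀ x ∈ Ω, Tendsto (fun n => wavg Ω (powSum q.toReal m
      fun γ y => D γ y - mixedDeriv γ (φ n) y) x) atTop (𝓝 0)) : WeaklyTendsto m θ q Ω φ u := by
  intro G hGm
  have hq0 : q ≠ 0 := (zero_lt_one.trans_le hq1).ne'
  have hqr : 0 < q.toReal := toReal_pos hq0 hqt
  have hq'0 : conjExponent q ≠ 0 := by
    rw [conjExponent]
    exact (zero_lt_one.trans_le le_self_add).ne'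
  obtain ⟨C, hC⟩ := exists_whitneyAverage_le d m hq1 hqt
  obtain ⟨C₁, hC₁⟩ := exists_lintegral_mul_le hΩ hne m hq1
  set WG := whitneyAverage m (conjExponent q) Ω G
  have hWGm : AEMeasurable WG (volume.restrict Ω) := aemeasurable_whitneyAverage hΩ hne hq'0 hGm.1
  have hWGfin : ∫⁻ x in Ω, WG x * dw Ω (θ - 1) x < ∞ := by
    have := hGm.2
    simp only [avNorm, if_neg ENNReal.one_ne_top, toReal_one, div_one, rpow_one]
      at this
    have e : (1 : ℝ) - 1 - 1 * (1 - θ) = θ - 1 := by ring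
    rw [e] at this
    exact this
  obtain ⟨G', -, hGG', -, hG'⟩ := hG
  obtain ⟨C₂, hC₂⟩ := hG' rfl
  have hbd : ∀ (H : Jet d) (x), x ∈ Ω → wavg Ω (powSum q.toReal m H) x ≤ Gd x →
      whitneyAverage m q Ω H x ≤ C * (C₂ : ℝ≥0∞) ^ (1 / q.toReal) * dw Ω (θ - 1) x := by
    intro H x hx h
    have hx0 := bdist_pos hΩ hne hx
    refine (hC Ω H x hx0).trans ?_
    rw [mul_assoc]
    gcongr
    refine (rpow_le_rpow ((h.trans (hGG' x hx)).trans (hC₂ x hx)) (by positivity)).trans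
      (le_of_eq ?_)
    rw [mul_rpow_of_nonneg _ _ (by positivity), dw_rpow hx0]
    congr 2
    field_simp
  have hBt : C * (C₂ : ℝ≥0∞) ^ (1 / q.toReal) ≠ ∞ := mul_ne_top coe_ne_top
    (rpow_ne_top_of_nonneg (by positivity) coe_ne_top)
  set B := C * (C₂ : ℝ≥0∞) ^ (1 / q.toReal)
  have hbig : ∫⁻ x in Ω, WG x * (B * dw Ω (θ - 1) x) < ∞ := by
    have e : ∀ x, WG x * (B * dw Ω (θ - 1) x) = B * (WG x * dw Ω (θ - 1) x) := fun x => by ring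
    rw [lintegral_congr e, lintegral_const_mul' _ _ hBt]
    exact mul_lt_top hBt.lt_top hWGfin
  have hpi : ∀ H H' : Jet d, (∀ γ ∈ multiIndices d m, LocallyIntegrableOn (H γ) Ω) →
      (∀ γ ∈ multiIndices d m, H γ =ᵐ[volume.restrict Ω] H' γ) →
      (∀ x ∈ Ω, wavg Ω (powSum q.toReal m H') x ≤ Gd x) → PairingIntegrable m Ω G H := by
    intro H H' hH hHH' hd γ hγ
    refine ⟨(Complex.continuous_conj.comp_aestronglyMeasurable
      (hGm.1 γ hγ).aestronglyMeasurable).mul (hH γ hγ).aestronglyMeasurable, ?_⟩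
    rw [hasFiniteIntegral_iff_enorm]
    have e : ∀ x, ‖conj (G γ x) * H γ x‖ₑ = ‖G γ x‖ₑ * ‖H γ x‖ₑ := by
      intro x; rw [enorm_mul]; congr 1; rw [← ofReal_norm, ← ofReal_norm]; simp
    rw [lintegral_congr e]
    refine (hC₁ G H hGm.1 hH γ hγ).trans_lt (mul_lt_top coe_lt_top (lt_of_le_of_lt ?_ hbig))
    refine setLIntegral_mono' hΩ.measurableSet fun x hx => ?_
    rw [whitneyAverage_congr_ae hΩ q hHH' hx]
    gcongr
    exact hbd H' x hx (hd x hx)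
  have hlocu : ∀ γ ∈ multiIndices d m, LocallyIntegrableOn (gradArray Ω u γ) Ω := fun γ hγ =>
    (hasWeakDeriv_weakDeriv ⟨_, hD.2 γ (mem_multiIndices.1 hγ).le⟩).1
  have hlocφ : ∀ n, ∀ γ ∈ multiIndices d m, LocallyIntegrableOn (gradArray Ω (φ n) γ) Ω :=
    fun n γ hγ => (hasWeakDeriv_weakDeriv ⟨_, hasWeakDeriv_of_smooth (hφ n) γ⟩).1
  have hpu := hpi (gradArray Ω u) D hlocu
    (fun γ hγ => hD.weakDeriv_ae_eq hΩ (mem_multiIndices.1 hγ).le) hdomu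
  have hpφ : ∀ n, PairingIntegrable m Ω G (gradArray Ω (φ n)) := fun n =>
    hpi (gradArray Ω (φ n)) (fun γ => mixedDeriv γ (φ n)) (hlocφ n)
      (fun γ _ => gradArray_smooth_ae_eq hΩ (hφ n) γ) (hdom' n)
  refine ⟨hpu, hpφ, ?_⟩
  set H : ℕ → Jet d := fun n γ y => D γ y - mixedDeriv γ (φ n) y with hH
  have hlocH : ∀ n, ∀ γ ∈ multiIndices d m, LocallyIntegrableOn (H n γ) Ω := fun n γ hγ =>
    (hD.2 γ (mem_multiIndices.1 hγ).le).1.sub (hasWeakDeriv_of_smooth (hφ n) γ).1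
  have hI : Tendsto (fun n => ∫⁻ x in Ω, WG x * whitneyAverage m q Ω (H n) x) atTop (𝓝 0) := by
    have := tendsto_lintegral_of_dominated_convergence' (μ := volume.restrict Ω)
      (F := fun n x => WG x * whitneyAverage m q Ω (H n) x) (f := fun _ => 0)
      (fun x => WG x * (B * dw Ω (θ - 1) x))
      (fun n => hWGm.mul (aemeasurable_whitneyAverage hΩ hne hq0 (hlocH n))) (fun n => ?_)
      hbig.ne ?_
    · simpa using this
    · filter_upwards [ae_restrict_mem hΩ.measurableSet] with x hx
      gcongr
      exact hbd _ x hx (hdom n x hx)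
    · have hfin := ae_lt_top' (hWGm.mul (measurable_dw Ω (θ - 1)).aemeasurable) hWGfin.ne
      filter_upwards [ae_restrict_mem hΩ.measurableSet, hfin] with x hx hxf
      have hx0 := bdist_pos hΩ hne hx
      have hWt : WG x ≠ ∞ := by
        intro h
        rw [Pi.mul_apply, h, ENNReal.top_mul (dw_ne_zero hx0 _)] at hxf
        exact lt_irrefl _ hxf
      have h1 := tendsto_rpow_zero_of_pos (hconv x hx) (s := 1 / q.toReal) (by positivity)
      have h2 := tendsto_const_mul_zero h1 (c := (C : ℝ≥0∞)) coe_ne_top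
      have h3 : Tendsto (fun n => whitneyAverage m q Ω (H n) x) atTop (𝓝 0) :=
        tendsto_zero_of_le h2 fun n => hC Ω _ x hx0
      simpa using tendsto_const_mul_zero h3 hWt
  unfold pairing
  refine tendsto_finsetSum _ fun γ hγ => ?_
  have hI2 := tendsto_const_mul_zero hI (c := (C₁ : ℝ≥0∞)) coe_ne_top
  rw [tendsto_iff_edist_tendsto_0]
  refine tendsto_zero_of_le hI2 fun n => ?_
  rw [edist_comm, edist_eq_enorm_sub, ← integral_sub (hpu γ hγ) (hpφ n γ hγ)]
  refine (enorm_integral_le_lintegral_enorm _).trans ((le_of_eq (lintegral_congr_ae ?_)).trans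
    (hC₁ G (H n) hGm.1 (hlocH n) γ hγ))
  filter_upwards [hD.weakDeriv_ae_eq hΩ (mem_multiIndices.1 hγ).le,
    gradArray_smooth_ae_eq hΩ (hφ n) γ] with x h1 h2
  simp only [hH]
  rw [← mul_sub, enorm_mul, h2, show gradArray Ω u γ x = D γ x from h1]
  congr 1; rw [← ofReal_norm, ← ofReal_norm]; simp

/-- Domination and local convergence imply convergence. -/
theorem sobolevTendsto_of_dominated (hΩ : IsOpen Ω) (hne : (frontier Ω).Nonempty)
    (hlayer : HasLayerBounds Ω) (hp0 : 0 < p) (hθ : θ < 1) {q : ℝ≥0∞}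
    (hq1 : 1 ≤ q) (hqt : q ≠ ∞) (hu : MemSobolev m p θ q Ω u) (hD : IsJet Ω m u D)
    {φ : ℕ → Eucl d → ℂ} (hφ : ∀ n, Smooth (φ n)) {A : Eucl d → ℝ≥0∞}
    (hA : Dominating Ω p θ q.toReal A)
    (hdom : ∀ n, ∀ x ∈ Ω, wavg Ω (powSum q.toReal m fun γ => mixedDeriv γ (φ n)) x ≤ A x)
    (hconv : ∀ x ∈ Ω, Tendsto (fun n => wavg Ω (powSum q.toReal m
      fun γ y => D γ y - mixedDeriv γ (φ n) y) x) atTop (𝓝 0)) : SobolevTendsto m p θ q Ω φ u := by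
  have hq := one_le_toReal hq1 hqt
  have hqr : 0 < q.toReal := by linarith
  obtain ⟨C, hC⟩ := exists_wavg_le_coneSup d
  have hFm := hD.measurable_jet q.toReal
  set Gd : Eucl d → ℝ≥0∞ := fun x => A x + C * coneSup Ω (powSum q.toReal m D) 32 x
  have hG : Dominating Ω p θ q.toReal Gd := hA.add hqr ((dominating_coneSup hΩ hne hp0 hθ hq hlayer
    hFm (hu.avFinite hΩ hne hp0 hq1 hqt hD) 32).const_mul hqr C)
  have hdomu : ∀ x ∈ Ω, wavg Ω (powSum q.toReal m D) x ≤ Gd x := fun x hx =>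
    (hC Ω hΩ hne _ hFm x hx).trans le_add_self
  replace hdom := fun n x hx => (hdom n x hx).trans (le_self_add : _ ≤ Gd x)
  have h2 : (2 : ℝ≥0∞) ^ q.toReal = (((2 : ℝ≥0) ^ q.toReal : ℝ≥0) : ℝ≥0∞) := by
    rw [coe_rpow_of_nonneg _ hqr.le]; norm_num
  have hG' := (hG.add hqr ((hG.add hqr hG).const_mul hqr ((2 : ℝ≥0) ^ q.toReal)))
  have hdom2 : ∀ n, ∀ x ∈ Ω, wavg Ω (powSum q.toReal m fun γ y => D γ y - mixedDeriv γ (φ n) y) x ≤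
      Gd x + (((2 : ℝ≥0) ^ q.toReal : ℝ≥0) : ℝ≥0∞) * (Gd x + Gd x) := by
    intro n x hx
    refine (wavg_powSum_sub_le hΩ hne hqr.le hD.1 hx (hdomu x hx) (hdom n x hx)).trans ?_
    rw [h2]; exact le_add_self
  refine ⟨fun hpt => tendsto_sobolevNorm_of_dominated hΩ hne hp0 hpt hq1 hqt hu.1 hD hφ hG' hdom2
    hconv, fun hpt => ?_⟩
  subst hpt
  exact weaklyTendsto_of_dominated hΩ hne hq1 hqt hD hφ hG'
    (fun x hx => (hdomu x hx).trans le_self_add) (fun n x hx => (hdom n x hx).trans le_self_add)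
    hdom2 hconv

lemma exists_powSum_le_jetPow (d m : ℕ) (hq : 0 ≤ q) :
    ∃ C : ℝ≥0, ∀ (φ : Eucl d → ℂ),
    Smooth φ → ∀ y, powSum q m (fun γ => mixedDeriv γ φ) y ≤ C * jetPow q m φ y := by
  refine ⟨(multiIndices d m).card, fun φ hφ y => ?_⟩
  rw [ENNReal.coe_natCast, ← nsmul_eq_mul]
  refine Finset.sum_le_card_nsmul _ _ _ fun γ hγ => rpow_le_rpow ?_ hq
  rw [← ofReal_norm, ← ofReal_norm]
  exact ofReal_le_ofReal (norm_mixedDeriv_le hφ (mem_multiIndices.1 hγ) y)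

lemma exists_jetPow_le_powSum (d k : ℕ) (hq : 1 ≤ q) : ∃ C : ℝ≥0, ∀ (φ : Eucl d → ℂ),
    Smooth φ → ∀ y, jetPow q k φ y ≤ C * powSum q k (fun γ => mixedDeriv γ φ) y := by
  refine ⟨((d : ℝ≥0) ^ k) ^ q * ((multiIndices d k).card : ℝ≥0) ^ (q - 1), fun φ hφ y => ?_⟩
  have hq0 : 0 ≤ q := by linarith
  have h1 : ‖iteratedFDeriv ℝ k φ y‖ₑ ≤
      (d : ℝ≥0∞) ^ k * ∑ γ ∈ multiIndices d k, ‖mixedDeriv γ φ y‖ₑ := by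
    rw [← ofReal_norm]
    refine (ofReal_le_ofReal (norm_iteratedFDeriv_le_sum hφ k y)).trans (le_of_eq ?_)
    rw [ofReal_mul (by positivity), ENNReal.ofReal_pow (by positivity),
      ofReal_natCast, ENNReal.ofReal_sum_of_nonneg fun _ _ => norm_nonneg _]
    simp_rw [ofReal_norm]
  refine (rpow_le_rpow h1 hq0).trans ?_
  rw [mul_rpow_of_nonneg _ _ hq0, coe_mul, coe_rpow_of_nonneg _ hq0,
    coe_rpow_of_nonneg _ (by linarith), mul_assoc]
  push_cast
  gcongr
  exact ennreal_rpow_sum_le _ _ hq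

/-- The Whitney averages of a compactly supported function vanish away from a ball. -/
lemma exists_notMem_support_of_mem_whitney_ball (hne : (frontier Ω).Nonempty) (R : ℝ) :
    ∃ D : ℝ, ∀ x y : Eucl d, y ∈ ball x (bdist Ω x) → dist y x ≤ 3 / 4 * bdist Ω x → ‖y‖ ≤ R →
      x ∈ ball (0 : Eucl d) D := by
  obtain ⟨z, hz⟩ := hne
  refine ⟨4 * |R| + 3 * ‖z‖ + 1, fun x y _ hy hR => ?_⟩
  have h1 : bdist Ω x ≤ ‖x‖ + ‖z‖ :=
    (infDist_le_dist_of_mem hz).trans (by rw [dist_eq_norm]; exact norm_sub_le _ _)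
  have h2 : ‖x‖ ≤ dist y x + ‖y‖ := by
    have := norm_sub_le y (y - x)
    rw [sub_sub_cancel] at this
    rw [dist_eq_norm]; linarith
  rw [mem_ball_zero_iff]
  have := le_abs_self R
  linarith

theorem memSobolev_of_isSmoothCompact (hΩ : IsOpen Ω) (hne : (frontier Ω).Nonempty)
    (hΩne : Ω.Nonempty) (hp0 : 0 < p) (hpt : p < ∞) (hθ : θ < 1) {q : ℝ≥0∞} (hq1 : 1 ≤ q)
    (hqt : q ≠ ∞) (hC : HasLayerBounds Ω) {Φ : Eucl d → ℂ}
    (hΦ : IsSmoothCompact Φ) : MemSobolev m p θ q Ω Φ := by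
  have hq0 : q ≠ 0 := (zero_lt_one.trans_le hq1).ne'
  have hqr : 0 < q.toReal := toReal_pos hq0 hqt
  have hpr : 0 < p.toReal := toReal_pos hp0.ne' hpt.ne
  have hsm : Smooth Φ := hΦ.1
  refine ⟨hsm.continuous.locallyIntegrable.locallyIntegrableOn _,
    fun γ _ => ⟨_, hasWeakDeriv_of_smooth hsm γ⟩,
    fun γ _ => (hasWeakDeriv_weakDeriv ⟨_, hasWeakDeriv_of_smooth hsm γ⟩).1, ?_⟩
  obtain ⟨C, hCw⟩ := exists_whitneyAverage_le d m hq1 hqt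
  set P := powSum q.toReal m (fun γ => mixedDeriv γ Φ)
  have hcs : ∀ γ : Fin d → ℕ, HasCompactSupport (mixedDeriv γ Φ) := fun γ =>
    ((show IsSmoothCompactIn Set.univ Φ from ⟨hΦ, Set.subset_univ _⟩).mixedDeriv γ).1.2
  have hb : ∀ γ : Fin d → ℕ, ∃ B : ℝ≥0, ∀ y, ‖mixedDeriv γ Φ y‖ₑ ^ q.toReal ≤ B := by
    intro γ
    obtain ⟨B, hB⟩ := (hcs γ).exists_bound_of_continuous (hsm.mixedDeriv γ).continuous
    refine ⟨(ofReal B ^ q.toReal).toNNReal, fun y => ?_⟩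
    rw [coe_toNNReal (rpow_ne_top_of_nonneg hqr.le ofReal_ne_top), ← ofReal_norm]
    gcongr
    exact hB y
  choose B hB using hb
  obtain ⟨R, hR⟩ := hΦ.2.isBounded.subset_closedBall (0 : Eucl d)
  have hPR : ∀ y, ¬ ‖y‖ ≤ R → P y = 0 := by
    intro y hy
    refine Finset.sum_eq_zero fun γ _ => ?_
    have : mixedDeriv γ Φ y = 0 := by
      refine image_eq_zero_of_notMem_tsupport fun h => hy ?_
      have h2 := ((show IsSmoothCompactIn (tsupport Φ) Φ from ⟨hΦ, le_rfl⟩).mixedDeriv γ).2 h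
      simpa using hR h2
    simp only [this, enorm_zero, zero_rpow_of_pos hqr]
  have hPB : ∀ y, P y ≤ ((∑ γ ∈ multiIndices d m, B γ : ℝ≥0) : ℝ≥0∞) := by
    intro y
    rw [ENNReal.ofNNReal_finsetSum]
    exact sum_le_sum fun γ _ => hB γ y
  obtain ⟨D, hD⟩ := exists_notMem_support_of_mem_whitney_ball (Ω := Ω) hne R
  set v := volume (ball (0 : Eucl d) 1)
  have hvt : v ≠ ∞ := measure_ball_lt_top.ne
  have hdom := (dominating_indicator_ball hΩ hne hΩne hp0 hθ hqr hC D).const_mul hqr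
    ((∑ γ ∈ multiIndices d m, B γ) * v.toNNReal)
  obtain ⟨G', -, hG', hG'f, -⟩ := hdom
  have hwav : ∀ x ∈ Ω, wavg Ω P x ≤ G' x := by
    intro x hx
    have hx0 := bdist_pos hΩ hne hx
    refine le_trans ?_ (hG' x hx)
    simp only
    by_cases hxD : x ∈ ball (0 : Eucl d) D
    · rw [indicator_of_mem hxD, mul_one, coe_mul, coe_toNNReal hvt, wavg]
      refine (bavg_mono (by positivity) fun y _ => hPB y).trans (le_of_eq ?_)
      rw [bavg_const]
    · have : wavg Ω P x = 0 := by
        rw [wavg, bavg_congr (G := fun _ => 0) (by positivity) fun y hy => ?_, bavg_const, zero_mul]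
        refine hPR y fun h => hxD (hD x y (ball_subset_ball (by linarith) hy) ?_ h)
        rw [mem_ball] at hy
        linarith
      rw [this]; exact bot_le
  rw [avNorm, if_neg hpt.ne, ENNReal.rpow_lt_top_iff_of_pos (by positivity)]
  have hCt : (C : ℝ≥0∞) ^ p.toReal ≠ ∞ := rpow_ne_top_of_nonneg hpr.le coe_ne_top
  refine lt_of_le_of_lt ?_ (mul_lt_top hCt.lt_top (hG'f hpt))
  rw [← lintegral_const_mul' _ _ hCt]
  refine setLIntegral_mono' hΩ.measurableSet fun x hx => ?_
  rw [← mul_assoc, dw]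
  gcongr
  rw [whitneyAverage_congr_ae hΩ q (fun γ _ => gradArray_smooth_ae_eq hΩ hsm γ) hx]
  refine (rpow_le_rpow (hCw Ω _ x (bdist_pos hΩ hne hx)) hpr.le).trans ?_
  rw [mul_rpow_of_nonneg _ _ hpr.le, ← rpow_mul, one_div_mul_eq_div]
  gcongr
  exact hwav x hx

/-! ### Mollification -/

/-- A normalized bump function in the unit ball. -/
def unitBump (d : ℕ) : Eucl d → ℝ :=
  (⟨1 / 2, 1, by norm_num, by norm_num⟩ : ContDiffBump (0 : Eucl d)).normed volume

lemma unitBump_smooth (d : ℕ) : ContDiff ℝ ((⊤ : ℕ∞) : WithTop ℕ∞) (unitBump d) :=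
  ContDiffBump.contDiff_normed _

lemma unitBump_nonneg (z : Eucl d) : 0 ≤ unitBump d z := ContDiffBump.nonneg_normed _ z

lemma unitBump_eq_zero {z : Eucl d} (hz : 1 ≤ ‖z‖) : unitBump d z = 0 := by
  have := ContDiffBump.support_normed_eq
    (⟨1 / 2, 1, by norm_num, by norm_num⟩ : ContDiffBump (0 : Eucl d)) (μ := volume)
  by_contra h
  have h2 : z ∈ Function.support (unitBump d) := h
  rw [unitBump, this] at h2
  simp at h2
  linarith

lemma integral_unitBump (d : ℕ) : ∫ z, unitBump d z = 1 := ContDiffBump.integral_normed _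

lemma exists_unitBump_le (d : ℕ) : ∃ C : ℝ≥0, ∀ z, unitBump d z ≤ C :=
  ⟨⟨_, div_nonneg zero_le_one measureReal_nonneg⟩,
    fun z => ContDiffBump.normed_le_div_measure_closedBall_rIn _ _ z⟩

/-- A mollification kernel of scale `ε`, supported in `B(-εb, ε)`. -/
def kern (ε : ℝ) (b : Eucl d) (z : Eucl d) : ℂ := (((ε ^ d)⁻¹ * unitBump d (ε⁻¹ • z + b) : ℝ) : ℂ)

lemma kern_smooth (ε : ℝ) (b : Eucl d) : Smooth (kern ε b) := by
  have h : ContDiff ℝ ((⊤ : ℕ∞) : WithTop ℕ∞) fun z : Eucl d => ε⁻¹ • z + b := by fun_prop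
  exact Complex.ofRealCLM.contDiff.comp (contDiff_const.mul ((unitBump_smooth d).comp h))

lemma kern_eq_zero (hε : 0 < ε) {b z : Eucl d} (h : y ∉ ball (z + ε • b) ε) :
    kern ε b (z - y) = 0 := by
  have : unitBump d (ε⁻¹ • (z - y) + b) = 0 := by
    apply unitBump_eq_zero
    rw [mem_ball, not_lt, dist_eq_norm] at h
    have e : ε⁻¹ • (z - y) + b = ε⁻¹ • (z + ε • b - y) := by
      rw [smul_sub, smul_sub, smul_add, inv_smul_smul₀ hε.ne']; abel
    rw [e, norm_smul, norm_inv, norm_of_nonneg hε.le, norm_sub_rev, inv_mul_eq_div,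
      le_div_iff₀ hε]
    linarith
  rw [kern, this]; simp

lemma kern_hasCompactSupport (hε : 0 < ε) (b : Eucl d) : HasCompactSupport (kern ε b) := by
  refine HasCompactSupport.of_support_subset_isCompact (isCompact_closedBall (-(ε • b)) ε) ?_
  intro z hz
  by_contra h
  refine hz ?_
  have := kern_eq_zero (b := b) (z := z) (y := 0) hε (fun h2 => h ?_)
  · simpa using this
  · rw [mem_ball, dist_eq_norm] at h2
    rw [mem_closedBall, dist_eq_norm, sub_neg_eq_add]
    rw [zero_sub, norm_neg] at h2
    exact h2.le

lemma exists_enorm_kern_le (d : ℕ) : ∃ C : ℝ≥0, ∀ (ε : ℝ), 0 < ε → ∀ (b z : Eucl d),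
    ‖kern ε b z‖ₑ ≤ C * ofReal ((ε ^ d)⁻¹) := by
  obtain ⟨C, hC⟩ := exists_unitBump_le d
  refine ⟨C, fun ε hε b z => ?_⟩
  rw [← ofReal_norm, kern, Complex.norm_real, norm_of_nonneg
    (mul_nonneg (by positivity) (unitBump_nonneg _)), mul_comm, ofReal_mul
    (unitBump_nonneg _)]
  gcongr
  exact ENNReal.ofReal_le_of_le_toReal (by simpa using hC _)

lemma integral_kern (hε : 0 < ε) (b z : Eucl d) : ∫ y, kern ε b (z - y) = 1 := by
  rw [integral_sub_left_eq_self (kern ε b) volume z]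
  unfold kern
  rw [integral_complex_ofReal, integral_const_mul]
  have h1 : ∫ y, unitBump d (ε⁻¹ • y + b) = ε ^ d := by
    have := Measure.integral_comp_smul (volume : Measure (Eucl d)) (fun y => unitBump d (y + b)) ε⁻¹
    rw [this, integral_add_right_eq_self (unitBump d) b, integral_unitBump]
    simp [abs_of_pos hε]
  rw [h1, inv_mul_cancel₀ (by positivity)]
  simp

/-- Convolution with the kernel `kern ε b`. -/
def smoothing (ε : ℝ) (b : Eucl d) (f : Eucl d → ℂ) : Eucl d → ℂ :=
  convolution f (kern ε b) (ContinuousLinearMap.mul ℝ ℂ) volume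

lemma smoothing_apply (ε : ℝ) (b : Eucl d) (f : Eucl d → ℂ) (z : Eucl d) :
    smoothing ε b f z = ∫ y, f y * kern ε b (z - y) := rfl

lemma smoothing_smooth (hε : 0 < ε) (b : Eucl d) (hf : LocallyIntegrable f) :
    Smooth (smoothing ε b f) :=
  (kern_hasCompactSupport hε b).contDiff_convolution_right _ hf (kern_smooth ε b)

lemma partialDeriv_convolution {k : Eucl d → ℂ} (hf : LocallyIntegrable f) (hk : Smooth k)
    (hc : HasCompactSupport k) (i : Fin d) :
    partialDeriv i (convolution f k (ContinuousLinearMap.mul ℝ ℂ) volume) =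
      convolution f (partialDeriv i k) (ContinuousLinearMap.mul ℝ ℂ) volume := by
  have hk1 : ContDiff ℝ 1 k := hk.of_le (by exact_mod_cast le_top)
  funext z
  rw [partialDeriv, (hc.hasFDerivAt_convolution_right (ContinuousLinearMap.mul ℝ ℂ) hf hk1 z).fderiv,
    convolution_precompR_apply _ hf (hc.fderiv ℝ) (hk1.continuous_fderiv one_ne_zero)]
  rfl

lemma mixedDeriv_convolution {k : Eucl d → ℂ} (hf : LocallyIntegrable f) (hk : Smooth k)
    (hc : HasCompactSupport k) (γ : Fin d → ℕ) :
    mixedDeriv γ (convolution f k (ContinuousLinearMap.mul ℝ ℂ) volume) =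
      convolution f (mixedDeriv γ k) (ContinuousLinearMap.mul ℝ ℂ) volume := by
  have hs : Smooth (convolution f k (ContinuousLinearMap.mul ℝ ℂ) volume) :=
    hc.contDiff_convolution_right _ hf hk
  induction γ using multiIndex_induction with
  | h0 => rw [mixedDeriv_zero, mixedDeriv_zero]
  | h1 γ i ih =>
    rw [mixedDeriv_add_single hs, ih, mixedDeriv_add_single hk, partialDeriv_convolution hf
      (hk.mixedDeriv γ)]
    exact ((show IsSmoothCompactIn Set.univ k from ⟨⟨hk, hc⟩, Set.subset_univ _⟩).mixedDeriv γ).1.2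

lemma smooth_comp_sub_left (hf : Smooth f) (z : Eucl d) : Smooth fun y => f (z - y) := hf.comp (contDiff_const.sub contDiff_id)

lemma partialDeriv_comp_sub_left (hf : Smooth f) (z : Eucl d) (i : Fin d) :
    partialDeriv i (fun y => f (z - y)) = fun y => -partialDeriv i f (z - y) := by
  funext y
  have h1 : HasFDerivAt (fun y : Eucl d => z - y) (-ContinuousLinearMap.id ℝ (Eucl d)) y :=
    (hasFDerivAt_id y).const_sub z
  have h2 := ((hf.differentiable (by simp)).differentiableAt (x := z - y)).hasFDerivAt.comp y h1
  rw [partialDeriv, show (fun y => f (z - y)) = f ∘ fun y => z - y from rfl, h2.fderiv]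
  simp [partialDeriv]

lemma partialDeriv_const_mul (hf : Smooth f) (c : ℂ) (i : Fin d) :
    partialDeriv i (fun y => c * f y) = fun y => c * partialDeriv i f y := by
  funext y
  have h := ((hf.differentiable (by simp)).differentiableAt (x := y)).hasFDerivAt.const_mul c
  rw [partialDeriv, h.fderiv]
  simp [partialDeriv]

lemma mixedDeriv_comp_sub_left (hf : Smooth f) (z : Eucl d) (γ : Fin d → ℕ) :
    mixedDeriv γ (fun y => f (z - y)) = fun y => (-1) ^ (∑ i, γ i) * mixedDeriv γ f (z - y) := by
  induction γ using multiIndex_induction with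
  | h0 => simp [mixedDeriv_zero]
  | h1 γ i ih =>
    rw [mixedDeriv_add_single (smooth_comp_sub_left hf z), ih,
      partialDeriv_const_mul (smooth_comp_sub_left (hf.mixedDeriv γ) z),
      partialDeriv_comp_sub_left (hf.mixedDeriv γ), mixedDeriv_add_single hf, sum_add_single]
    funext y
    ring

/-- The restriction of `u` to the points of `Ω` at distance at least `ε` from the boundary. -/
def innerPart (Ω : Set (Eucl d)) (ε : ℝ) (u : Eucl d → ℂ) : Eucl d → ℂ :=
  {y | y ∈ Ω ∧ ε ≤ bdist Ω y}.indicator u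

lemma isClosed_inner (hε : 0 < ε) : IsClosed {y | y ∈ Ω ∧ ε ≤ bdist Ω y} := by
  have h : {y | y ∈ Ω ∧ ε ≤ bdist Ω y} = closure Ω ∩ {y | ε ≤ bdist Ω y} := by
    ext y
    refine ⟨fun h => ⟨subset_closure h.1, h.2⟩, fun h => ⟨?_, h.2⟩⟩
    by_contra hy
    have h2 : y ∈ frontier Ω := ⟨h.1, fun h3 => hy (interior_subset h3)⟩
    have h3 : bdist Ω y = 0 := infDist_zero_of_mem h2
    have h4 : ε ≤ bdist Ω y := h.2
    linarith
  rw [h]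
  exact isClosed_closure.inter (isClosed_le continuous_const (continuous_bdist Ω))

lemma locallyIntegrable_innerPart (hε : 0 < ε) (hu : LocallyIntegrableOn u Ω) :
    LocallyIntegrable (innerPart Ω ε u) := by
  intro x
  have hc : IsClosed {y | y ∈ Ω ∧ ε ≤ bdist Ω y} := isClosed_inner hε
  refine ⟨closedBall x 1, closedBall_mem_nhds x one_pos, ?_⟩
  rw [innerPart, IntegrableOn, integrable_indicator_iff hc.measurableSet, IntegrableOn,
    Measure.restrict_restrict hc.measurableSet]
  exact hu.integrableOn_compact_subset (fun y hy => hy.1.1)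
    ((isCompact_closedBall x 1).inter_left hc)

/-- The mollification of `u` with the kernel `kern ε b`. -/
def moll (Ω : Set (Eucl d)) (ε : ℝ) (b : Eucl d) (u : Eucl d → ℂ) : Eucl d → ℂ :=
  smoothing ε b (innerPart Ω ε u)

lemma moll_smooth (hε : 0 < ε) (b : Eucl d) (hu : LocallyIntegrableOn u Ω) :
    Smooth (moll Ω ε b u) :=
  smoothing_smooth hε b (locallyIntegrable_innerPart hε hu)

/-- The points at which the derivatives of the mollification are the mollifications of the weak
derivatives. -/
def MollAt (Ω : Set (Eucl d)) (ε : ℝ) (b : Eucl d) (z : Eucl d) : Prop :=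
  z + ε • b ∈ Ω ∧ 20 * ε ≤ bdist Ω (z + ε • b)

lemma MollAt.ball_subset (hΩ : IsOpen Ω) (hε : 0 < ε) {b z : Eucl d} (h : MollAt Ω ε b z) :
    closedBall (z + ε • b) ε ⊆ {y | y ∈ Ω ∧ ε ≤ bdist Ω y} := by
  intro y hy
  rw [mem_closedBall] at hy
  have h1 := bdist_le_add' Ω (z + ε • b) y
  have := h.2
  exact ⟨mem_of_dist_lt hΩ h.1 (by linarith), by linarith⟩

lemma mixedDeriv_moll (hΩ : IsOpen Ω) (hε : 0 < ε) {b z : Eucl d} (hz : MollAt Ω ε b z)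
    (hu : LocallyIntegrableOn u Ω) {g : Eucl d → ℂ} {β : Fin d → ℕ} (hg : HasWeakDeriv Ω β u g) :
    mixedDeriv β (moll Ω ε b u) z = smoothing ε b g z := by
  have hk := kern_smooth ε b
  have hkc := kern_hasCompactSupport hε b
  set k : Eucl d → ℂ := fun y => kern ε b (z - y) with hkdef
  have hts : tsupport k ⊆ closedBall (z + ε • b) ε := by
    refine closure_minimal (fun y hy => ?_) isClosed_closedBall
    by_contra h
    exact hy (kern_eq_zero hε fun h2 => h (ball_subset_closedBall h2))
  have hsub := hz.ball_subset hΩ hε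
  have hkin : IsSmoothCompactIn Ω k :=
    ⟨⟨smooth_comp_sub_left hk z, HasCompactSupport.of_support_subset_isCompact
      (isCompact_closedBall (z + ε • b) ε) ((subset_tsupport k).trans hts)⟩,
      hts.trans fun y hy => (hsub hy).1⟩
  have h1 := hg.2 k hkin
  have hmk : tsupport (mixedDeriv β k) ⊆ closedBall (z + ε • b) ε :=
    ((show IsSmoothCompactIn _ k from ⟨hkin.1, hts⟩).mixedDeriv β).2
  have e1 : mixedDeriv β (moll Ω ε b u) z = ∫ y, innerPart Ω ε u y * mixedDeriv β (kern ε b) (z - y) := by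
    rw [moll, smoothing, mixedDeriv_convolution (locallyIntegrable_innerPart hε hu) hk hkc]
    rfl
  have e2 : ∀ y, innerPart Ω ε u y * mixedDeriv β (kern ε b) (z - y) =
      (-1) ^ (∑ i, β i) * (u y * mixedDeriv β k y) := by
    intro y
    have e3 : mixedDeriv β k y = (-1) ^ (∑ i, β i) * mixedDeriv β (kern ε b) (z - y) := by
      rw [hkdef, mixedDeriv_comp_sub_left hk]
    have e4 : mixedDeriv β (kern ε b) (z - y) = (-1) ^ (∑ i, β i) * mixedDeriv β k y := by
      rw [e3, ← mul_assoc, ← mul_pow]; simp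
    rw [e4]
    by_cases hy : y ∈ closedBall (z + ε • b) ε
    · rw [innerPart, indicator_of_mem (hsub hy)]; ring
    · rw [image_eq_zero_of_notMem_tsupport fun h => hy (hmk h)]; simp
  rw [e1, integral_congr_ae (Eventually.of_forall e2), integral_const_mul,
    ← setIntegral_eq_integral_of_tsupport_subset (hmk.trans fun y hy => (hsub hy).1), h1,
    ← mul_assoc, ← mul_pow, setIntegral_eq_integral_of_tsupport_subset hkin.2]
  simp [smoothing_apply, hkdef]

lemma exists_enorm_smoothing_le (d : ℕ) : ∃ C : ℝ≥0, ∀ (ε : ℝ), 0 < ε → ∀ (b z : Eucl d)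
    (f : Eucl d → ℂ), ‖smoothing ε b f z‖ₑ ≤ C * bavg (fun y => ‖f y‖ₑ) (z + ε • b) ε := by
  obtain ⟨C, hC⟩ := exists_enorm_kern_le d
  refine ⟨C, fun ε hε b z f => ?_⟩
  rw [smoothing_apply, bavg_eq _ _ hε, ← mul_assoc, ← lintegral_const_mul' _ _ (by finiteness),
    ← lintegral_indicator measurableSet_ball]
  refine (enorm_integral_le_lintegral_enorm _).trans (lintegral_mono fun y => ?_)
  by_cases hy : y ∈ ball (z + ε • b) ε
  · rw [indicator_of_mem hy, enorm_mul, mul_comm]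
    gcongr
    exact hC ε hε b _
  · rw [kern_eq_zero hε hy, mul_zero, enorm_zero]; exact bot_le

/-! ### Bounds for mollifications -/

lemma bavg_rpow_le {f : Eucl d → ℝ≥0∞} (hf : Measurable f) (hq : 1 ≤ q) (w : Eucl d) (r : ℝ) :
    bavg f w r ^ q ≤ volume (ball (0 : Eucl d) 1) ^ (q - 1) * bavg (fun y => f y ^ q) w r := by
  have h1 : Measurable fun z => f (w + r • z) :=
    hf.comp (by fun_prop : Continuous fun z : Eucl d => w + r • z).measurable
  have := rpow_lintegral_le (volume.restrict (ball (0 : Eucl d) 1)) h1.aemeasurable hq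
  rwa [Measure.restrict_apply_univ] at this

lemma exists_enorm_smoothing_rpow_le (d : ℕ) (hq : 1 ≤ q) : ∃ C : ℝ≥0, ∀ (ε : ℝ),
    0 < ε → ∀ (b z : Eucl d) (f : Eucl d → ℂ), Measurable f →
    ‖smoothing ε b f z‖ₑ ^ q ≤ C * bavg (fun y => ‖f y‖ₑ ^ q) (z + ε • b) ε := by
  obtain ⟨C, hC⟩ := exists_enorm_smoothing_le d
  have hq0 : 0 ≤ q := by linarith
  set A : ℝ≥0∞ := (C : ℝ≥0∞) ^ q * volume (ball (0 : Eucl d) 1) ^ (q - 1) with hA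
  have hAt : A ≠ ∞ := mul_ne_top (rpow_ne_top_of_nonneg hq0 coe_ne_top)
    (rpow_ne_top_of_nonneg (by linarith) measure_ball_lt_top.ne)
  refine ⟨A.toNNReal, fun ε hε b z f hf => ?_⟩
  rw [coe_toNNReal hAt]
  refine (rpow_le_rpow (hC ε hε b z f) hq0).trans ?_
  rw [mul_rpow_of_nonneg _ _ hq0, hA, mul_assoc]
  gcongr
  exact bavg_rpow_le hf.enorm hq _ _

lemma exists_jetPow_moll_le (d k : ℕ) (hq : 1 ≤ q) : ∃ C : ℝ≥0, ∀ (Ω : Set (Eucl d)),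
    IsOpen Ω → ∀ (m : ℕ), k ≤ m → ∀ (u : Eucl d → ℂ) (D : Jet d),
    LocallyIntegrableOn u Ω → IsJet Ω m u D → ∀ (ε : ℝ), 0 < ε → ∀ b z : Eucl d, MollAt Ω ε b z →
    jetPow q k (moll Ω ε b u) z ≤ C * bavg (powSum q k D) (z + ε • b) ε := by
  obtain ⟨C₁, hC₁⟩ := exists_jetPow_le_powSum d k hq
  obtain ⟨C₂, hC₂⟩ := exists_enorm_smoothing_rpow_le d hq
  refine ⟨C₁ * C₂, fun Ω hΩ m hkm u D hu hD ε hε b z hz => ?_⟩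
  refine (hC₁ _ (moll_smooth hε b hu) z).trans ?_
  rw [coe_mul, mul_assoc]
  gcongr
  have e : bavg (powSum q k D) (z + ε • b) ε =
      ∑ γ ∈ multiIndices d k, bavg (fun y => ‖D γ y‖ₑ ^ q) (z + ε • b) ε :=
    bavg_sum fun γ _ => (hD.1 γ).enorm.pow_const q
  rw [e, Finset.mul_sum]
  refine sum_le_sum fun γ hγ => ?_
  simp only
  rw [mixedDeriv_moll hΩ hε hz hu (hD.2 γ ((mem_multiIndices.1 hγ).le.trans hkm))]
  exact hC₂ ε hε b z _ (hD.1 γ)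

lemma bavg_bavg_eq (hF : Measurable F) (w b : Eucl d) (r ε : ℝ) :
    bavg (fun z => bavg F (z + ε • b) ε) w r =
      ∫⁻ t in ball (0 : Eucl d) 1, bavg F (w + ε • (b + t)) r := by
  unfold bavg
  have hm : Measurable fun p : Eucl d × Eucl d => F (w + r • p.1 + ε • b + ε • p.2) :=
    hF.comp (by fun_prop : Continuous fun p : Eucl d × Eucl d =>
      w + r • p.1 + ε • b + ε • p.2).measurable
  rw [lintegral_swap_of_measurable (f := fun p : Eucl d × Eucl d =>
    F (w + r • p.1 + ε • b + ε • p.2)) hm]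
  refine lintegral_congr fun t => lintegral_congr fun z => ?_
  congr 1
  rw [smul_add]; abel

lemma exists_bavg_moll_le (d k : ℕ) (hq : 1 ≤ q) : ∃ C : ℝ≥0, ∀ (Ω : Set (Eucl d)),
    IsOpen Ω → ∀ (m : ℕ), k ≤ m → ∀ (u : Eucl d → ℂ) (D : Jet d),
    LocallyIntegrableOn u Ω → IsJet Ω m u D → ∀ (ε : ℝ), 0 < ε → ∀ (b w : Eucl d) (r : ℝ), 0 < r →
    (∀ z ∈ ball w r, MollAt Ω ε b z) →
    bavg (jetPow q k (moll Ω ε b u)) w r ≤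
        C * bavg (fun z => bavg (powSum q k D) (z + ε • b) ε) w r := by
  obtain ⟨C, hC⟩ := exists_jetPow_moll_le d k hq
  refine ⟨C, fun Ω hΩ m hkm u D hu hD ε hε b w r hr hz => ?_⟩
  rw [← bavg_const_mul coe_ne_top]
  exact bavg_mono hr fun z hz' => hC Ω hΩ m hkm u D hu hD ε hε b z (hz z hz')

/-- The averages of the top order derivatives of a mollification are controlled by the averages
over the Whitney balls in a cone. -/
lemma exists_bavg_moll_le_coneSup (d m : ℕ) (hq : 1 ≤ q) (K : ℝ) {B₀ : ℝ} (hB₀ : 0 ≤ B₀) :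
    ∃ C : ℝ≥0, ∃ K' : ℝ, ∀ (Ω : Set (Eucl d)), IsOpen Ω →
    ∀ (u : Eucl d → ℂ) (D : Jet d),
    LocallyIntegrableOn u Ω → IsJet Ω m u D → ∀ (ε : ℝ), 0 < ε → ∀ b : Eucl d, ‖b‖ ≤ B₀ →
    ∀ (x w : Eucl d) (r : ℝ), 0 < r → w ∈ Ω → 16 * r ≤ bdist Ω w → bdist Ω w ≤ K * r →
    dist w x ≤ K * r → (∀ z ∈ ball w r, MollAt Ω ε b z) →
    bavg (jetPow q m (moll Ω ε b u)) w r ≤ C * coneSup Ω (powSum q m D) K' x := by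
  obtain ⟨C, hC⟩ := exists_bavg_moll_le d m hq
  set v := volume (ball (0 : Eucl d) 1) with hv
  have hvt : v ≠ ∞ := measure_ball_lt_top.ne
  set K' := (|K| + 2) * (B₀ + 2) with hK'
  refine ⟨C * v.toNNReal, K', fun Ω hΩ u D hu hD ε hε b hb x w r hr hw h16 hKr hd hz => ?_⟩
  have hFm : Measurable (powSum q m D) := measurable_powSum q m fun γ _ => hD.1 γ
  refine (hC Ω hΩ m le_rfl u D hu hD ε hε b w r hr hz).trans ?_
  rw [coe_mul, coe_toNNReal hvt, mul_assoc]
  gcongr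
  have hKa := le_abs_self K
  have hKn := abs_nonneg K
  have hK'1 : |K| + 2 ≤ K' := by rw [hK']; nlinarith
  by_cases hcase : ε * (B₀ + 1) ≤ r
  · rw [bavg_bavg_eq hFm]
    calc _ ≤ ∫⁻ t in ball (0 : Eucl d) 1, coneSup Ω (powSum q m D) K' x := by
          refine setLIntegral_mono' measurableSet_ball fun t ht => ?_
          rw [mem_ball_zero_iff] at ht
          have h1 : dist (w + ε • (b + t)) w ≤ r := by
            rw [dist_self_add_left, norm_smul, norm_of_nonneg hε.le]
            refine le_trans ?_ hcase
            gcongr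
            exact (norm_add_le _ _).trans (by linarith)
          have h2 := bdist_le_add Ω (w + ε • (b + t)) w
          have h3 := bdist_le_add' Ω w (w + ε • (b + t))
          have h4 := dist_triangle (w + ε • (b + t)) w x
          have h5 : |K| * r + 2 * r ≤ K' * r := by nlinarith
          have h6 : K * r ≤ |K| * r := by gcongr
          refine Adm.le_coneSup (B := (w + ε • (b + t), r)) ⟨mem_of_dist_lt hΩ hw (by linarith), hr,
            ?_, ?_, ?_⟩ _ <;> simp only <;> linarith
      _ = _ := by rw [setLIntegral_const, mul_comm]
  · rw [not_le] at hcase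
    calc _ ≤ bavg (fun _ => coneSup Ω (powSum q m D) K' x) w r := by
          refine bavg_mono hr fun z hz' => ?_
          have hv := hz z hz'
          rw [mem_ball] at hz'
          have h1 : dist (z + ε • b) z ≤ ε * B₀ := by
            rw [dist_self_add_left, norm_smul, norm_of_nonneg hε.le]; gcongr
          have h2 := bdist_le_add Ω (z + ε • b) w
          have h3 := dist_triangle (z + ε • b) z w
          have h4 := dist_triangle (z + ε • b) w x
          have h6 : K * r ≤ |K| * r := by gcongr
          have h7 : (|K| + 1) * r ≤ (|K| + 1) * (ε * (B₀ + 1)) := by gcongr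
          have h8 : (|K| + 1) * (ε * (B₀ + 1)) + ε * B₀ ≤ K' * ε := by
            rw [hK']; nlinarith [mul_nonneg hε.le hB₀, mul_nonneg hKn hε.le]
          refine Adm.le_coneSup (B := (z + ε • b, ε)) ⟨hv.1, hε, ?_, ?_, ?_⟩ _ <;> simp only
          · linarith [hv.2]
          · linarith
          · linarith
      _ = _ := by rw [bavg_const, mul_comm]

lemma enorm_integral_le_bavg (U : Eucl d → ℂ) (j : ℕ) (w : Eucl d) (r : ℝ) :
    ‖∫ z in ball (0 : Eucl d) 1, iteratedFDeriv ℝ j U (w + r • z)‖ₑ ≤ bavg (jetPow 1 j U) w r := by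
  refine (enorm_integral_le_lintegral_enorm _).trans (le_of_eq ?_)
  simp [bavg, jetPow]

/-! ### Local convergence of mollifications -/

lemma smoothing_sub (hε : 0 < ε) (b : Eucl d) {g : Eucl d → ℂ} (hf : LocallyIntegrable f)
    (hg : LocallyIntegrable g) (z : Eucl d) :
    smoothing ε b (f - g) z = smoothing ε b f z - smoothing ε b g z := by
  have h1 : Integrable fun y => f y * kern ε b (z - y) := (kern_hasCompactSupport hε b).convolutionExists_right (ContinuousLinearMap.mul ℝ ℂ) hf
    (kern_smooth ε b).continuous z
  have h2 : Integrable fun y => g y * kern ε b (z - y) := (kern_hasCompactSupport hε b).convolutionExists_right (ContinuousLinearMap.mul ℝ ℂ) hg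
    (kern_smooth ε b).continuous z
  rw [smoothing_apply, smoothing_apply, smoothing_apply, ← integral_sub h1 h2]
  congr 1; funext y; simp [sub_mul]

lemma smoothing_const (hε : 0 < ε) (b : Eucl d) (c : ℂ) (z : Eucl d) :
    smoothing ε b (fun _ => c) z = c := by
  rw [smoothing_apply, integral_const_mul, integral_kern hε, mul_one]

lemma exists_lintegral_smoothing_rpow_le (d : ℕ) (hq : 1 ≤ q) : ∃ C : ℝ≥0, ∀ (ε : ℝ),
    0 < ε → ∀ (b : Eucl d) (f : Eucl d → ℂ), Measurable f →
    ∫⁻ z, ‖smoothing ε b f z‖ₑ ^ q ≤ C * ∫⁻ y, ‖f y‖ₑ ^ q := by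
  obtain ⟨C, hC⟩ := exists_enorm_smoothing_rpow_le d hq
  set v := volume (ball (0 : Eucl d) 1)
  have hvt : v ≠ ∞ := measure_ball_lt_top.ne
  refine ⟨C * v.toNNReal, fun ε hε b f hf => ?_⟩
  have hm : Measurable fun y => ‖f y‖ₑ ^ q := hf.enorm.pow_const q
  calc _ ≤ ∫⁻ z, C * bavg (fun y => ‖f y‖ₑ ^ q) (z + ε • b) ε :=
        lintegral_mono fun z => hC ε hε b z f hf
    _ = C * ∫⁻ z, bavg (fun y => ‖f y‖ₑ ^ q) (z + ε • b) ε := lintegral_const_mul' _ _ coe_ne_top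
    _ = C * ∫⁻ t in ball (0 : Eucl d) 1, ∫⁻ z, ‖f (z + ε • b + ε • t)‖ₑ ^ q := by
        unfold bavg
        rw [lintegral_swap_of_measurable (f := fun p : Eucl d × Eucl d =>
          ‖f (p.1 + ε • b + ε • p.2)‖ₑ ^ q) (hm.comp (by fun_prop : Continuous
            fun p : Eucl d × Eucl d => p.1 + ε • b + ε • p.2).measurable)]
    _ = C * ∫⁻ t in ball (0 : Eucl d) 1, ∫⁻ y, ‖f y‖ₑ ^ q := by
        congr 1
        refine lintegral_congr fun t => ?_
        have := lintegral_add_right_eq_self (μ := (volume : Measure (Eucl d)))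
          (fun y => ‖f y‖ₑ ^ q) (ε • b + ε • t)
        simp_rw [← add_assoc] at this
        exact this
    _ = _ := by
        rw [setLIntegral_const, coe_mul, coe_toNNReal hvt]; ring

lemma tendsto_lintegral_smoothing_sub (hq : 1 ≤ q) (b : Eucl d) (hf : Measurable f) {r' : ℝ}
    (hr : r < r') (hfin : ∫⁻ y in ball w r', ‖f y‖ₑ ^ q < ∞) {ε : ℕ → ℝ} (hε : ∀ n, 0 < ε n)
    (hε0 : Tendsto ε atTop (𝓝 0)) :
    Tendsto (fun n => ∫⁻ z in ball w r, ‖smoothing (ε n) b f z - f z‖ₑ ^ q) atTop (𝓝 0) := by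
  have hq0 : 0 < q := by linarith
  obtain ⟨C, hC⟩ := exists_lintegral_smoothing_rpow_le d hq
  obtain ⟨C', hC'⟩ := exists_enorm_smoothing_le d
  set v := volume (ball (0 : Eucl d) 1)
  have hvt : v ≠ ∞ := measure_ball_lt_top.ne
  set V := volume (ball w r)
  have hVt : V ≠ ∞ := measure_ball_lt_top.ne
  have h2q : (2 : ℝ≥0∞) ^ q ≠ ∞ := rpow_ne_top_of_nonneg hq0.le (by norm_num)
  set f₁ := (ball w r').indicator f with hf₁
  have hf₁m : Measurable f₁ := hf.indicator measurableSet_ball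
  have hqof : ofReal q ≠ 0 := by simp [hq0]
  have hf₁L : MemLp f₁ (ofReal q) := by
    refine ⟨hf₁m.aestronglyMeasurable, ?_⟩
    rw [hf₁, eLpNorm_indicator_eq_eLpNorm_restrict measurableSet_ball,
      eLpNorm_lt_top_iff_lintegral_rpow_enorm_lt_top hqof ofReal_ne_top,
      ENNReal.toReal_ofReal hq0.le]
    exact hfin
  have hf₁loc : LocallyIntegrable f₁ :=
    hf₁L.locallyIntegrable (by rw [← ofReal_one]; exact ofReal_le_ofReal hq)
  rw [ENNReal.tendsto_nhds_zero]
  intro η hη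
  set M : ℝ≥0∞ := 2 ^ q * (C + 2 ^ q * ((C' * v) ^ q * V + 1)) with hM
  have hCvt : ((C' : ℝ≥0∞) * v) ^ q ≠ ∞ := rpow_ne_top_of_nonneg hq0.le (mul_ne_top coe_ne_top hvt)
  have hMt : M ≠ ∞ := by rw [hM]; finiteness
  obtain ⟨σ, hσ0, hσt, hσ⟩ : ∃ σ : ℝ≥0∞, 0 < σ ∧ σ < ∞ ∧ M * σ ^ q ≤ η := by
    rcases eq_or_ne η ∞ with rfl | hηt
    · exact ⟨1, one_pos, by simp, le_top⟩
    · have hx0 : η / (M + 1) ≠ 0 := by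
        rw [Ne, ENNReal.div_eq_zero_iff]; simp [hη.ne', hMt]
      have hxt : η / (M + 1) ≠ ∞ := ENNReal.div_ne_top hηt (by simp)
      refine ⟨(η / (M + 1)) ^ (1 / q), ENNReal.rpow_pos (pos_iff_ne_zero.2 hx0) hxt,
        (ENNReal.rpow_lt_top_of_nonneg (by positivity) hxt), ?_⟩
      rw [← rpow_mul, one_div_mul_cancel hq0.ne', rpow_one]
      calc M * (η / (M + 1)) ≤ (M + 1) * (η / (M + 1)) := by gcongr; exact le_self_add
        _ = η := ENNReal.mul_div_cancel (by simp) (by finiteness)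
  obtain ⟨g, hgc, hgf, hgcont, hgL⟩ := hf₁L.exists_hasCompactSupport_eLpNorm_sub_le
    ofReal_ne_top hσ0.ne'
  have hgloc : LocallyIntegrable g := hgcont.locallyIntegrable
  have hgf' : ∫⁻ y, ‖(f₁ - g) y‖ₑ ^ q ≤ σ ^ q := by
    rw [eLpNorm_eq_lintegral_rpow_enorm_toReal hqof ofReal_ne_top,
      ENNReal.toReal_ofReal hq0.le] at hgf
    have := rpow_le_rpow hgf hq0.le
    rwa [← rpow_mul, one_div_mul_cancel hq0.ne', rpow_one] at this
  have huc := hgc.uniformContinuous_of_continuous hgcont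
  obtain ⟨σ', hσ'0, hσ'⟩ : ∃ σ' : ℝ, 0 < σ' ∧ ofReal σ' = σ :=
    ⟨σ.toReal, toReal_pos hσ0.ne' hσt.ne, ENNReal.ofReal_toReal hσt.ne⟩
  obtain ⟨ρ, hρ0, hρ⟩ := Metric.uniformContinuous_iff.1 huc σ' hσ'0
  have hlim : Tendsto (fun n => ε n * (‖b‖ + 1)) atTop (𝓝 0) := by simpa using hε0.mul_const (‖b‖ + 1)
  filter_upwards [hlim.eventually (gt_mem_nhds (show 0 < r' - r by linarith)),
    hlim.eventually (gt_mem_nhds hρ0)] with n hn1 hn2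
  have hsm : ∀ z ∈ ball w r, ∀ y ∈ ball (z + ε n • b) (ε n), dist y z < ε n * (‖b‖ + 1) := by
    intro z _ y hy
    rw [mem_ball] at hy
    have h1 : dist (z + ε n • b) z = ε n * ‖b‖ := by
      rw [dist_self_add_left, norm_smul, norm_of_nonneg (hε n).le]
    have := dist_triangle y (z + ε n • b) z
    linarith
  have e1 : ∀ z ∈ ball w r, smoothing (ε n) b f z - f z =
      smoothing (ε n) b (f₁ - g) z + (smoothing (ε n) b (g - fun _ => g z) z - (f₁ - g) z) := by
    intro z hz
    have h1 : smoothing (ε n) b f z = smoothing (ε n) b f₁ z := by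
      rw [smoothing_apply, smoothing_apply]
      congr 1; funext y
      by_cases hy : y ∈ ball (z + ε n • b) (ε n)
      · rw [hf₁, indicator_of_mem]
        have h2 := hsm z hz y hy
        rw [mem_ball] at hz ⊢
        have := dist_triangle y z w
        linarith
      · rw [kern_eq_zero (hε n) hy]; simp
    have h2 : f z = f₁ z := by
      rw [hf₁, indicator_of_mem (ball_subset_ball hr.le hz)]
    rw [h1, h2, smoothing_sub (hε n) b hf₁loc hgloc, smoothing_sub (hε n) b hgloc
      (continuous_const.locallyIntegrable), smoothing_const (hε n)]
    simp
  have e2 : ∀ z ∈ ball w r, ‖smoothing (ε n) b (g - fun _ => g z) z‖ₑ ≤ C' * v * σ := by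
    intro z hz
    refine (hC' (ε n) (hε n) b z _).trans ?_
    rw [mul_assoc]
    gcongr
    calc _ ≤ bavg (fun _ => σ) (z + ε n • b) (ε n) := by
          refine bavg_mono (hε n) fun y hy => ?_
          rw [← hσ', ← ofReal_norm]
          apply ofReal_le_ofReal
          have := hρ ((hsm z hz y hy).trans hn2)
          rw [dist_eq_norm] at this
          exact this.le
      _ = _ := by rw [bavg_const, mul_comm]
  have hsmm : Measurable fun z => ‖smoothing (ε n) b (f₁ - g) z‖ₑ ^ q :=
    measurable_enorm_rpow_comp (smoothing_smooth (hε n) b (hf₁loc.sub hgloc)).continuous q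
  have hfgm : Measurable fun z => ‖(f₁ - g) z‖ₑ ^ q :=
    (hf₁m.sub hgcont.measurable).enorm.pow_const q
  calc ∫⁻ z in ball w r, ‖smoothing (ε n) b f z - f z‖ₑ ^ q
      ≤ ∫⁻ z in ball w r, 2 ^ q * (‖smoothing (ε n) b (f₁ - g) z‖ₑ ^ q +
          2 ^ q * ((C' * v * σ) ^ q + ‖(f₁ - g) z‖ₑ ^ q)) := by
        refine setLIntegral_mono' measurableSet_ball fun z hz => ?_
        rw [e1 z hz]
        refine (rpow_le_rpow (enorm_add_le _ _) hq0.le).trans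
          ((add_rpow_le_two_rpow_mul _ _ hq0.le).trans ?_)
        gcongr
        refine (rpow_le_rpow enorm_sub_le hq0.le).trans
          ((add_rpow_le_two_rpow_mul _ _ hq0.le).trans ?_)
        gcongr
        exact e2 z hz
    _ = 2 ^ q * ((∫⁻ z in ball w r, ‖smoothing (ε n) b (f₁ - g) z‖ₑ ^ q) +
          2 ^ q * ((C' * v * σ) ^ q * V + ∫⁻ z in ball w r, ‖(f₁ - g) z‖ₑ ^ q)) := by
        rw [lintegral_const_mul' _ _ h2q, lintegral_add_left hsmm, lintegral_const_mul' _ _ h2q,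
          lintegral_add_left measurable_const, setLIntegral_const]
    _ ≤ 2 ^ q * (C * σ ^ q + 2 ^ q * ((C' * v) ^ q * σ ^ q * V + σ ^ q)) := by
        rw [mul_rpow_of_nonneg _ σ hq0.le]
        gcongr
        · exact (setLIntegral_le_lintegral _ _).trans
            ((hC (ε n) (hε n) b _ (hf₁m.sub hgcont.measurable)).trans (by gcongr))
        · exact (setLIntegral_le_lintegral _ _).trans hgf'
    _ = M * σ ^ q := by rw [hM]; ring
    _ ≤ η := hσ

/-! ### Cut-off functions -/

lemma enorm_mixedDeriv_smoothing_indicator_le (S : Set (Eucl d)) (hS : MeasurableSet S)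
    (γ : Fin d → ℕ) (z : Eucl d) :
    ‖mixedDeriv γ (smoothing 1 0 (S.indicator fun _ => (1 : ℂ))) z‖ₑ ≤
      ∫⁻ y, ‖mixedDeriv γ (kern 1 (0 : Eucl d)) y‖ₑ := by
  have hf : LocallyIntegrable (S.indicator fun _ => (1 : ℂ)) :=
    (locallyIntegrable_const 1).indicator hS
  rw [smoothing, mixedDeriv_convolution hf (kern_smooth 1 0) (kern_hasCompactSupport one_pos 0)]
  refine (enorm_integral_le_lintegral_enorm _).trans ?_
  rw [← lintegral_sub_left_eq_self (fun y => ‖mixedDeriv γ (kern 1 (0 : Eucl d)) y‖ₑ) z]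
  refine lintegral_mono fun y => ?_
  rw [ContinuousLinearMap.mul_apply', enorm_mul]
  by_cases hy : y ∈ S <;> simp [hy]

/-- Smooth versions of indicator functions. -/
lemma exists_cutoff (d m : ℕ) : ∃ C : ℝ, 0 < C ∧ ∀ (S : Set (Eucl d)), MeasurableSet S →
    ∀ s : ℝ, 0 < s → ∃ χ : Eucl d → ℂ, Smooth χ ∧ (∀ y, ball y s ⊆ S → χ y = 1) ∧
      (∀ y, Disjoint (ball y s) S → χ y = 0) ∧
      ∀ i ≤ m, ∀ y, ‖iteratedFDeriv ℝ i χ y‖ * s ^ i ≤ C := by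
  have hInt : ∀ γ : Fin d → ℕ, Integrable (mixedDeriv γ (kern 1 (0 : Eucl d))) := fun γ =>
    ((kern_smooth 1 0).mixedDeriv γ).continuous.integrable_of_hasCompactSupport
      ((show IsSmoothCompactIn Set.univ (kern 1 (0 : Eucl d)) from ⟨⟨kern_smooth 1 0,
        kern_hasCompactSupport one_pos 0⟩, Set.subset_univ _⟩).mixedDeriv γ).1.2
  set c : (Fin d → ℕ) → ℝ := fun γ => (∫⁻ y, ‖mixedDeriv γ (kern 1 (0 : Eucl d)) y‖ₑ).toReal with hc
  set C : ℝ := 1 + ∑ i ∈ Finset.range (m + 1), (d : ℝ) ^ i * ∑ γ ∈ multiIndices d i, c γ with hC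
  have hterm : ∀ i, 0 ≤ (d : ℝ) ^ i * ∑ γ ∈ multiIndices d i, c γ := fun i =>
    mul_nonneg (by positivity) (Finset.sum_nonneg fun _ _ => ENNReal.toReal_nonneg)
  have hC0 : 0 < C := by
    have h0 := Finset.sum_nonneg (s := Finset.range (m + 1)) fun i _ => hterm i
    rw [hC]; linarith
  refine ⟨C, hC0, fun S hS s hs => ?_⟩
  set S' : Set (Eucl d) := (fun y : Eucl d => s • y) ⁻¹' S
  have hS'm : MeasurableSet S' := hS.preimage (measurable_const_smul s)
  have hf : LocallyIntegrable (S'.indicator fun _ => (1 : ℂ)) :=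
    (locallyIntegrable_const 1).indicator hS'm
  set g := smoothing 1 0 (S'.indicator fun _ => (1 : ℂ)) with hg
  have hgs : Smooth g := smoothing_smooth one_pos 0 hf
  have hball : ∀ (y t : Eucl d), t ∈ ball (s⁻¹ • y + (1 : ℝ) • (0 : Eucl d)) 1 →
      s • t ∈ ball y s := by
    intro y t ht
    rw [smul_zero, add_zero, mem_ball, dist_eq_norm] at ht
    rw [mem_ball, dist_eq_norm]
    have : s • t - y = s • (t - s⁻¹ • y) := by rw [smul_sub, smul_inv_smul₀ hs.ne']
    rw [this, norm_smul, norm_of_nonneg hs.le]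
    nlinarith
  refine ⟨fun y => g (s⁻¹ • y), hgs.comp (contDiff_const_smul _), fun y hy => ?_, fun y hy => ?_,
    fun i hi y => ?_⟩
  · have : g (s⁻¹ • y) = smoothing 1 0 (fun _ => (1 : ℂ)) (s⁻¹ • y) := by
      rw [hg, smoothing_apply, smoothing_apply]
      congr 1; funext t
      by_cases ht : t ∈ ball (s⁻¹ • y + (1 : ℝ) • (0 : Eucl d)) 1
      · rw [indicator_of_mem (show t ∈ S' from hy (hball y t ht))]
      · rw [kern_eq_zero one_pos ht]; simp
    simp only [this, smoothing_const one_pos]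
  · have : g (s⁻¹ • y) = smoothing 1 0 (fun _ => (0 : ℂ)) (s⁻¹ • y) := by
      rw [hg, smoothing_apply, smoothing_apply]
      congr 1; funext t
      by_cases ht : t ∈ ball (s⁻¹ • y + (1 : ℝ) • (0 : Eucl d)) 1
      · rw [indicator_of_notMem (show t ∉ S' from
          fun h => Set.disjoint_left.1 hy (hball y t ht) h)]
      · rw [kern_eq_zero one_pos ht]; simp
    simp only [this, smoothing_const one_pos]
  · rw [iteratedFDeriv_comp_const_smul (s⁻¹) (hgs.of_le (by exact_mod_cast le_top)), norm_smul,
      norm_pow, norm_inv, norm_of_nonneg hs.le]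
    have h1 : (s⁻¹) ^ i * ‖iteratedFDeriv ℝ i g (s⁻¹ • y)‖ * s ^ i =
        ‖iteratedFDeriv ℝ i g (s⁻¹ • y)‖ := by
      rw [inv_pow]; field_simp
    rw [h1]
    refine (norm_iteratedFDeriv_le_sum hgs i _).trans ?_
    have h2 : (d : ℝ) ^ i * ∑ γ ∈ multiIndices d i, ‖mixedDeriv γ g (s⁻¹ • y)‖ ≤
        (d : ℝ) ^ i * ∑ γ ∈ multiIndices d i, c γ := by
      gcongr with γ hγ
      rw [hc, ← toReal_enorm]
      refine ENNReal.toReal_mono ?_ (enorm_mixedDeriv_smoothing_indicator_le S' hS'm γ _)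
      exact (hInt γ).2.ne
    refine h2.trans ?_
    rw [hC]
    have := single_le_sum (f := fun i => (d : ℝ) ^ i * ∑ γ ∈ multiIndices d i, c γ)
      (fun i _ => hterm i) (mem_range.2 (Nat.lt_succ_of_le hi))
    linarith

/-- A cut-off function for a ball. -/
lemma exists_ball_cutoff (d m : ℕ) : ∃ C : ℝ, 0 < C ∧ ∀ (x₀ : Eucl d) (R : ℝ), 0 < R →
    ∃ ζ : Eucl d → ℂ, Smooth ζ ∧ HasCompactSupport ζ ∧ (∀ y ∈ ball x₀ R, ζ y = 1) ∧
      (∀ y, 2 * R ≤ dist y x₀ → ζ y = 0) ∧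
      ∀ i ≤ m, ∀ y, ‖iteratedFDeriv ℝ i ζ y‖ * R ^ i ≤ C := by
  obtain ⟨C, hC0, hC⟩ := exists_cutoff d m
  refine ⟨2 ^ m * C, by positivity, fun x₀ R hR => ?_⟩
  obtain ⟨ζ, h1, h2, h3, h4⟩ := hC (ball x₀ (3 / 2 * R)) measurableSet_ball (R / 2) (by positivity)
  have h5 : ∀ y, 2 * R ≤ dist y x₀ → ζ y = 0 := by
    intro y hy
    refine h3 y (Set.disjoint_left.2 fun t ht ht' => ?_)
    rw [mem_ball] at ht ht'
    have := dist_triangle y t x₀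
    rw [dist_comm y t] at this
    linarith
  refine ⟨ζ, h1, HasCompactSupport.of_support_subset_isCompact (isCompact_closedBall x₀ (2 * R))
    fun y hy => ?_, fun y hy => h2 y fun t ht => ?_, h5, fun i hi y => ?_⟩
  · by_contra h
    rw [mem_closedBall, not_le] at h
    exact hy (h5 y h.le)
  · rw [mem_ball] at ht hy ⊢
    have := dist_triangle t y x₀
    linarith
  · calc ‖iteratedFDeriv ℝ i ζ y‖ * R ^ i = 2 ^ i * (‖iteratedFDeriv ℝ i ζ y‖ * (R / 2) ^ i) := by
          rw [div_pow]; field_simp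
      _ ≤ 2 ^ m * C := by
          gcongr
          · norm_num
          · exact h4 i hi y

/-! ### Boundary layers -/

/-- `Ω` contains truncated cones with axis `e` and vertices in `Ω ∩ N`. -/
def UpCone (Ω N : Set (Eucl d)) (e : Eucl d) (c h : ℝ) : Prop :=
  ∀ y ∈ Ω ∩ N, ∀ t : ℝ, 0 < t → t ≤ h → ball (y + t • e) (c * t) ⊆ Ω

lemma UpCone.mem {N : Set (Eucl d)} {e : Eucl d} {c h : ℝ} (H : UpCone Ω N e c h) (hc : 0 < c)
    (hy : y ∈ Ω ∩ N) {t : ℝ} (ht : 0 < t) (hth : t ≤ h) : y + t • e ∈ Ω := H y hy t ht hth (mem_ball_self (by positivity))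

lemma UpCone.le_bdist (hΩ : IsOpen Ω) (hne : (frontier Ω).Nonempty) {N : Set (Eucl d)}
    {e : Eucl d} {c h : ℝ} (H : UpCone Ω N e c h) (hy : y ∈ Ω ∩ N) {t : ℝ} (ht : 0 < t)
    (hth : t ≤ h) : c * t ≤ bdist Ω (y + t • e) := le_bdist_of_ball_subset hΩ hne (H y hy t ht hth)

/-- The volume of a boundary layer of thickness `s` in a ball of radius `R` is at most
`C s R^(d-1)`. -/
def HasLayerVolume (Ω : Set (Eucl d)) : Prop := ∃ C : ℝ≥0, ∀ (z : Eucl d) (s R : ℝ), 0 < s → s ≤ R →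
    volume (Ω ∩ ball z R ∩ {x | bdist Ω x < s}) ≤ C * ofReal (s / R * R ^ d)

lemma volume_layer_le (hΩ : IsOpen Ω) (hne : (frontier Ω).Nonempty) {N : Set (Eucl d)}
    (hN : IsOpen N) {e : Eucl d} (he : ‖e‖ ≤ 1) {c h : ℝ} (hc : 0 < c) (hh : 0 < h)
    (H : UpCone Ω N e c h) {z : Eucl d} {s R : ℝ} (hs : 0 < s) (hhR : h ≤ R) :
    volume (Ω ∩ N ∩ ball z R ∩ {x | bdist Ω x < s}) ≤
      ofReal (2 ^ d / c * (s / h * R ^ d)) * volume (ball (0 : Eucl d) 1) := by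
  set E := Ω ∩ N ∩ ball z R ∩ {x | bdist Ω x < s}
  have hEm : MeasurableSet E := ((hΩ.inter hN).inter isOpen_ball).inter
    (isOpen_lt (continuous_bdist Ω) continuous_const) |>.measurableSet
  have hR : 0 < R := by linarith
  set J := ⌊h * c / s⌋₊
  have hJ1 : h * c / s < J + 1 := Nat.lt_floor_add_one _
  have hJ2 : (J : ℝ) * (s / c) ≤ h := by
    have : (J : ℝ) ≤ h * c / s := Nat.floor_le (by positivity)
    calc (J : ℝ) * (s / c) ≤ h * c / s * (s / c) := by gcongr
      _ = h := by field_simp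
  set T : ℕ → Set (Eucl d) := fun j => (fun x => (j * (s / c) : ℝ) • e + x) '' E with hT
  have hTm : ∀ j, MeasurableSet (T j) := fun j =>
    (measurableEmbedding_addLeft _).measurableSet_image.2 hEm
  have hTv : ∀ j, volume (T j) = volume E := fun j => by
    simp only [hT, Set.image_add_left, measure_preimage_add]
  have hdisj : Set.PairwiseDisjoint (↑(Finset.range (J + 1))) T := by
    have key : ∀ i j : ℕ, i < j → j ≤ J → Disjoint (T i) (T j) := by
      intro i j hij hj
      rw [Set.disjoint_left]
      rintro _ ⟨x, hx, rfl⟩ ⟨y, hy, hxy⟩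
      have e1 : x = y + ((j - i : ℝ) * (s / c)) • e := by
        have : (i * (s / c) : ℝ) • e + x = (j * (s / c) : ℝ) • e + y := hxy.symm
        have h2 : x = (j * (s / c) : ℝ) • e + y - (i * (s / c) : ℝ) • e := by rw [← this]; abel
        rw [h2, sub_mul, sub_smul]; abel
      have hij' : (1 : ℝ) ≤ j - i := by
        have : (i : ℝ) + 1 ≤ j := by exact_mod_cast hij
        linarith
      have hjJ : (j : ℝ) ≤ J := by exact_mod_cast hj
      have hsc : 0 < s / c := by positivity
      have ht : 0 < (j - i : ℝ) * (s / c) := by positivity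
      have hth : (j - i : ℝ) * (s / c) ≤ h := by
        refine le_trans ?_ hJ2
        gcongr
        have : (0 : ℝ) ≤ i := Nat.cast_nonneg i
        linarith
      have h3 := H.le_bdist hΩ hne hy.1.1 ht hth
      rw [← e1] at h3
      have h4 : bdist Ω x < s := hx.2
      have h5 : s ≤ c * ((j - i : ℝ) * (s / c)) := by
        calc s = c * (1 * (s / c)) := by field_simp
          _ ≤ _ := by gcongr
      linarith
    intro i hi j hj hij
    simp only [Finset.coe_range, Set.mem_Iio] at hi hj
    rcases lt_or_gt_of_ne hij with h1 | h1
    · exact key i j h1 (by omega)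
    · exact (key j i h1 (by omega)).symm
  have hsub : (⋃ j ∈ Finset.range (J + 1), T j) ⊆ ball z (2 * R) := by
    refine Set.iUnion₂_subset fun j hj => ?_
    rintro _ ⟨x, hx, rfl⟩
    have hx' : x ∈ ball z R := hx.1.2
    rw [mem_ball] at hx' ⊢
    have h1 : dist ((j * (s / c) : ℝ) • e + x) x ≤ h := by
      rw [dist_add_self_left, norm_smul, norm_of_nonneg (by positivity)]
      have hjJ : (j : ℝ) ≤ J := by exact_mod_cast Nat.lt_succ_iff.1 (mem_range.1 hj)
      calc (j * (s / c) : ℝ) * ‖e‖ ≤ (J * (s / c)) * 1 := by gcongr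
        _ ≤ h := by rw [mul_one]; exact hJ2
    have := dist_triangle ((j * (s / c) : ℝ) • e + x) x z
    simp only
    linarith
  have hsum : ((J + 1 : ℕ) : ℝ≥0∞) * volume E ≤ volume (ball z (2 * R)) := by
    calc ((J + 1 : ℕ) : ℝ≥0∞) * volume E = ∑ j ∈ Finset.range (J + 1), volume (T j) := by
          simp_rw [hTv]; rw [Finset.sum_const, Finset.card_range, nsmul_eq_mul]
      _ = volume (⋃ j ∈ Finset.range (J + 1), T j) :=
          (measure_biUnion_finset hdisj fun j _ => hTm j).symm
      _ ≤ _ := measure_mono hsub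
  rw [volume_ball_eq z (by positivity)] at hsum
  have hpos : 0 < h * c / s := by positivity
  have h1 : ofReal (h * c / s) * volume E ≤
      ofReal ((2 * R) ^ d) * volume (ball (0 : Eucl d) 1) := by
    refine le_trans ?_ hsum
    gcongr
    rw [← ofReal_natCast]
    apply ofReal_le_ofReal
    push_cast; exact hJ1.le
  calc volume E = ofReal ((h * c / s)⁻¹) * (ofReal (h * c / s) * volume E) := by
        rw [← mul_assoc, ← ofReal_mul (by positivity), inv_mul_cancel₀ hpos.ne']; simp
    _ ≤ ofReal ((h * c / s)⁻¹) * (ofReal ((2 * R) ^ d) * volume (ball (0 : Eucl d) 1)) := by gcongr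
    _ = _ := by
        rw [← mul_assoc, ← ofReal_mul (by positivity), mul_pow]
        congr 2
        field_simp

lemma HasLayerVolume.hasLayerBound (hΩ : IsOpen Ω) (hne : (frontier Ω).Nonempty)
    (hV : HasLayerVolume Ω) : HasLayerBounds Ω := by
  intro a ha
  obtain ⟨C, hC⟩ := hV
  intro K
  set Λ := 2 * (|K| + 1) with hΛ
  have hΛ0 : 0 < Λ := by positivity
  have hKΛ : K ≤ Λ := by linarith [le_abs_self K, abs_nonneg K]
  set ρ : ℝ := (1 / 2) ^ (1 + a) with hρ
  have hρ0 : 0 ≤ ρ := by positivity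
  have hρ1 : ρ < 1 := Real.rpow_lt_one (by norm_num) (by norm_num) (by linarith)
  set M : ℝ := 2 ^ |a| * Λ ^ (d + a) with hM
  set B : ℝ≥0∞ := C * (ofReal M * ∑' k : ℕ, ofReal (ρ ^ k)) with hB
  have hsum : ∑' k : ℕ, ofReal (ρ ^ k) ≠ ∞ :=
    (summable_geometric_of_lt_one hρ0 hρ1).tsum_ofReal_ne_top
  have hBt : B ≠ ∞ := by rw [hB]; finiteness
  refine ⟨B.toNNReal, fun y hy => ?_⟩
  rw [coe_toNNReal hBt]
  have hy0 := bdist_pos hΩ hne hy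
  set R := Λ * bdist Ω y with hR
  have hR0 : 0 < R := by positivity
  set s : ℕ → ℝ := fun k => (1 / 2) ^ k * R with hs
  have hs0 : ∀ k, 0 < s k := fun k => by positivity
  set c : ℕ → ℝ≥0∞ := fun k => ofReal (2 ^ |a| * s k ^ a) with hc
  set X := Ω ∩ ball y (K * bdist Ω y)
  have hXm : MeasurableSet X := hΩ.measurableSet.inter measurableSet_ball
  have hlm : ∀ k, MeasurableSet {x | bdist Ω x < s k} := fun k =>
    (isOpen_lt (continuous_bdist Ω) continuous_const).measurableSet
  have pt : ∀ x ∈ X, dw Ω a x ≤ ∑' k, {x | bdist Ω x < s k}.indicator (fun _ => c k) x := by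
    intro x hx
    have hx0 := bdist_pos hΩ hne hx.1
    have h1 : bdist Ω x < R := by
      have h2 := bdist_le_add Ω x y
      have h3 : dist x y < K * bdist Ω y := hx.2
      have h4 : K * bdist Ω y ≤ |K| * bdist Ω y := by gcongr; exact le_abs_self K
      rw [hR, hΛ]
      nlinarith [abs_nonneg K]
    obtain ⟨k, hk1, hk2⟩ : ∃ k : ℕ, (1 / 2 : ℝ) ^ (k + 1) < bdist Ω x / R ∧
        bdist Ω x / R ≤ (1 / 2) ^ k := by
      obtain ⟨k, hk⟩ := exists_nat_pow_near_of_lt_one (x := bdist Ω x / R) (y := 1 / 2)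
        (by positivity) ((div_le_one hR0).2 h1.le) (by norm_num) (by norm_num)
      exact ⟨k, hk⟩
    obtain ⟨k, hk1, hk2⟩ : ∃ k : ℕ, s k ≤ 2 * bdist Ω x ∧ bdist Ω x < s k := by
      rcases hk2.lt_or_eq with h | h
      · refine ⟨k, ?_, ?_⟩
        · rw [lt_div_iff₀ hR0, pow_succ] at hk1
          simp only [hs]; linarith
        · rw [div_lt_iff₀ hR0] at h; exact h
      · have hk0 : k ≠ 0 := by
          rintro rfl
          rw [pow_zero, div_eq_one_iff_eq hR0.ne'] at h
          linarith
        obtain ⟨j, rfl⟩ := Nat.exists_eq_succ_of_ne_zero hk0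
        have h' : bdist Ω x = (1 / 2) ^ (j + 1) * R := by
          rw [div_eq_iff hR0.ne'] at h; exact h
        have hp := hs0 j
        refine ⟨j, ?_, ?_⟩ <;> rw [h', pow_succ] <;> simp only [hs] at hp ⊢ <;> linarith
    refine le_trans ?_ (ENNReal.le_tsum k)
    rw [indicator_of_mem (by exact hk2), hc, dw]
    apply ofReal_le_ofReal
    have h2 : bdist Ω x ^ a ≤ 2 ^ |a| * s k ^ a := by
      rcases le_total 0 a with h0 | h0
      · calc bdist Ω x ^ a ≤ 1 * s k ^ a := by
              rw [one_mul]; exact Real.rpow_le_rpow hx0.le hk2.le h0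
          _ ≤ _ := by
              gcongr
              exact Real.one_le_rpow (by norm_num) (abs_nonneg a)
      · calc bdist Ω x ^ a ≤ (s k / 2) ^ a :=
              Real.rpow_le_rpow_of_nonpos (by have := hs0 k; positivity) (by linarith) h0
          _ = _ := by
              rw [Real.div_rpow (hs0 k).le (by norm_num), abs_of_nonpos h0,
                Real.rpow_neg (by norm_num), div_eq_inv_mul]
    exact h2
  have e1 : (1 / 2 : ℝ) ^ (1 + a) = ρ := hρ.symm
  calc ∫⁻ x in X, dw Ω a x ≤ ∫⁻ x in X, ∑' k, {x | bdist Ω x < s k}.indicator (fun _ => c k) x :=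
        setLIntegral_mono' hXm pt
    _ = ∑' k, ∫⁻ x in X, {x | bdist Ω x < s k}.indicator (fun _ => c k) x :=
        lintegral_tsum fun k => (measurable_const.indicator (hlm k)).aemeasurable
    _ ≤ ∑' k, c k * (C * ofReal (s k / R * R ^ d)) := by
        refine ENNReal.tsum_le_tsum fun k => ?_
        rw [lintegral_indicator (hlm k), setLIntegral_const, Measure.restrict_apply (hlm k)]
        gcongr
        refine le_trans (measure_mono ?_) (hC y (s k) R (hs0 k) ?_)
        · rintro x ⟨h1, h2, h3⟩
          exact ⟨⟨h2, ball_subset_ball (by rw [hR]; gcongr) h3⟩, h1⟩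
        · simp only [hs]
          have : (1 / 2 : ℝ) ^ k ≤ 1 := pow_le_one₀ (by norm_num) (by norm_num)
          nlinarith
    _ = ∑' k, C * ofReal (M * bdist Ω y ^ (d + a)) * ofReal (ρ ^ k) := by
        congr 1
        funext k
        rw [mul_left_comm, mul_assoc, hc, ← ofReal_mul (by have := hs0 k; positivity),
          ← ofReal_mul (by positivity)]
        congr 2
        have h1 : s k ^ a * (s k / R * R ^ d) = R ^ (d + a) * ρ ^ k := by
          have h2 : s k ^ a = ((1 / 2 : ℝ) ^ k) ^ a * R ^ a := by
            rw [hs]; exact Real.mul_rpow (by positivity) hR0.le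
          have h3 : s k / R = (1 / 2 : ℝ) ^ k := by simp only [hs]; field_simp
          have h4 : ρ ^ k = (1 / 2 : ℝ) ^ k * ((1 / 2 : ℝ) ^ k) ^ a := by
            rw [hρ, ← Real.rpow_natCast, ← Real.rpow_natCast, ← Real.rpow_mul (by norm_num),
              ← Real.rpow_mul (by norm_num), ← Real.rpow_add (by norm_num)]
            congr 1; ring
          rw [h2, h3, h4, Real.rpow_add hR0, Real.rpow_natCast]; ring
        rw [mul_assoc, h1, hM, hR, Real.mul_rpow hΛ0.le hy0.le]; ring
    _ = _ := by
        rw [ENNReal.tsum_mul_left, hB, dw, ofReal_mul (by positivity)]; ring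

lemma UpCone.mono {N N' : Set (Eucl d)} {e : Eucl d} {c h h' : ℝ} (H : UpCone Ω N e c h)
    (hN : N' ⊆ N) (hh : h' ≤ h) : UpCone Ω N' e c h' :=
  fun y hy t ht hth => H y ⟨hy.1, hN hy.2⟩ t ht (hth.trans hh)

/-- `Ω` contains the infinite cones with axis `e` and vertices in `Ω`. -/
structure ConeDomain (Ω : Set (Eucl d)) (e : Eucl d) (c : ℝ) : Prop where
  norm_le : ‖e‖ ≤ 1
  pos : 0 < c
  le_one : c ≤ 1
  cone : ∀ h, UpCone Ω Set.univ e c h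

/-- The boundary of `Ω` is covered by finitely many bounded open sets, around each of which `Ω`
contains the truncated cones of some fixed axis. -/
structure ConeCover (Ω : Set (Eucl d)) {N : ℕ} (W : Fin N → Set (Eucl d)) (e : Fin N → Eucl d)
    (c h D : ℝ) : Prop where
  isOpen : ∀ i, IsOpen (W i)
  subset_ball : ∀ i, W i ⊆ ball 0 D
  cover : ∀ x, bdist Ω x < h → ∃ i, x ∈ W i
  norm_le : ∀ i, ‖e i‖ ≤ 1
  cone : ∀ i, UpCone Ω (thickening h (W i)) (e i) c h
  c_pos : 0 < c
  c_le_one : c ≤ 1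
  h_pos : 0 < h
  D_pos : 0 < D

lemma ConeDomain.hasLayerVolume (hΩ : IsOpen Ω) (hne : (frontier Ω).Nonempty) {e : Eucl d} {c : ℝ}
    (H : ConeDomain Ω e c) : HasLayerVolume Ω := by
  have hc := H.pos
  refine ⟨(ofReal (2 ^ d / c) * volume (ball (0 : Eucl d) 1)).toNNReal, fun z s R hs hsR => ?_⟩
  have hV : volume (ball (0 : Eucl d) 1) ≠ ∞ := measure_ball_lt_top.ne
  rw [coe_toNNReal (by finiteness)]
  have := volume_layer_le hΩ hne isOpen_univ H.norm_le hc (by linarith : 0 < R) (H.cone R)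
    (z := z) hs le_rfl
  rw [Set.inter_univ, ofReal_mul (by positivity)] at this
  refine this.trans (le_of_eq ?_)
  ring

lemma ConeCover.frontier_subset {N : ℕ} {W : Fin N → Set (Eucl d)}
    {e : Fin N → Eucl d} {c h D : ℝ} (H : ConeCover Ω W e c h D) : frontier Ω ⊆ ball 0 D := by
  intro z hz
  obtain ⟨i, hi⟩ := H.cover z (by rw [bdist, infDist_zero_of_mem hz]; exact H.h_pos)
  exact H.subset_ball i hi

lemma ConeCover.norm_lt {N : ℕ} {W : Fin N → Set (Eucl d)} {e : Fin N → Eucl d} {c h D : ℝ}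
    (hne : (frontier Ω).Nonempty) (H : ConeCover Ω W e c h D) {s : ℝ} (hx : bdist Ω x < s) :
    ‖x‖ < D + s := by
  obtain ⟨z, hz, hxz⟩ := (infDist_lt_iff hne).1 hx
  have h1 := H.frontier_subset hz
  rw [mem_ball_zero_iff] at h1
  have := norm_sub_le_dist x z
  linarith

lemma ConeCover.hasLayerVolume (hd : 0 < d) (hΩ : IsOpen Ω) (hne : (frontier Ω).Nonempty) {N : ℕ}
    {W : Fin N → Set (Eucl d)} {e : Fin N → Eucl d} {c h D : ℝ} (H : ConeCover Ω W e c h D) :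
    HasLayerVolume Ω := by
  obtain ⟨n, rfl⟩ : ∃ n, d = n + 1 := ⟨d - 1, by omega⟩
  have hc := H.c_pos
  have hh := H.h_pos
  have hD := H.D_pos
  set V := volume (ball (0 : Eucl (n + 1)) 1)
  have hVt : V ≠ ∞ := measure_ball_lt_top.ne
  set C₁ : ℝ := (D / h + 1) ^ (n + 1)
  set C₂ : ℝ := 2 ^ (n + 1) / c * (1 + ((D + h) / h) ^ (n + 1)) with hC₂
  have hC₁0 : 0 ≤ C₁ := by positivity
  have hC₂0 : 0 ≤ C₂ := by positivity
  refine ⟨(ofReal (C₁ + N * C₂) * V).toNNReal, fun z s R hs hsR => ?_⟩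
  have hR : 0 < R := by linarith
  rw [coe_toNNReal (by finiteness)]
  rcases le_or_gt h s with hhs | hhs
  · calc volume (Ω ∩ ball z R ∩ {x | bdist Ω x < s})
        ≤ volume (ball (0 : Eucl (n + 1)) (D + s)) := measure_mono fun x hx => by
          rw [mem_ball_zero_iff]; exact H.norm_lt hne hx.2
      _ = ofReal ((D + s) ^ (n + 1)) * V := volume_ball_eq _ (by positivity)
      _ ≤ ofReal ((C₁ + N * C₂) * (s / R * R ^ (n + 1))) * V := by
          gcongr
          calc (D + s) ^ (n + 1) ≤ ((D / h + 1) * s) ^ (n + 1) := by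
                gcongr
                rw [add_mul, one_mul]
                gcongr
                calc D = D / h * h := by field_simp
                  _ ≤ D / h * s := by gcongr
            _ = C₁ * (s * s ^ n) := by rw [mul_pow, pow_succ' s]
            _ ≤ (C₁ + N * C₂) * (s * R ^ n) := by
                gcongr
                have : (0 : ℝ) ≤ N * C₂ := by positivity
                linarith
            _ = _ := by rw [pow_succ]; field_simp
      _ = _ := by rw [ofReal_mul (by positivity)]; ring
  · have key : ∀ i, volume (Ω ∩ W i ∩ ball z R ∩ {x | bdist Ω x < s}) ≤
        ofReal (C₂ * (s / R * R ^ (n + 1))) * V := by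
      intro i
      have hcone : ∀ h' ≤ h, UpCone Ω (W i) (e i) c h' := fun h' h'' =>
        (H.cone i).mono (self_subset_thickening hh _) h''
      rcases le_or_gt R h with hRh | hRh
      · refine (volume_layer_le hΩ hne (H.isOpen i) (H.norm_le i) hc hR (hcone R hRh) hs
          le_rfl).trans ?_
        gcongr ofReal ?_ * _
        rw [hC₂, mul_assoc]
        gcongr 2 ^ (n + 1) / c * ?_
        have : 0 ≤ ((D + h) / h) ^ (n + 1) * (s / R * R ^ (n + 1)) := by positivity
        linarith
      · calc _ ≤ volume (Ω ∩ W i ∩ ball 0 (D + h) ∩ {x | bdist Ω x < s}) :=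
              measure_mono fun x hx => ⟨⟨hx.1.1, ball_subset_ball (by linarith)
                (H.subset_ball i hx.1.1.2)⟩, hx.2⟩
          _ ≤ ofReal (2 ^ (n + 1) / c * (s / h * (D + h) ^ (n + 1))) * V :=
              volume_layer_le hΩ hne (H.isOpen i) (H.norm_le i) hc hh (hcone h le_rfl) hs
                (by linarith)
          _ ≤ _ := by
              gcongr ofReal ?_ * _
              rw [hC₂, mul_assoc]
              gcongr 2 ^ (n + 1) / c * ?_
              calc s / h * (D + h) ^ (n + 1) = ((D + h) / h) ^ (n + 1) * (s * h ^ n) := by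
                    rw [div_pow]; field_simp; ring
                _ ≤ (1 + ((D + h) / h) ^ (n + 1)) * (s * R ^ n) := by gcongr; linarith
                _ = _ := by rw [pow_succ R]; field_simp
    calc volume (Ω ∩ ball z R ∩ {x | bdist Ω x < s})
        ≤ volume (⋃ i, Ω ∩ W i ∩ ball z R ∩ {x | bdist Ω x < s}) := measure_mono fun x hx => by
          obtain ⟨i, hi⟩ := H.cover x (lt_trans hx.2 hhs)
          exact Set.mem_iUnion.2 ⟨i, ⟨⟨hx.1.1, hi⟩, hx.1.2⟩, hx.2⟩
      _ ≤ ∑ i, volume (Ω ∩ W i ∩ ball z R ∩ {x | bdist Ω x < s}) := measure_iUnion_fintype_le _ _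
      _ ≤ ∑ _i : Fin N, ofReal (C₂ * (s / R * R ^ (n + 1))) * V :=
          sum_le_sum fun i _ => key i
      _ = ofReal (N * C₂ * (s / R * R ^ (n + 1))) * V := by
          rw [Finset.sum_const, Finset.card_univ, Fintype.card_fin, nsmul_eq_mul, ← mul_assoc,
            ← ofReal_natCast, ← ofReal_mul (by positivity), mul_assoc (N : ℝ)]
      _ ≤ ofReal ((C₁ + N * C₂) * (s / R * R ^ (n + 1))) * V := by
          gcongr; linarith
      _ = _ := by rw [ofReal_mul (by positivity)]; ring

/-! ### Graph coordinates -/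

section Graph

variable {n : ℕ}

/-- Orthonormal coordinates `(x', t)`. -/
abbrev Coord (n : ℕ) :=
  EuclideanSpace ℝ (Fin (n + 1)) ≃ᵃⁱ[ℝ] WithLp 2 (EuclideanSpace ℝ (Fin n) × ℝ)

/-- The direction of the `t`-axis. -/
def upVec (e : Coord n) : Eucl (n + 1) := e.linearIsometryEquiv.symm (WithLp.toLp 2 (0, 1))

lemma norm_upVec (e : Coord n) : ‖upVec e‖ = 1 := by
  rw [upVec, LinearIsometryEquiv.norm_map, WithLp.norm_toLp_snd]; simp

lemma coord_add_smul (e : Coord n) (x : Eucl (n + 1)) (t : ℝ) :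
    e (x + t • upVec e) = e x + t • WithLp.toLp 2 (0, 1) := by
  have := e.map_vadd x (t • upVec e)
  rw [vadd_eq_add, vadd_eq_add, map_smul, upVec, LinearIsometryEquiv.apply_symm_apply] at this
  rw [add_comm x, add_comm (e x)]
  exact this

lemma fst_add_smul (e : Coord n) (x : Eucl (n + 1)) (t : ℝ) :
    (e (x + t • upVec e)).fst = (e x).fst := by
  rw [coord_add_smul]; simp

lemma snd_add_smul (e : Coord n) (x : Eucl (n + 1)) (t : ℝ) :
    (e (x + t • upVec e)).snd = (e x).snd + t := by
  rw [coord_add_smul]; simp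

lemma dist_fst_le (e : Coord n) (x y : Eucl (n + 1)) : dist (e x).fst (e y).fst ≤ dist x y := by
  rw [← e.dist_map x y]; exact WithLp.dist_fst_le _ _

lemma dist_snd_le (e : Coord n) (x y : Eucl (n + 1)) : |(e x).snd - (e y).snd| ≤ dist x y := by
  rw [← e.dist_map x y, ← Real.dist_eq]; exact WithLp.dist_snd_le _ _

lemma dist_le_fst_add_snd (e : Coord n) (x y : Eucl (n + 1)) :
    dist x y ≤ dist (e x).fst (e y).fst + |(e x).snd - (e y).snd| := by
  rw [← e.dist_map x y, WithLp.prod_dist_eq_of_L2, ← Real.dist_eq]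
  apply Real.sqrt_le_iff.2
  constructor
  · positivity
  · nlinarith [dist_nonneg (x := (e x).fst) (y := (e y).fst), dist_nonneg (x := (e x).snd) (y := (e y).snd)]

/-- The height above the graph of `ψ`. -/
def height (e : Coord n) (ψ : Eucl n → ℝ) (x : Eucl (n + 1)) : ℝ := (e x).snd - ψ (e x).fst

lemma mem_graphRegion {e : Coord n} {ψ : Eucl n → ℝ} {x : Eucl (n + 1)} :
    x ∈ graphRegion e ψ ↔ 0 < height e ψ x := by
  rw [height, sub_pos]; rfl

lemma height_add_smul (e : Coord n) (ψ : Eucl n → ℝ) (x : Eucl (n + 1)) (t : ℝ) :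
    height e ψ (x + t • upVec e) = height e ψ x + t := by
  rw [height, height, fst_add_smul, snd_add_smul]; ring

lemma height_le_add {ψ : Eucl n → ℝ} {M : ℝ≥0} (hψ : LipschitzWith M ψ) (e : Coord n)
    (x y : Eucl (n + 1)) : height e ψ x ≤ height e ψ y + (1 + M) * dist x y := by
  have h1 := hψ.dist_le_mul (e x).fst (e y).fst
  have h2 := dist_fst_le e x y
  have h3 := dist_snd_le e x y
  have h4 : (M : ℝ) * dist (e x).fst (e y).fst ≤ M * dist x y := by gcongr
  rw [Real.dist_eq] at h1
  rw [height, height]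
  have := abs_le.1 h3
  have := abs_le.1 (h1.trans h4)
  linarith

/-- In the open set `Q`, the set `Ω` is a Lipschitz graph domain. -/
structure IsChart (Ω : Set (Eucl (n + 1))) (e : Coord n) (ψ : Eucl n → ℝ) (M : ℝ≥0)
    (Q : Set (Eucl (n + 1))) : Prop where
  lip : LipschitzWith M ψ
  inter_eq : Q ∩ Ω = Q ∩ graphRegion e ψ

variable {Ω : Set (Eucl (n + 1))} {e : Coord n} {ψ : Eucl n → ℝ} {M : ℝ≥0} {Q : Set (Eucl (n + 1))}

lemma IsChart.mem_iff (H : IsChart Ω e ψ M Q) {x : Eucl (n + 1)} (hx : x ∈ Q) :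
    x ∈ Ω ↔ 0 < height e ψ x := by
  rw [← mem_graphRegion]
  have := Set.ext_iff.1 H.inter_eq x
  simpa [hx] using this

lemma IsChart.upCone (H : IsChart Ω e ψ M Q) {N : Set (Eucl (n + 1))} {h : ℝ}
    (hN : ∀ y ∈ N, ball y (2 * h) ⊆ Q) : UpCone Ω N (upVec e) (1 / (1 + M)) h := by
  intro y hy t ht hth z hz
  have hM : (0 : ℝ) < 1 + M := by positivity
  rw [mem_ball] at hz
  have hyt : dist (y + t • upVec e) y = t := by
    rw [dist_self_add_left, norm_smul, norm_upVec, norm_of_nonneg ht.le, mul_one]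
  have h1 : 1 / (1 + M) * t ≤ t := by
    rw [one_div, inv_mul_le_iff₀ hM]
    nlinarith [M.coe_nonneg]
  have hzQ : z ∈ Q := by
    refine hN y hy.2 ?_
    rw [mem_ball]
    linarith [dist_triangle z (y + t • upVec e) y]
  rw [H.mem_iff hzQ]
  have hyQ : y ∈ Q := hN y hy.2 (mem_ball_self (by linarith))
  have h2 := (H.mem_iff hyQ).1 hy.1
  have h3 := height_le_add H.lip e (y + t • upVec e) z
  rw [height_add_smul] at h3
  rw [dist_comm, one_div, ← div_eq_inv_mul, lt_div_iff₀ hM] at hz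
  nlinarith

/-- The height is comparable to the distance to the boundary. -/
lemma IsChart.height_lt (hΩ : IsOpen Ω) (hne : (frontier Ω).Nonempty) (H : IsChart Ω e ψ M Q)
    {x : Eucl (n + 1)} (hr : bdist Ω x < r) (hQ : ball x r ⊆ Q) : height e ψ x < (1 + M) * r := by
  obtain ⟨z, hz, hxz⟩ := (infDist_lt_iff hne).1 hr
  have hzQ : z ∈ Q := hQ (by rwa [mem_ball, dist_comm])
  have hzΩ : z ∉ Ω := fun h => by
    rw [hΩ.frontier_eq] at hz; exact hz.2 h
  rw [H.mem_iff hzQ, not_lt] at hzΩ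
  have h1 := height_le_add H.lip e x z
  have : (1 + M : ℝ) * dist x z < (1 + M) * r := by gcongr
  linarith

lemma continuous_height (e : Coord n) {ψ : Eucl n → ℝ} (hψ : Continuous ψ) :
    Continuous (height e ψ) := by
  unfold height
  have h1 : Continuous fun x => (e x).fst := (WithLp.continuous_fst 2 _ _).comp e.continuous
  have h2 : Continuous fun x => (e x).snd := (WithLp.continuous_snd 2 _ _).comp e.continuous
  exact h2.sub (hψ.comp h1)

lemma IsChart.mem_frontier (hΩ : IsOpen Ω) (hQ : IsOpen Q) (H : IsChart Ω e ψ M Q)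
    {x : Eucl (n + 1)} (hx : x ∈ Q) (h0 : height e ψ x = 0) : x ∈ frontier Ω := by
  rw [hΩ.frontier_eq]
  refine ⟨?_, by rw [H.mem_iff hx]; linarith⟩
  have h1 : Tendsto (fun t : ℝ => x + t • upVec e) (𝓝[>] 0) (𝓝 x) := by
    have : Continuous fun t : ℝ => x + t • upVec e := by fun_prop
    have := (this.tendsto 0).mono_left (nhdsWithin_le_nhds (s := Set.Ioi 0))
    simpa using this
  refine mem_closure_of_tendsto h1 ?_
  filter_upwards [h1.eventually_mem (hQ.mem_nhds hx), self_mem_nhdsWithin] with t ht ht0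
  rw [H.mem_iff ht, height_add_smul, h0, zero_add]
  exact ht0

lemma isChart_graphRegion {e : Coord n} {ψ : Eucl n → ℝ} {M : ℝ≥0} (hψ : LipschitzWith M ψ) :
    IsChart (graphRegion e ψ) e ψ M Set.univ := ⟨hψ, rfl⟩

lemma isOpen_graphRegion {e : Coord n} {ψ : Eucl n → ℝ} (hψ : Continuous ψ) :
    IsOpen (graphRegion e ψ) := by
  have : graphRegion e ψ = {x | 0 < height e ψ x} := by ext x; exact mem_graphRegion
  rw [this]
  exact isOpen_lt continuous_const (continuous_height e hψ)

lemma frontier_graphRegion_nonempty {e : Coord n} {ψ : Eucl n → ℝ} {M : ℝ≥0}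
    (hψ : LipschitzWith M ψ) : (frontier (graphRegion e ψ)).Nonempty :=
  ⟨e.symm (WithLp.toLp 2 (0, ψ 0)), (isChart_graphRegion hψ).mem_frontier
    (isOpen_graphRegion hψ.continuous) isOpen_univ trivial (by simp [height])⟩

lemma coneDomain_graphRegion {e : Coord n} {ψ : Eucl n → ℝ} {M : ℝ≥0}
    (hψ : LipschitzWith M ψ) : ConeDomain (graphRegion e ψ) (upVec e) (1 / (1 + M)) :=
  ⟨(norm_upVec e).le, by positivity, (div_le_one (by positivity)).2 (by simp), fun _ => (isChart_graphRegion hψ).upCone fun _ _ => by simp⟩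

end Graph

/-- The geometric content of a finite system of Lipschitz charts. -/
lemma HasLipschitzCharts.exists_coneCover {n : ℕ} {Ω : Set (Eucl (n + 1))}
    (H : HasLipschitzCharts Ω) (hne : (frontier Ω).Nonempty) :
    ∃ (N : ℕ) (W : Fin N → Set (Eucl (n + 1))) (v : Fin N → Eucl (n + 1)) (M : ℝ≥0) (c h D : ℝ),
      ConeCover Ω W v c h D ∧ ∀ x, bdist Ω x < h → ∃ (e : Coord n) (ψ : Eucl n → ℝ),
        IsChart Ω e ψ M (ball x h) := by
  obtain ⟨r, M, c₀, N, x, ρ, hr, -, hc₀, -, -, hρ, hcov, hch⟩ := H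
  choose e ψ hψ _ hcyl using hch
  have hc₀' : 0 < c₀ := by linarith
  have hrc : 0 < r / c₀ := by positivity
  have hρ0 : ∀ j, 0 < ρ j := fun j => hrc.trans (hρ j).1
  have hchart : ∀ j, IsChart Ω (e j) (ψ j) M (ball (x j) (2 * ρ j)) := by
    intro j
    refine ⟨hψ j, ?_⟩
    have hsub : ball (x j) (2 * ρ j) ⊆
        cylinder (e j) (x j) ((8 + 8 * M) * ρ j) (2 * ρ j) := by
      intro y hy
      rw [mem_ball] at hy
      refine ⟨(dist_fst_le _ _ _).trans_lt hy, (dist_snd_le _ _ _).trans_lt (hy.trans_le ?_)⟩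
      nlinarith [mul_nonneg M.coe_nonneg (hρ0 j).le, hρ0 j]
    rw [← Set.inter_eq_left.2 hsub, Set.inter_assoc, Set.inter_assoc, hcyl j]
  set h := r / c₀ / 8 with hh
  have hh0 : 0 < h := by positivity
  have hhρ : ∀ j, 8 * h < ρ j := fun j => by rw [hh]; linarith [(hρ j).1]
  have hcov' : ∀ y, bdist Ω y < h → ∃ j, y ∈ ball (x j) (ρ j + h) := by
    intro y hy
    obtain ⟨z, hz, hyz⟩ := (infDist_lt_iff hne).1 hy
    obtain ⟨j, hj⟩ := Set.mem_iUnion.1 (hcov hz)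
    refine ⟨j, ?_⟩
    rw [mem_ball] at hj ⊢
    linarith [dist_triangle y z (x j)]
  obtain ⟨D, hD⟩ : ∃ D, ∀ j, ‖x j‖ ≤ D := ⟨∑ j, ‖x j‖, fun j =>
    single_le_sum (f := fun j => ‖x j‖) (fun _ _ => norm_nonneg _) (Finset.mem_univ j)⟩
  refine ⟨N, fun j => ball (x j) (ρ j + h), fun j => upVec (e j), M, 1 / (1 + M), h,
    |D| + c₀ * r + h, ⟨fun _ => isOpen_ball, ?_, hcov', fun j => (norm_upVec _).le, ?_,
      by positivity, (div_le_one (by positivity)).2 (by simp), hh0, by positivity⟩, ?_⟩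
  · intro j y hy
    rw [mem_ball_zero_iff]
    rw [mem_ball, dist_eq_norm] at hy
    linarith [norm_sub_norm_le y (x j), hD j, (hρ j).2, le_abs_self D]
  · intro j
    refine (hchart j).upCone fun y hy => ?_
    obtain ⟨z, hz, hyz⟩ := mem_thickening_iff.1 hy
    refine ball_subset_ball' ?_
    rw [mem_ball] at hz
    linarith [dist_triangle y z (x j), hhρ j]
  · intro y hy
    obtain ⟨j, hj⟩ := hcov' y hy
    refine ⟨e j, ψ j, hψ j, ?_⟩
    have hsub : ball y h ⊆ ball (x j) (2 * ρ j) := by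
      refine ball_subset_ball' ?_
      rw [mem_ball] at hj
      linarith [hhρ j]
    rw [← Set.inter_eq_left.2 hsub, Set.inter_assoc, Set.inter_assoc, (hchart j).inter_eq]

section Coordinates

variable {n : ℕ}

/-! ### Hardy's inequality for functions with vanishing trace -/

/-- The point at height `s` above the point `a` of the base. -/
def graphMap (e : Coord n) (ψ : Eucl n → ℝ) (p : Eucl n × ℝ) : Eucl (n + 1) :=
  e.symm (WithLp.toLp 2 (p.1, ψ p.1 + p.2))

lemma fst_graphMap (e : Coord n) (ψ : Eucl n → ℝ) (p : Eucl n × ℝ) :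
    (e (graphMap e ψ p)).fst = p.1 := by simp [graphMap]

lemma height_graphMap (e : Coord n) (ψ : Eucl n → ℝ) (p : Eucl n × ℝ) :
    height e ψ (graphMap e ψ p) = p.2 := by simp [graphMap, height]

lemma graphMap_eq (e : Coord n) (ψ : Eucl n → ℝ) (x : Eucl (n + 1)) :
    graphMap e ψ ((e x).fst, height e ψ x) = x := by
  rw [graphMap, AffineIsometryEquiv.symm_apply_eq, height]
  simp only [add_sub_cancel]
  rfl

lemma graphMap_eq_add (e : Coord n) (ψ : Eucl n → ℝ) (a : Eucl n) (s : ℝ) :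
    graphMap e ψ (a, s) = graphMap e ψ (a, 0) + s • upVec e := by
  have := graphMap_eq e ψ (graphMap e ψ (a, 0) + s • upVec e)
  rw [fst_add_smul, height_add_smul, fst_graphMap, height_graphMap, zero_add] at this
  exact this

lemma measurePreserving_graphMap (e : Coord n) {ψ : Eucl n → ℝ} (hψ : Continuous ψ) :
    MeasurePreserving (graphMap e ψ) := by
  have h1 : MeasurePreserving (fun p : Eucl n × ℝ => (p.1, ψ p.1 + p.2)) :=
    (MeasurePreserving.id (volume : Measure (Eucl n))).skew_product
      (g := fun a s => ψ a + s) (by unfold Function.uncurry; fun_prop)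
      (Eventually.of_forall fun a => (measurePreserving_add_left volume (ψ a)).map_eq)
  have h2 : MeasurePreserving (fun p : WithLp 2 (Eucl n × ℝ) => e.symm p) := by
    have h3 : (fun p : WithLp 2 (Eucl n × ℝ) => e.symm p) =
        fun p => e.symm.linearIsometryEquiv p + e.symm 0 := by
      funext p
      have := e.symm.map_vadd 0 p
      simpa using this
    rw [h3]
    exact (measurePreserving_add_right volume (e.symm 0)).comp
      e.symm.linearIsometryEquiv.measurePreserving
  exact h2.comp ((WithLp.volume_preserving_toLp (Eucl n) ℝ).comp h1)

/-- Projection along the `t`-axis does not increase surface measure. -/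
lemma setLIntegral_graphMap_le (e : Coord n) {ψ : Eucl n → ℝ} (hψ : Continuous ψ)
    {A : Set (Eucl n)} (hA : MeasurableSet A) {g : Eucl (n + 1) → ℝ≥0∞} (hg : Measurable g) :
    ∫⁻ a in A, g (graphMap e ψ (a, 0)) ≤
      ∫⁻ y in {y | (e y).fst ∈ A ∧ height e ψ y = 0}, g y ∂μHE[n] := by
  set Γ := {y : Eucl (n + 1) | (e y).fst ∈ A ∧ height e ψ y = 0}
  have hπc : Continuous fun y : Eucl (n + 1) => (e y).fst :=
    (WithLp.continuous_fst 2 _ _).comp e.continuous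
  have hΓm : MeasurableSet Γ := (hπc.measurable hA).inter
    (isClosed_eq (continuous_height e hψ) continuous_const).measurableSet
  have hπ : LipschitzWith 1 fun y : Eucl (n + 1) => (e y).fst :=
    LipschitzWith.of_dist_le_mul fun x y => by simpa using dist_fst_le e x y
  have himg : ∀ X : Set (Eucl (n + 1)),
      volume ((fun y : Eucl (n + 1) => (e y).fst) '' X) ≤ μHE[n] X := by
    intro X
    rw [← EuclideanSpace.euclideanHausdorffMeasure_eq_volume,
      Measure.euclideanHausdorffMeasure_def, Measure.euclideanHausdorffMeasure_def,
      Measure.smul_apply, Measure.smul_apply]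
    have := hπ.hausdorffMeasure_image_le (d := n) (Nat.cast_nonneg n) X
    simp only [ENNReal.coe_one, ENNReal.one_rpow, one_mul] at this
    gcongr
  have hle : volume.restrict A ≤ (μHE[n].restrict Γ).map (fun y : Eucl (n + 1) => (e y).fst) := by
    refine Measure.le_iff.2 fun E hE => ?_
    rw [Measure.restrict_apply hE, Measure.map_apply hπc.measurable hE,
      Measure.restrict_apply (hπc.measurable hE)]
    refine le_trans (measure_mono ?_) (himg _)
    rintro a ⟨haE, haA⟩
    refine ⟨graphMap e ψ (a, 0), ⟨?_, ?_, height_graphMap e ψ _⟩, fst_graphMap e ψ _⟩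
    · simpa [fst_graphMap] using haE
    · simpa [fst_graphMap] using haA
  have hgm : Measurable fun a => g (graphMap e ψ (a, 0)) :=
    hg.comp ((measurePreserving_graphMap e hψ).measurable.comp (by fun_prop))
  calc ∫⁻ a in A, g (graphMap e ψ (a, 0))
      ≤ ∫⁻ a, g (graphMap e ψ (a, 0)) ∂((μHE[n].restrict Γ).map
          (fun y : Eucl (n + 1) => (e y).fst)) := lintegral_mono' hle le_rfl
    _ = ∫⁻ y in Γ, g (graphMap e ψ ((e y).fst, 0)) ∂μHE[n] := lintegral_map hgm hπc.measurable
    _ = _ := setLIntegral_congr_fun hΓm fun y hy => by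
        have := graphMap_eq e ψ y
        rw [hy.2] at this
        simp only [this]

lemma enorm_fderiv_le_sum {φ : Eucl d → ℂ} (y v : Eucl d) (hv : ‖v‖ ≤ 1) :
    ‖fderiv ℝ φ y v‖ₑ ≤ ∑ i, ‖partialDeriv i φ y‖ₑ := by
  have h1 : fderiv ℝ φ y v = ∑ i, v i • partialDeriv i φ y := by
    have h2 : v = ∑ i, v i • single i (1 : ℝ) := by
      have := (EuclideanSpace.basisFun (Fin d) ℝ).sum_repr v
      simpa using this.symm
    conv_lhs => rw [h2]
    rw [map_sum]
    simp only [map_smul, partialDeriv]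
  rw [h1]
  refine (enorm_sum_le _ _).trans (sum_le_sum fun i _ => ?_)
  rw [enorm_smul]
  refine mul_le_of_le_one_left' ?_
  rw [← ofReal_norm]
  exact ENNReal.ofReal_le_one.2 ((PiLp.norm_apply_le v i).trans hv)

/-- Hardy's inequality in a tube over a graph, with a boundary term. -/
lemma setLIntegral_tube_le (e : Coord n) {ψ : Eucl n → ℝ} (hψ : Continuous ψ)
    {A : Set (Eucl n)} (hA : MeasurableSet A) {H : ℝ} {φ : Eucl (n + 1) → ℂ}
    (hφ : Smooth φ) :
    ∫⁻ y in {y | (e y).fst ∈ A ∧ 0 < height e ψ y ∧ height e ψ y < H}, ‖φ y‖ₑ ≤ ofReal H *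
        ((∫⁻ y in {y | (e y).fst ∈ A ∧ height e ψ y = 0}, ‖φ y‖ₑ ∂μHE[n]) +
        ∑ i, ∫⁻ y in {y | (e y).fst ∈ A ∧ 0 < height e ψ y ∧ height e ψ y < H},
          ‖partialDeriv i φ y‖ₑ) := by
  set S := {y : Eucl (n + 1) | (e y).fst ∈ A ∧ 0 < height e ψ y ∧ height e ψ y < H} with hS
  set G := graphMap e ψ with hG
  have hGp := measurePreserving_graphMap e hψ
  have hπc : Continuous fun y : Eucl (n + 1) => (e y).fst :=
    (WithLp.continuous_fst 2 _ _).comp e.continuous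
  have hhc := continuous_height e hψ
  have hSm : MeasurableSet S := (hπc.measurable hA).inter
    ((isOpen_lt continuous_const hhc).measurableSet.inter
      (isOpen_lt hhc continuous_const).measurableSet)
  have hpre : G ⁻¹' S = A ×ˢ Ioo 0 H := by
    ext p
    simp only [hS, hG, Set.mem_preimage, Set.mem_ofPred_eq, fst_graphMap, height_graphMap,
      Set.mem_prod, Set.mem_Ioo]
  have hrew : ∀ F : Eucl (n + 1) → ℝ≥0∞, Measurable F →
      ∫⁻ y in S, F y = ∫⁻ a in A, ∫⁻ s in Ioo 0 H, F (G (a, s)) := by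
    intro F hF
    rw [← hGp.setLIntegral_comp_preimage hSm hF, hpre, Measure.volume_eq_prod]
    exact setLIntegral_prod (fun p => F (graphMap e ψ p)) (hF.comp hGp.measurable).aemeasurable
  have hφm : Measurable fun y => ‖φ y‖ₑ := hφ.continuous.measurable.enorm
  have hdm : ∀ i, Measurable fun y => ‖partialDeriv i φ y‖ₑ := fun i =>
    (hφ.partialDeriv i).continuous.measurable.enorm
  set F : Eucl (n + 1) → ℝ≥0∞ := fun y => ∑ i, ‖partialDeriv i φ y‖ₑ with hF
  have hFm : Measurable F := Finset.measurable_fun_sum _ fun i _ => hdm i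
  have hFsum : ∑ i, ∫⁻ y in S, ‖partialDeriv i φ y‖ₑ = ∫⁻ y in S, F y :=
    (lintegral_finsetSum _ fun i _ => hdm i).symm
  have hpt : ∀ a s, s ∈ Ioo 0 H →
      ‖φ (G (a, s))‖ₑ ≤ ‖φ (G (a, 0))‖ₑ + ∫⁻ t in Ioo 0 H, F (G (a, t)) := by
    intro a s hs
    set g : ℝ → ℂ := fun t => φ (G (a, 0) + t • upVec e) with hg
    have hgd : ∀ t, HasDerivAt g (fderiv ℝ φ (G (a, t)) (upVec e)) t := by
      intro t
      have h1 : HasDerivAt (fun t : ℝ => G (a, 0) + t • upVec e) (upVec e) t := by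
        simpa using ((hasDerivAt_id t).smul_const (upVec e)).const_add (G (a, 0))
      have h2 : DifferentiableAt ℝ φ (G (a, 0) + t • upVec e) := hφ.differentiable (by simp) _
      rw [hG, graphMap_eq_add e ψ a t]
      exact h2.hasFDerivAt.comp_hasDerivAt t h1
    have hgc : Continuous fun t => fderiv ℝ φ (G (a, t)) (upVec e) := by
      have h1 : Continuous (fderiv ℝ φ) := hφ.continuous_fderiv (by simp)
      have h2 : Continuous fun t : ℝ => G (a, t) := by
        have : (fun t : ℝ => G (a, t)) = fun t => G (a, 0) + t • upVec e := by
          funext t; exact graphMap_eq_add e ψ a t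
        rw [this]; fun_prop
      exact (h1.comp h2).clm_apply continuous_const
    have hInt := intervalIntegral.integral_eq_sub_of_hasDerivAt (a := 0) (b := s)
      (fun t _ => hgd t) (hgc.intervalIntegrable 0 s)
    have e1 : φ (G (a, s)) = φ (G (a, 0)) + ∫ t in (0 : ℝ)..s, fderiv ℝ φ (G (a, t)) (upVec e) := by
      rw [hInt, hg, hG, graphMap_eq_add e ψ a s]
      simp
    rw [e1]
    refine (enorm_add_le _ _).trans ?_
    gcongr
    rw [intervalIntegral.integral_of_le hs.1.le, integral_Ioc_eq_integral_Ioo]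
    refine (enorm_integral_le_lintegral_enorm _).trans ?_
    refine le_trans (lintegral_mono fun t => enorm_fderiv_le_sum _ _ (norm_upVec e).le) ?_
    exact lintegral_mono_set (Set.Ioo_subset_Ioo_right hs.2.le)
  have hvol : volume (Ioo (0 : ℝ) H) = ofReal H := by simp
  have hGm0 : Measurable fun a : Eucl n => ‖φ (G (a, 0))‖ₑ :=
    hφm.comp (hGp.measurable.comp (by fun_prop))
  rw [hFsum, hrew _ hφm, hrew _ hFm]
  calc ∫⁻ a in A, ∫⁻ s in Ioo 0 H, ‖φ (G (a, s))‖ₑ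
      ≤ ∫⁻ a in A, ∫⁻ s in Ioo 0 H, (‖φ (G (a, 0))‖ₑ + ∫⁻ t in Ioo 0 H, F (G (a, t))) :=
        lintegral_mono fun a => setLIntegral_mono' measurableSet_Ioo fun s hs => hpt a s hs
    _ = ∫⁻ a in A, ofReal H * (‖φ (G (a, 0))‖ₑ + ∫⁻ t in Ioo 0 H, F (G (a, t))) := by
        refine lintegral_congr fun a => ?_
        rw [setLIntegral_const, hvol, mul_comm]
    _ = ofReal H * ((∫⁻ a in A, ‖φ (G (a, 0))‖ₑ) +
          ∫⁻ a in A, ∫⁻ t in Ioo 0 H, F (G (a, t))) := by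
        rw [lintegral_const_mul' _ _ ofReal_ne_top, lintegral_add_left hGm0]
    _ ≤ _ := by
        gcongr
        exact setLIntegral_graphMap_le e hψ hA hφm

variable {Ω : Set (Eucl (n + 1))} {e : Coord n} {ψ : Eucl n → ℝ} {M : ℝ≥0} {Q : Set (Eucl (n + 1))}

/-- Hardy's inequality for a function with vanishing trace. -/
lemma HasTrace.setLIntegral_le (hΩ : IsOpen Ω) (hne : (frontier Ω).Nonempty)
    (H : IsChart Ω e ψ M Q) (hQ : IsOpen Q) {x : Eucl (n + 1)} {R : ℝ} (hR : 0 < R)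
    (hx : bdist Ω x < R) (hxQ : ball x (8 * (1 + M) * R) ⊆ Q) {f : Eucl (n + 1) → ℂ}
    (hf : HasTrace Ω f 0) {Df : Fin (n + 1) → Eucl (n + 1) → ℂ}
    (hDf : ∀ i, HasWeakDeriv Ω (Pi.single i 1) f (Df i)) :
    ∫⁻ y in Ω ∩ ball x R, ‖f y‖ₑ ≤ ofReal (2 * (1 + M) * R) *
      ∑ i, ∫⁻ y in Ω ∩ ball x (8 * (1 + M) * R), ‖Df i y‖ₑ := by
  obtain ⟨-, -, Df', hDf', φ, hφ, hlim⟩ := hf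
  have hM : (1 : ℝ) ≤ 1 + M := by simp
  set h₀ : ℝ := 2 * (1 + M) * R with hh₀
  have hh0 : 0 < h₀ := by positivity
  set A := ball (e x).fst R
  set B := Ω ∩ ball x (8 * (1 + M) * R)
  have hBm : MeasurableSet B := hΩ.measurableSet.inter measurableSet_ball
  set S := {y : Eucl (n + 1) | (e y).fst ∈ A ∧ 0 < height e ψ y ∧ height e ψ y < h₀}
  set Γ := {y : Eucl (n + 1) | (e y).fst ∈ A ∧ height e ψ y = 0}
  have hRQ : ball x R ⊆ Q := (ball_subset_ball (by nlinarith)).trans hxQ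
  have hxh : height e ψ x < (1 + M) * R := H.height_lt hΩ hne hx hRQ
  have hxh' : -((1 + M) * R) < height e ψ x := by
    obtain ⟨z, hz, hxz⟩ := (infDist_lt_iff hne).1 hx
    have hz2 : z ∈ closure Ω := frontier_subset_closure hz
    obtain ⟨w, hw, hzw⟩ := Metric.mem_closure_iff.1 hz2 (R - dist x z) (by linarith)
    have hxw : dist w x < R := by
      rw [dist_comm]; linarith [dist_triangle x z w]
    have h1 := (H.mem_iff (hRQ (mem_ball.2 hxw))).1 hw
    have h2 := height_le_add H.lip e w x
    nlinarith
  have hnear : ∀ y, (e y).fst ∈ A → 0 ≤ height e ψ y → height e ψ y < h₀ →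
      y ∈ ball x (8 * (1 + M) * R) := by
    intro y hy h1 h2
    have h3 := dist_le_fst_add_snd e y x
    have h4 := H.lip.dist_le_mul (e y).fst (e x).fst
    rw [Real.dist_eq] at h4
    have hy' : dist (e y).fst (e x).fst < R := hy
    have h5 : (M : ℝ) * dist (e y).fst (e x).fst ≤ M * R := by gcongr
    have h6 := abs_le.1 (h4.trans h5)
    rw [mem_ball]
    rw [height] at h1 h2 hxh hxh'
    have h7 : |(e y).snd - (e x).snd| ≤ h₀ + (1 + M) * R + M * R := by
      rw [abs_le]; constructor <;> nlinarith
    rw [hh₀] at h7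
    nlinarith [M.coe_nonneg, mul_nonneg M.coe_nonneg hR.le]
  have hSB : S ⊆ B := fun y hy => by
    have h1 := hnear y hy.1 hy.2.1.le hy.2.2
    exact ⟨(H.mem_iff (hxQ h1)).2 hy.2.1, h1⟩
  have hBS : Ω ∩ ball x R ⊆ S := fun y hy => by
    have h1 : dist y x < R := hy.2
    refine ⟨(dist_fst_le e y x).trans_lt h1, (H.mem_iff (hRQ hy.2)).1 hy.1, ?_⟩
    have h2 := height_le_add H.lip e y x
    have h3 : (1 + M : ℝ) * dist y x < (1 + M) * R := by gcongr
    rw [hh₀]; linarith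
  set R' : ℝ := ‖x‖ + 8 * (1 + M) * R with hR'
  have hR'0 : 0 < R' := by positivity
  have hballR' : ball x (8 * (1 + M) * R) ⊆ ball 0 R' := by
    refine ball_subset_ball' ?_
    rw [dist_zero_right, hR', add_comm]
  have hΓB : Γ ⊆ frontier Ω ∩ ball 0 R' := fun y hy => by
    have h1 := hnear y hy.1 hy.2.ge (by rw [hy.2]; exact hh0)
    exact ⟨H.mem_frontier hΩ hQ (hxQ h1) hy.2, hballR' h1⟩
  obtain ⟨l1, l2, l3⟩ := hlim R' hR'0
  have hDfe : ∀ i, ∫⁻ y in B, ‖Df' i y‖ₑ = ∫⁻ y in B, ‖Df i y‖ₑ := fun i => by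
    refine lintegral_congr_ae ?_
    have h1 := ae_mono (Measure.restrict_mono_set volume (Set.inter_subset_left : B ⊆ Ω))
      ((hDf' i).ae_eq hΩ (hDf i))
    filter_upwards [h1] with y hy
    rw [hy]
  have hDm : ∀ i, AEMeasurable (fun y => ‖Df' i y‖ₑ) (volume.restrict B) := fun i =>
    ((hDf' i).1.aestronglyMeasurable.mono_measure
      (Measure.restrict_mono_set volume Set.inter_subset_left)).enorm
  have hBR : B ⊆ Ω ∩ ball 0 R' := Set.inter_subset_inter_right _ hballR'
  have hbound : ∀ j, ∫⁻ y in Ω ∩ ball x R, ‖f y‖ₑ ≤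
      (∫⁻ y in Ω ∩ ball 0 R', ‖φ j y - f y‖ₑ) + ofReal h₀ *
      ((∫⁻ y in frontier Ω ∩ ball 0 R', ‖φ j y - (0 : Eucl (n + 1) → ℂ) y‖ₑ ∂μHE[n]) +
        ∑ i, ((∫⁻ y in Ω ∩ ball 0 R', ‖partialDeriv i (φ j) y - Df' i y‖ₑ) +
          ∫⁻ y in B, ‖Df i y‖ₑ)) := by
    intro j
    have hφj : Smooth (φ j) := (hφ j).1
    have hφm : Measurable fun y => ‖φ j y‖ₑ := hφj.continuous.measurable.enorm
    calc ∫⁻ y in Ω ∩ ball x R, ‖f y‖ₑ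
        ≤ ∫⁻ y in Ω ∩ ball x R, (‖φ j y - f y‖ₑ + ‖φ j y‖ₑ) := lintegral_mono fun y => by
          calc ‖f y‖ₑ = ‖φ j y - (φ j y - f y)‖ₑ := by rw [sub_sub_cancel]
            _ ≤ ‖φ j y‖ₑ + ‖φ j y - f y‖ₑ := enorm_sub_le
            _ = _ := add_comm _ _
      _ = (∫⁻ y in Ω ∩ ball x R, ‖φ j y - f y‖ₑ) + ∫⁻ y in Ω ∩ ball x R, ‖φ j y‖ₑ :=
          lintegral_add_right _ hφm
      _ ≤ (∫⁻ y in Ω ∩ ball 0 R', ‖φ j y - f y‖ₑ) + ∫⁻ y in S, ‖φ j y‖ₑ := by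
          refine add_le_add (lintegral_mono_set ((hBS.trans hSB).trans hBR))
            (lintegral_mono_set hBS)
      _ ≤ (∫⁻ y in Ω ∩ ball 0 R', ‖φ j y - f y‖ₑ) + ofReal h₀ *
          ((∫⁻ y in Γ, ‖φ j y‖ₑ ∂μHE[n]) + ∑ i, ∫⁻ y in S, ‖partialDeriv i (φ j) y‖ₑ) := by
          gcongr
          exact setLIntegral_tube_le e H.lip.continuous measurableSet_ball hφj
      _ ≤ _ := by
          refine add_le_add le_rfl (mul_le_mul_right (add_le_add ?_
            (sum_le_sum fun i _ => ?_)) _)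
          · simp only [Pi.zero_apply, sub_zero]
            exact lintegral_mono_set hΓB
          · calc ∫⁻ y in S, ‖partialDeriv i (φ j) y‖ₑ
                ≤ ∫⁻ y in B, ‖partialDeriv i (φ j) y‖ₑ := lintegral_mono_set hSB
              _ ≤ ∫⁻ y in B, (‖partialDeriv i (φ j) y - Df' i y‖ₑ + ‖Df' i y‖ₑ) :=
                  lintegral_mono fun y => by
                    simpa using enorm_add_le (partialDeriv i (φ j) y - Df' i y) (Df' i y)
              _ = (∫⁻ y in B, ‖partialDeriv i (φ j) y - Df' i y‖ₑ) + ∫⁻ y in B, ‖Df' i y‖ₑ :=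
                  lintegral_add_right' _ (hDm i)
              _ ≤ _ := by
                  rw [hDfe]
                  exact add_le_add (lintegral_mono_set hBR) le_rfl
  refine ge_of_tendsto' (x := atTop) ?_ hbound
  have hlim2 : Tendsto (fun j => ∑ i, ((∫⁻ y in Ω ∩ ball 0 R', ‖partialDeriv i (φ j) y - Df' i y‖ₑ) +
          ∫⁻ y in B, ‖Df i y‖ₑ)) atTop (𝓝 (∑ i, (0 + ∫⁻ y in B, ‖Df i y‖ₑ))) :=
    tendsto_finsetSum _ fun i _ => (l2 i).add tendsto_const_nhds
  simpa using l1.add (ENNReal.Tendsto.const_mul (l3.add hlim2) (Or.inr (ofReal_ne_top (r := h₀))))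

lemma IsJet.hasWeakDeriv_single {Ω : Set (Eucl d)} (hD : IsJet Ω m u D)
    (hγ : ∑ i, γ i < m) (i : Fin d) :
    HasWeakDeriv Ω (Pi.single i 1) (weakDeriv Ω γ u) (D (γ + Pi.single i 1)) := by
  have h1 := hD.2 (γ + Pi.single i 1) (by rw [sum_add_single]; omega)
  have h2 := hasWeakDeriv_weakDeriv ⟨_, hD.2 γ hγ.le⟩
  refine ⟨h1.1, fun φ hφ => ?_⟩
  have e1 : mixedDeriv (Pi.single i 1) φ = partialDeriv i φ := by
    have := mixedDeriv_add_single (f := φ) hφ.1.1 0 i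
    rwa [zero_add, mixedDeriv_zero] at this
  have h3 := h2.2 (partialDeriv i φ) (hφ.partialDeriv i)
  have h4 := h1.2 φ hφ
  rw [mixedDeriv_partialDeriv hφ.1.1, h4, sum_add_single] at h3
  rw [e1]
  have h6 : ∑ j, (Pi.single i 1 : Fin d → ℕ) j = 1 := by simp
  rw [h6, pow_one]
  set s := ∑ j, γ j
  have h5 : ((-1 : ℂ) ^ s) * (-1) ^ s = 1 := by
    rw [← mul_pow]; simp
  rw [pow_succ] at h3
  linear_combination -((-1 : ℂ) ^ s) * h3 - ((∫ x in Ω, D (γ + Pi.single i 1) x * φ x) +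
      ∫ x in Ω, weakDeriv Ω γ u x * partialDeriv i φ x) * h5

lemma exists_iterated_hardy (n : ℕ) (M : ℝ≥0) (j : ℕ) : ∃ C : ℝ, 0 ≤ C ∧
    ∀ (Ω : Set (Eucl (n + 1))), IsOpen Ω → (frontier Ω).Nonempty → ∀ (e : Coord n)
      (ψ : Eucl n → ℝ) (Q : Set (Eucl (n + 1))), IsOpen Q → IsChart Ω e ψ M Q →
    ∀ (m : ℕ) (u : Eucl (n + 1) → ℂ) (D : (Fin (n + 1) → ℕ) → Eucl (n + 1) → ℂ), IsJet Ω m u D →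
      (∀ k < m, HasTraceArray k Ω u 0) → ∀ f : Eucl (n + 1) → ℝ≥0∞,
      (∀ γ ∈ multiIndices (n + 1) m, ∀ y, ‖D γ y‖ₑ ≤ f y) →
    ∀ γ : Fin (n + 1) → ℕ, ∑ i, γ i + j = m → ∀ (x : Eucl (n + 1)) (R : ℝ), 0 < R →
      bdist Ω x < R → ball x ((8 * (1 + M)) ^ j * R) ⊆ Q →
      ∫⁻ y in Ω ∩ ball x R, ‖D γ y‖ₑ ≤ ofReal (C * R ^ j) *
        ∫⁻ y in Ω ∩ ball x ((8 * (1 + M)) ^ j * R), f y := by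
  induction j with
  | zero =>
    refine ⟨1, zero_le_one, ?_⟩
    intro Ω _ _ e ψ Q _ _ m u D _ _ f hf γ hγ x R _ _ _
    simp only [pow_zero, mul_one, one_mul, ofReal_one]
    exact lintegral_mono fun y => hf γ (mem_multiIndices.2 (by omega)) y
  | succ j ih =>
    obtain ⟨C, hC0, hC⟩ := ih
    set K : ℝ := 8 * (1 + M) with hK
    have hK1 : 1 ≤ K := by rw [hK]; nlinarith [M.coe_nonneg]
    refine ⟨2 * (1 + M) * (n + 1) * C * K ^ j, by positivity, ?_⟩
    intro Ω hΩ hne e ψ Q hQ H m u D hD htr f hf γ hγ x R hR hx hxQ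
    have hγm : ∑ i, γ i < m := by omega
    have hKR : 0 < K * R := by positivity
    have hKj : K ^ (j + 1) * R = K ^ j * (K * R) := by rw [pow_succ]; ring
    have htr' := htr (∑ i, γ i) hγm γ (mem_multiIndices.2 rfl)
    have h1 := htr'.setLIntegral_le hΩ hne H hQ hR hx ((ball_subset_ball (by
        rw [← hK, hKj]; exact le_mul_of_one_le_left hKR.le (one_le_pow₀ hK1))).trans hxQ)
      (fun i => hD.hasWeakDeriv_single hγm i)
    rw [← hK] at h1
    have e1 : ∫⁻ y in Ω ∩ ball x R, ‖D γ y‖ₑ = ∫⁻ y in Ω ∩ ball x R, ‖weakDeriv Ω γ u y‖ₑ := by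
      refine lintegral_congr_ae ?_
      have := ae_mono (Measure.restrict_mono_set volume
        (Set.inter_subset_left : Ω ∩ ball x R ⊆ Ω)) (hD.weakDeriv_ae_eq hΩ hγm.le)
      filter_upwards [this] with y hy
      rw [hy]
    rw [e1]
    refine h1.trans ?_
    have h2 : ∀ i, ∫⁻ y in Ω ∩ ball x (K * R), ‖D (γ + Pi.single i 1) y‖ₑ ≤
        ofReal (C * (K * R) ^ j) * ∫⁻ y in Ω ∩ ball x (K ^ (j + 1) * R), f y := by
      intro i
      have := hC Ω hΩ hne e ψ Q hQ H m u D hD htr f hf (γ + Pi.single i 1)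
        (by rw [sum_add_single]; omega) x (K * R) hKR (by nlinarith) (by rw [← hKj]; exact hxQ)
      rwa [← hKj] at this
    refine (mul_le_mul_right (sum_le_sum fun i _ => h2 i) _).trans (le_of_eq ?_)
    rw [Finset.sum_const, Finset.card_univ, Fintype.card_fin, nsmul_eq_mul, ← mul_assoc,
      ← mul_assoc, ← ofReal_natCast, ← ofReal_mul (by positivity),
      ← ofReal_mul (by positivity)]
    congr 2
    push_cast
    ring

/-- The derivatives of lower order, near `x`, are controlled by the derivatives of order `m`. -/
def HardyAt (Ω : Set (Eucl d)) (m : ℕ) (D : Jet d)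
    (f : Eucl d → ℝ≥0∞) (C P : ℝ) (x : Eucl d) : Prop :=
  ∀ γ : Fin d → ℕ, ∑ i, γ i ≤ m → ∫⁻ y in Ω ∩ ball x (2 * bdist Ω x), ‖D γ y‖ₑ ≤
    ofReal (C * bdist Ω x ^ (m - ∑ i, γ i)) * ∫⁻ y in Ω ∩ ball x (P * bdist Ω x), f y

lemma exists_hardyAt (n m : ℕ) (M : ℝ≥0) : ∃ C P : ℝ, 0 ≤ C ∧ 0 < P ∧
    ∀ (Ω : Set (Eucl (n + 1))), IsOpen Ω → (frontier Ω).Nonempty → ∀ (e : Coord n)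
      (ψ : Eucl n → ℝ) (Q : Set (Eucl (n + 1))), IsOpen Q → IsChart Ω e ψ M Q →
    ∀ (u : Eucl (n + 1) → ℂ) (D : (Fin (n + 1) → ℕ) → Eucl (n + 1) → ℂ), IsJet Ω m u D →
      (∀ k < m, HasTraceArray k Ω u 0) → ∀ f : Eucl (n + 1) → ℝ≥0∞,
      (∀ γ ∈ multiIndices (n + 1) m, ∀ y, ‖D γ y‖ₑ ≤ f y) →
    ∀ x ∈ Ω, ball x (P * bdist Ω x) ⊆ Q → HardyAt Ω m D f C P x := by
  choose C hC0 hC using exists_iterated_hardy n M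
  set K : ℝ := 8 * (1 + M) with hK
  have hK1 : 1 ≤ K := by rw [hK]; nlinarith [M.coe_nonneg]
  refine ⟨∑ j ∈ Finset.range (m + 1), C j * 2 ^ j, 2 * K ^ m,
    Finset.sum_nonneg fun j _ => mul_nonneg (hC0 j) (by positivity), by positivity, ?_⟩
  intro Ω hΩ hne e ψ Q hQ H u D hD htr f hf x hx hxQ γ hγ
  have hx0 := bdist_pos hΩ hne hx
  set j := m - ∑ i, γ i
  have hsub : ball x (K ^ j * (2 * bdist Ω x)) ⊆ ball x (2 * K ^ m * bdist Ω x) := by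
    refine ball_subset_ball ?_
    have : K ^ j ≤ K ^ m := pow_le_pow_right₀ hK1 (by omega)
    nlinarith
  refine (hC j Ω hΩ hne e ψ Q hQ H m u D hD htr f hf γ (by omega) x (2 * bdist Ω x)
    (by positivity) (by linarith) (hsub.trans hxQ)).trans ?_
  refine mul_le_mul' (ofReal_le_ofReal ?_)
    (lintegral_mono_set (Set.inter_subset_inter_right _ hsub))
  rw [mul_pow, ← mul_assoc]
  gcongr
  exact single_le_sum (f := fun j => C j * 2 ^ j)
    (fun j _ => mul_nonneg (hC0 j) (by positivity)) (mem_range.2 (by omega))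

end Coordinates

/-! ### Local convergence of mollifications -/

lemma AvFinite.ae_lt_top (hΩ : IsOpen Ω) (hne : (frontier Ω).Nonempty) (hp0 : 0 < p) (hq : 0 < q)
    (hF : Measurable F) (h : AvFinite Ω p θ q F) : ∀ᵐ x ∂volume.restrict Ω, wavg Ω F x < ∞ := by
  rcases lt_or_ge p ∞ with hp | hp
  · have hpr : 0 < p.toReal := toReal_pos hp0.ne' hp.ne
    have h1 := MeasureTheory.ae_lt_top (((measurable_wavg Ω hF).pow_const _).mul (measurable_dw Ω _)) (h.1 hp).ne
    filter_upwards [h1, ae_restrict_mem hΩ.measurableSet] with x hx hxΩ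
    by_contra hcon
    rw [not_lt, top_le_iff] at hcon
    simp only [Pi.mul_apply] at hx
    rw [hcon, ENNReal.top_rpow_of_pos (by positivity), ENNReal.top_mul] at hx
    · exact lt_irrefl _ hx
    · exact dw_ne_zero (bdist_pos hΩ hne hxΩ) _
  · obtain ⟨C, hC⟩ := h.2 (top_le_iff.1 hp)
    filter_upwards [hC] with x hx
    exact hx.trans_lt (mul_lt_top coe_lt_top (dw_ne_top Ω _ x).lt_top)

lemma AvFinite.lintegral_closedBall_lt_top (hΩ : IsOpen Ω) (hne : (frontier Ω).Nonempty)
    (hp0 : 0 < p) (hq : 0 < q) (hF : Measurable F) (h : AvFinite Ω p θ q F) (hx : x ∈ Ω)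
    (hr : r < bdist Ω x) : ∫⁻ y in closedBall x r, F y < ∞ := by
  have hsub : closedBall x r ⊆ Ω := fun y hy => mem_of_dist_lt hΩ hx (lt_of_le_of_lt hy hr)
  have key : (volume.withDensity F) (closedBall x r) < ∞ := by
    refine (isCompact_closedBall x r).measure_lt_top_of_nhdsWithin fun y hy => ?_
    have hy' := hsub hy
    have hy0 := bdist_pos hΩ hne hy'
    obtain ⟨z, hz, hzF⟩ := exists_mem_ball_of_ae (r := bdist Ω y / 10) (by positivity)
      ((ball_subset_ball (by linarith)).trans (ball_subset_of_mem hΩ hy'))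
      (h.ae_lt_top hΩ hne hp0 hq hF)
    rw [mem_ball] at hz
    have hz0 := bdist_le_add' Ω y z
    have hzp : 0 < bdist Ω z / 2 := by linarith
    refine ⟨ball y (bdist Ω y / 10), mem_nhdsWithin_of_mem_nhds (ball_mem_nhds y (by positivity)),
      ?_⟩
    rw [withDensity_apply _ measurableSet_ball]
    refine lt_of_le_of_lt (lintegral_mono_set (ball_subset_ball' ?_ :
      _ ⊆ ball z (bdist Ω z / 2))) ?_
    · rw [dist_comm]; linarith
    · rw [wavg, bavg_eq _ _ hzp] at hzF
      by_contra hcon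
      rw [not_lt, top_le_iff] at hcon
      rw [hcon, ENNReal.mul_top (by simp only [ne_eq, ofReal_eq_zero, not_le]; positivity)] at hzF
      exact lt_irrefl _ hzF
  rwa [withDensity_apply _ measurableSet_closedBall] at key

lemma eventually_mollAt (hΩ : IsOpen Ω) (hx : x ∈ Ω) (hr : r < bdist Ω x) (b : Eucl d) {ε : ℕ → ℝ}
    (hε : ∀ n, 0 < ε n) (hε0 : Tendsto ε atTop (𝓝 0)) :
    ∀ᶠ n in atTop, ∀ z ∈ ball x r, MollAt Ω (ε n) b z := by
  have hlim : Tendsto (fun n => ε n * (‖b‖ + 20)) atTop (𝓝 0) := by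
    simpa using hε0.mul_const (‖b‖ + 20)
  filter_upwards [hlim.eventually (gt_mem_nhds (show 0 < bdist Ω x - r by linarith))] with n hn z hz
  rw [mem_ball] at hz
  have h1 : dist (z + ε n • b) z = ε n * ‖b‖ := by
    rw [dist_self_add_left, norm_smul, norm_of_nonneg (hε n).le]
  have h2 := dist_triangle (z + ε n • b) z x
  have h3 : 0 < ε n * 20 := by have := hε n; positivity
  have h4 := bdist_le_add' Ω x (z + ε n • b)
  exact ⟨mem_of_dist_lt hΩ hx (by linarith), by linarith⟩

lemma tendsto_lintegral_moll_sub (hΩ : IsOpen Ω) (hu : LocallyIntegrableOn u Ω)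
    (hD : IsJet Ω m u D) (hx : x ∈ Ω) {r' : ℝ} (hr : r < r') (hr' : r' < bdist Ω x) (b : Eucl d)
    {ε : ℕ → ℝ} (hε : ∀ n, 0 < ε n) (hε0 : Tendsto ε atTop (𝓝 0)) (hγ : ∑ i, γ i ≤ m) (hq : 1 ≤ q)
    (hfin : ∫⁻ y in ball x r', ‖D γ y‖ₑ ^ q < ∞) :
    Tendsto (fun n => ∫⁻ z in ball x r, ‖mixedDeriv γ (moll Ω (ε n) b u) z - D γ z‖ₑ ^ q) atTop
      (𝓝 0) := by
  refine (tendsto_lintegral_smoothing_sub hq b (hD.1 γ) hr hfin hε hε0).congr' ?_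
  filter_upwards [eventually_mollAt hΩ hx (hr.trans hr') b hε hε0] with n hn
  refine setLIntegral_congr_fun measurableSet_ball fun z hz => ?_
  rw [mixedDeriv_moll hΩ (hε n) (hn z hz) hu (hD.2 γ hγ)]

lemma powSum_lintegral_lt_top_iff {S : Set (Eucl d)} (h : ∫⁻ y in S, powSum q m H y < ∞)
    (hγ : γ ∈ multiIndices d m) : ∫⁻ y in S, ‖H γ y‖ₑ ^ q < ∞ := by
  refine lt_of_le_of_lt (lintegral_mono fun y => ?_) h
  exact single_le_sum (f := fun γ => ‖H γ y‖ₑ ^ q) (fun _ _ => bot_le) hγ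

/-- Mollifications converge in the Whitney averages. -/
lemma tendsto_wavg_moll_sub (hΩ : IsOpen Ω) (hne : (frontier Ω).Nonempty) (hp0 : 0 < p)
    (hq : 1 ≤ q) (hu : LocallyIntegrableOn u Ω) (hD : IsJet Ω m u D)
    (h : AvFinite Ω p θ q (powSum q m D)) (hx : x ∈ Ω) (b : Eucl d) {ε : ℕ → ℝ}
    (hε : ∀ n, 0 < ε n) (hε0 : Tendsto ε atTop (𝓝 0)) :
    Tendsto (fun n => wavg Ω (powSum q m
      fun γ y => D γ y - mixedDeriv γ (moll Ω (ε n) b u) y) x) atTop (𝓝 0) := by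
  have hx0 := bdist_pos hΩ hne hx
  have hfin : ∫⁻ y in ball x (3 / 4 * bdist Ω x), powSum q m D y < ∞ :=
    lt_of_le_of_lt (lintegral_mono_set ball_subset_closedBall)
      (h.lintegral_closedBall_lt_top hΩ hne hp0 (by linarith)
        (hD.measurable_jet q) hx (by linarith))
  have h1 : ∀ n, wavg Ω (powSum q m fun γ y => D γ y - mixedDeriv γ (moll Ω (ε n) b u) y) x =
      ofReal (((bdist Ω x / 2) ^ d)⁻¹) * ∑ γ ∈ multiIndices d m,
        ∫⁻ z in ball x (bdist Ω x / 2), ‖mixedDeriv γ (moll Ω (ε n) b u) z - D γ z‖ₑ ^ q := by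
    intro n
    rw [wavg, bavg_eq _ _ (by positivity)]
    congr 1
    rw [← lintegral_finsetSum]
    · refine lintegral_congr fun z => ?_
      rw [powSum]
      refine sum_congr rfl fun γ _ => ?_
      rw [enorm_sub_rev]
    · intro γ _
      exact (((moll_smooth (hε n) b hu).mixedDeriv γ).continuous.measurable.sub (hD.1 γ)).enorm.pow_const q
  simp_rw [h1]
  have h2 : Tendsto (fun n => ∑ γ ∈ multiIndices d m,
        ∫⁻ z in ball x (bdist Ω x / 2), ‖mixedDeriv γ (moll Ω (ε n) b u) z - D γ z‖ₑ ^ q) atTop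
        (𝓝 (∑ γ ∈ multiIndices d m, 0)) := tendsto_finsetSum _ fun γ hγ =>
    tendsto_lintegral_moll_sub hΩ hu hD hx (by linarith) (by linarith : 3 / 4 * bdist Ω x < _) b
      hε hε0 (mem_multiIndices.1 hγ).le hq (powSum_lintegral_lt_top_iff hfin hγ)
  exact tendsto_const_mul_zero (by simpa using h2) ofReal_ne_top

/-- Local convergence depends only on the functions up to polynomials, locally and eventually. -/
lemma tendsto_wavg_congr (hΩ : IsOpen Ω) (hne : (frontier Ω).Nonempty) (hx : x ∈ Ω)
    {U φ : ℕ → Eucl d → ℂ}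
    (hU : Tendsto (fun n => wavg Ω (powSum q m fun γ y => D γ y - mixedDeriv γ (U n) y) x) atTop
      (𝓝 0))
    (hφ : ∀ᶠ n in atTop, ∀ γ ∈ multiIndices d m, ∀ y ∈ ball x (bdist Ω x / 2),
      mixedDeriv γ (φ n) y = mixedDeriv γ (U n) y) :
    Tendsto (fun n => wavg Ω (powSum q m fun γ y => D γ y - mixedDeriv γ (φ n) y) x) atTop
      (𝓝 0) := by
  refine hU.congr' ?_
  filter_upwards [hφ] with n hn
  have hx0 := bdist_pos hΩ hne hx
  refine le_antisymm (bavg_mono (by positivity) fun y hy => le_of_eq ?_)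
    (bavg_mono (by positivity) fun y hy => le_of_eq ?_) <;>
  exact sum_congr rfl fun γ hγ => by simp only [hn γ hγ y hy]

/-- A sequence of small parameters. -/
lemma exists_null_seq {κ : ℝ} (hκ : 0 < κ) :
    ∃ ε : ℕ → ℝ, (∀ n, 0 < ε n) ∧ (∀ n, ε n ≤ κ) ∧ Tendsto ε atTop (𝓝 0) :=
  ⟨fun n => κ / (n + 1), fun n => by positivity,
    fun n => div_le_self hκ.le (by linarith [Nat.cast_nonneg (α := ℝ) n]),
    tendsto_const_div_atTop_nhds_zero_nat κ |>.comp (tendsto_add_atTop_nat 1) |>.congr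
      fun n => by simp⟩

lemma partialDeriv_sub {g : Eucl d → ℂ} (hf : Smooth f) (hg : Smooth g) (i : Fin d) :
    partialDeriv i (fun y => f y - g y) = fun y => partialDeriv i f y - partialDeriv i g y := by
  funext y
  have hf' : DifferentiableAt ℝ f y := hf.differentiable (by simp) y
  have hg' : DifferentiableAt ℝ g y := hg.differentiable (by simp) y
  simp only [partialDeriv]
  rw [fderiv_fun_sub hf' hg']
  rfl

lemma mixedDeriv_sub {g : Eucl d → ℂ} (hf : Smooth f) (hg : Smooth g) (γ : Fin d → ℕ) :
    mixedDeriv γ (fun y => f y - g y) = fun y => mixedDeriv γ f y - mixedDeriv γ g y := by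
  have hfg : Smooth fun y => f y - g y := hf.sub hg
  induction γ using multiIndex_induction with
  | h0 => simp only [mixedDeriv_zero]
  | h1 γ i ih =>
    rw [mixedDeriv_add_single hfg, mixedDeriv_add_single hf, mixedDeriv_add_single hg, ih,
      partialDeriv_sub (hf.mixedDeriv γ) (hg.mixedDeriv γ)]

/-- Derivatives of all orders up to `m` of the difference of two mollifications converge to zero. -/
lemma tendsto_bavg_jetPow_moll_sub (hΩ : IsOpen Ω) (hne : (frontier Ω).Nonempty) (hp0 : 0 < p)
    (hq : 1 ≤ q) (hu : LocallyIntegrableOn u Ω) (hD : IsJet Ω m u D)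
    (h : AvFinite Ω p θ q (powSum q m D)) (hx : x ∈ Ω) (b b' : Eucl d) {ε : ℕ → ℝ}
    (hε : ∀ n, 0 < ε n) (hε0 : Tendsto ε atTop (𝓝 0)) :
    ∃ A : ℕ → ℝ≥0∞, Tendsto A atTop (𝓝 0) ∧ ∀ n, ∀ k ≤ m, bavg (jetPow q k
      (fun y => moll Ω (ε n) b u y - moll Ω (ε n) b' u y)) x (bdist Ω x / 2) ≤
        (ofReal (bdist Ω x / 2) ^ q) ^ (m - k) * A n := by
  have hx0 := bdist_pos hΩ hne hx
  have hq0 : 0 < q := by linarith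
  set r := bdist Ω x / 2 with hr
  have hr0 : 0 < r := by positivity
  set c : ℝ≥0∞ := ofReal ((r ^ d)⁻¹) with hc
  set V : ℕ → Eucl d → ℂ := fun n y => moll Ω (ε n) b u y - moll Ω (ε n) b' u y with hV
  have hVs : ∀ n, Smooth (V n) := fun n => (moll_smooth (hε n) b hu).sub (moll_smooth (hε n) b' hu)
  have hfinq : ∀ γ ∈ multiIndices d m, ∫⁻ y in ball x (3 / 4 * bdist Ω x), ‖D γ y‖ₑ ^ q < ∞ :=
    fun γ hγ => powSum_lintegral_lt_top_iff
      (lt_of_le_of_lt (lintegral_mono_set ball_subset_closedBall)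
        (h.lintegral_closedBall_lt_top hΩ hne hp0 (by linarith)
          (hD.measurable_jet q) hx (by linarith))) hγ
  have hfin1 : ∀ γ : Fin d → ℕ, ∑ i, γ i ≤ m →
      ∫⁻ y in ball x (3 / 4 * bdist Ω x), ‖D γ y‖ₑ ^ (1 : ℝ) < ∞ := fun γ hγ => by
    simp only [rpow_one]
    have h1 := (hD.2 γ hγ).1.integrableOn_compact_subset (t := closedBall x (3 / 4 * bdist Ω x))
      (fun y hy => mem_of_dist_lt hΩ hx (lt_of_le_of_lt hy (by linarith)))
      (isCompact_closedBall _ _)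
    exact (h1.mono_set ball_subset_closedBall).2
  have hdiff : ∀ (s : ℝ), 1 ≤ s → ∀ γ : Fin d → ℕ, ∑ i, γ i ≤ m →
      ∫⁻ y in ball x (3 / 4 * bdist Ω x), ‖D γ y‖ₑ ^ s < ∞ →
      Tendsto (fun n => ∫⁻ z in ball x r, ‖mixedDeriv γ (V n) z‖ₑ ^ s) atTop (𝓝 0) := by
    intro s hs γ hγ hf
    have h1 := tendsto_lintegral_moll_sub hΩ hu hD hx (r := r) (by rw [hr]; linarith)
      (by linarith : 3 / 4 * bdist Ω x < _) b hε hε0 hγ hs hf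
    have h2 := tendsto_lintegral_moll_sub hΩ hu hD hx (r := r) (by rw [hr]; linarith)
      (by linarith : 3 / 4 * bdist Ω x < _) b' hε hε0 hγ hs hf
    have h2t : (2 : ℝ≥0∞) ^ s ≠ ∞ := by finiteness
    have h3 := tendsto_const_mul_zero (by simpa using h1.add h2) h2t
    refine tendsto_zero_of_le h3 fun n => ?_
    have hm1 : Measurable fun z => ‖mixedDeriv γ (moll Ω (ε n) b u) z - D γ z‖ₑ ^ s :=
      (((moll_smooth (hε n) b hu).mixedDeriv γ).continuous.measurable.sub (hD.1 γ)).enorm.pow_const s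
    rw [← lintegral_add_left hm1, ← lintegral_const_mul' _ _ h2t]
    refine lintegral_mono fun z => ?_
    refine le_trans ?_ (add_rpow_le_two_rpow_mul _ _ (by linarith))
    refine rpow_le_rpow ?_ (by linarith)
    rw [hV, mixedDeriv_sub (moll_smooth (hε n) b hu) (moll_smooth (hε n) b' hu)]
    calc _ = ‖(mixedDeriv γ (moll Ω (ε n) b u) z - D γ z) -
          (mixedDeriv γ (moll Ω (ε n) b' u) z - D γ z)‖ₑ := by rw [sub_sub_sub_cancel_right]
      _ ≤ _ := enorm_sub_le
  have hjet : ∀ (s : ℝ), 1 ≤ s → ∀ k ≤ m, (∀ γ ∈ multiIndices d k,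
      ∫⁻ y in ball x (3 / 4 * bdist Ω x), ‖D γ y‖ₑ ^ s < ∞) →
      Tendsto (fun n => bavg (jetPow s k (V n)) x r) atTop (𝓝 0) := by
    intro s hs k hk hf
    obtain ⟨C, hC⟩ := exists_jetPow_le_powSum d k hs
    have h1 := tendsto_finsetSum _ fun γ hγ => hdiff s hs γ
      ((mem_multiIndices.1 hγ).le.trans hk) (hf γ hγ)
    rw [Finset.sum_const_zero] at h1
    replace h1 := tendsto_const_mul_zero h1 (by rw [hc]; finiteness : c * C ≠ ∞)
    refine tendsto_zero_of_le h1 fun n => ?_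
    rw [bavg_eq _ _ hr0, mul_assoc]
    gcongr
    rw [← lintegral_finsetSum _ fun γ _ =>
      measurable_enorm_rpow_comp ((hVs n).mixedDeriv γ).continuous s,
      ← lintegral_const_mul' _ _ coe_ne_top]
    exact lintegral_mono fun z => hC (V n) (hVs n) z
  obtain ⟨C, hC⟩ := exists_chain_const d m hq
  set ℓ : ℕ → ℝ≥0∞ := fun j => (ofReal r ^ q) ^ (m - j)
  have hr0' : ofReal r ^ q ≠ 0 := by
    rw [Ne, ENNReal.rpow_eq_zero_iff]; simp [hr0]
  have hrt' : ofReal r ^ q ≠ ∞ := rpow_ne_top_of_nonneg hq0.le (by simp)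
  have hℓ0 : ∀ j, ℓ j ≠ 0 := fun j => pow_ne_zero _ hr0'
  have hℓt : ∀ j, ℓ j ≠ ∞ := fun j => ENNReal.pow_ne_top hrt'
  set A : ℕ → ℝ≥0∞ := fun n => bavg (jetPow q m (V n)) x r +
    ∑ j ∈ Finset.range m, (ℓ j)⁻¹ * bavg (jetPow 1 j (V n)) x r ^ q
  refine ⟨fun n => C * A n, ?_, fun n k hk => ?_⟩
  · have h1 : Tendsto A atTop (𝓝 (0 + ∑ j ∈ Finset.range m, 0)) := by
      refine (hjet q hq m le_rfl hfinq).add (tendsto_finsetSum _ fun j hj => ?_)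
      have hjm := mem_range.1 hj
      have h2 := hjet 1 le_rfl j hjm.le fun γ hγ => hfin1 γ ((mem_multiIndices.1 hγ).le.trans hjm.le)
      exact tendsto_const_mul_zero (zero_rpow_of_pos hq0 ▸ h2.ennrpow_const q)
        (ENNReal.inv_ne_top.2 (hℓ0 j))
    exact tendsto_const_mul_zero (by simpa using h1) coe_ne_top
  · have := hC (V n) (hVs n) {(x, r)} (x, r) r (A n) rfl hr0.le le_rfl
      (by rintro B rfl; exact ⟨(x, r), (x, r), by simp, by simp, by simp⟩)
      (by rintro B rfl B' rfl; simpa using hr0.le)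
      (by rintro B rfl; exact le_self_add)
      (fun j hj => by
        refine (rpow_le_rpow (enorm_integral_le_bavg (V n) j x r) hq0.le).trans ?_
        calc bavg (jetPow 1 j (V n)) x r ^ q
            = ℓ j * ((ℓ j)⁻¹ * bavg (jetPow 1 j (V n)) x r ^ q) := by
              rw [← mul_assoc, ENNReal.mul_inv_cancel (hℓ0 j) (hℓt j), one_mul]
          _ ≤ ℓ j * A n := by
              gcongr
              refine le_trans ?_ (le_add_self)
              exact single_le_sum (f := fun j => (ℓ j)⁻¹ * bavg (jetPow 1 j (V n)) x r ^ q)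
                (fun _ _ => bot_le) (mem_range.2 hj)) k hk (x, r) rfl
    refine this.trans (le_of_eq ?_)
    ring

/-! ### Test balls -/

/-- Whitney averages of derivatives are controlled by averages over small test balls. -/
lemma exists_wavg_le_of_test_balls (d m : ℕ) (hq : 1 ≤ q) : ∃ C : ℝ≥0,
    ∀ (Ω : Set (Eucl d)), IsOpen Ω → (frontier Ω).Nonempty → ∀ φ : Eucl d → ℂ, Smooth φ →
    ∀ x ∈ Ω, ∀ (τ : ℝ) (A : ℝ≥0∞), 0 < τ → τ ≤ 1 / 100 →
    (∀ y, dist y x < 3 / 5 * bdist Ω x → bavg (jetPow q m φ) y (τ * bdist Ω x) ≤ A) →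
    wavg Ω (powSum q m fun γ => mixedDeriv γ φ) x ≤ C * A := by
  obtain ⟨C₁, hC₁⟩ := exists_powSum_le_jetPow d m (by linarith : 0 ≤ q)
  refine ⟨C₁ * (Real.toNNReal ((2 : ℝ) ^ d)), fun Ω hΩ hne φ hφ x hx τ A hτ hτ1 h => ?_⟩
  have hx0 := bdist_pos hΩ hne hx
  calc wavg Ω (powSum q m fun γ => mixedDeriv γ φ) x
      ≤ C₁ * bavg (jetPow q m φ) x (bdist Ω x / 2) := by
        rw [wavg, ← bavg_const_mul coe_ne_top]
        exact bavg_mono (by positivity) fun y _ => hC₁ φ hφ y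
    _ ≤ C₁ * (ofReal (((bdist Ω x / 2 + τ * bdist Ω x) / (bdist Ω x / 2)) ^ d) * A) := by
        gcongr
        refine bavg_le_of_forall_le (measurable_jetPow q m hφ) (by positivity) (by positivity)
          fun y hy => h y ?_
        rw [mem_ball] at hy
        nlinarith
    _ ≤ C₁ * (ofReal ((2 : ℝ) ^ d) * A) := by
        gcongr
        rw [div_le_iff₀ (by positivity)]
        nlinarith
    _ = _ := by rw [coe_mul, mul_assoc, ofReal]

/-! ### Locality -/

lemma mixedDeriv_congr {g : Eucl d → ℂ} (hf : Smooth f) (hg : Smooth g) (h : f =ᶠ[𝓝 x] g)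
    (γ : Fin d → ℕ) : mixedDeriv γ f x = mixedDeriv γ g x := by
  obtain ⟨k, hk⟩ : ∃ k, ∑ i, γ i = k := ⟨_, rfl⟩
  obtain ⟨t, rfl⟩ := exists_tupleCount_eq hk
  rw [← iteratedFDeriv_apply_single hf, ← iteratedFDeriv_apply_single hg,
    (h.iteratedFDeriv ℝ _).eq_of_nhds]

lemma jetPow_congr {g : Eucl d → ℂ} (h : f =ᶠ[𝓝 x] g) : jetPow q k f x = jetPow q k g x := by
  rw [jetPow, jetPow, (h.iteratedFDeriv ℝ k).eq_of_nhds]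

lemma bavg_jetPow_congr {g : Eucl d → ℂ} (hr : 0 < r) (h : ∀ y ∈ ball w r, f y = g y) :
    bavg (jetPow q k f) w r = bavg (jetPow q k g) w r := by
  have key : ∀ y ∈ ball w r, jetPow q k f y = jetPow q k g y := fun y hy =>
    jetPow_congr (Filter.eventuallyEq_of_mem (isOpen_ball.mem_nhds hy) h)
  exact le_antisymm (bavg_mono hr fun y hy => (key y hy).le)
    (bavg_mono hr fun y hy => (key y hy).ge)

lemma bavg_jetPow_eq_zero (hq : 0 < q) (hr : 0 < r) (h : ∀ y ∈ ball w r, f y = 0) :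
    bavg (jetPow q k f) w r = 0 := by
  rw [bavg_jetPow_congr (g := fun _ => 0) hr h]
  have : jetPow q k (fun _ : Eucl d => (0 : ℂ)) = fun _ => 0 := by
    funext y
    have h0 : iteratedFDeriv ℝ k (fun _ : Eucl d => (0 : ℂ)) y = 0 := by
      rw [iteratedFDeriv_fun_zero]
      rfl
    rw [jetPow, h0, enorm_zero, zero_rpow_of_pos hq]
  rw [this, bavg_const, zero_mul]

lemma iteratedFDeriv_sub_of_eq_zero {U P : Eucl d → ℂ} (hU : Smooth U) (hP : Smooth P)
    (hP0 : iteratedFDeriv ℝ m P = 0) :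
    iteratedFDeriv ℝ m (fun y => U y - P y) = iteratedFDeriv ℝ m U := by
  have hU' : ContDiff ℝ m U := hU.of_le (by exact_mod_cast le_top)
  have hP' : ContDiff ℝ m P := hP.of_le (by exact_mod_cast le_top)
  funext y
  have := iteratedFDeriv_sub_apply (x := y) hU'.contDiffAt hP'.contDiffAt
  rw [hP0, Pi.zero_apply, sub_zero] at this
  exact this

lemma mixedDeriv_sub_of_eq_zero {U P : Eucl d → ℂ} (hU : Smooth U) (hP : Smooth P)
    (hP0 : iteratedFDeriv ℝ m P = 0) (hγ : γ ∈ multiIndices d m) :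
    mixedDeriv γ (fun y => U y - P y) = mixedDeriv γ U := by
  obtain ⟨t, rfl⟩ := exists_tupleCount_eq (mem_multiIndices.1 hγ)
  funext y
  have hUP : Smooth fun y => U y - P y := hU.sub hP
  rw [← iteratedFDeriv_apply_single hUP, ← iteratedFDeriv_apply_single hU,
    iteratedFDeriv_sub_of_eq_zero hU hP hP0]

lemma tendsto_wavg_sub_polynomial (hΩ : IsOpen Ω) (hne : (frontier Ω).Nonempty) (hx : x ∈ Ω)
    {U φ P : ℕ → Eucl d → ℂ}
    (hU : Tendsto (fun n => wavg Ω (powSum q m fun γ y => D γ y - mixedDeriv γ (U n) y) x) atTop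
      (𝓝 0)) (hUs : ∀ n, Smooth (U n)) (hφ : ∀ n, Smooth (φ n)) (hP : ∀ n, Smooth (P n))
    (hP0 : ∀ n, iteratedFDeriv ℝ m (P n) = 0) {x₀ : Eucl d} {R : ℕ → ℝ} (hR : Tendsto R atTop atTop)
    (hφP : ∀ n, ∀ y ∈ ball x₀ (R n), φ n y = U n y - P n y) :
    Tendsto (fun n => wavg Ω (powSum q m fun γ y => D γ y - mixedDeriv γ (φ n) y) x) atTop
      (𝓝 0) := by
  refine tendsto_wavg_congr hΩ hne hx hU ?_
  filter_upwards [hR.eventually_gt_atTop (dist x x₀ + bdist Ω x)] with n hn γ hγ y hy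
  have hx0 := bdist_pos hΩ hne hx
  rw [← mixedDeriv_sub_of_eq_zero (hUs n) (hP n) (hP0 n) hγ]
  refine mixedDeriv_congr (hφ n) ((hUs n).sub (hP n)) (Filter.eventuallyEq_of_mem
    (isOpen_ball.mem_nhds (?_ : y ∈ ball x₀ (R n))) (hφP n)) γ
  rw [mem_ball] at hy ⊢
  linarith [dist_triangle y x x₀]

/-! ### Chains of balls along polygonal paths -/

lemma mem_segment_prod {B B₀ B₁ : Eucl d × ℝ} (h : B ∈ segment ℝ B₀ B₁) : ∃ s : ℝ, 0 ≤ s ∧ s ≤ 1 ∧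
    B = (B₀.1 + s • (B₁.1 - B₀.1), B₀.2 + s * (B₁.2 - B₀.2)) := by
  rw [segment_eq_image'] at h
  obtain ⟨s, hs, rfl⟩ := h
  exact ⟨s, hs.1, hs.2, by ext <;> simp⟩

/-- Derivatives of order up to `m` on a ball that is joined, by a path of three segments, to a ball
on which the means are controlled. -/
lemma exists_path_const (d m : ℕ) (hq : 1 ≤ q) :
    ∃ C : ℝ≥0, ∀ (U : Eucl d → ℂ) (_ : Smooth U) (B₀ B₁ B₂ B₃ : Eucl d × ℝ) (L : ℝ) (A : ℝ≥0∞),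
      0 ≤ B₃.2 → B₃.2 ≤ L →
      (∀ B ∈ segment ℝ B₀ B₁ ∪ segment ℝ B₁ B₂ ∪ segment ℝ B₂ B₃,
        ‖B.1 - B₃.1‖ + |B.2 - B₃.2| ≤ L / 2 ∧ bavg (jetPow q m U) B.1 B.2 ≤ A) →
      (∀ j < m, ‖∫ z in ball (0 : Eucl d) 1, iteratedFDeriv ℝ j U (B₃.1 + B₃.2 • z)‖ₑ ^ q ≤
        (ofReal L ^ q) ^ (m - j) * A) →
      ∀ k ≤ m, bavg (jetPow q k U) B₀.1 B₀.2 ≤ C * ((ofReal L ^ q) ^ (m - k) * A) := by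
  obtain ⟨C, hC⟩ := exists_chain_const d m hq
  refine ⟨C, fun U hU B₀ B₁ B₂ B₃ L A h0 hL hB hmean k hk => ?_⟩
  set Good := segment ℝ B₀ B₁ ∪ segment ℝ B₁ B₂ ∪ segment ℝ B₂ B₃
  have s1 : segment ℝ B₀ B₁ ⊆ Good := fun B h => Or.inl (Or.inl h)
  have s2 : segment ℝ B₁ B₂ ⊆ Good := fun B h => Or.inl (Or.inr h)
  have s3 : segment ℝ B₂ B₃ ⊆ Good := fun B h => Or.inr h
  have hsub : ∀ {P Q B : Eucl d × ℝ}, B ∈ segment ℝ P Q → segment ℝ B Q ⊆ segment ℝ P Q :=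
    fun {P Q B} h => (convex_segment P Q).segment_subset h (right_mem_segment ℝ P Q)
  have hself : ∀ {P Q : Eucl d × ℝ}, segment ℝ Q Q ⊆ segment ℝ P Q := fun {P Q} => by
    rw [segment_same]; exact Set.singleton_subset_iff.2 (right_mem_segment ℝ P Q)
  refine hC U hU Good B₃ L A (s3 (right_mem_segment ℝ _ _)) h0 hL ?_ ?_ (fun B h => (hB B h).2)
    hmean k hk B₀ (s1 (left_mem_segment ℝ _ _))
  · rintro B ((h | h) | h)
    · exact ⟨B₁, B₂, (hsub h).trans s1, s2, s3⟩
    · exact ⟨B₂, B₂, (hsub h).trans s2, hself.trans s2, s3⟩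
    · exact ⟨B₃, B₃, (hsub h).trans s3, hself.trans s3, hself.trans s3⟩
  · intro B h B' h'
    have h1 := (hB B h).1
    have h2 := (hB B' h').1
    have h3 : ‖B'.1 - B.1‖ ≤ ‖B'.1 - B₃.1‖ + ‖B.1 - B₃.1‖ := by
      calc ‖B'.1 - B.1‖ = ‖(B'.1 - B₃.1) - (B.1 - B₃.1)‖ := by rw [sub_sub_sub_cancel_right]
        _ ≤ _ := norm_sub_le _ _
    have h4 : |B'.2 - B.2| ≤ |B'.2 - B₃.2| + |B.2 - B₃.2| := by
      calc |B'.2 - B.2| = |(B'.2 - B₃.2) - (B.2 - B₃.2)| := by rw [sub_sub_sub_cancel_right]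
        _ ≤ _ := abs_sub _ _
    linarith

/-- Balls along the axis of a cone are Whitney balls. -/
lemma UpCone.whitney (hΩ : IsOpen Ω) (hne : (frontier Ω).Nonempty) {N : Set (Eucl d)} {e : Eucl d}
    (he : ‖e‖ ≤ 1) {c h : ℝ} (hc : 0 < c) (hc1 : c ≤ 1) (H : UpCone Ω N e c h) (hx : x ∈ Ω)
    (hyx : dist y x < 3 / 5 * bdist Ω x) (hyN : y ∈ N) {t : ℝ} (ht : 0 ≤ t) (hth : t ≤ h) :
    y + t • e ∈ Ω ∧ c / 10 * (bdist Ω x + t) ≤ bdist Ω (y + t • e) ∧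
      bdist Ω (y + t • e) ≤ 2 * (bdist Ω x + t) ∧ dist (y + t • e) x ≤ bdist Ω x + t := by
  have hx0 := bdist_pos hΩ hne hx
  have hy : y ∈ Ω := mem_of_dist_lt hΩ hx (by linarith)
  have h1 : dist (y + t • e) y ≤ t := by
    rw [dist_self_add_left, norm_smul, norm_of_nonneg ht]
    exact mul_le_of_le_one_right ht he
  have h2 := bdist_le_add Ω y x
  have h3 := bdist_le_add' Ω x y
  have h4 := bdist_le_add Ω (y + t • e) y
  have h5 := bdist_le_add' Ω y (y + t • e)
  have h6 := dist_triangle (y + t • e) y x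
  refine ⟨?_, ?_, by linarith, by linarith⟩
  · rcases ht.eq_or_lt with rfl | ht0
    · simpa using hy
    · exact H.mem hc ⟨hy, hyN⟩ ht0 hth
  · rcases le_or_gt (bdist Ω x / 5) t with h7 | h7
    · have := H.le_bdist hΩ hne ⟨hy, hyN⟩ (by linarith) hth
      nlinarith
    · nlinarith

/-! ### Graph domains -/

lemma ConeDomain.mollAt (hΩ : IsOpen Ω) (hne : (frontier Ω).Nonempty) {e : Eucl d} {c : ℝ}
    (H : ConeDomain Ω e c) (hε : 0 < ε) {z : Eucl d} (hz : z ∈ Ω) :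
    MollAt Ω ε ((20 / c) • e) z := by
  have hc := H.pos
  have ht : 0 < ε * (20 / c) := by positivity
  rw [MollAt, smul_smul]
  refine ⟨(H.cone _).mem hc ⟨hz, trivial⟩ ht le_rfl, ?_⟩
  have := (H.cone _).le_bdist hΩ hne ⟨hz, trivial⟩ ht le_rfl
  refine le_trans (le_of_eq ?_) this
  field_simp

lemma le_of_scaled_cutoff {i : ℕ} (hi : i ≤ m) {a R L C κ : ℝ} (ha : 0 ≤ a) (hL : 0 ≤ L)
    (hR : 0 ≤ R) (hκ : 1 ≤ κ) (hLR : L ≤ κ * R) (h : a * R ^ i ≤ C) : a * L ^ i ≤ κ ^ m * C := by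
  calc a * L ^ i ≤ a * (κ * R) ^ i := by gcongr
    _ = κ ^ i * (a * R ^ i) := by rw [mul_pow]; ring
    _ ≤ κ ^ m * C := by
        have : 0 ≤ a * R ^ i := by positivity
        gcongr

lemma mul_div_cancel_radius {c a : ℝ} (hc : c ≠ 0) : 2 * a = 2 / (c / 200) * (c / 200 * a) := by
  field_simp

set_option maxHeartbeats 1000000 in
/-- The cut-off approximations on a graph domain are dominated. -/
lemma exists_graph_bound (d m : ℕ) (hq : 1 ≤ q) {c : ℝ} (hc : 0 < c) (hc1 : c ≤ 1) :
    ∃ (C : ℝ≥0) (K : ℝ), ∀ (Ω : Set (Eucl d)), IsOpen Ω → (frontier Ω).Nonempty →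
    ∀ (e : Eucl d), ConeDomain Ω e c → ∀ (u : Eucl d → ℂ) (D : Jet d),
    LocallyIntegrableOn u Ω → IsJet Ω m u D → ∀ x₀ ∈ Ω, ∀ R : ℝ, bdist Ω x₀ ≤ R →
    ∀ ε : ℝ, 0 < ε → ∃ φ P : Eucl d → ℂ, IsSmoothCompact φ ∧ Smooth P ∧ iteratedFDeriv ℝ m P = 0 ∧
      (∀ y ∈ ball x₀ R, φ y = moll Ω ε ((20 / c) • e) u y - P y) ∧
      ∀ x ∈ Ω, wavg Ω (powSum q m fun γ => mixedDeriv γ φ) x ≤ C * coneSup Ω (powSum q m D) K x := by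
  have hq0 : 0 < q := by linarith
  obtain ⟨C₁, hC₁⟩ := exists_wavg_le_of_test_balls d m hq
  obtain ⟨C₂, hC₂⟩ := exists_path_const d m hq
  obtain ⟨C₃, hC₃⟩ := exists_leibniz_const d m hq
  obtain ⟨C₄, K, hC₄⟩ := exists_bavg_moll_le_coneSup d m hq (2 / (c / 200)) (B₀ := 20 / c)
    (by positivity)
  obtain ⟨C₅, hC₅0, hC₅⟩ := exists_ball_cutoff d m
  set Cζ : ℝ := (400 / c) ^ m * C₅
  set Cq : ℝ≥0∞ := ofReal Cζ ^ q
  have hCqt : Cq ≠ ∞ := rpow_ne_top_of_nonneg hq0.le ofReal_ne_top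
  refine ⟨C₁ * (C₃ * Cq.toNNReal * C₂ * C₄), K, ?_⟩
  intro Ω hΩ hne e H u D hu hD x₀ hx₀ R hR ε hε
  have hx₀0 := bdist_pos hΩ hne hx₀
  have hR0 : 0 < R := by linarith
  set b := (20 / c) • e with hb
  have hbn : ‖b‖ ≤ 20 / c := by
    rw [hb, norm_smul, norm_of_nonneg (by positivity)]
    exact mul_le_of_le_one_right (by positivity) H.norm_le
  set T : ℝ := 60 * R / c with hT
  have hT0 : 0 < T := by positivity
  have hTR : 60 * R ≤ T := by rw [hT, le_div_iff₀ hc]; nlinarith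
  have hcT : c * T = 60 * R := by rw [hT]; field_simp
  set τ := c / 200 with hτ
  have hτ0 : 0 < τ := by positivity
  set L : ℝ := 400 / c * R with hL
  have hL0 : 0 < L := by positivity
  have hLT : L = 20 / 3 * T := by rw [hL, hT]; field_simp; norm_num
  set U := moll Ω ε b u
  have hUs : Smooth U := moll_smooth hε b hu
  obtain ⟨P, hPs, hP0, hPm⟩ := exists_polynomial_mean_zero hUs (x₀ + T • e) (τ * T) m
  obtain ⟨ζ, hζs, hζc, hζ1, hζ0, hζb⟩ := hC₅ x₀ R hR0
  set V : Eucl d → ℂ := fun y => U y - P y with hV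
  have hVs : Smooth V := hUs.sub hPs
  refine ⟨fun y => ζ y * V y, P, ⟨hζs.mul hVs, hζc.mul_right⟩, hPs, hP0,
    fun y hy => by simp only [hζ1 y hy, one_mul, hV], fun x hx => ?_⟩
  have hx0 := bdist_pos hΩ hne hx
  set A := coneSup Ω (powSum q m D) K x
  have e0 : ((C₁ * (C₃ * Cq.toNNReal * C₂ * C₄) : ℝ≥0) : ℝ≥0∞) * A =
      C₁ * (C₃ * (Cq * (C₂ * (C₄ * A)))) := by
    push_cast
    rw [coe_toNNReal hCqt]; ring
  rw [e0]
  refine hC₁ Ω hΩ hne _ (hζs.mul hVs) x hx τ _ hτ0 (by rw [hτ]; linarith) fun y hy => ?_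
  have hr0 : 0 < τ * bdist Ω x := by positivity
  have hxx₀ := bdist_le_add Ω x x₀
  rcases le_or_gt (14 * R) (dist x x₀) with hfar | hnear
  · rw [bavg_jetPow_eq_zero hq0 hr0]
    · exact bot_le
    · intro z hz
      rw [mem_ball] at hz
      have h1 := dist_triangle x z x₀
      have h2 := dist_triangle z y x
      rw [dist_comm z x] at h2
      have h3 : τ * bdist Ω x ≤ 1 / 200 * bdist Ω x := by rw [hτ]; gcongr
      rw [hζ0 z (by linarith), zero_mul]
  · have hδR : bdist Ω x ≤ 15 * R := by linarith
    refine hC₃ ζ V hζs hVs y (τ * bdist Ω x) L Cζ (C₂ * (C₄ * A)) hr0 hL0 ?_ ?_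
    · intro i hi z _
      exact le_of_scaled_cutoff hi (norm_nonneg _) hL0.le hR0.le
        (by rw [le_div_iff₀ hc]; linarith) le_rfl (hζb i hi z)
    · have htop : ∀ w r, 0 < r → w ∈ Ω → 16 * r ≤ bdist Ω w → bdist Ω w ≤ 2 / τ * r →
          dist w x ≤ 2 / τ * r → bavg (jetPow q m V) w r ≤ C₄ * A := by
        intro w r hr hw h1 h2 h3
        have e1 : jetPow q m V = jetPow q m U := by
          funext z; rw [jetPow, jetPow, iteratedFDeriv_sub_of_eq_zero hUs hPs hP0]
        rw [e1]
        refine hC₄ Ω hΩ u D hu hD ε hε b hbn x w r hr hw h1 h2 h3 fun z hz => ?_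
        refine H.mollAt hΩ hne hε (mem_of_dist_lt hΩ hw ?_)
        rw [mem_ball] at hz
        linarith
      have hyx₀ : dist y x₀ ≤ 23 * R := by linarith [dist_triangle y x x₀]
      intro k hk
      have := hC₂ V hVs (y, τ * bdist Ω x) (y + T • e, τ * (bdist Ω x + T)) (x₀ + T • e, τ * T)
        (x₀ + T • e, τ * T) L (C₄ * A) (by positivity)
        (by simp only; rw [hLT]; nlinarith) ?_ ?_ k hk
      · exact this.trans (le_of_eq (by ring))
      · have hball := (H.cone T) x₀ ⟨hx₀, trivial⟩ T hT0 le_rfl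
        have hδref := (H.cone T).le_bdist hΩ hne ⟨hx₀, trivial⟩ hT0 le_rfl
        have hτT : τ * T = 3 / 10 * R := by rw [hτ]; linarith
        have hτδ : τ * bdist Ω x ≤ R := by
          rw [hτ]; nlinarith
        have hτK : ∀ a, 2 * a = 2 / τ * (τ * a) := fun a => mul_div_cancel_radius hc.ne'
        have hTe : ‖T • e‖ ≤ T := by
          rw [norm_smul, norm_of_nonneg hT0.le]
          exact mul_le_of_le_one_right hT0.le H.norm_le
        intro B hB
        rw [Set.union_assoc] at hB
        rcases hB with hB | hB
        · obtain ⟨s, hs0, hs1, rfl⟩ := mem_segment_prod hB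
          simp only [add_sub_cancel_left]
          have e1 : τ * bdist Ω x + s * (τ * (bdist Ω x + T) - τ * bdist Ω x) =
              τ * (bdist Ω x + s * T) := by ring
          have hsT : 0 ≤ s * T := by positivity
          have hsT1 : s * T ≤ T := by nlinarith
          obtain ⟨w1, w2, w3, w4⟩ := (H.cone T).whitney hΩ hne H.norm_le hc hc1 hx hy trivial
            hsT hsT1
          rw [e1, smul_smul]
          refine ⟨?_, htop _ _ (by positivity) w1 ?_ ?_ ?_⟩
          · have h1 : ‖y + (s * T) • e - (x₀ + T • e)‖ ≤ 23 * R + T := by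
              have h2 : y + (s * T) • e - (x₀ + T • e) = (y - x₀) - ((1 - s) * T) • e := by module
              rw [h2]
              refine (norm_sub_le _ _).trans ?_
              rw [← dist_eq_norm, norm_smul, norm_of_nonneg (by nlinarith)]
              have h3 : (1 - s) * T * ‖e‖ ≤ 1 * T * 1 := by
                gcongr
                · linarith
                · exact H.norm_le
              linarith
            have h2 : |τ * (bdist Ω x + s * T) - τ * T| ≤ R + R := by
              have h3 : τ * (s * T) ≤ τ * T := by gcongr
              have h4 : 0 ≤ τ * (s * T) := by positivity
              rw [abs_le, mul_add]
              constructor <;> linarith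
            linarith
          · rw [hτ]; nlinarith
          · rw [← hτK]; exact w3
          · rw [← hτK]; linarith
        · replace hB : B ∈ segment ℝ (y + T • e, τ * (bdist Ω x + T)) (x₀ + T • e, τ * T) := by
            rw [segment_same] at hB
            exact hB.elim id fun h => h ▸ right_mem_segment ℝ _ _
          obtain ⟨s, hs0, hs1, rfl⟩ := mem_segment_prod hB
          dsimp only
          have h1 : dist (y + T • e + s • (x₀ + T • e - (y + T • e))) (x₀ + T • e) ≤ 23 * R := by
            have : (y + T • e + s • (x₀ + T • e - (y + T • e))) - (x₀ + T • e) =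
                (1 - s) • (y - x₀) := by module
            rw [dist_eq_norm, this, norm_smul, norm_of_nonneg (by linarith), ← dist_eq_norm]
            nlinarith [dist_nonneg (x := y) (y := x₀)]
          set w := y + T • e + s • (x₀ + T • e - (y + T • e))
          have e2 : τ * (bdist Ω x + T) + s * (τ * T - τ * (bdist Ω x + T)) =
              τ * ((1 - s) * bdist Ω x + T) := by ring
          have h2 : 0 ≤ (1 - s) * bdist Ω x := mul_nonneg (by linarith) hx0.le
          have h3 : (1 - s) * bdist Ω x ≤ bdist Ω x := by nlinarith
          have h4 : τ * ((1 - s) * bdist Ω x) ≤ R := (mul_le_mul_of_nonneg_left h3 hτ0.le).trans hτδ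
          rw [e2]
          have hwx₀ : dist w x₀ ≤ 23 * R + T := by
            have h5 := dist_triangle w (x₀ + T • e) x₀
            have h6 : dist (x₀ + T • e) x₀ ≤ T := by rwa [dist_self_add_left]
            linarith
          refine ⟨?_, htop w _ (by positivity) (hball ?_) ?_ ?_ ?_⟩
          · rw [← dist_eq_norm, mul_add, add_sub_cancel_right, abs_of_nonneg (by positivity)]
            linarith
          · rw [mem_ball]; linarith
          · have h5 := bdist_le_add' Ω (x₀ + T • e) w
            rw [mul_add]; linarith
          · rw [← hτK]
            linarith [bdist_le_add Ω w x₀]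
          · rw [← hτK]
            linarith [dist_triangle w x₀ x, dist_comm x x₀]
      · intro j hj
        have := hPm j hj
        simp only at this ⊢
        rw [this, enorm_zero, zero_rpow_of_pos hq0]
        exact bot_le

/-- Approximation on graph domains. -/
theorem ConeDomain.exists_approx (hΩ : IsOpen Ω) (hne : (frontier Ω).Nonempty) (hΩne : Ω.Nonempty)
    {e : Eucl d} {c : ℝ} (H : ConeDomain Ω e c) (hp0 : 0 < p) (hθ : θ < 1) {q : ℝ≥0∞}
    (hq1 : 1 ≤ q) (hqt : q ≠ ∞) (hu : MemSobolev m p θ q Ω u) :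
    ∃ φ : ℕ → Eucl d → ℂ, (∀ j, IsSmoothCompact (φ j)) ∧ SobolevTendsto m p θ q Ω φ u := by
  have hq := one_le_toReal hq1 hqt
  obtain ⟨D, hD⟩ := exists_isJet hu.2.1
  obtain ⟨x₀, hx₀⟩ := hΩne
  obtain ⟨C, K, hC⟩ := exists_graph_bound d m hq H.pos H.le_one
  have hfin := hu.avFinite hΩ hne hp0 hq1 hqt hD
  have hlayer : HasLayerBounds Ω := (H.hasLayerVolume hΩ hne).hasLayerBound hΩ hne
  set R : ℕ → ℝ := fun n => n + bdist Ω x₀ with hR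
  obtain ⟨ε, hε0, -, hεt⟩ := exists_null_seq one_pos
  choose φ P hφ hP hP0 hφP hdom using fun n : ℕ => hC Ω hΩ hne e H u D hu.1 hD x₀ hx₀ (R n)
    (by simp [hR]) (ε n) (hε0 n)
  refine ⟨φ, hφ, ?_⟩
  exact sobolevTendsto_of_dominated hΩ hne hlayer hp0 hθ hq1 hqt hu hD (fun n => (hφ n).1)
    ((dominating_coneSup hΩ hne hp0 hθ hq hlayer (hD.measurable_jet _) hfin K).const_mul
      (by linarith) C) hdom fun x hx =>
    tendsto_wavg_sub_polynomial hΩ hne hx (tendsto_wavg_moll_sub hΩ hne hp0 hq hu.1 hD hfin hx _ hε0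
      hεt) (fun n => moll_smooth (hε0 n) _ hu.1) (fun n => (hφ n).1) hP hP0
      (tendsto_atTop_add_const_right _ _ tendsto_natCast_atTop_atTop) hφP

/-! ### Approximation of functions with vanishing traces -/

/-- The means of the derivatives of a mollification. -/
lemma exists_mean_moll_le (d j : ℕ) : ∃ C : ℝ≥0, ∀ (Ω : Set (Eucl d)), IsOpen Ω →
    ∀ (m : ℕ), j ≤ m → ∀ (u : Eucl d → ℂ) (D : Jet d),
    LocallyIntegrableOn u Ω → IsJet Ω m u D → ∀ (ε : ℝ), 0 < ε → ∀ (b w : Eucl d) (r : ℝ), 0 < r →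
    ∀ S : Set (Eucl d), (∀ z ∈ ball w r, MollAt Ω ε b z) → ball w (r + ε * (‖b‖ + 1)) ⊆ S →
    ‖∫ z in ball (0 : Eucl d) 1, iteratedFDeriv ℝ j (moll Ω ε b u) (w + r • z)‖ₑ ≤
      C * (ofReal ((r ^ d)⁻¹) * ∑ γ ∈ multiIndices d j, ∫⁻ y in S, ‖D γ y‖ₑ) := by
  obtain ⟨C, hC⟩ := exists_bavg_moll_le d j (le_refl (1 : ℝ))
  set v := volume (ball (0 : Eucl d) 1)
  have hvt : v ≠ ∞ := measure_ball_lt_top.ne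
  refine ⟨C * v.toNNReal, fun Ω hΩ m hj u D hu hD ε hε b w r hr S hmoll hS => ?_⟩
  have hPm : Measurable (powSum 1 j D) := measurable_powSum 1 j fun γ _ => hD.1 γ
  have hsum : ∫⁻ y in S, powSum 1 j D y = ∑ γ ∈ multiIndices d j, ∫⁻ y in S, ‖D γ y‖ₑ := by
    rw [← lintegral_finsetSum _ fun γ _ => (hD.1 γ).enorm]
    refine lintegral_congr fun y => ?_
    simp [powSum]
  calc _ ≤ bavg (jetPow 1 j (moll Ω ε b u)) w r := enorm_integral_le_bavg _ j w r
    _ ≤ C * bavg (fun z => bavg (powSum 1 j D) (z + ε • b) ε) w r :=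
        hC Ω hΩ m hj u D hu hD ε hε b w r hr hmoll
    _ = C * ∫⁻ t in ball (0 : Eucl d) 1, bavg (powSum 1 j D) (w + ε • (b + t)) r := by
        rw [bavg_bavg_eq hPm]
    _ ≤ C * ∫⁻ _t in ball (0 : Eucl d) 1, (ofReal ((r ^ d)⁻¹) * ∫⁻ y in S, powSum 1 j D y) := by
        refine mul_le_mul_right (setLIntegral_mono' measurableSet_ball fun t ht => ?_) _
        rw [bavg_eq _ _ hr]
        gcongr
        refine Set.Subset.trans (ball_subset_ball' ?_) hS
        rw [mem_ball_zero_iff] at ht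
        rw [dist_self_add_left, norm_smul, norm_of_nonneg hε.le]
        have : ‖b + t‖ ≤ ‖b‖ + 1 := (norm_add_le _ _).trans (by linarith)
        gcongr
    _ = _ := by
        rw [setLIntegral_const, hsum]
        push_cast
        rw [coe_toNNReal hvt]; ring

/-- Derivatives of mollifications of functions with vanishing traces. -/
lemma exists_hardy_moll_bound (d m : ℕ) (hq : 1 ≤ q) (C₀ P : ℝ) :
    ∃ (C : ℝ≥0) (K : ℝ), ∀ (Ω : Set (Eucl d)), IsOpen Ω → (frontier Ω).Nonempty →
    ∀ (u : Eucl d → ℂ) (D : Jet d), LocallyIntegrableOn u Ω → IsJet Ω m u D →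
    ∀ ε : ℝ, 0 < ε → ∀ x ∈ Ω, 100 * ε ≤ bdist Ω x → ∀ y, dist y x < 3 / 5 * bdist Ω x →
    bavg (jetPow q m (moll Ω ε 0 u)) y (1 / 200 * bdist Ω x) ≤ C * coneSup Ω (powSum q m D) K x ∧
    ∀ f : Eucl d → ℝ≥0∞, HardyAt Ω m D f C₀ P x →
    ∀ k ≤ m, bavg (jetPow q k (moll Ω ε 0 u)) y (1 / 200 * bdist Ω x) ≤
      C * ((ofReal (bdist Ω x) ^ q) ^ (m - k) *
        (coneSup Ω (powSum q m D) K x + shadowAvg Ω f P x ^ q)) := by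
  have hq0 : 0 < q := by linarith
  obtain ⟨C₂, hC₂⟩ := exists_path_const d m hq
  obtain ⟨C₄, K, hC₄⟩ := exists_bavg_moll_le_coneSup d m hq 400 (B₀ := 0) le_rfl
  choose C₅ hC₅ using fun j => exists_mean_moll_le d j
  set c : ℕ → ℝ≥0∞ := fun j => C₅ j * (ofReal (200 ^ d) *
    (((multiIndices d j).card : ℝ≥0∞) * ofReal C₀)) with hc
  have hct : ∀ j, c j ≠ ∞ := fun j => by
    simp only [hc]
    have : ((multiIndices d j).card : ℝ≥0∞) ≠ ∞ := ENNReal.natCast_ne_top _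
    finiteness
  set E : ℝ≥0∞ := ∑ j ∈ Finset.range m, c j ^ q with hE
  have hEt : E ≠ ∞ := by
    rw [hE]
    exact ENNReal.sum_ne_top.2 fun j _ => rpow_ne_top_of_nonneg hq0.le (hct j)
  refine ⟨C₄ + C₂ * (C₄ + E.toNNReal), K, ?_⟩
  intro Ω hΩ hne u D hu hD ε hε x hx hεx y hy
  have hx0 := bdist_pos hΩ hne hx
  set δ := bdist Ω x with hδ
  have hy1 := bdist_le_add Ω y x
  have hy2 := bdist_le_add' Ω x y
  have hyΩ : y ∈ Ω := mem_of_dist_lt hΩ hx (by linarith)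
  have hball : ∀ z, dist z y < δ / 20 → MollAt Ω ε 0 z := by
    intro z hz
    have h1 := dist_triangle z y x
    have h2 := bdist_le_add' Ω x z
    rw [MollAt, smul_zero, add_zero]
    exact ⟨mem_of_dist_lt hΩ hx (by linarith), by linarith⟩
  have hmoll : ∀ z ∈ ball y (1 / 200 * δ), MollAt Ω ε 0 z := fun z hz =>
    hball z (by rw [mem_ball] at hz; linarith)
  set r := 1 / 200 * δ with hr
  have hr0 : 0 < r := by positivity
  set A := coneSup Ω (powSum q m D) K x
  have htop : bavg (jetPow q m (moll Ω ε 0 u)) y r ≤ C₄ * A :=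
    hC₄ Ω hΩ u D hu hD ε hε 0 (by simp) x y r hr0 hyΩ (by linarith) (by linarith) (by linarith) hmoll
  refine ⟨htop.trans (by gcongr; simp), fun f hH k hk => ?_⟩
  set B := shadowAvg Ω f P x with hB
  have hmean : ∀ j < m, ‖∫ z in ball (0 : Eucl d) 1,
      iteratedFDeriv ℝ j (moll Ω ε 0 u) (y + r • z)‖ₑ ^ q ≤
      (ofReal δ ^ q) ^ (m - j) * (C₄ * A + E * B ^ q) := by
    intro j hj
    have h1 := hC₅ j Ω hΩ m hj.le u D hu hD ε hε 0 y r hr0 (Ω ∩ ball x (2 * δ)) hmoll (by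
      intro z hz
      rw [norm_zero, zero_add, mul_one, mem_ball] at hz
      have h2 := dist_triangle z y x
      refine ⟨(by simpa using (hball z (by linarith)).1), ?_⟩
      rw [mem_ball]; linarith)
    have h2 : ‖∫ z in ball (0 : Eucl d) 1, iteratedFDeriv ℝ j (moll Ω ε 0 u) (y + r • z)‖ₑ ≤
        c j * (ofReal δ ^ (m - j) * B) := by
      refine h1.trans ?_
      have h3 : ∀ γ ∈ multiIndices d j, ∫⁻ y in Ω ∩ ball x (2 * δ), ‖D γ y‖ₑ ≤
          ofReal C₀ * (ofReal δ ^ (m - j) * ∫⁻ y in Ω ∩ ball x (P * δ), f y) := by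
        intro γ hγ
        have hγj := mem_multiIndices.1 hγ
        have := hH γ (by omega)
        rw [hγj] at this
        refine this.trans (le_of_eq ?_)
        rw [ENNReal.ofReal_mul' (by positivity), ENNReal.ofReal_pow hx0.le, mul_assoc]
      refine (mul_le_mul_right (mul_le_mul_right (sum_le_sum h3) _) _).trans (le_of_eq ?_)
      rw [Finset.sum_const, nsmul_eq_mul, hB, shadowAvg, hc, dw, ← hδ]
      have h4 : ofReal ((r ^ d)⁻¹) = ofReal (200 ^ d) * ofReal (δ ^ (-(d : ℝ))) := by
        rw [← ofReal_mul (by positivity), Real.rpow_neg hx0.le, Real.rpow_natCast, hr,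
          mul_pow, mul_inv]
        congr 2
        rw [one_div, inv_pow, inv_inv]
      rw [h4]
      ring
    calc _ ≤ (c j * (ofReal δ ^ (m - j) * B)) ^ q := rpow_le_rpow h2 hq0.le
      _ = (ofReal δ ^ q) ^ (m - j) * (c j ^ q * B ^ q) := by
          generalize c j = cj
          rw [mul_rpow_of_nonneg _ _ hq0.le, mul_rpow_of_nonneg _ _ hq0.le,
            ← rpow_natCast, ← rpow_natCast, ← rpow_mul,
            ← rpow_mul, mul_comm q]
          ring
      _ ≤ _ := by
          gcongr
          refine le_trans ?_ le_add_self
          gcongr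
          exact single_le_sum (f := fun j => c j ^ q) (fun _ _ => bot_le)
            (mem_range.2 hj)
  have := hC₂ (moll Ω ε 0 u) (moll_smooth hε 0 hu) (y, r) (y, r) (y, r) (y, r) δ
    (C₄ * A + E * B ^ q) hr0.le (by simp only; linarith) (by
      intro B' hB'
      simp only [segment_same, Set.union_self, Set.mem_singleton_iff] at hB'
      subst hB'
      simp only [sub_self, norm_zero, abs_zero, add_zero]
      exact ⟨by linarith, htop.trans le_self_add⟩) hmean k hk
  refine this.trans ?_
  calc C₂ * ((ofReal δ ^ q) ^ (m - k) * (C₄ * A + E * B ^ q))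
      ≤ C₂ * ((ofReal δ ^ q) ^ (m - k) * ((C₄ + E) * A + (C₄ + E) * B ^ q)) := by
        gcongr
        · exact le_self_add
        · exact le_add_self
    _ = (C₂ * (C₄ + E)) * ((ofReal δ ^ q) ^ (m - k) * (A + B ^ q)) := by ring
    _ ≤ _ := by
        gcongr
        push_cast
        rw [coe_toNNReal hEt]
        exact le_add_self

/-- A smooth function that agrees with `u`, up to a mollification, away from the boundary. -/
lemma exists_cutoff_moll (d m : ℕ) (hq : 1 ≤ q) (C₀ P : ℝ) :
    ∃ (C : ℝ≥0) (K : ℝ), ∀ (Ω : Set (Eucl d)), IsOpen Ω → (frontier Ω).Nonempty →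
    ∀ (u : Eucl d → ℂ) (D : Jet d), LocallyIntegrableOn u Ω → IsJet Ω m u D →
    ∀ ε : ℝ, 0 < ε → ∃ V : Eucl d → ℂ, Smooth V ∧ (∀ y, ¬ (y ∈ Ω ∧ ε ≤ bdist Ω y) → V y = 0) ∧
      (∀ y ∈ Ω, 2 * ε ≤ bdist Ω y → V y = moll Ω (ε / 200) 0 u y) ∧
      ∀ x ∈ Ω, ∀ y, dist y x < 3 / 5 * bdist Ω x →
        (6 * ε ≤ bdist Ω x → bavg (jetPow q m V) y (1 / 200 * bdist Ω x) ≤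
          C * coneSup Ω (powSum q m D) K x) ∧
        ∀ f : Eucl d → ℝ≥0∞, HardyAt Ω m D f C₀ P x →
        ∀ k ≤ m, bavg (jetPow q k V) y (1 / 200 * bdist Ω x) ≤
          C * ((ofReal (bdist Ω x) ^ q) ^ (m - k) *
            (coneSup Ω (powSum q m D) K x + shadowAvg Ω f P x ^ q)) := by
  have hq0 : 0 < q := by linarith
  obtain ⟨C₁, K, hC₁⟩ := exists_hardy_moll_bound d m hq C₀ P
  choose C₃ hC₃ using fun k => exists_leibniz_const d k hq
  obtain ⟨C₅, hC₅0, hC₅⟩ := exists_cutoff d m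
  set Cq : ℝ≥0∞ := ofReal (24 ^ m * C₅) ^ q
  have hCqt : Cq ≠ ∞ := rpow_ne_top_of_nonneg hq0.le ofReal_ne_top
  set S₃ : ℝ≥0 := ∑ k ∈ Finset.range (m + 1), C₃ k
  refine ⟨C₁ + S₃ * Cq.toNNReal * C₁, K, ?_⟩
  intro Ω hΩ hne u D hu hD ε hε
  set S : Set (Eucl d) := {y | y ∈ Ω ∧ 3 / 2 * ε ≤ bdist Ω y}
  obtain ⟨χ, hχs, hχ1, hχ0, hχb⟩ := hC₅ S (isClosed_inner (by positivity)).measurableSet (ε / 4)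
    (by positivity)
  set T := moll Ω (ε / 200) 0 u
  have hTs : Smooth T := moll_smooth (by positivity) 0 hu
  have hχ1' : ∀ y ∈ Ω, 2 * ε ≤ bdist Ω y → χ y = 1 := fun y hy h => hχ1 y fun z hz => by
    rw [mem_ball] at hz
    have h1 := bdist_le_add' Ω y z
    exact ⟨mem_of_dist_lt hΩ hy (by linarith), by linarith⟩
  have hχ0' : ∀ y, ¬ (y ∈ Ω ∧ 5 / 4 * ε ≤ bdist Ω y) → χ y = 0 := fun y h => by
    refine hχ0 y (Set.disjoint_left.2 fun z hz hzS => h ?_)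
    rw [mem_ball] at hz
    have h1 := bdist_le_add Ω z y
    have h2 : 3 / 2 * ε ≤ bdist Ω z := hzS.2
    rw [dist_comm] at hz
    exact ⟨mem_of_dist_lt hΩ hzS.1 (by linarith), by rw [dist_comm] at hz; linarith⟩
  refine ⟨fun y => χ y * T y, hχs.mul hTs, fun y h => ?_, fun y hy h => ?_, ?_⟩
  · have : χ y = 0 := hχ0' y fun h' => h ⟨h'.1, by linarith [h'.2]⟩
    simp only [this, zero_mul]
  · simp only [hχ1' y hy h, one_mul]
  intro x hx y hy
  have hx0 := bdist_pos hΩ hne hx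
  set δ := bdist Ω x
  have hr0 : 0 < 1 / 200 * δ := by positivity
  have hpt : ∀ z ∈ ball y (1 / 200 * δ), z ∈ Ω ∧ 39 / 100 * δ ≤ bdist Ω z ∧
      bdist Ω z ≤ 161 / 100 * δ := by
    intro z hz
    rw [mem_ball] at hz
    have h1 := dist_triangle z y x
    have h2 := bdist_le_add' Ω x z
    have h3 := bdist_le_add Ω z x
    exact ⟨mem_of_dist_lt hΩ hx (by linarith), by linarith, by linarith⟩
  have hbig : 6 * ε ≤ δ → ∀ z ∈ ball y (1 / 200 * δ), χ z * T z = T z := fun h z hz => by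
    obtain ⟨h1, h2, -⟩ := hpt z hz
    rw [hχ1' z h1 (by linarith), one_mul]
  constructor
  · intro h
    rw [bavg_jetPow_congr hr0 (hbig h)]
    refine ((hC₁ Ω hΩ hne u D hu hD (ε / 200) (by positivity) x hx (by linarith) y hy).1).trans ?_
    gcongr
    simp
  · intro f hH k hk
    rcases lt_or_ge δ (3 / 4 * ε) with hsmall | hge
    · rw [bavg_jetPow_eq_zero hq0 hr0]
      · exact bot_le
      · intro z hz
        rw [hχ0' z fun h => by linarith [h.2, (hpt z hz).2.2], zero_mul]
    have hTb := (hC₁ Ω hΩ hne u D hu hD (ε / 200) (by positivity) x hx (by linarith) y hy).2 f hH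
    set A := coneSup Ω (powSum q m D) K x + shadowAvg Ω f P x ^ q
    rcases le_or_gt (6 * ε) δ with hlarge | hlt
    · rw [bavg_jetPow_congr hr0 (hbig hlarge)]
      refine (hTb k hk).trans ?_
      gcongr
      simp
    · have := hC₃ k χ T hχs hTs y (1 / 200 * δ) δ (24 ^ m * C₅)
        (C₁ * ((ofReal δ ^ q) ^ (m - k) * A)) hr0 hx0 ?_ ?_
      · refine this.trans ?_
        calc (C₃ k : ℝ≥0∞) * (Cq * (C₁ * ((ofReal δ ^ q) ^ (m - k) * A)))
            = (C₃ k * Cq * C₁) * ((ofReal δ ^ q) ^ (m - k) * A) := by ring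
          _ ≤ _ := by
              gcongr
              push_cast
              rw [coe_toNNReal hCqt]
              refine le_trans ?_ le_add_self
              gcongr
              exact single_le_sum (f := C₃) (fun _ _ => bot_le)
                (mem_range.2 (by omega))
      · intro i hi z _
        exact le_of_scaled_cutoff (hi.trans hk) (norm_nonneg _) hx0.le (by positivity)
          (by norm_num) (by linarith) (hχb i (hi.trans hk) z)
      · intro j hj
        refine (hTb j (hj.trans hk)).trans (le_of_eq ?_)
        have : m - j = (k - j) + (m - k) := by omega
        rw [this, pow_add]; ring

lemma enorm_le_powSum_rpow (hq : 0 < q) (D : Jet d) (hγ : γ ∈ multiIndices d m) (y : Eucl d) :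
    ‖D γ y‖ₑ ≤ powSum q m D y ^ (1 / q) := by
  calc ‖D γ y‖ₑ = (‖D γ y‖ₑ ^ q) ^ (1 / q) := by
        rw [← rpow_mul, mul_one_div_cancel hq.ne', rpow_one]
    _ ≤ _ := by
        refine rpow_le_rpow ?_ (by positivity)
        exact single_le_sum (f := fun γ => ‖D γ y‖ₑ ^ q) (fun _ _ => bot_le) hγ

lemma tsupport_subset_inner (hε : 0 < ε) {V : Eucl d → ℂ}
    (hV : ∀ y, ¬ (y ∈ Ω ∧ ε ≤ bdist Ω y) → V y = 0) : tsupport V ⊆ {y | y ∈ Ω ∧ ε ≤ bdist Ω y} := by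
  refine closure_minimal (fun y hy => ?_) (isClosed_inner hε)
  by_contra hcon
  exact hy (hV y hcon)

/-- Approximation, on a graph domain, of functions with vanishing traces. -/
theorem exists_approx_of_hardyAt (hΩ : IsOpen Ω) (hne : (frontier Ω).Nonempty) (hΩne : Ω.Nonempty)
    (hlayer : HasLayerBounds Ω) (hp0 : 0 < p) (hθ0 : 0 < θ) (hθ : θ < 1)
    {q : ℝ≥0∞} (hq1 : 1 ≤ q) (hqt : q ≠ ∞) (hpd : p < ∞ → (d : ℝ) - 1 < p.toReal * (d - 1 + θ))
    (hu : MemSobolev m p θ q Ω u) (hD : IsJet Ω m u D) {C₀ P : ℝ} (hP : 0 ≤ P)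
    (hH : ∀ x ∈ Ω, HardyAt Ω m D (fun y => powSum q.toReal m D y ^ (1 / q.toReal)) C₀ P x) :
    ∃ φ : ℕ → Eucl d → ℂ, (∀ j, IsSmoothCompactIn Ω (φ j)) ∧ SobolevTendsto m p θ q Ω φ u := by
  have hq := one_le_toReal hq1 hqt
  have hq0 : 0 < q.toReal := by linarith
  set s := q.toReal
  obtain ⟨x₀, hx₀⟩ := hΩne
  have hx₀0 := bdist_pos hΩ hne hx₀
  have hfin := hu.avFinite hΩ hne hp0 hq1 hqt hD
  have hFm := hD.measurable_jet s
  set f : Eucl d → ℝ≥0∞ := fun y => powSum s m D y ^ (1 / s)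
  obtain ⟨C₁, hC₁⟩ := exists_wavg_le_of_test_balls d m hq
  obtain ⟨C₂, K, hC₂⟩ := exists_cutoff_moll d m hq C₀ P
  obtain ⟨C₃, hC₃⟩ := exists_leibniz_const d m hq
  obtain ⟨C₅, hC₅0, hC₅⟩ := exists_ball_cutoff d m
  set Cq : ℝ≥0∞ := ofReal (15 ^ m * C₅) ^ s
  have hCqt : Cq ≠ ∞ := rpow_ne_top_of_nonneg hq0.le ofReal_ne_top
  set R : ℕ → ℝ := fun n => n + bdist Ω x₀ with hR
  have hR0 : ∀ n, 0 < R n := fun n => by simp only [hR]; positivity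
  obtain ⟨ε, hε0, -, hεt⟩ := exists_null_seq one_pos
  choose V hVs hV0 hV1 hVb using fun n : ℕ => hC₂ Ω hΩ hne u D hu.1 hD (ε n) (hε0 n)
  choose ζ hζs hζc hζ1 hζ0 hζb using fun n : ℕ => hC₅ x₀ (R n) (hR0 n)
  set φ : ℕ → Eucl d → ℂ := fun n y => ζ n y * V n y with hφ
  have hφs : ∀ n, Smooth (φ n) := fun n => (hζs n).mul (hVs n)
  refine ⟨φ, fun n => ⟨⟨hφs n, (hζc n).mul_right⟩, ?_⟩, ?_⟩
  · refine (tsupport_subset_inner (hε0 n) fun y hy => ?_).trans fun y hy => hy.1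
    simp only [hφ, hV0 n y hy, mul_zero]
  set A : Eucl d → ℝ≥0∞ := fun x => coneSup Ω (powSum s m D) K x + shadowAvg Ω f P x ^ s
  have hAd : Dominating Ω p θ s A := (dominating_coneSup hΩ hne hp0 hθ hq hlayer hFm hfin _).add hq0
      (dominating_shadowAvg hΩ hne hp0 hθ0 hθ hq hpd hlayer hFm hfin hP)
  refine sobolevTendsto_of_dominated hΩ hne hlayer hp0 hθ hq1 hqt hu hD hφs
    (hAd.const_mul hq0 (C₁ * (C₃ * (Cq.toNNReal * C₂)))) ?_ ?_
  · intro n x hx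
    have hx0 := bdist_pos hΩ hne hx
    have hr0 : 0 < 1 / 200 * bdist Ω x := by positivity
    have hRx : bdist Ω x₀ ≤ R n := by simp [hR]
    have hxx₀ := bdist_le_add Ω x x₀
    have key := hC₁ Ω hΩ hne (φ n) (hφs n) x hx (1 / 200) (C₃ * (Cq * (C₂ * A x))) (by norm_num)
      (by norm_num) fun y hy => ?_
    · refine key.trans_eq ?_
      push_cast
      rw [coe_toNNReal hCqt]
      ring
    · rcases le_or_gt (14 * R n) (dist x x₀) with hfar | hnear
      · rw [bavg_jetPow_eq_zero hq0 hr0]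
        · exact bot_le
        · intro z hz
          rw [mem_ball] at hz
          have h1 := dist_triangle x z x₀
          have h2 := dist_triangle z y x
          rw [dist_comm z x] at h2
          have := hR0 n
          simp only [hφ]
          rw [hζ0 n z (by linarith), zero_mul]
      · refine hC₃ (ζ n) (V n) (hζs n) (hVs n) y (1 / 200 * bdist Ω x) (bdist Ω x) _ _ hr0 hx0 ?_ ?_
        · intro i hi z _
          exact le_of_scaled_cutoff hi (norm_nonneg _) hx0.le (hR0 n).le (by norm_num)
            (by linarith) (hζb n i hi z)
        · intro k hk
          refine ((hVb n x hx y hy).2 f (hH x hx) k hk).trans ?_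
          rw [mul_left_comm]
  · intro x hx
    have hx0 := bdist_pos hΩ hne hx
    refine tendsto_wavg_congr hΩ hne hx (tendsto_wavg_moll_sub hΩ hne hp0 hq hu.1 hD hfin hx 0
      (ε := fun n => ε n / 200) (fun n => by have := hε0 n; positivity)
      (by simpa using hεt.div_const 200)) ?_
    have hRt : Tendsto R atTop atTop := tendsto_atTop_add_const_right _ _ tendsto_natCast_atTop_atTop
    filter_upwards [hRt.eventually_gt_atTop (dist x x₀ + bdist Ω x),
      hεt.eventually (gt_mem_nhds (show 0 < bdist Ω x / 4 by positivity))] with n hn hn2 γ _ y hy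
    refine mixedDeriv_congr (hφs n) (moll_smooth (by have := hε0 n; positivity) 0 hu.1)
      (Filter.eventuallyEq_of_mem (isOpen_ball.mem_nhds hy) fun z hz => ?_) γ
    rw [mem_ball] at hz
    have h1 := bdist_le_add' Ω x z
    simp only [hφ]
    rw [hζ1 n z (by rw [mem_ball]; linarith [dist_triangle z x x₀]), one_mul,
      hV1 n z (mem_of_dist_lt hΩ hx (by linarith)) (by linarith)]

/-! ### Cutting off at infinity in exterior domains -/

lemma exists_norm_le_mul_coord (hd : 0 < d) (y : Eucl d) : ∃ i, ‖y‖ ≤ d * |y i| := by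
  have : Nonempty (Fin d) := ⟨⟨0, hd⟩⟩
  obtain ⟨i, -, hi⟩ := Finset.exists_max_image Finset.univ (fun i => |y i|) Finset.univ_nonempty
  refine ⟨i, ?_⟩
  have h1 : (1 : ℝ) ≤ d := by exact_mod_cast hd
  refine abs_le_of_sq_le_sq' ?_ (by positivity) |>.2
  rw [EuclideanSpace.real_norm_sq_eq]
  calc ∑ j, y j ^ 2 ≤ ∑ _j : Fin d, |y i| ^ 2 := sum_le_sum fun j hj => by
        rw [← sq_abs]; exact pow_le_pow_left₀ (abs_nonneg _) (hi j hj) 2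
    _ = d * |y i| ^ 2 := by simp
    _ ≤ (d * |y i|) ^ 2 := by rw [mul_pow]; gcongr; nlinarith

lemma abs_coord_le_norm (w : Eucl d) (i : Fin d) : |w i| ≤ ‖w‖ := PiLp.norm_apply_le w i

lemma exists_coord_of_mem_segment {i k : Fin d} (hik : i ≠ k) {σ R s : ℝ} (hσ : |σ| = 1)
    (hR : 0 ≤ R) {v w : Eucl d} (hv : v = (σ * R) • single i 1) (hw : w = R • single k 1) :
    ∃ j, R / 2 ≤ |(v + s • (w - v)) j| := by
  subst hv hw
  rcases le_or_gt s (1 / 2) with h | h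
  · refine ⟨i, le_of_le_of_eq (b := |σ * ((1 - s) * R)|) ?_ (by congr 1; simp [hik]; ring)⟩
    rw [abs_mul, hσ, one_mul, abs_of_nonneg (mul_nonneg (by linarith) hR)]
    nlinarith
  · refine ⟨k, le_of_le_of_eq (b := |s * R|) ?_ (by simp [hik.symm])⟩
    rw [abs_of_nonneg (mul_nonneg (by linarith) hR)]
    nlinarith

lemma norm_add_smul_sub_le {v : Eucl d} {s c : ℝ} (hs0 : 0 ≤ s) (hs1 : s ≤ 1) (hv : ‖v‖ ≤ c)
    (hw : ‖w‖ ≤ c) : ‖v + s • (w - v)‖ ≤ c := by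
  have h1 : v + s • (w - v) = (1 - s) • v + s • w := by module
  rw [h1]
  refine (norm_add_le _ _).trans ?_
  rw [norm_smul, norm_smul, norm_of_nonneg hs0, norm_of_nonneg (by linarith)]
  nlinarith

/-- Points of an annulus can be joined inside a larger annulus. -/
lemma exists_annulus_path (hd : 2 ≤ d) {R a : ℝ} (hR : 0 < R) (ha : a ≤ 1 / 2) (i₀ : Fin d)
    {i : Fin d} (hyi : a * R ≤ |y i|) (hy : ‖y‖ ≤ 10 * R) (r ρ : ℝ) :
    ∃ B₁ B₂ : Eucl d × ℝ, ∀ B ∈ segment ℝ (y, r) B₁ ∪ segment ℝ B₁ B₂ ∪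
      segment ℝ B₂ (R • single i₀ 1, ρ),
      (∃ j, a * R ≤ |B.1 j|) ∧ ‖B.1‖ ≤ 10 * R ∧ min r ρ ≤ B.2 ∧ B.2 ≤ max r ρ := by
  have : Nontrivial (Fin d) := Fin.nontrivial_iff_two_le.2 hd
  obtain ⟨k, hk⟩ : ∃ k, i ≠ k := (exists_ne i).imp fun _ => Ne.symm
  obtain ⟨σ, hσ, hσy⟩ : ∃ σ : ℝ, |σ| = 1 ∧ σ * |y i| = y i := by
    rcases le_total 0 (y i) with h | h
    · exact ⟨1, by simp, by rw [abs_of_nonneg h, one_mul]⟩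
    · exact ⟨-1, by simp, by rw [abs_of_nonpos h]; ring⟩
  have haR : a * R ≤ R / 2 := by nlinarith
  have hnσ : ∀ (σ : ℝ) (j : Fin d), |σ| = 1 → ‖(σ * R) • (single j (1 : ℝ) : Eucl d)‖ ≤ 10 * R := by
    intro σ j hσ
    rw [norm_smul, norm_eq_abs, abs_mul, hσ, abs_of_nonneg hR.le]
    simp only [one_mul, PiLp.norm_single, norm_one, mul_one]
    linarith
  have hseg : ∀ (σ : ℝ) (i k : Fin d), i ≠ k → |σ| = 1 → ∀ s : ℝ, 0 ≤ s → s ≤ 1 → ∀ v w : Eucl d,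
      v = (σ * R) • single i 1 → w = R • single k 1 →
      (∃ j, a * R ≤ |(v + s • (w - v)) j|) ∧ ‖v + s • (w - v)‖ ≤ 10 * R := by
    intro σ i k hik hσ s hs0 hs1 v w hv hw
    obtain ⟨j, hj⟩ := exists_coord_of_mem_segment hik (s := s) hσ hR.le hv hw
    exact ⟨⟨j, haR.trans hj⟩, norm_add_smul_sub_le hs0 hs1 (hv ▸ hnσ σ i hσ)
      (by have := hnσ 1 k (by simp); rwa [one_mul, ← hw] at this)⟩
  refine ⟨((σ * R) • single i 1, ρ), (R • single k 1, ρ), ?_⟩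
  rintro B ((hB | hB) | hB)
  · obtain ⟨s, hs0, hs1, rfl⟩ := mem_segment_prod hB
    refine ⟨⟨i, ?_⟩, norm_add_smul_sub_le hs0 hs1 hy (hnσ σ i hσ), ?_, ?_⟩
    · have h1 : (y + s • ((σ * R) • single i (1 : ℝ) - y) : Eucl d) i =
          σ * ((1 - s) * |y i| + s * R) := by
        simp only [PiLp.add_apply, PiLp.smul_apply, PiLp.sub_apply, smul_eq_mul,
          PiLp.single_apply, if_true, mul_one]
        linear_combination (s - 1) * hσy
      have h2 : 0 ≤ (1 - s) * |y i| := mul_nonneg (by linarith) (abs_nonneg _)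
      simp only
      rw [h1, abs_mul, hσ, one_mul, abs_of_nonneg (by positivity)]
      nlinarith
    · dsimp only; nlinarith [min_le_left r ρ, min_le_right r ρ]
    · dsimp only; nlinarith [le_max_left r ρ, le_max_right r ρ]
  · obtain ⟨s, hs0, hs1, rfl⟩ := mem_segment_prod hB
    obtain ⟨h1, h2⟩ := hseg σ i k hk hσ s hs0 hs1 _ _ rfl rfl
    exact ⟨h1, h2, by simp, by simp⟩
  · obtain ⟨s, hs0, hs1, rfl⟩ := mem_segment_prod hB
    have h3 := hnσ 1 k (by simp)
    rw [one_mul] at h3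
    by_cases hki : k = i₀
    · rw [← hki]
      refine ⟨⟨k, ?_⟩, by simpa using h3, by simp, by simp⟩
      simp only [sub_self, smul_zero, add_zero, PiLp.smul_apply, PiLp.single_apply, if_true,
        smul_eq_mul, mul_one]
      rw [abs_of_nonneg hR.le]
      linarith
    · obtain ⟨h1, h2⟩ := hseg 1 k i₀ hki (by simp) s hs0 hs1 _ _ (by rw [one_mul]) rfl
      exact ⟨h1, h2, by simp, by simp⟩

set_option maxHeartbeats 1000000 in
/-- Cutting off, in an exterior domain, a function that agrees with a mollification of `u` away
from the boundary. -/
lemma exists_exterior_cutoff (d m : ℕ) (hd : 2 ≤ d) (hq : 1 ≤ q) {τ : ℝ} (hτ0 : 0 < τ)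
    (hτ : 2000 * d * τ ≤ 1) :
    ∃ (C : ℝ≥0) (K : ℝ), ∀ (Ω : Set (Eucl d)), IsOpen Ω → (frontier Ω).Nonempty →
    ∀ D₁ : ℝ, 0 < D₁ → frontier Ω ⊆ ball 0 D₁ → (∀ x, D₁ ≤ ‖x‖ → x ∈ Ω) →
    ∀ (u : Eucl d → ℂ) (D : Jet d), LocallyIntegrableOn u Ω → IsJet Ω m u D →
    ∀ ε : ℝ, 0 < ε → 10 * ε ≤ D₁ → ∀ U : Eucl d → ℂ, Smooth U →
    (∀ y, D₁ ≤ ‖y‖ → U y = moll Ω ε 0 u y) → ∀ R : ℝ, 100 * d * D₁ ≤ R →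
    ∃ φ P : Eucl d → ℂ, IsSmoothCompact φ ∧ Smooth P ∧ iteratedFDeriv ℝ m P = 0 ∧
      (∀ y ∈ ball 0 R, φ y = U y - P y) ∧
      ∀ x ∈ Ω, ∀ y, dist y x < 3 / 5 * bdist Ω x → bavg (jetPow q m φ) y (τ * bdist Ω x) ≤
          bavg (jetPow q m U) y (τ * bdist Ω x) + C * coneSup Ω (powSum q m D) K x := by
  have hq0 : 0 < q := by linarith
  have hd0 : (2 : ℝ) ≤ d := by exact_mod_cast hd
  obtain ⟨C₂, hC₂⟩ := exists_path_const d m hq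
  obtain ⟨C₃, hC₃⟩ := exists_leibniz_const d m hq
  obtain ⟨C₄, K, hC₄⟩ := exists_bavg_moll_le_coneSup d m hq (40 / τ) (B₀ := 0) le_rfl
  obtain ⟨C₅, hC₅0, hC₅⟩ := exists_ball_cutoff d m
  set Cq : ℝ≥0∞ := ofReal (24 ^ m * C₅) ^ q
  have hCqt : Cq ≠ ∞ := rpow_ne_top_of_nonneg hq0.le ofReal_ne_top
  refine ⟨C₃ * Cq.toNNReal * C₂ * C₄, K, ?_⟩
  intro Ω hΩ hne D₁ hD₁ hfr hext u D hu hD ε hε hεD U hUs hU R hR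
  have hRD : 200 * D₁ ≤ R := by nlinarith
  have hR0 : 0 < R := by linarith
  set a : ℝ := 1 / (10 * d) with ha
  have had : a * d = 1 / 10 := by rw [ha]; field_simp
  have ha0 : 0 < a := by positivity
  have haR : 10 * D₁ ≤ a * R := by
    calc 10 * D₁ = a * (100 * d * D₁) := by linear_combination (-100 * D₁) * had
      _ ≤ a * R := by gcongr
  have hτa : 200 * τ ≤ a := by
    rw [ha, le_div_iff₀ (by positivity)]; linarith
  have ha1 : a ≤ 1 / 20 := by nlinarith
  have hlow := norm_sub_le_bdist hne hfr
  have hup := bdist_le_norm_add hne hfr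
  set i₀ : Fin d := ⟨0, by omega⟩
  obtain ⟨P, hPs, hP0, hPm⟩ := exists_polynomial_mean_zero hUs (R • single i₀ 1) (τ * R) m
  obtain ⟨ζ, hζs, hζc, hζ1, hζ0, hζb⟩ := hC₅ 0 R hR0
  set V : Eucl d → ℂ := fun y => U y - P y with hV
  have hVs : Smooth V := hUs.sub hPs
  have eV : jetPow q m V = jetPow q m U := by
    funext z; rw [jetPow, jetPow, iteratedFDeriv_sub_of_eq_zero hUs hPs hP0]
  refine ⟨fun y => ζ y * V y, P, ⟨hζs.mul hVs, hζc.mul_right⟩, hPs, hP0,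
    fun y hy => by simp only [hζ1 y hy, one_mul, hV], fun x hx y hy => ?_⟩
  have hx0 := bdist_pos hΩ hne hx
  set r := τ * bdist Ω x with hr
  have hr0 : 0 < r := by positivity
  have hrδ : r ≤ 1 / 200 * bdist Ω x := by rw [hr]; gcongr; linarith
  have hlx := hlow x
  have hux := hup x
  set A := coneSup Ω (powSum q m D) K x
  by_cases hin : ball y r ⊆ ball 0 R
  · rw [bavg_jetPow_congr (g := V) hr0 fun z hz => by rw [hζ1 z (hin hz), one_mul], eV]
    exact le_self_add
  refine le_trans ?_ le_add_self
  obtain ⟨z, hz, hzR⟩ := Set.not_subset.1 hin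
  rw [mem_ball_zero_iff, not_lt] at hzR
  rw [mem_ball] at hz
  have hzx := dist_triangle z y x
  have hxR : R / 2 ≤ ‖x‖ := by
    have := norm_sub_le_dist z x
    linarith
  rcases le_or_gt (6 * R) ‖x‖ with hfar | hnear
  · rw [bavg_jetPow_eq_zero hq0 hr0]
    · exact bot_le
    · intro z' hz'
      rw [mem_ball] at hz'
      have h1 := dist_triangle z' y x
      have h2 := norm_sub_le_dist' x z'
      rw [hζ0 z' (by rw [dist_zero_right]; linarith), zero_mul]
  have e0 : ((C₃ * Cq.toNNReal * C₂ * C₄ : ℝ≥0) : ℝ≥0∞) * A = C₃ * (Cq * (C₂ * (C₄ * A))) := by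
    push_cast
    rw [coe_toNNReal hCqt]; ring
  rw [e0]
  refine hC₃ ζ V hζs hVs y r (24 * R) (24 ^ m * C₅) (C₂ * (C₄ * A)) hr0 (by positivity) ?_ ?_
  · intro i hi z _
    exact le_of_scaled_cutoff hi (norm_nonneg _) (by positivity) hR0.le (by norm_num) le_rfl
      (hζb i hi z)
  have hτR : 0 < τ * R := by positivity
  have hrR1 : 49 / 100 * (τ * R) ≤ r := by rw [hr]; nlinarith
  have hrR2 : r ≤ 601 / 100 * (τ * R) := by rw [hr]; nlinarith
  have hτaR : 200 * (τ * R) ≤ a * R := by nlinarith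
  have htop : ∀ (w : Eucl d) (ρ : ℝ), (∃ j, a * R ≤ |w j|) → ‖w‖ ≤ 10 * R →
      49 / 100 * (τ * R) ≤ ρ → ρ ≤ 601 / 100 * (τ * R) →
      ‖w - R • single i₀ 1‖ + |ρ - τ * R| ≤ 24 * R / 2 ∧ bavg (jetPow q m V) w ρ ≤ C₄ * A := by
    rintro w ρ ⟨j, hj⟩ hw h1 h2
    have hjw : a * R ≤ ‖w‖ := hj.trans (abs_coord_le_norm w j)
    have hρ0 : 0 < ρ := by linarith
    have haR1 : a * R ≤ 1 / 20 * R := by gcongr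
    have hKρ : 19 * R ≤ 40 / τ * ρ := by
      calc 19 * R ≤ 40 / τ * (49 / 100 * (τ * R)) := by field_simp; norm_num
        _ ≤ _ := by gcongr
    have hwD : D₁ ≤ ‖w‖ := by linarith
    have hlw := hlow w
    have hpts : ∀ z ∈ ball w ρ, 9 * (a * R) / 10 ≤ ‖z‖ := fun z hz => by
      have := norm_sub_norm_le w z
      rw [mem_ball, dist_comm, dist_eq_norm] at hz
      linarith
    constructor
    · have h3 : ‖R • single i₀ (1 : ℝ)‖ = R := by
        rw [norm_smul, norm_of_nonneg hR0.le]; simp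
      have h4 := norm_sub_le w (R • single i₀ (1 : ℝ))
      have h5 : |ρ - τ * R| ≤ R := by rw [abs_le]; constructor <;> linarith
      linarith
    · rw [eV, bavg_jetPow_congr (g := moll Ω ε 0 u) hρ0 fun z hz => hU z (by
        linarith [hpts z hz])]
      refine hC₄ Ω hΩ u D hu hD ε hε 0 (by simp) x w ρ hρ0 (hext w hwD) (by linarith)
        (by linarith [hup w]) ?_ fun z hz => ?_
      · rw [dist_eq_norm]
        linarith [norm_sub_le w x]
      · have h3 := hpts z hz
        rw [MollAt, smul_zero, add_zero]
        exact ⟨hext z (by linarith), by linarith [hlow z]⟩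
  have hyn := norm_sub_le_dist' x y
  have hyn2 := norm_sub_le_dist y x
  have hylow : 19 / 100 * R ≤ ‖y‖ := by linarith
  have hyup : ‖y‖ ≤ 10 * R := by linarith
  obtain ⟨i, hi⟩ := exists_norm_le_mul_coord (by omega) y
  have hyi : a * R ≤ |y i| := by
    have h1 : a * (19 / 100 * R) ≤ a * (d * |y i|) :=
      mul_le_mul_of_nonneg_left (hylow.trans hi) ha0.le
    have h2 : a * (d * |y i|) = 1 / 10 * |y i| := by rw [← mul_assoc, had]
    linarith
  obtain ⟨B₁, B₂, hpath⟩ := exists_annulus_path hd hR0 (by linarith : a ≤ 1 / 2) i₀ hyi hyup r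
    (τ * R)
  intro k' hk'
  have := hC₂ V hVs (y, r) B₁ B₂ (R • single i₀ 1, τ * R) (24 * R)
    (C₄ * A) hτR.le (by simp only; linarith) ?_ ?_ k' hk'
  · exact this.trans (le_of_eq (by ring))
  · intro B hB
    obtain ⟨h1, h2, h3, h4⟩ := hpath B hB
    exact htop B.1 B.2 h1 h2 ((le_min hrR1 (by linarith)).trans h3)
      (h4.trans (max_le hrR2 (by linarith)))
  · intro j hj
    have := hPm j hj
    simp only at this ⊢
    rw [this, enorm_zero, zero_rpow_of_pos hq0]
    exact bot_le

/-! ### Domains with bounded boundary -/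

/-- `Ω` lies in a ball, or contains the exterior of a ball. -/
def BoundedOrExterior (Ω : Set (Eucl d)) (D₁ : ℝ) : Prop :=
  Ω ⊆ ball 0 D₁ ∨ (2 ≤ d ∧ ∀ x, D₁ ≤ ‖x‖ → x ∈ Ω)

/-- Dominated, locally convergent sequences can be made compactly supported. -/
theorem exists_compactly_supported_approx (hΩ : IsOpen Ω) (hne : (frontier Ω).Nonempty)
    (hlayer : HasLayerBounds Ω) (hp0 : 0 < p) (hθ : θ < 1) {q : ℝ≥0∞}
    (hq1 : 1 ≤ q) (hqt : q ≠ ∞) (hu : MemSobolev m p θ q Ω u) (hD : IsJet Ω m u D) {D₁ : ℝ}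
    (hD₁ : 0 < D₁) (hfr : frontier Ω ⊆ ball 0 D₁) (hcase : BoundedOrExterior Ω D₁) {ε : ℕ → ℝ}
    (hε : ∀ n, 0 < ε n) (hεD : ∀ n, 10 * ε n ≤ D₁) {U : ℕ → Eucl d → ℂ} (hUs : ∀ n, Smooth (U n))
    (hU : ∀ n y, y ∈ Ω → D₁ ≤ ‖y‖ → U n y = moll Ω (ε n) 0 u y) {τ : ℝ} (hτ0 : 0 < τ)
    (hτ : 2000 * d * τ ≤ 1) (hτ1 : τ ≤ 1 / 100) {A : Eucl d → ℝ≥0∞}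
    (hA : Dominating Ω p θ q.toReal A) (hUA : ∀ n, ∀ x ∈ Ω, ∀ y, dist y x < 3 / 5 * bdist Ω x →
      bavg (jetPow q.toReal m (U n)) y (τ * bdist Ω x) ≤ A x)
    (hconv : ∀ x ∈ Ω, Tendsto (fun n => wavg Ω (powSum q.toReal m
      fun γ y => D γ y - mixedDeriv γ (U n) y) x) atTop (𝓝 0)) :
    ∃ φ P : ℕ → Eucl d → ℂ, (∀ n, IsSmoothCompact (φ n)) ∧ (∀ n, Smooth (P n)) ∧
      (∀ n, iteratedFDeriv ℝ m (P n) = 0) ∧ (∀ n, ∀ y ∈ ball 0 D₁, φ n y = U n y - P n y) ∧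
      (Ω ⊆ ball 0 D₁ → ∀ n, tsupport (φ n) ⊆ tsupport (U n)) ∧
      SobolevTendsto m p θ q Ω φ u := by
  have hq := one_le_toReal hq1 hqt
  have hq0 : 0 < q.toReal := by linarith
  set s := q.toReal
  set R : ℕ → ℝ := fun n => n + (100 * d + 1) * D₁ with hR
  have hRD : ∀ n, D₁ ≤ R n := fun n => by
    have : 0 ≤ (n : ℝ) + 100 * d * D₁ := by positivity
    simp only [hR]; linarith
  have hRt : Tendsto R atTop atTop := tendsto_atTop_add_const_right _ _ tendsto_natCast_atTop_atTop
  obtain ⟨C, K, φ, P, hφ, hP, hP0, hφP, hsupp, hdom⟩ : ∃ (C : ℝ≥0) (K : ℝ) (φ P : ℕ → Eucl d → ℂ),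
      (∀ n, IsSmoothCompact (φ n)) ∧ (∀ n, Smooth (P n)) ∧ (∀ n, iteratedFDeriv ℝ m (P n) = 0) ∧
      (∀ n, ∀ y ∈ ball 0 (R n), φ n y = U n y - P n y) ∧
      (Ω ⊆ ball 0 D₁ → ∀ n, tsupport (φ n) ⊆ tsupport (U n)) ∧
      ∀ n, ∀ x ∈ Ω, ∀ y, dist y x < 3 / 5 * bdist Ω x → bavg (jetPow s m (φ n)) y (τ * bdist Ω x) ≤
          bavg (jetPow s m (U n)) y (τ * bdist Ω x) + C * coneSup Ω (powSum s m D) K x := by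
    by_cases hb : Ω ⊆ ball 0 D₁
    · obtain ⟨C₅, hC₅0, hC₅⟩ := exists_ball_cutoff d m
      choose ζ hζs hζc hζ1 hζ0 hζb using fun n : ℕ => hC₅ 0 (R n) (hD₁.trans_le (hRD n))
      refine ⟨0, 0, fun n y => ζ n y * U n y, fun _ _ => 0, fun n => ⟨(hζs n).mul (hUs n),
        (hζc n).mul_right⟩, fun n => contDiff_const, fun n => ?_, fun n y hy => ?_,
        fun _ n => closure_mono fun y hy => right_ne_zero_of_mul hy, ?_⟩
      · exact iteratedFDeriv_fun_zero
      · simp only [hζ1 n y hy, one_mul, sub_zero]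
      · intro n x hx y hy
        have hx0 := bdist_pos hΩ hne hx
        rw [bavg_jetPow_congr (g := U n) (by positivity)]
        · exact le_self_add
        · intro z hz
          rw [mem_ball] at hz
          have h1 := dist_triangle z y x
          have h2 : z ∈ Ω := mem_of_dist_lt hΩ hx (by nlinarith)
          simp only [hζ1 n z (ball_subset_ball (hRD n) (hb h2)), one_mul]
    · obtain ⟨hd, hext⟩ := hcase.resolve_left hb
      obtain ⟨C, K, hC⟩ := exists_exterior_cutoff d m hd hq hτ0 hτ
      choose φ P h1 h2 h3 h4 h5 using fun n : ℕ => hC Ω hΩ hne D₁ hD₁ hfr hext u D hu.1 hD (ε n)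
        (hε n) (hεD n) (U n) (hUs n) (fun y hy => hU n y (hext y hy) hy) (R n)
        (by simp only [hR]; have : (0 : ℝ) ≤ n := Nat.cast_nonneg n; linarith)
      exact ⟨C, K, φ, P, h1, h2, h3, h4, fun h => absurd h hb, h5⟩
  refine ⟨φ, P, hφ, hP, hP0, fun n y hy => hφP n y (ball_subset_ball (hRD n) hy), hsupp, ?_⟩
  obtain ⟨C₁, hC₁⟩ := exists_wavg_le_of_test_balls d m hq
  refine sobolevTendsto_of_dominated hΩ hne hlayer hp0 hθ hq1 hqt hu hD (fun n => (hφ n).1)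
    ((hA.add hq0 ((dominating_coneSup hΩ hne hp0 hθ hq hlayer (hD.measurable_jet _)
      (hu.avFinite hΩ hne hp0 hq1 hqt hD) K).const_mul hq0 C)).const_mul hq0 C₁)
    (fun n x hx => hC₁ Ω hΩ hne (φ n) (hφ n).1 x hx τ _ hτ0 hτ1 fun y hy =>
      (hdom n x hx y hy).trans (by gcongr; exact hUA n x hx y hy))
    fun x hx => tendsto_wavg_sub_polynomial hΩ hne hx (hconv x hx) hUs (fun n => (hφ n).1) hP hP0
      hRt hφP

/-- Approximation, on domains with bounded boundary, of functions with vanishing traces. -/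
theorem exists_approx_of_hardyAt_near (hd : 0 < d) (hΩ : IsOpen Ω) (hne : (frontier Ω).Nonempty)
    (hlayer : HasLayerBounds Ω) (hp0 : 0 < p) (hθ0 : 0 < θ) (hθ : θ < 1)
    {q : ℝ≥0∞} (hq1 : 1 ≤ q) (hqt : q ≠ ∞) (hpd : p < ∞ → (d : ℝ) - 1 < p.toReal * (d - 1 + θ))
    (hu : MemSobolev m p θ q Ω u) (hD : IsJet Ω m u D) {D₁ : ℝ} (hD₁ : 0 < D₁)
    (hfr : frontier Ω ⊆ ball 0 D₁) (hcase : BoundedOrExterior Ω D₁) {C₀ P : ℝ} (hP : 0 ≤ P)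
    {h : ℝ} (hh : 0 < h) (hH : ∀ x ∈ Ω, bdist Ω x < h →
      HardyAt Ω m D (fun y => powSum q.toReal m D y ^ (1 / q.toReal)) C₀ P x) :
    ∃ V φ P : ℕ → Eucl d → ℂ, (∀ n, Smooth (V n)) ∧ (∀ n, tsupport (V n) ⊆ Ω) ∧
      (∀ n, IsSmoothCompact (φ n)) ∧ (∀ n, Smooth (P n)) ∧
      (∀ n, iteratedFDeriv ℝ m (P n) = 0) ∧
      (∀ n, ∀ y ∈ ball 0 (2 * D₁), φ n y = V n y - P n y) ∧
      (Ω ⊆ ball 0 D₁ → ∀ n, tsupport (φ n) ⊆ tsupport (V n)) ∧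
      SobolevTendsto m p θ q Ω φ u := by
  have hq := one_le_toReal hq1 hqt
  have hq0 : 0 < q.toReal := by linarith
  set s := q.toReal
  have hfin := hu.avFinite hΩ hne hp0 hq1 hqt hD
  have hFm := hD.measurable_jet s
  have hd1 : (1 : ℝ) ≤ d := by exact_mod_cast hd
  set f : Eucl d → ℝ≥0∞ := fun y => powSum s m D y ^ (1 / s)
  obtain ⟨C₂, K, hC₂⟩ := exists_cutoff_moll d m hq C₀ P
  set κ : ℝ := min (h / 6) (D₁ / 10)
  have hκ0 : 0 < κ := by positivity
  have hκh : κ ≤ h / 6 := min_le_left _ _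
  have hκD : κ ≤ D₁ / 10 := min_le_right _ _
  obtain ⟨ε, hε0, hε1, hεt⟩ := exists_null_seq hκ0
  choose V hVs hV0 hV1 hVb using fun n : ℕ => hC₂ Ω hΩ hne u D hu.1 hD (ε n) (hε0 n)
  set A : Eucl d → ℝ≥0∞ := fun x => coneSup Ω (powSum s m D) K x + shadowAvg Ω f P x ^ s
  have hAd : Dominating Ω p θ s A := (dominating_coneSup hΩ hne hp0 hθ hq hlayer hFm hfin _).add hq0
      (dominating_shadowAvg hΩ hne hp0 hθ0 hθ hq hpd hlayer hFm hfin hP)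
  set τ : ℝ := 1 / (2000 * d) with hτ
  have hτ0 : 0 < τ := by positivity
  have hτ1 : τ ≤ 1 / 2000 := by
    rw [hτ]; gcongr; linarith
  have hlow := norm_sub_le_bdist hne hfr
  have hcase' : BoundedOrExterior Ω (2 * D₁) := by
    rcases hcase with h1 | ⟨h1, h2⟩
    · exact Or.inl (h1.trans (ball_subset_ball (by linarith)))
    · exact Or.inr ⟨h1, fun x hx => h2 x (by linarith)⟩
  have hk1 : ∀ n, ∀ x ∈ Ω, ∀ y, dist y x < 3 / 5 * bdist Ω x → bavg (jetPow s m (V n)) y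
      (τ * bdist Ω x) ≤ (Real.toNNReal ((10 * d) ^ d) * C₂ : ℝ≥0) * A x := by
    intro n x hx y hy
    have hx0 := bdist_pos hΩ hne hx
    have hb : bavg (jetPow s m (V n)) y (1 / 200 * bdist Ω x) ≤ C₂ * A x := by
      rcases lt_or_ge (bdist Ω x) h with hxh | hxh
      · have := (hVb n x hx y hy).2 f (hH x hx hxh) m le_rfl
        rwa [Nat.sub_self, pow_zero, one_mul] at this
      · refine ((hVb n x hx y hy).1 (by linarith [hε1 n])).trans ?_
        gcongr
        exact le_self_add
    refine (bavg_le_of_subset (r' := 1 / 200 * bdist Ω x) (w' := y) (by positivity) (by positivity)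
      (ball_subset_ball (by gcongr; linarith))).trans ?_
    have e1 : 1 / 200 * bdist Ω x / (τ * bdist Ω x) = 10 * d := by
      rw [hτ]; field_simp; norm_num
    rw [e1]
    push_cast
    rw [mul_assoc]
    gcongr
    exact le_rfl
  have hk2 : ∀ x ∈ Ω, Tendsto (fun n => wavg Ω (powSum s m
      fun γ y => D γ y - mixedDeriv γ (V n) y) x) atTop (𝓝 0) := by
    intro x hx
    have hx0 := bdist_pos hΩ hne hx
    refine tendsto_wavg_congr hΩ hne hx (tendsto_wavg_moll_sub hΩ hne hp0 hq hu.1 hD hfin hx 0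
      (ε := fun n => ε n / 200) (fun n => by have := hε0 n; positivity)
      (by simpa using hεt.div_const 200)) ?_
    filter_upwards [hεt.eventually (gt_mem_nhds (show 0 < bdist Ω x / 4 by positivity))]
      with n hn2 γ _ y hy
    refine mixedDeriv_congr (hVs n) (moll_smooth (by have := hε0 n; positivity) 0 hu.1)
      (Filter.eventuallyEq_of_mem (isOpen_ball.mem_nhds hy) fun z hz => ?_) γ
    rw [mem_ball] at hz
    have h1 := bdist_le_add' Ω x z
    exact hV1 n z (mem_of_dist_lt hΩ hx (by linarith)) (by linarith)
  obtain ⟨φ, P', h1, h2, h3, h4, h5, h6⟩ := exists_compactly_supported_approx hΩ hne hlayer hp0 hθ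
    hq1 hqt hu hD (by linarith : 0 < 2 * D₁) (hfr.trans (ball_subset_ball (by linarith))) hcase'
    (ε := fun n => ε n / 200) (fun n => by have := hε0 n; positivity)
    (fun n => by have := hε1 n; linarith) hVs
    (fun n y hy hyD => hV1 n y hy (by linarith [hlow y, hε1 n])) hτ0
    (by rw [hτ, mul_one_div_cancel (by positivity)]) (by linarith)
    (A := fun x => (Real.toNNReal ((10 * d) ^ d) * C₂ : ℝ≥0) * A x) (hAd.const_mul hq0 _) hk1 hk2
  exact ⟨V, φ, P', hVs, fun n => (tsupport_subset_inner (hε0 n) (hV0 n)).trans fun y hy => hy.1,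
    h1, h2, h3, h4, fun hb => h5 (hb.trans (ball_subset_ball (by linarith))), h6⟩

/-! ### Patched mollifications -/

/-- Bounds along a path that leads away from the boundary, on a bounded part of `Ω`. -/
lemma exists_bavg_moll_le_of_path (hΩ : IsOpen Ω) (hq : 1 ≤ q) (hu : LocallyIntegrableOn u Ω)
    (hD : IsJet Ω m u D) {τ B₀ s₀ R : ℝ} (hτ : 0 < τ) (hτ1 : τ ≤ 1) (hB₀ : 0 ≤ B₀) (hs₀ : 0 < s₀) :
    ∃ (C : ℝ≥0) (K : ℝ), ∀ ε : ℝ, 0 < ε → ε * (B₀ + 1) ≤ τ * s₀ → ∀ b : Eucl d, ‖b‖ ≤ B₀ →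
    ∀ x : Eucl d, ‖x‖ ≤ R → ∀ (y v : Eucl d) (t₁ : ℝ), ‖v‖ ≤ 1 → 0 ≤ t₁ → 0 < bdist Ω x →
    s₀ ≤ bdist Ω x + t₁ → bdist Ω x + t₁ ≤ R →
    (∀ t : ℝ, 0 ≤ t → t ≤ t₁ → y + t • v ∈ Ω ∧ 16 * (τ * (bdist Ω x + t)) ≤ bdist Ω (y + t • v) ∧
      bdist Ω (y + t • v) ≤ 2 * (bdist Ω x + t) ∧ dist (y + t • v) x ≤ bdist Ω x + t ∧
      ∀ z ∈ ball (y + t • v) (τ * (bdist Ω x + t)), MollAt Ω ε b z) →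
    ∀ k ≤ m, bavg (jetPow q k (moll Ω ε b u)) y (τ * bdist Ω x) ≤
      C * (coneSup Ω (powSum q m D) K x + 1) := by
  have hq0 : 0 < q := by linarith
  obtain ⟨C₁, K, hC₁⟩ := exists_bavg_moll_le_coneSup d m hq (2 / τ) hB₀
  obtain ⟨C₂, hC₂⟩ := exists_path_const d m hq
  choose C₃ hC₃ using exists_mean_moll_le d
  set S : Set (Eucl d) := {z | z ∈ Ω ∧ τ * s₀ ≤ bdist Ω z} ∩ closedBall 0 (4 * R)
  have hSc : IsCompact S := (isCompact_closedBall _ _).inter_left (isClosed_inner (by positivity))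
  have hfin : ∀ γ : Fin d → ℕ, ∑ i, γ i ≤ m → ∫⁻ y in S, ‖D γ y‖ₑ < ∞ := fun γ hγ =>
    ((hD.2 γ hγ).1.integrableOn_compact_subset (fun z hz => hz.1.1) hSc).2
  set N : ℕ → ℝ≥0∞ := fun j => C₃ j * (ofReal (((τ * s₀) ^ d)⁻¹) *
    ∑ γ ∈ multiIndices d j, ∫⁻ y in S, ‖D γ y‖ₑ) with hN
  have hNt : ∀ j < m, N j < ∞ := fun j hj =>
    mul_lt_top coe_lt_top (mul_lt_top ENNReal.ofReal_lt_top
      (ENNReal.sum_lt_top.2 fun γ hγ => hfin γ ((mem_multiIndices.1 hγ).le.trans hj.le)))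
  set N₀ : ℝ≥0∞ := ∑ j ∈ Finset.range m, N j ^ q
  have hN₀t : N₀ ≠ ∞ := (ENNReal.sum_lt_top.2 fun j hj =>
    ENNReal.rpow_lt_top_of_nonneg hq0.le (hNt j (mem_range.1 hj)).ne).ne
  set L : ℝ := 4 * max R 0 + 1 with hL
  have hL1 : 1 ≤ ofReal L ^ q := by
    refine ENNReal.one_le_rpow ?_ hq0
    rw [← ofReal_one]
    exact ofReal_le_ofReal (by rw [hL]; linarith [le_max_right R 0])
  have hLt : ofReal L ^ q ≠ ∞ := rpow_ne_top_of_nonneg hq0.le ofReal_ne_top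
  refine ⟨C₂ * ((ofReal L ^ q).toNNReal ^ m * (C₁ + N₀.toNNReal)), K, ?_⟩
  intro ε hε hεs b hb x hxR y v t₁ hv ht₁ hx0 hs hR hpath k hk
  set A : ℝ≥0∞ := (C₁ + N₀) * (coneSup Ω (powSum q m D) K x + 1) with hA
  have hRR : max R 0 = R := max_eq_left (by linarith)
  have main := hC₂ (moll Ω ε b u) (moll_smooth hε b hu) (y, τ * bdist Ω x)
    (y + t₁ • v, τ * (bdist Ω x + t₁)) (y + t₁ • v, τ * (bdist Ω x + t₁))
    (y + t₁ • v, τ * (bdist Ω x + t₁)) L A (by dsimp only; positivity)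
    (by dsimp only; rw [hL, hRR]; nlinarith) ?_ ?_ k hk
  · refine main.trans ?_
    push_cast
    rw [coe_toNNReal hLt, coe_toNNReal hN₀t, mul_assoc, mul_assoc]
    gcongr
    omega
  · intro B hB
    obtain ⟨t, ht0, ht1, rfl⟩ : ∃ t : ℝ, 0 ≤ t ∧ t ≤ t₁ ∧ B = (y + t • v, τ * (bdist Ω x + t)) := by
      rw [segment_same] at hB
      rcases hB with (hB | rfl) | rfl
      · obtain ⟨s, hs0, hs1, rfl⟩ := mem_segment_prod hB
        exact ⟨s * t₁, by positivity, mul_le_of_le_one_left ht₁ hs1,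
          Prod.ext (by simp [mul_smul]) (by ring)⟩
      all_goals exact ⟨t₁, ht₁, le_rfl, rfl⟩
    obtain ⟨h1, h2, h3, h4, h5⟩ := hpath t ht0 ht1
    constructor
    · have e1 : y + t • v - (y + t₁ • v) = (t - t₁) • v := by rw [sub_smul]; abel
      have e2 : ‖(t - t₁) • v‖ ≤ t₁ := by
        rw [norm_smul, norm_eq_abs, abs_of_nonpos (by linarith)]
        nlinarith [norm_nonneg v]
      have e3 : |τ * (bdist Ω x + t) - τ * (bdist Ω x + t₁)| ≤ t₁ := by
        rw [← mul_sub, abs_mul, abs_of_pos hτ, add_sub_add_left_eq_sub, abs_of_nonpos (by linarith)]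
        nlinarith
      dsimp only
      rw [e1, hL, hRR]
      linarith
    · have hr0 : 0 < τ * (bdist Ω x + t) := by positivity
      refine (hC₁ Ω hΩ u D hu hD ε hε b hb x (y + t • v) _ hr0 h1 h2 ?_ ?_ h5).trans ?_
      · rw [← mul_assoc, div_mul_cancel₀ _ hτ.ne']; exact h3
      · rw [← mul_assoc, div_mul_cancel₀ _ hτ.ne']; linarith
      · rw [hA]
        gcongr
        · exact le_self_add
        · exact le_self_add
  · intro j hj
    obtain ⟨h1, h2, -, h4, h5⟩ := hpath t₁ ht₁ le_rfl
    have hr : τ * s₀ ≤ τ * (bdist Ω x + t₁) := by gcongr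
    have hr0 : 0 < τ * s₀ := by positivity
    have hεb : ε * (‖b‖ + 1) ≤ τ * s₀ := le_trans (by gcongr) hεs
    have hmean := hC₃ j Ω hΩ m hj.le u D hu hD ε hε b (y + t₁ • v) (τ * (bdist Ω x + t₁))
      (by linarith) S h5 ?_
    · calc _ ≤ N j ^ q := by
            refine rpow_le_rpow (hmean.trans ?_) hq0.le
            simp only [hN]
            gcongr
        _ ≤ N₀ := single_le_sum (f := fun j => N j ^ q) (fun _ _ => bot_le)
            (mem_range.2 hj)
        _ ≤ A := by
            rw [hA]
            calc N₀ = N₀ * 1 := (mul_one _).symm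
              _ ≤ _ := by
                gcongr
                · exact le_add_self
                · exact le_add_self
        _ ≤ _ := le_mul_of_one_le_left bot_le (one_le_pow₀ hL1)
    · intro z hz
      rw [mem_ball] at hz
      have e1 := bdist_le_add' Ω (y + t₁ • v) z
      refine ⟨⟨mem_of_dist_lt hΩ h1 (by linarith), by linarith⟩, ?_⟩
      rw [mem_closedBall, dist_zero_right]
      have e2 := norm_sub_le_dist z x
      have e3 := dist_triangle z (y + t₁ • v) x
      nlinarith

/-- A partition of unity near the boundary. -/
lemma ConeCover.exists_partition {N : ℕ} {W : Fin N → Set (Eucl d)} {e : Fin N → Eucl d}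
    {c h D₁ : ℝ} (H : ConeCover Ω W e c h D₁) :
    ∃ η : Fin N → Eucl d → ℂ, (∀ j, Smooth (η j)) ∧ (∀ j, ∀ y ∉ W j, η j y = 0) ∧
      ∀ y, bdist Ω y ≤ h / 2 → ∑ j, η j y = 1 := by
  obtain ⟨f, hf⟩ := SmoothPartitionOfUnity.exists_isSubordinate (modelWithCornersSelf ℝ (Eucl d))
    (s := {y | bdist Ω y ≤ h / 2}) (isClosed_le (continuous_bdist Ω) continuous_const) W H.isOpen
    fun y hy => by
      obtain ⟨i, hi⟩ := H.cover y (lt_of_le_of_lt hy (by linarith [H.h_pos]))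
      exact Set.mem_iUnion.2 ⟨i, hi⟩
  refine ⟨fun j y => (f j y : ℂ), fun j => Complex.ofRealCLM.contDiff.comp (f j).contMDiff.contDiff,
    fun j y hy => ?_, fun y hy => ?_⟩
  · have : f j y = 0 := by
      by_contra h0
      exact hy (hf j (subset_tsupport _ h0))
    simp [this]
  · have := f.sum_eq_one (x := y) hy
    rw [finsum_eq_sum_of_fintype] at this
    rw [← Complex.ofReal_sum, this, Complex.ofReal_one]

lemma exists_iteratedFDeriv_le (hf : Smooth f) (m : ℕ) (R : ℝ) :
    ∃ C : ℝ, ∀ i ≤ m, ∀ y ∈ closedBall 0 R, ‖iteratedFDeriv ℝ i f y‖ ≤ C := by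
  choose C hC using fun i : ℕ => (isCompact_closedBall (0 : Eucl d) R).exists_bound_of_continuousOn
    (hf.continuous_iteratedFDeriv (m := i) (by exact_mod_cast le_top)).continuousOn
  refine ⟨∑ i ∈ Finset.range (m + 1), |C i|, fun i hi y hy => (hC i y hy).trans ?_⟩
  exact (le_abs_self _).trans (single_le_sum (f := fun i => |C i|) (fun _ _ => abs_nonneg _)
    (mem_range.2 (by omega)))

lemma bavg_jetPow_sum_le {ι : Type*} (s : Finset ι) (hq : 1 ≤ q) (k : ℕ) {f : ι → Eucl d → ℂ}
    (hf : ∀ i ∈ s, Smooth (f i)) (w : Eucl d) (hr : 0 < r) :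
    bavg (jetPow q k fun y => ∑ i ∈ s, f i y) w r ≤
      (s.card : ℝ≥0∞) ^ (q - 1) * ∑ i ∈ s, bavg (jetPow q k (f i)) w r := by
  rw [← bavg_sum fun i hi => measurable_jetPow q k (hf i hi), ← bavg_const_mul
    (rpow_ne_top_of_nonneg (by linarith) (by simp))]
  refine bavg_mono hr fun y _ => ?_
  simp only [jetPow]
  refine le_trans ?_ (ennreal_rpow_sum_le s (fun i => ‖iteratedFDeriv ℝ k (f i) y‖ₑ) hq)
  refine rpow_le_rpow ?_ (by linarith)
  have : iteratedFDeriv ℝ k (fun y => ∑ i ∈ s, f i y) y = ∑ i ∈ s, iteratedFDeriv ℝ k (f i) y :=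
    iteratedFDeriv_fun_sum_apply fun i hi => ((hf i hi).of_le (by exact_mod_cast le_top)).contDiffAt
  rw [this]
  exact enorm_sum_le _ _

/-- `MollPath Ω ε b τ x y v t₁`: the balls `B(y + tv, τ(δ + t))`, `0 ≤ t ≤ t₁`, `δ = dist(x, ∂Ω)`,
are Whitney balls on which the mollification with parameters `ε`, `b` is well behaved. -/
def MollPath (Ω : Set (Eucl d)) (ε : ℝ) (b : Eucl d) (τ : ℝ) (x y v : Eucl d) (t₁ : ℝ) : Prop :=
  ∀ t : ℝ, 0 ≤ t → t ≤ t₁ → y + t • v ∈ Ω ∧ 16 * (τ * (bdist Ω x + t)) ≤ bdist Ω (y + t • v) ∧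
    bdist Ω (y + t • v) ≤ 2 * (bdist Ω x + t) ∧ dist (y + t • v) x ≤ bdist Ω x + t ∧
    ∀ z ∈ ball (y + t • v) (τ * (bdist Ω x + t)), MollAt Ω ε b z

lemma exists_patch_bound (hΩ : IsOpen Ω) (hne : (frontier Ω).Nonempty) (hq : 1 ≤ q)
    (hu : LocallyIntegrableOn u Ω) (hD : IsJet Ω m u D) {τ s₀ R t₁ : ℝ} (hτ : 0 < τ)
    (hτ1 : τ ≤ 1 / 100) (hs₀ : 0 < s₀) (ht₁ : 0 ≤ t₁) {b v : Eucl d} (hv : ‖v‖ ≤ 1)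
    {η : Eucl d → ℂ} (hη : Smooth η) :
    ∃ (C : ℝ≥0) (K : ℝ), ∀ ε : ℝ, 0 < ε → ε * (‖b‖ + 1) ≤ τ * s₀ → ∀ x ∈ Ω, ‖x‖ ≤ R →
    bdist Ω x + t₁ ≤ R → ∀ y, dist y x < 3 / 5 * bdist Ω x →
    ((∃ z ∈ ball y (τ * bdist Ω x), η z ≠ 0) → s₀ ≤ bdist Ω x + t₁ ∧ MollPath Ω ε b τ x y v t₁) →
    bavg (jetPow q m fun z => η z * moll Ω ε b u z) y (τ * bdist Ω x) ≤
      C * (coneSup Ω (powSum q m D) K x + 1) := by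
  have hq0 : 0 < q := by linarith
  obtain ⟨C₁, K, hC₁⟩ := exists_bavg_moll_le_of_path hΩ hq hu hD (R := R) hτ (by linarith)
    (norm_nonneg b) hs₀
  obtain ⟨C₂, hC₂⟩ := exists_leibniz_const d m hq
  obtain ⟨Cη, hCη⟩ := exists_iteratedFDeriv_le hη m (2 * R)
  have hCt : ofReal Cη ^ q ≠ ∞ := rpow_ne_top_of_nonneg hq0.le ofReal_ne_top
  refine ⟨C₂ * ((ofReal Cη ^ q).toNNReal * C₁), K, ?_⟩
  intro ε hε hεs x hx hxR hxR' y hy hpath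
  have hx0 := bdist_pos hΩ hne hx
  by_cases hz : ∃ z ∈ ball y (τ * bdist Ω x), η z ≠ 0
  · obtain ⟨h1, h2⟩ := hpath hz
    refine (hC₂ η (moll Ω ε b u) hη (moll_smooth hε b hu) y (τ * bdist Ω x) 1 Cη
      (C₁ * (coneSup Ω (powSum q m D) K x + 1)) (by positivity) one_pos ?_ ?_).trans ?_
    · intro i hi z hz
      rw [one_pow, mul_one]
      refine hCη i hi z ?_
      rw [mem_ball] at hz
      rw [mem_closedBall, dist_zero_right]
      have e1 := norm_sub_le_dist z x
      have e2 := dist_triangle z y x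
      nlinarith
    · intro k hk
      rw [ofReal_one, ENNReal.one_rpow, one_pow, one_mul]
      exact hC₁ ε hε hεs b le_rfl x hxR y v t₁ hv ht₁ hx0 h1 hxR' h2 k hk
    · push_cast
      rw [coe_toNNReal hCt]
      exact le_of_eq (by ring)
  · push Not at hz
    rw [bavg_jetPow_eq_zero hq0 (by positivity)]
    · exact bot_le
    · intro z hz'
      rw [hz z hz', zero_mul]

/-- Paths in the direction of a cone. -/
lemma UpCone.mollPath (hΩ : IsOpen Ω) (hne : (frontier Ω).Nonempty) {N : Set (Eucl d)}
    {e : Eucl d} (he : ‖e‖ ≤ 1) {c h : ℝ} (hc : 0 < c) (hc1 : c ≤ 1) (H : UpCone Ω N e c h)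
    (hx : x ∈ Ω) (hyx : dist y x < 3 / 5 * bdist Ω x) (hyN : y ∈ N) {τ : ℝ} (hτ : 0 < τ)
    (hτc : 160 * τ ≤ c) (hε : 0 < ε) (hεh : 200 / c * ε ≤ h / 2) :
    MollPath Ω ε ((200 / c) • e) τ x y e (h / 2) := by
  intro t ht hth
  have hx0 := bdist_pos hΩ hne hx
  have hε' : 0 ≤ 200 / c * ε := by positivity
  obtain ⟨h1, h2, h3, h4⟩ := H.whitney hΩ hne he hc hc1 hx hyx hyN ht (by linarith)
  have h0 : 0 < bdist Ω x + t := by linarith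
  refine ⟨h1, by nlinarith, h3, h4, fun z hz => ?_⟩
  obtain ⟨k1, k2, -, -⟩ := H.whitney hΩ hne he hc hc1 hx hyx hyN
    (t := t + 200 / c * ε) (by linarith) (by linarith)
  rw [mem_ball] at hz
  have e1 : dist (z + ε • (200 / c) • e) (y + (t + 200 / c * ε) • e) = dist z (y + t • e) := by
    rw [add_smul, smul_smul, mul_comm ε, ← add_assoc, dist_add_right]
  have e2 : c / 10 * (bdist Ω x + (t + 200 / c * ε)) = c / 10 * (bdist Ω x + t) + 20 * ε := by
    field_simp; ring
  have e3 := bdist_le_add Ω (y + (t + 200 / c * ε) • e) (z + ε • (200 / c) • e)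
  rw [dist_comm, e1] at e3
  have e4 : τ * (bdist Ω x + t) ≤ c / 10 * (bdist Ω x + t) := by gcongr; linarith
  exact ⟨mem_of_dist_lt hΩ k1 (by rw [e1]; linarith), by linarith⟩

/-- Mollifications adapted to the cones, patched together by a partition of unity. -/
lemma ConeCover.exists_patch (hΩ : IsOpen Ω) (hne : (frontier Ω).Nonempty) {N : ℕ}
    {W : Fin N → Set (Eucl d)} {e : Fin N → Eucl d} {c h D₁ : ℝ} (H : ConeCover Ω W e c h D₁)
    {R τ : ℝ} (hτ : 0 < τ) (hτ1 : τ ≤ 1 / 100) (hτc : 160 * τ ≤ c) (hR : τ * (R + D₁) ≤ h) :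
    ∃ (η : Option (Fin N) → Eucl d → ℂ) (b v : Option (Fin N) → Eucl d) (t : Option (Fin N) → ℝ),
      (∀ i, Smooth (η i)) ∧ (∀ y, ∑ i, η i y = 1) ∧ (∀ y, D₁ ≤ ‖y‖ → ∀ i, i ≠ none → η i y = 0) ∧
      b none = 0 ∧ (∀ i, ‖b i‖ ≤ 200 / c) ∧ (∀ i, ‖v i‖ ≤ 1) ∧ (∀ i, 0 ≤ t i) ∧
      (∀ i, t i ≤ h / 2) ∧
      ∀ i, ∀ ε : ℝ, 0 < ε → ε * (200 / c + 1) ≤ τ * (h / 4) → ∀ x ∈ Ω, ‖x‖ ≤ R → ∀ y,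
        dist y x < 3 / 5 * bdist Ω x → (∃ z ∈ ball y (τ * bdist Ω x), η i z ≠ 0) →
        h / 4 ≤ bdist Ω x + t i ∧ MollPath Ω ε (b i) τ x y (v i) (t i) := by
  have hc := H.c_pos
  have hc1 := H.c_le_one
  have hh := H.h_pos
  obtain ⟨η, hηs, hη0, hη1⟩ := H.exists_partition
  refine ⟨fun i => i.elim (fun y => 1 - ∑ j, η j y) η, fun i => i.elim 0 fun j => (200 / c) • e j,
    fun i => i.elim 0 e, fun i => i.elim 0 fun _ => h / 2, ?_, ?_, ?_, rfl, ?_, ?_, ?_, ?_, ?_⟩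
  · rintro (_ | j)
    · exact contDiff_const.sub (ContDiff.sum fun j _ => hηs j)
    · exact hηs j
  · intro y
    simp [Fintype.sum_option]
  · rintro y hy (_ | j) hi
    · exact absurd rfl hi
    · refine hη0 j y fun hj => ?_
      have := H.subset_ball j hj
      rw [mem_ball_zero_iff] at this
      linarith
  · rintro (_ | j)
    · simp only [Option.elim, norm_zero]; positivity
    · simp only [Option.elim]
      rw [norm_smul, norm_eq_abs, abs_of_pos (by positivity)]
      exact mul_le_of_le_one_right (by positivity) (H.norm_le j)
  · rintro (_ | j)
    · simp
    · exact H.norm_le j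
  · rintro (_ | j)
    · exact le_rfl
    · simp only [Option.elim]; positivity
  · rintro (_ | j)
    · simp only [Option.elim]; positivity
    · exact le_rfl
  · rintro (_ | j) ε hε hεh x hx hxR y hy ⟨z, hz, hηz⟩
    · have hx0 := bdist_pos hΩ hne hx
      simp only [Option.elim] at hηz ⊢
      have hδz : h / 2 < bdist Ω z := by
        by_contra hcon
        exact hηz (by rw [hη1 z (not_lt.1 hcon), sub_self])
      rw [mem_ball] at hz
      have e1 := bdist_le_add Ω z x
      have e2 := dist_triangle z y x
      have e3 : τ * bdist Ω x ≤ 1 / 100 * bdist Ω x := by gcongr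
      have e5 : ε ≤ h / 400 := by
        have h1 : 0 ≤ ε * (200 / c) := by positivity
        nlinarith
      refine ⟨by linarith, fun t ht ht0 => ?_⟩
      obtain rfl : t = 0 := le_antisymm ht0 ht
      have e4 := bdist_le_add' Ω x y
      have e6 := bdist_le_add Ω y x
      simp only [smul_zero, add_zero]
      refine ⟨mem_of_dist_lt hΩ hx (by linarith), by linarith, by linarith, by linarith,
        fun w hw => ?_⟩
      rw [mem_ball] at hw
      have e7 := dist_triangle w y x
      have e8 := bdist_le_add' Ω x w
      simp only [MollAt, smul_zero, add_zero]
      exact ⟨mem_of_dist_lt hΩ hx (by linarith), by linarith⟩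
    · have hx0 := bdist_pos hΩ hne hx
      simp only [Option.elim] at hηz ⊢
      have hzW : z ∈ W j := by
        by_contra hcon
        exact hηz (hη0 j z hcon)
      have hδ := bdist_le_norm_add hne H.frontier_subset x
      refine ⟨by linarith, (H.cone j).mollPath hΩ hne (H.norm_le j) hc hc1 hx hy ?_ hτ hτc hε ?_⟩
      · rw [mem_thickening_iff]
        refine ⟨z, hzW, ?_⟩
        rw [mem_ball, dist_comm] at hz
        nlinarith
      · nlinarith

/-- Patched mollifications converge locally. -/
lemma tendsto_wavg_patch (hΩ : IsOpen Ω) (hne : (frontier Ω).Nonempty) (hp0 : 0 < p) (hq : 1 ≤ q)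
    (hu : LocallyIntegrableOn u Ω) (hD : IsJet Ω m u D) (h : AvFinite Ω p θ q (powSum q m D))
    (hx : x ∈ Ω) {ι : Type*} [Fintype ι] (b : ι → Eucl d) {η : ι → Eucl d → ℂ}
    (hη : ∀ i, Smooth (η i)) (hη1 : ∀ y, ∑ i, η i y = 1) {ε : ℕ → ℝ} (hε : ∀ n, 0 < ε n)
    (hε0 : Tendsto ε atTop (𝓝 0)) :
    Tendsto (fun n => wavg Ω (powSum q m fun γ y => D γ y -
      mixedDeriv γ (fun y => ∑ i, η i y * moll Ω (ε n) (b i) u y) y) x) atTop (𝓝 0) := by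
  have hq0 : 0 < q := by linarith
  have hx0 := bdist_pos hΩ hne hx
  have hr0 : 0 < bdist Ω x / 2 := by positivity
  choose A hA0 hA using fun i =>
    tendsto_bavg_jetPow_moll_sub hΩ hne hp0 hq hu hD h hx (b i) 0 hε hε0
  have hT0 := tendsto_wavg_moll_sub hΩ hne hp0 hq hu hD h hx 0 hε hε0
  obtain ⟨C₁, hC₁⟩ := exists_leibniz_const d m hq
  obtain ⟨C₂, hC₂⟩ := exists_powSum_le_jetPow d m hq0.le
  choose Cη hCη using fun i => exists_iteratedFDeriv_le (hη i) m (‖x‖ + bdist Ω x)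
  set L := bdist Ω x / 2 with hL
  set Cs : ι → ℝ := fun i => |Cη i| * max L 1 ^ m
  have hCst : ∀ i, ofReal (Cs i) ^ q ≠ ∞ := fun i =>
    rpow_ne_top_of_nonneg hq0.le ofReal_ne_top
  have hct : ((Finset.univ : Finset ι).card : ℝ≥0∞) ^ (q - 1) ≠ ∞ :=
    rpow_ne_top_of_nonneg (by linarith) (by simp)
  have hTs : ∀ n i, Smooth (moll Ω (ε n) (b i) u) := fun n i => moll_smooth (hε n) (b i) hu
  have hTs0 : ∀ n, Smooth (moll Ω (ε n) 0 u) := fun n => moll_smooth (hε n) 0 hu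
  have hterm : ∀ n i, bavg (jetPow q m fun y => η i y *
      (moll Ω (ε n) (b i) u y - moll Ω (ε n) 0 u y)) x L ≤
        C₁ * (ofReal (Cs i) ^ q * A i n) := fun n i => by
    refine hC₁ (η i) _ (hη i) ((hTs n i).sub (hTs0 n)) x L L (Cs i) (A i n) hr0 hr0 ?_ (hA i n)
    intro k hk y hy
    have h1 : ‖iteratedFDeriv ℝ k (η i) y‖ ≤ |Cη i| := (hCη i k hk y (by
      rw [mem_ball] at hy
      rw [mem_closedBall, dist_zero_right]
      have e1 := norm_sub_le_dist y x
      linarith)).trans (le_abs_self _)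
    have h2 : L ^ k ≤ max L 1 ^ m :=
      (pow_le_pow_left₀ hr0.le (le_max_left L 1) k).trans (pow_le_pow_right₀ (le_max_right L 1) hk)
    exact mul_le_mul h1 h2 (by positivity) (by positivity)
  refine tendsto_zero_of_le (g := fun n => 2 ^ q *
    (wavg Ω (powSum q m fun γ y => D γ y - mixedDeriv γ (moll Ω (ε n) 0 u) y) x +
      C₂ * (((Finset.univ : Finset ι).card : ℝ≥0∞) ^ (q - 1) *
        ∑ i, C₁ * (ofReal (Cs i) ^ q * A i n)))) ?_ ?_
  · refine tendsto_const_mul_zero ?_ (by finiteness)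
    simpa using hT0.add (tendsto_const_mul_zero (tendsto_const_mul_zero (c := _ ^ (q - 1))
      (by simpa using tendsto_finsetSum (a := fun _ => 0) Finset.univ fun i _ =>
        tendsto_const_mul_zero (tendsto_const_mul_zero (hA0 i) (hCst i)) (coe_ne_top (r := C₁))) hct)
      (coe_ne_top (r := C₂)))
  · intro n
    set T := moll Ω (ε n) 0 u
    set U : Eucl d → ℂ := fun y => ∑ i, η i y * moll Ω (ε n) (b i) u y with hU
    set G : Eucl d → ℂ := fun y => ∑ i, η i y * (moll Ω (ε n) (b i) u y - T y) with hG
    have hUs : Smooth U := ContDiff.sum fun i _ => (hη i).mul (hTs n i)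
    have hGs : Smooth G := ContDiff.sum fun i _ => (hη i).mul ((hTs n i).sub (hTs0 n))
    have hUG : G = fun y => U y - T y := by
      funext y
      simp only [hG, hU, mul_sub, Finset.sum_sub_distrib]
      rw [← Finset.sum_mul, hη1, one_mul]
    have hle : ∀ y, powSum q m (fun γ y => D γ y - mixedDeriv γ U y) y ≤ 2 ^ q *
        (powSum q m (fun γ y => D γ y - mixedDeriv γ T y) y + C₂ * jetPow q m G y) := fun y => by
      have e1 := powSum_sub_le hq0.le m (fun γ y => D γ y - mixedDeriv γ T y)
        (fun γ => mixedDeriv γ G) y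
      refine (le_of_eq ?_).trans (e1.trans (by gcongr; exact hC₂ G hGs y))
      simp only [powSum]
      refine sum_congr rfl fun γ _ => ?_
      rw [hUG, mixedDeriv_sub hUs (hTs0 n) γ]
      congr 2
      ring
    have hmeas : Measurable (powSum q m fun γ y => D γ y - mixedDeriv γ T y) :=
      measurable_powSum _ _ fun γ _ => (hD.1 γ).sub ((hTs0 n).mixedDeriv γ).continuous.measurable
    calc wavg Ω (powSum q m fun γ y => D γ y - mixedDeriv γ U y) x
        ≤ bavg (fun y => 2 ^ q * (powSum q m (fun γ y => D γ y - mixedDeriv γ T y) y +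
          C₂ * jetPow q m G y)) x L := bavg_mono hr0 fun y _ => hle y
      _ = 2 ^ q * (wavg Ω (powSum q m fun γ y => D γ y - mixedDeriv γ T y) x +
          C₂ * bavg (jetPow q m G) x L) := by
          rw [bavg_const_mul (rpow_ne_top_of_nonneg hq0.le (by norm_num)),
            bavg_add hmeas, bavg_const_mul coe_ne_top]
          rfl
      _ ≤ _ := by
          gcongr
          refine (bavg_jetPow_sum_le _ hq m
            (fun i _ => (hη i).mul ((hTs n i).sub (hTs0 n))) x hr0).trans ?_
          gcongr with i _
          exact hterm n i

/-- Approximation on domains with bounded boundary. -/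
theorem ConeCover.exists_approx (hd : 0 < d) (hΩ : IsOpen Ω) (hne : (frontier Ω).Nonempty)
    (hΩne : Ω.Nonempty) {N : ℕ} {W : Fin N → Set (Eucl d)} {e : Fin N → Eucl d} {c h D₁ : ℝ}
    (H : ConeCover Ω W e c h D₁) (hcase : BoundedOrExterior Ω D₁) (hp0 : 0 < p) (hθ : θ < 1)
    {q : ℝ≥0∞} (hq1 : 1 ≤ q) (hqt : q ≠ ∞) (hu : MemSobolev m p θ q Ω u) :
    ∃ φ : ℕ → Eucl d → ℂ, (∀ j, IsSmoothCompact (φ j)) ∧ SobolevTendsto m p θ q Ω φ u := by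
  have hq := one_le_toReal hq1 hqt
  have hq0 : 0 < q.toReal := by linarith
  set s := q.toReal
  have hlayer : HasLayerBounds Ω := (H.hasLayerVolume hd hΩ hne).hasLayerBound hΩ hne
  obtain ⟨D, hD⟩ := exists_isJet hu.2.1
  have hfin := hu.avFinite hΩ hne hp0 hq1 hqt hD
  have hFm := hD.measurable_jet s
  have hd1 : (1 : ℝ) ≤ d := by exact_mod_cast hd
  have hc := H.c_pos
  have hh := H.h_pos
  have hD₁ := H.D_pos
  have hfr := H.frontier_subset
  set τ : ℝ := min (1 / (2000 * d)) (min (c / 160) (h / (6 * D₁)))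
  have hτ0 : 0 < τ := by positivity
  have hτd : 2000 * d * τ ≤ 1 := by
    have : τ ≤ 1 / (2000 * d) := min_le_left _ _
    rw [le_div_iff₀ (by positivity)] at this
    linarith
  have hτ1 : τ ≤ 1 / 2000 := by nlinarith
  have hτc : 160 * τ ≤ c := by
    have : τ ≤ c / 160 := (min_le_right _ _).trans (min_le_left _ _)
    linarith
  have hτh : τ * (5 * D₁ + D₁) ≤ h := by
    have : τ ≤ h / (6 * D₁) := (min_le_right _ _).trans (min_le_right _ _)
    rw [le_div_iff₀ (by positivity)] at this
    linarith
  obtain ⟨η, b, v, t, hηs, hη1, hη0, hb0, hb, hv, ht0, ht1, hpatch⟩ :=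
    H.exists_patch hΩ hne (R := 5 * D₁) hτ0 (by linarith) hτc hτh
  choose C₁ K₁ hC₁ using fun i => exists_patch_bound hΩ hne hq hu.1 hD (R := 6 * D₁ + h) hτ0
    (by linarith : τ ≤ 1 / 100) (by positivity : 0 < h / 4) (ht0 i) (b := b i) (hv i) (hηs i)
  obtain ⟨C₂, K₂, hC₂⟩ := exists_bavg_moll_le_coneSup d m hq (2 / τ) (le_refl (0 : ℝ))
  set κ : ℝ := min (τ * (h / 4) / (200 / c + 1)) (D₁ / 100)
  have hκ0 : 0 < κ := by positivity
  have hκ1 : κ * (200 / c + 1) ≤ τ * (h / 4) := by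
    rw [← le_div_iff₀ (by positivity)]; exact min_le_left _ _
  have hκD : κ ≤ D₁ / 100 := min_le_right _ _
  obtain ⟨ε, hε0, hε1, hεt⟩ := exists_null_seq hκ0
  set U : ℕ → Eucl d → ℂ := fun n y => ∑ i, η i y * moll Ω (ε n) (b i) u y with hU
  have hUs : ∀ n, Smooth (U n) := fun n =>
    ContDiff.sum fun i _ => (hηs i).mul (moll_smooth (hε0 n) (b i) hu.1)
  have hUfar : ∀ n y, D₁ ≤ ‖y‖ → U n y = moll Ω (ε n) 0 u y := fun n y hy => by
    have h1 : η none y = 1 := by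
      rw [← hη1 y, Finset.sum_eq_single none (fun i _ hi => hη0 y hy i hi) (by simp)]
    simp only [hU]
    rw [Finset.sum_eq_single none (fun i _ hi => by rw [hη0 y hy i hi, zero_mul]) (by simp), h1,
      hb0, one_mul]
  set K := max K₂ (∑ i, |K₁ i|)
  have hK₁ : ∀ i, K₁ i ≤ K := fun i => (le_abs_self _).trans
    ((single_le_sum (f := fun i => |K₁ i|) (fun _ _ => abs_nonneg _)
      (Finset.mem_univ i)).trans (le_max_right _ _))
  set c' : ℝ≥0 := ((Finset.univ : Finset (Option (Fin N))).card : ℝ≥0) ^ (s - 1) with hc'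
  set A : Eucl d → ℝ≥0∞ := fun x => (C₂ + c' * ∑ i, C₁ i : ℝ≥0) *
    (coneSup Ω (powSum s m D) K x + (ball (0 : Eucl d) (5 * D₁)).indicator (fun _ => 1) x) with hA
  have hAd : Dominating Ω p θ s A :=
    ((dominating_coneSup hΩ hne hp0 hθ hq hlayer hFm hfin _).add hq0
      (dominating_indicator_ball hΩ hne hΩne hp0 hθ hq0 hlayer _)).const_mul hq0 _
  have hUA : ∀ n, ∀ x ∈ Ω, ∀ y, dist y x < 3 / 5 * bdist Ω x →
      bavg (jetPow s m (U n)) y (τ * bdist Ω x) ≤ A x := by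
    intro n x hx y hy
    have hx0 := bdist_pos hΩ hne hx
    have hδ := bdist_le_norm_add hne hfr x
    have hr0 : 0 < τ * bdist Ω x := by positivity
    have hr1 : τ * bdist Ω x ≤ 1 / 100 * bdist Ω x := by gcongr; linarith
    rcases lt_or_ge ‖x‖ (5 * D₁) with hxD | hxD
    · have h1 : ∀ i, bavg (jetPow s m fun z => η i z * moll Ω (ε n) (b i) u z) y
          (τ * bdist Ω x) ≤ C₁ i * (coneSup Ω (powSum s m D) K x + 1) := fun i => by
        have hεn := (hε0 n).le
        have hεb : ε n * (200 / c + 1) ≤ τ * (h / 4) := le_trans (by gcongr; exact hε1 n) hκ1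
        refine (hC₁ i (ε n) (hε0 n) (le_trans (by gcongr; exact hb i) hεb) x hx
          (by linarith) (by linarith [ht1 i]) y hy
          (hpatch i (ε n) (hε0 n) hεb x hx hxD.le y hy)).trans ?_
        gcongr
        exact coneSup_mono (hK₁ i) _ _
      refine (bavg_jetPow_sum_le Finset.univ hq m (fun i _ => (hηs i).mul
        (moll_smooth (hε0 n) (b i) hu.1)) y hr0).trans ?_
      have h2 : (((Finset.univ : Finset (Option (Fin N))).card : ℝ≥0∞)) ^ (s - 1) = c' := by
        rw [hc', coe_rpow_of_nonneg _ (by linarith)]; simp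
      rw [h2]
      calc (c' : ℝ≥0∞) * ∑ i, bavg (jetPow s m fun z => η i z * moll Ω (ε n) (b i) u z) y
            (τ * bdist Ω x)
          ≤ c' * ∑ i, C₁ i * (coneSup Ω (powSum s m D) K x + 1) := by
            gcongr with i _; exact h1 i
        _ = (c' * ∑ i, C₁ i : ℝ≥0) * (coneSup Ω (powSum s m D) K x + 1) := by
            rw [← Finset.sum_mul]; push_cast; ring
        _ ≤ A x := by
            have h3 : (ball (0 : Eucl d) (5 * D₁)).indicator (fun _ => (1 : ℝ≥0∞)) x = 1 :=
              indicator_of_mem (by rwa [mem_ball_zero_iff]) _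
            simp only [hA]
            rw [h3]
            gcongr
            exact le_add_self
    · have hlow := norm_sub_le_bdist hne hfr x
      have hz : ∀ z ∈ ball y (τ * bdist Ω x), dist z x ≤ 61 / 100 * bdist Ω x := fun z hz => by
        rw [mem_ball] at hz
        linarith [dist_triangle z y x]
      rw [bavg_jetPow_congr (g := moll Ω (ε n) 0 u) hr0 fun z hz' => hUfar n z ?_]
      · have e4 := bdist_le_add' Ω x y
        have e6 := bdist_le_add Ω y x
        refine (hC₂ Ω hΩ u D hu.1 hD (ε n) (hε0 n) 0 (by simp) x y _ hr0
          (mem_of_dist_lt hΩ hx (by linarith)) (by nlinarith) ?_ ?_ ?_).trans ?_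
        · rw [← mul_assoc, div_mul_cancel₀ _ hτ0.ne']; linarith
        · rw [← mul_assoc, div_mul_cancel₀ _ hτ0.ne']; linarith
        · intro z hz'
          have h1 := hz z hz'
          have h2 := bdist_le_add' Ω x z
          simp only [MollAt, smul_zero, add_zero]
          exact ⟨mem_of_dist_lt hΩ hx (by linarith), by linarith [hε1 n]⟩
        · simp only [hA]
          gcongr
          · exact le_self_add
          · exact (coneSup_mono (le_max_left _ _) _ _).trans le_self_add
      · have h1 := hz z hz'
        rw [dist_comm, dist_eq_norm] at h1
        linarith [norm_sub_norm_le x z]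
  obtain ⟨φ, P, h1, -, -, -, -, h2⟩ := exists_compactly_supported_approx hΩ hne hlayer hp0 hθ hq1
    hqt hu hD hD₁ hfr hcase hε0 (fun n => by linarith [hε1 n]) hUs (fun n y _ hy => hUfar n y hy)
    hτ0 hτd (by linarith) hAd hUA
    fun x hx => tendsto_wavg_patch hΩ hne hp0 hq hu.1 hD hfin hx b hηs hη1 hε0 hεt
  exact ⟨φ, h1, h2⟩

/-! ### Lipschitz domains -/

section Zero

lemma mixedDeriv_eq_zero_of_notMem_tsupport {V : Eucl d → ℂ} (hV : Smooth V) (hx : x ∉ tsupport V)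
    (γ : Fin d → ℕ) : mixedDeriv γ V x = 0 := by
  have h0 : Smooth fun _ : Eucl d => (0 : ℂ) := contDiff_const
  have h := mixedDeriv_sub h0 h0 γ
  simp only [sub_self] at h
  rw [mixedDeriv_congr hV h0 (notMem_tsupport_iff_eventuallyEq.1 hx) γ, h]

lemma eventually_mixedDeriv_eq_zero {φ : Eucl d → ℂ}
    (hφ : IsSmoothCompactIn Ω φ) (γ : Fin d → ℕ) : ∀ᶠ x in 𝓝ˢ Ωᶜ, mixedDeriv γ φ x = 0 := by
  filter_upwards [(isClosed_tsupport φ).isOpen_compl.mem_nhdsSet.2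
    (Set.compl_subset_compl.2 hφ.2)] with x hx
  exact mixedDeriv_eq_zero_of_notMem_tsupport hφ.1.1 hx γ

/-- The complement of a ball is connected in dimension at least two. -/
lemma isPreconnected_setOf_le_norm (hd : 2 ≤ d) {D : ℝ} (hD : 0 < D) :
    IsPreconnected {x : Eucl d | D ≤ ‖x‖} := by
  have hrank : 1 < Module.rank ℝ (Eucl d) := by
    rw [← Module.finrank_eq_rank, finrank_euclideanSpace_fin]; exact_mod_cast hd
  have h1 : IsPreconnected (Set.Ici D ×ˢ sphere (0 : Eucl d) 1) :=
    isPreconnected_Ici.prod (isPreconnected_sphere hrank 0 1)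
  have h2 : {x : Eucl d | D ≤ ‖x‖} =
      (fun z : ℝ × Eucl d => z.1 • z.2) '' (Set.Ici D ×ˢ sphere (0 : Eucl d) 1) := by
    ext x
    constructor
    · intro hx
      have hx' : D ≤ ‖x‖ := hx
      have hx0 : ‖x‖ ≠ 0 := (hD.trans_le hx').ne'
      refine ⟨(‖x‖, ‖x‖⁻¹ • x), ⟨hx', ?_⟩, ?_⟩
      · rw [mem_sphere_zero_iff_norm, norm_smul, norm_inv, norm_norm, inv_mul_cancel₀ hx0]
      · simp only [smul_smul, mul_inv_cancel₀ hx0, one_smul]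
    · rintro ⟨⟨r, y⟩, ⟨hr, hy⟩, rfl⟩
      have hr' : D ≤ r := hr
      rw [mem_sphere_zero_iff_norm] at hy
      change D ≤ ‖r • y‖
      dsimp only at hy
      rw [norm_smul, hy, mul_one, norm_eq_abs]
      exact hr'.trans (le_abs_self r)
  rw [h2]
  exact h1.image _ (by fun_prop)

lemma boundedOrExterior_of_frontier_subset (hd : 2 ≤ d) (hΩ : IsOpen Ω) {D : ℝ} (hD : 0 < D)
    (hfr : frontier Ω ⊆ ball 0 D) : BoundedOrExterior Ω D := by
  have hsub : {x : Eucl d | D ≤ ‖x‖} ⊆ Ω ∪ (closure Ω)ᶜ := fun x hx => by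
    by_contra hcon
    rw [Set.mem_union, not_or, Set.mem_compl_iff, not_not] at hcon
    have h1 : x ∈ frontier Ω := by rw [hΩ.frontier_eq]; exact ⟨hcon.2, hcon.1⟩
    have h2 := hfr h1
    rw [mem_ball_zero_iff] at h2
    exact absurd h2 (not_lt.2 hx)
  rcases (isPreconnected_setOf_le_norm hd hD).subset_or_subset hΩ isClosed_closure.isOpen_compl
    (Set.disjoint_left.2 fun x hx hx' => hx' (subset_closure hx)) hsub with h | h
  · exact Or.inr ⟨hd, fun x hx => h hx⟩
  · refine Or.inl fun x hx => ?_
    rw [mem_ball_zero_iff]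
    by_contra hcon
    exact h (not_lt.1 hcon : x ∈ {x : Eucl d | D ≤ ‖x‖}) (subset_closure hx)

end Zero

/-- An unbounded interval with a boundary point is a graph domain. -/
lemma isLipschitzGraphDomain_of_not_bddAbove {Ω : Set (Eucl (0 + 1))} (hΩ : IsOpen Ω)
    (hconn : IsPreconnected Ω) (hne : (frontier Ω).Nonempty) (e : Coord 0)
    (hb : ¬ BddAbove ((fun x => (e x).snd) '' Ω)) : IsLipschitzGraphDomain Ω := by
  set f : Eucl (0 + 1) → ℝ := fun x => (e x).snd with hf
  have hfc : Continuous f := (WithLp.prod_continuous_ofLp 2 _ _).snd.comp e.continuous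
  have hinj : ∀ x y, f x = f y → x = y := fun x y h => e.injective (by
    refine WithLp.ofLp_injective _ (Prod.ext (Subsingleton.elim _ _) h))
  set g : ℝ → Eucl (0 + 1) := fun t => e.symm (WithLp.toLp 2 (0, t)) with hg
  have hfg : ∀ t, f (g t) = t := fun t => by simp [hf, hg]
  have hgc : Continuous g :=
    e.symm.continuous.comp ((WithLp.prod_continuous_toLp 2 _ _).comp (by fun_prop))
  set S := f '' Ω
  have hmem : ∀ x, f x ∈ S ↔ x ∈ Ω := fun x =>
    ⟨fun ⟨y, hy, hyx⟩ => hinj y x hyx ▸ hy, fun hx => ⟨x, hx, rfl⟩⟩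
  have hSo : IsOpen S := by
    have : S = g ⁻¹' Ω := by
      ext t
      rw [Set.mem_preimage, ← hmem, hfg]
    rw [this]
    exact hΩ.preimage hgc
  have hSp : IsPreconnected S := hconn.image _ hfc.continuousOn
  have hbb : BddBelow S := by
    by_contra hbb
    have hSu : S = Set.univ := hSp.eq_univ_of_unbounded hbb hb
    have hΩu : Ω = Set.univ := Set.eq_univ_of_forall fun x => (hmem x).1 (hSu ▸ trivial)
    rw [hΩu, frontier_univ] at hne
    exact Set.not_nonempty_empty hne
  have hSe : S = Set.Ioi (sInf S) := by
    refine Set.Subset.antisymm (fun t ht => ?_) (hSp.Ioi_csInf_subset hbb hb)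
    obtain ⟨l, hl, hlt⟩ := exists_Ioc_subset_of_mem_nhds (hSo.mem_nhds ht) ⟨t - 1, by linarith⟩
    have : (l + t) / 2 ∈ S := hlt ⟨by linarith, by linarith⟩
    exact lt_of_le_of_lt (csInf_le hbb this) (by linarith)
  refine ⟨e, fun _ => sInf S, 0, LipschitzWith.const _, ?_⟩
  ext x
  rw [← hmem]
  exact Set.ext_iff.1 hSe (f x)

/-- A Lipschitz domain is a graph domain, or a domain with bounded boundary whose complement or
which itself is bounded. -/
lemma IsLipschitzDomain.graph_or_cover {n : ℕ} {Ω : Set (Eucl (n + 1))}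
    (H : IsLipschitzDomain Ω) : IsLipschitzGraphDomain Ω ∨
    (frontier Ω).Nonempty ∧ ∃ (N : ℕ) (W : Fin N → Set (Eucl (n + 1))) (v : Fin N → Eucl (n + 1))
      (M : ℝ≥0) (c h D : ℝ), ConeCover Ω W v c h D ∧ BoundedOrExterior Ω D ∧
      ∀ x, bdist Ω x < h → ∃ (e : Coord n) (ψ : Eucl n → ℝ), IsChart Ω e ψ M (ball x h) := by
  obtain ⟨hΩ, hconn, hg | hch⟩ := H
  · exact Or.inl hg
  have hne : (frontier Ω).Nonempty := by
    obtain ⟨r, M, c₀, N, x, ρ, -, -, -, hN, hx, -⟩ := hch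
    exact ⟨x ⟨0, hN⟩, hx _⟩
  obtain ⟨N, W, v, M, c, h, D, hcov, hchart⟩ := hch.exists_coneCover hne
  rcases Nat.eq_zero_or_pos n with rfl | hn
  · obtain ⟨z, hz⟩ := hne
    obtain ⟨e, -, -⟩ := hchart z (by rw [bdist, infDist_zero_of_mem hz]; exact hcov.h_pos)
    by_cases ha : BddAbove ((fun x => (e x).snd) '' Ω)
    · by_cases hb : BddBelow ((fun x => (e x).snd) '' Ω)
      · right
        have hbd : Bornology.IsBounded Ω := by
          obtain ⟨a, ha⟩ := ha
          obtain ⟨b, hb⟩ := hb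
          rw [Metric.isBounded_iff]
          refine ⟨a - b, fun x hx y hy => ?_⟩
          have h1 := ha ⟨x, hx, rfl⟩
          have h2 := hb ⟨x, hx, rfl⟩
          have h3 := ha ⟨y, hy, rfl⟩
          have h4 := hb ⟨y, hy, rfl⟩
          dsimp only at h1 h2 h3 h4
          rw [← e.dist_map, WithLp.prod_dist_eq_of_L2, Subsingleton.elim (e x).fst (e y).fst,
            dist_self, zero_pow two_ne_zero, zero_add, Real.sqrt_sq dist_nonneg, Real.dist_eq,
            abs_le]
          constructor <;> linarith
        obtain ⟨D', hD'⟩ := hbd.subset_ball (0 : Eucl (0 + 1))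
        refine ⟨⟨z, hz⟩, N, W, v, M, c, h, max D D', { hcov with
          subset_ball := fun i => (hcov.subset_ball i).trans (ball_subset_ball (le_max_left _ _))
          D_pos := hcov.D_pos.trans_le (le_max_left _ _) },
          Or.inl (hD'.trans (ball_subset_ball (le_max_right _ _))), hchart⟩
      · left
        refine isLipschitzGraphDomain_of_not_bddAbove hΩ hconn.isPreconnected ⟨z, hz⟩
          (e.trans (LinearIsometryEquiv.neg ℝ).toAffineIsometryEquiv) fun hab => hb ?_
        obtain ⟨a, ha⟩ := hab
        refine ⟨-a, ?_⟩
        rintro _ ⟨x, hx, rfl⟩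
        have h1 := ha ⟨x, hx, rfl⟩
        simp only [AffineIsometryEquiv.coe_trans, Function.comp_apply,
          LinearIsometryEquiv.coe_toAffineIsometryEquiv, LinearIsometryEquiv.coe_neg,
          WithLp.neg_snd] at h1
        linarith
    · exact Or.inl (isLipschitzGraphDomain_of_not_bddAbove hΩ hconn.isPreconnected ⟨z, hz⟩ e ha)
  · exact Or.inr ⟨hne, N, W, v, M, c, h, D, hcov, boundedOrExterior_of_frontier_subset (by omega)
      hΩ hcov.D_pos hcov.frontier_subset, hchart⟩

section Coordinates

variable {n : ℕ} {Ω : Set (Eucl (n + 1))}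

/-- The distance to the boundary of a Lipschitz domain is integrable to powers above `-1`, and
functions are approximated by smooth functions with compact support. -/
theorem IsLipschitzDomain.exists_approx (H : IsLipschitzDomain Ω) : (frontier Ω).Nonempty ∧
    (HasLayerBounds Ω) ∧
    ∀ (m : ℕ) (p : ℝ≥0∞) (θ : ℝ) (q : ℝ≥0∞) (u : Eucl (n + 1) → ℂ), 0 < p → θ < 1 → 1 ≤ q →
      q ≠ ∞ → MemSobolev m p θ q Ω u →
      ∃ φ : ℕ → Eucl (n + 1) → ℂ, (∀ j, IsSmoothCompact (φ j)) ∧ SobolevTendsto m p θ q Ω φ u := by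
  have hΩ := H.1
  have hΩne := H.2.1.nonempty
  rcases H.graph_or_cover with ⟨e, ψ, M, hψ, rfl⟩ | ⟨hne, N, W, v, M, c, h, D, hcov, hcase, -⟩
  · have hne := frontier_graphRegion_nonempty (e := e) hψ
    have hcone := coneDomain_graphRegion (e := e) hψ
    exact ⟨hne, (hcone.hasLayerVolume hΩ hne).hasLayerBound hΩ hne,
      fun m p θ q u hp0 hθ hq1 hqt hu => hcone.exists_approx hΩ hne hΩne hp0 hθ hq1 hqt hu⟩
  · exact ⟨hne, (hcov.hasLayerVolume n.succ_pos hΩ hne).hasLayerBound hΩ hne,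
      fun m p θ q u hp0 hθ hq1 hqt hu =>
        hcov.exists_approx n.succ_pos hΩ hne hΩne hcase hp0 hθ hq1 hqt hu⟩

/-- Approximation of functions with vanishing traces on Lipschitz domains. -/
theorem IsLipschitzDomain.exists_approx_of_hasTraceArray_zero (H : IsLipschitzDomain Ω)
    (hθ0 : 0 < θ) (hθ : θ < 1) {q : ℝ≥0∞} (hq1 : 1 ≤ q) (hqt : q ≠ ∞)
    (hp : ofReal ((n : ℝ) / ((n : ℝ) + θ)) < p) {u : Eucl (n + 1) → ℂ}
    (hu : MemSobolev m p θ q Ω u) (htr : ∀ k < m, HasTraceArray k Ω u 0) :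
    (Bornology.IsBounded Ω ∨ IsLipschitzGraphDomain Ω →
      ∃ φ : ℕ → Eucl (n + 1) → ℂ, (∀ j, IsSmoothCompactIn Ω (φ j)) ∧ SobolevTendsto m p θ q Ω φ u) ∧
    ∃ φ : ℕ → Eucl (n + 1) → ℂ, (∀ j, IsSmoothCompact (φ j) ∧
        ∀ γ ∈ multiIndices (n + 1) m, ∀ᶠ x in 𝓝ˢ Ωᶜ, mixedDeriv γ (φ j) x = 0) ∧
      SobolevTendsto m p θ q Ω φ u := by
  have hp0 : 0 < p := lt_of_le_of_lt bot_le hp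
  have hpd : p < ∞ → ((n + 1 : ℕ) : ℝ) - 1 < p.toReal * ((n + 1 : ℕ) - 1 + θ) := fun hpt => by
    have h1 := (ENNReal.ofReal_lt_iff_lt_toReal (by positivity) hpt.ne).1 hp
    rw [div_lt_iff₀ (by positivity)] at h1
    push_cast
    simpa using h1
  have hsupp : (∃ φ : ℕ → Eucl (n + 1) → ℂ, (∀ j, IsSmoothCompactIn Ω (φ j)) ∧
      SobolevTendsto m p θ q Ω φ u) → ∃ φ : ℕ → Eucl (n + 1) → ℂ,
      (∀ j, IsSmoothCompact (φ j) ∧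
        ∀ γ ∈ multiIndices (n + 1) m, ∀ᶠ x in 𝓝ˢ Ωᶜ, mixedDeriv γ (φ j) x = 0) ∧
      SobolevTendsto m p θ q Ω φ u := fun ⟨φ, h1, h2⟩ =>
    ⟨φ, fun j => ⟨(h1 j).1, fun γ _ => eventually_mixedDeriv_eq_zero (h1 j) γ⟩, h2⟩
  have hq0 : 0 < q.toReal := toReal_pos (zero_lt_one.trans_le hq1).ne' hqt
  obtain ⟨D, hD⟩ := exists_isJet hu.2.1
  have hgraph : IsLipschitzGraphDomain Ω → ∃ φ : ℕ → Eucl (n + 1) → ℂ,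
      (∀ j, IsSmoothCompactIn Ω (φ j)) ∧ SobolevTendsto m p θ q Ω φ u := by
    rintro ⟨e, ψ, M, hψ, rfl⟩
    have hne := frontier_graphRegion_nonempty (e := e) hψ
    obtain ⟨C, P, -, hP, hH⟩ := exists_hardyAt n m M
    exact exists_approx_of_hardyAt H.1 hne H.2.1.nonempty
      (((coneDomain_graphRegion hψ).hasLayerVolume H.1 hne).hasLayerBound H.1 hne)
      hp0 hθ0 hθ hq1 hqt hpd hu hD hP.le fun x hx => hH _ H.1 hne e ψ Set.univ isOpen_univ
        (isChart_graphRegion hψ) u D hD htr _ (fun γ hγ y => enorm_le_powSum_rpow hq0 D hγ y) x hx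
        (Set.subset_univ _)
  rcases H.graph_or_cover with hG | ⟨hne, N, W, v, M, c, h, D₀, hcov, hcase, hch⟩
  · exact ⟨fun _ => hgraph hG, hsupp (hgraph hG)⟩
  obtain ⟨C, P, -, hP, hH⟩ := exists_hardyAt n m M
  have hh := hcov.h_pos
  have hcover := fun D₁ (hD₀ : D₀ ≤ D₁) hcase => exists_approx_of_hardyAt_near n.succ_pos H.1 hne
    ((hcov.hasLayerVolume n.succ_pos H.1 hne).hasLayerBound H.1 hne) hp0 hθ0 hθ hq1
    hqt hpd hu hD (hcov.D_pos.trans_le hD₀) (hcov.frontier_subset.trans (ball_subset_ball hD₀)) hcase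
    hP.le (h := min h (h / P)) (C₀ := C) (by positivity) fun x hx hxh => by
      obtain ⟨e, ψ, hchart⟩ := hch x (hxh.trans_le (min_le_left _ _))
      have hxP := (lt_div_iff₀ hP).1 (hxh.trans_le (min_le_right _ _))
      exact hH Ω H.1 hne e ψ (ball x h) isOpen_ball hchart u D hD htr _
        (fun γ hγ y => enorm_le_powSum_rpow hq0 D hγ y) x hx (ball_subset_ball (by linarith))
  have hbdd : Bornology.IsBounded Ω → ∃ φ : ℕ → Eucl (n + 1) → ℂ,
      (∀ j, IsSmoothCompactIn Ω (φ j)) ∧ SobolevTendsto m p θ q Ω φ u := fun hb => by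
    obtain ⟨D', hD'⟩ := hb.subset_ball (0 : Eucl (n + 1))
    have hsub := hD'.trans (ball_subset_ball (le_max_right D₀ D'))
    obtain ⟨V, φ, P, -, hV, hφ, -, -, -, hVφ, hlim⟩ := hcover _ (le_max_left D₀ D') (Or.inl hsub)
    exact ⟨φ, fun j => ⟨hφ j, (hVφ hsub j).trans (hV j)⟩, hlim⟩
  refine ⟨fun h => h.elim hbdd hgraph, ?_⟩
  rcases hcase with hsub | hext
  · exact hsupp (hbdd (isBounded_ball.subset hsub))
  obtain ⟨V, φ, P, hVs, hV, hφ, hPs, hP0, hVP, -, hlim⟩ := hcover _ le_rfl (Or.inr hext)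
  refine ⟨φ, fun j => ⟨hφ j, fun γ hγ => ?_⟩, hlim⟩
  have hopen : IsOpen ((tsupport (V j))ᶜ ∩ ball 0 (2 * D₀)) :=
    (isClosed_tsupport _).isOpen_compl.inter isOpen_ball
  have hsub : Ωᶜ ⊆ (tsupport (V j))ᶜ ∩ ball 0 (2 * D₀) := fun x hx => by
    refine ⟨fun h => hx (hV j h), ?_⟩
    rw [mem_ball_zero_iff]
    by_contra hcon
    exact hx (hext.2 x (by linarith [hcov.D_pos]))
  filter_upwards [hopen.mem_nhdsSet.2 hsub] with x hx
  rw [mixedDeriv_congr (hφ j).1 ((hVs j).sub (hPs j))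
    (Filter.eventuallyEq_of_mem (isOpen_ball.mem_nhds hx.2) (hVP j)) γ,
    mixedDeriv_sub_of_eq_zero (hVs j) (hPs j) (hP0 j) hγ,
    mixedDeriv_eq_zero_of_notMem_tsupport (hVs j) hx.1]

end Coordinates

end AvSobolev

end

open AvSobolev

theorem mainTheorem3 {n m : ℕ} (hm : 1 ≤ m) {θ : ℝ} (hθ₀ : 0 < θ) (hθ₁ : θ < 1)
    {q : ℝ≥0∞} (hq₁ : 1 ≤ q) (hq : q < ∞)
    {Ω : Set (EuclideanSpace ℝ (Fin (n + 1)))} (hΩ : IsLipschitzDomain Ω) :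
    -- density of the restrictions of smooth compactly supported functions, `0 < p < ∞`
    (∀ p : ℝ≥0∞, 0 < p → p < ∞ →
      (∀ Φ : EuclideanSpace ℝ (Fin (n + 1)) → ℂ, IsSmoothCompact Φ → MemSobolev m p θ q Ω Φ) ∧
      ∀ u : EuclideanSpace ℝ (Fin (n + 1)) → ℂ, MemSobolev m p θ q Ω u →
        ∀ ε : ℝ≥0∞, 0 < ε →
          ∃ Φ : EuclideanSpace ℝ (Fin (n + 1)) → ℂ, IsSmoothCompact Φ ∧
            sobolevNorm m p θ q Ω (u - Φ) < ε) ∧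
    -- weak approximation, `p = ∞`
    (∀ u : EuclideanSpace ℝ (Fin (n + 1)) → ℂ, MemSobolev m ∞ θ q Ω u →
      ∃ φ : ℕ → EuclideanSpace ℝ (Fin (n + 1)) → ℂ, (∀ j, IsSmoothCompact (φ j)) ∧
        WeaklyTendsto m θ q Ω φ u) ∧
    -- vanishing traces
    (∀ p : ℝ≥0∞, ENNReal.ofReal ((n : ℝ) / ((n : ℝ) + θ)) < p →
      ∀ u : EuclideanSpace ℝ (Fin (n + 1)) → ℂ, MemSobolev m p θ q Ω u →
        (∀ k : ℕ, k < m → HasTraceArray k Ω u 0) →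
        (Bornology.IsBounded Ω ∨ IsLipschitzGraphDomain Ω →
          ∃ φ : ℕ → EuclideanSpace ℝ (Fin (n + 1)) → ℂ, (∀ j, IsSmoothCompactIn Ω (φ j)) ∧
            SobolevTendsto m p θ q Ω φ u) ∧
        (Bornology.IsBounded Ωᶜ →
          ∃ φ : ℕ → EuclideanSpace ℝ (Fin (n + 1)) → ℂ,
            (∀ j, IsSmoothCompact (φ j) ∧
              ∀ γ ∈ multiIndices (n + 1) m, ∀ᶠ x in 𝓝ˢ Ωᶜ, mixedDeriv γ (φ j) x = 0) ∧
            SobolevTendsto m p θ q Ω φ u)) := by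
  obtain ⟨hne, hlayer, happ⟩ := hΩ.exists_approx
  refine ⟨fun p hp0 hpt => ⟨fun Φ hΦ => memSobolev_of_isSmoothCompact hΩ.1 hne hΩ.2.1.nonempty hp0
    hpt hθ₁ hq₁ hq.ne hlayer hΦ, fun u hu ε hε => ?_⟩, fun u hu => ?_, fun p hp u hu htr => ?_⟩
  · obtain ⟨φ, hφ, hlim⟩ := happ m p θ q u hp0 hθ₁ hq₁ hq.ne hu
    obtain ⟨j, hj⟩ := ((hlim.1 hpt).eventually (gt_mem_nhds hε)).exists
    exact ⟨φ j, hφ j, hj⟩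
  · obtain ⟨φ, hφ, hlim⟩ := happ m ∞ θ q u ENNReal.zero_lt_top hθ₁ hq₁ hq.ne hu
    exact ⟨φ, hφ, hlim.2 rfl⟩
  · obtain ⟨h1, h2⟩ := hΩ.exists_approx_of_hasTraceArray_zero hθ₀ hθ₁ hq₁ hq.ne hp hu htr
    exact ⟨h1, fun _ => h2⟩
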